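/- Let $k$ be a field with the trivial absolute value. All logarithmic schemes are fine and saturated, with logarithmic structure $\rho: M_X\to\mathcal O_X$ on the étale site, and of finite type over $k$; morphisms are morphisms over $k$. *Analytic spaces.* For a scheme $X$ of finite type over $k$ let $X^\beth$ be the topological space that is obtained by glueing, along reduction, the spaces $(\operatorname{Spec}A)^\beth$ of multiplicative seminorms $|\cdot|_x:A\to[0,1]$ (with the coarsest topology making all $x\mapsto|f|_x$ continuous). A point $x\in X^\beth$ is a point $r(x)\in X$ (its reduction) together with a multiplicative seminorm on $\mathcal O_{X,r(x)}$ that is $\le1$ and is $<1$ exactly on the maximal ideal. A morphism $f:X\to X'$ induces $f^\beth:X^\beth\to(X')^\beth$ by pull-back of seminorms. *Kato fans.* A fine and saturated Kato fan is a quasi-compact topological space $F$ with a sheaf $\mathcal O_F$ of sharp monoids that is locally isomorphic to $\operatorname{Spec}P$, for fine and saturated monoids $P$, where $\operatorname{Spec}P$ is the space of prime ideals with stalks $P_{\mathfrak p}/P_{\mathfrak p}^*$. Its extended cone complex is $\overline\Sigma_F=\operatorname{Hom}(\operatorname{Spec}[0,\infty],F)$, with the weak topology with respect to the subsets $\operatorname{Hom}(P,[0,\infty])$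 (topology of pointwise convergence) for the open affine subsets $\operatorname{Spec}P\subseteq F$. Put $\overline M_X=M_X/M_X^*$. If $M_X$ is defined on the Zariski site, a characteristic morphism of $X$ is a strict morphism $\phi_X:(X,\overline M_X)\to F_X$ to a fine and saturated Kato fan through which every strict morphism from $(X,\overline M_X)$ to a fine and saturated Kato fan factors by a unique strict morphism out of $F_X$; call $X$ *simple* if $M_X$ is defined on the Zariski site and $X$ has a characteristic morphism. For simple $X$ define $\operatorname{trop}_{F_X}:X^\beth\to\overline\Sigma_{F_X}$ by sending $x$ to the morphism $\operatorname{Spec}[0,\infty]\to F_X$ that maps the closed point to $\phi_X(r(x))$ and is given there by $$\mathcal O_{F_X,\phi_X(r(x))}\to\overline M_{X,r(x)}\to\mathcal O_{X,r(x)}/\mathcal O_{X,r(x)}^*\to[0,\infty],$$ where the last map is $f\mapsto-\log|f|_x$. *The general case.* A simple strict étale covering of $X$ is a strict surjective étale morphism $Y\to X$ with $Y$ simple. These coverings and the strict surjective étale morphisms over $X$ between them form a category. A morphism $Y_1\to Y_2$ in it induces $F_{Y_1}\to F_{Y_2}$, compatible with the characteristic morphisms. Let $\overline\Sigma_X$ be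 the colimit of the $\overline\Sigma_{F_Y}$ in topological spaces over this category. **Theorem.** 1. If $X$ is simple, $\operatorname{trop}_{F_X}$ is continuous. A morphism $f:X\to X'$ of simple logarithmic schemes induces a unique morphism $f^F:F_X\to F_{X'}$ with $f^F\circ\phi_X=\phi_{X'}\circ\overline f$, where $\overline f:(X,\overline M_X)\to(X',\overline M_{X'})$ is induced by $f$; the map $\overline\Sigma(f^F):\overline\Sigma_{F_X}\to\overline\Sigma_{F_{X'}}$ is continuous, and $\operatorname{trop}_{F_{X'}}\circ f^\beth=\overline\Sigma(f^F)\circ\operatorname{trop}_{F_X}$. 2. For every morphism $f:X\to X'$ the map $f^\beth$ is continuous, and $f\mapsto f^\beth$ is functorial. 3. Every $X$ has a simple strict étale covering. If a simple strict étale covering $Y\to X$ is an isomorphism, the natural map $\overline\Sigma_{F_Y}\to\overline\Sigma_X$ is a homeomorphism. 4. For every $X$ there is a unique map $\operatorname{trop}_X:X^\beth\to\overline\Sigma_X$ whose composition with $Y^\beth\to X^\beth$ is $Y^\beth\xrightarrow{\operatorname{trop}_{F_Y}}\overline\Sigma_{F_Y}\to\overline\Sigma_X$, for every simple strict étale covering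 $Y\to X$; it is continuous. 5. For every morphism $f:X\to X'$ there is a unique map $\overline\Sigma(f):\overline\Sigma_X\to\overline\Sigma_{X'}$ that is compatible with $\overline\Sigma(h^F):\overline\Sigma_{F_Y}\to\overline\Sigma_{F_{Y'}}$ for all simple strict étale coverings $Y\to X$, $Y'\to X'$ and all morphisms $h:Y\to Y'$ lying over $f$; it is continuous. One has $$\operatorname{trop}_{X'}\circ f^\beth=\overline\Sigma(f)\circ\operatorname{trop}_X,$$ and $f\mapsto\overline\Sigma(f)$ is functorial. -/

import Mathlib

open CategoryTheory CategoryTheory.Limits AlgebraicGeometry Opposite TopologicalSpace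
open scoped NNReal ENNReal

universe u v w

noncomputable section

namespace LogTrop

/-! ### Monoids (written multiplicatively) -/

/-- A fine and saturated commutative monoid: finitely generated, cancellative (so that it embeds
into its groupification), and an element `a / b` of the groupification with a positive power
`(a / b) ^ n = c` in `P` already lies in `P`. -/
structure IsFs (P : Type u) [CommMonoid P] : Prop where
  fg : Monoid.FG P
  cancel : ∀ a b c : P, a * b = a * c → b = c
  saturated : ∀ (a b c : P) (n : ℕ), 0 < n → a ^ n = b ^ n * c → ∃ d, a = b * d

/-- The monoid `[0, ∞]` under addition, in multiplicative clothing. -/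
abbrev RBar : Type := Multiplicative ℝ≥0∞

/-- Prime ideals of a commutative monoid. -/
@[ext]
structure MonPrime (P : Type u) [CommMonoid P] where
  carrier : Set P
  mul_mem : ∀ a b, b ∈ carrier → a * b ∈ carrier
  one_notMem : 1 ∉ carrier
  mem_or_mem : ∀ a b, a * b ∈ carrier → a ∈ carrier ∨ b ∈ carrier

namespace MonPrime

variable {P : Type u} [CommMonoid P] {Q : Type v} [CommMonoid Q]

/-- The complement of a prime ideal, a face. -/
def face (p : MonPrime P) : Submonoid P where
  carrier := p.carrierᶜ
  one_mem' := p.one_notMem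
  mul_mem' {a b} ha hb h := (p.mem_or_mem a b h).elim ha hb

theorem left_mem_face (p : MonPrime P) {a b : P} (h : a * b ∈ p.face) : a ∈ p.face :=
  fun ha => h (by rw [mul_comm]; exact p.mul_mem b a ha)

/-- The topology generated by the sets `D(f) = {p | f ∉ p}`. -/
instance : TopologicalSpace (MonPrime P) :=
  TopologicalSpace.generateFrom {D | ∃ f : P, D = {p | f ∉ p.carrier}}

theorem isOpen_basic (f : P) : IsOpen {p : MonPrime P | f ∉ p.carrier} :=
  TopologicalSpace.isOpen_generateFrom_of_mem ⟨f, rfl⟩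

/-- The preimage of a prime ideal under a homomorphism. -/
def comap (h : P →* Q) (q : MonPrime Q) : MonPrime P where
  carrier := h ⁻¹' q.carrier
  mul_mem a b hb := by
    simpa using q.mul_mem (h a) (h b) hb
  one_notMem := by simpa using q.one_notMem
  mem_or_mem a b hab := q.mem_or_mem (h a) (h b) (by simpa using hab)

theorem continuous_comap (h : P →* Q) : Continuous (comap h) := by
  refine continuous_generateFrom_iff.2 ?_
  rintro _ ⟨f, rfl⟩
  exact isOpen_basic (h f)

/-- The stalk `P_p / P_p^*` of the structure sheaf of `Spec P` at `p`. -/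
abbrev Stalk (p : MonPrime P) : Type u := Associates (Localization p.face)

/-- The natural map `P → P_p / P_p^*`. -/
def toStalk (p : MonPrime P) : P →* p.Stalk :=
  Associates.mkMonoidHom.comp (Localization.monoidOf p.face).toMonoidHom

theorem isUnit_of_mem_face (p : MonPrime P) {b : P} (hb : b ∈ p.face) :
    IsUnit (Localization.monoidOf p.face b) :=
  (Localization.monoidOf p.face).map_units ⟨b, hb⟩

theorem toStalk_surjective (p : MonPrime P) : Function.Surjective p.toStalk := by
  intro s
  obtain ⟨l, rfl⟩ := Associates.mk_surjective s
  obtain ⟨⟨a, b⟩, h⟩ := (Localization.monoidOf p.face).surj l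
  refine ⟨a, ?_⟩
  change Associates.mk (Localization.monoidOf p.face a) = _
  rw [Associates.mk_eq_mk_iff_associated, ← h]
  exact (associated_mul_unit_right _ _ (p.isUnit_of_mem_face b.2)).symm

theorem toStalk_eq_iff (p : MonPrime P) {a b : P} :
    p.toStalk a = p.toStalk b ↔ ∃ s ∈ p.face, ∃ t ∈ p.face, a * s = b * t := by
  change Associates.mk (Localization.monoidOf p.face a) =
    Associates.mk (Localization.monoidOf p.face b) ↔ _
  rw [Associates.mk_eq_mk_iff_associated]
  constructor
  · rintro ⟨w, hw⟩
    obtain ⟨⟨c, d⟩, h⟩ := (Localization.monoidOf p.face).surj (w : Localization p.face)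
    obtain ⟨⟨c', d'⟩, h'⟩ := (Localization.monoidOf p.face).surj
      ((w⁻¹ : (Localization p.face)ˣ) : Localization p.face)
    have hcd : Localization.monoidOf p.face (c * c')
        = Localization.monoidOf p.face ((d : P) * d') := by
      rw [map_mul, map_mul, ← h, ← h', mul_mul_mul_comm, Units.mul_inv, one_mul]
    obtain ⟨t, ht⟩ := (Localization.monoidOf p.face).eq_iff_exists.1 hcd
    have hc : c ∈ p.face := by
      have h1 : (t : P) * (c * c') ∈ p.face := by
        rw [ht]; exact p.face.mul_mem t.2 (p.face.mul_mem d.2 d'.2)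
      rw [mul_comm, mul_assoc] at h1
      exact p.left_mem_face h1
    have hab : Localization.monoidOf p.face (a * c)
        = Localization.monoidOf p.face (b * d) := by
      rw [map_mul, map_mul, ← hw, ← h, mul_assoc]
    obtain ⟨r, hr⟩ := (Localization.monoidOf p.face).eq_iff_exists.1 hab
    refine ⟨c * r, p.face.mul_mem hc r.2, d * r, p.face.mul_mem d.2 r.2, ?_⟩
    rw [← mul_assoc, ← mul_assoc, mul_comm _ (r : P), mul_comm _ (r : P), hr]
  · rintro ⟨s, hs, t, ht, h⟩
    have h1 := congrArg (Localization.monoidOf p.face) h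
    rw [map_mul, map_mul] at h1
    exact (associated_mul_unit_right _ _ (p.isUnit_of_mem_face hs)).trans
      (h1 ▸ (associated_mul_unit_right _ _ (p.isUnit_of_mem_face ht)).symm)

/-- A homomorphism out of `P` factors through `P_p / P_p^*` as soon as it identifies the elements
that become equal there. -/
noncomputable def liftStalk {N : Type w} [CommMonoid N] (p : MonPrime P) (g : P →* N)
    (hg : ∀ a b, p.toStalk a = p.toStalk b → g a = g b) : p.Stalk →* N where
  toFun s := g (Function.surjInv p.toStalk_surjective s)
  map_one' := by
    rw [← map_one g]
    exact hg _ _ (by rw [Function.surjInv_eq p.toStalk_surjective, map_one])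
  map_mul' x y := by
    rw [← map_mul g]
    exact hg _ _ (by simp only [map_mul, Function.surjInv_eq p.toStalk_surjective])

theorem liftStalk_toStalk {N : Type w} [CommMonoid N] (p : MonPrime P) (g : P →* N)
    (hg : ∀ a b, p.toStalk a = p.toStalk b → g a = g b) (a : P) :
    p.liftStalk g hg (p.toStalk a) = g a :=
  hg _ _ (Function.surjInv_eq p.toStalk_surjective _)

/-- The map `P_{h⁻¹ q} / units → Q_q / units` induced by `h : P → Q`. -/
noncomputable def stalkMap (h : P →* Q) (q : MonPrime Q) : (comap h q).Stalk →* q.Stalk :=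
  (comap h q).liftStalk (q.toStalk.comp h) fun a b hab => by
    obtain ⟨s, hs, t, ht, e⟩ := (toStalk_eq_iff _).1 hab
    exact (toStalk_eq_iff _).2 ⟨h s, hs, h t, ht, by rw [← map_mul, e, map_mul]⟩

theorem stalkMap_toStalk (h : P →* Q) (q : MonPrime Q) (a : P) :
    stalkMap h q ((comap h q).toStalk a) = q.toStalk (h a) :=
  liftStalk_toStalk _ _ _ a

theorem mem_face_of_isUnit (p : MonPrime P) {a : P} (ha : IsUnit (p.toStalk a)) : a ∈ p.face := by
  rw [Associates.isUnit_iff_eq_one, ← map_one p.toStalk, toStalk_eq_iff] at ha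
  obtain ⟨s, _, t, ht, e⟩ := ha
  exact p.left_mem_face (b := s) (by rw [e, one_mul]; exact ht)

theorem toStalk_eq_one (p : MonPrime P) {a : P} (ha : a ∈ p.face) : p.toStalk a = 1 := by
  rw [← map_one p.toStalk, toStalk_eq_iff]
  exact ⟨1, p.face.one_mem, a, ha, by rw [mul_one, one_mul]⟩

theorem isUnit_of_isUnit_stalkMap (h : P →* Q) (q : MonPrime Q) (s : (comap h q).Stalk)
    (hs : IsUnit (stalkMap h q s)) : IsUnit s := by
  obtain ⟨a, rfl⟩ := toStalk_surjective _ s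
  rw [stalkMap_toStalk] at hs
  rw [toStalk_eq_one _ (show a ∈ (comap h q).face from q.mem_face_of_isUnit hs)]
  exact isUnit_one

/-- The maximal ideal `P \ P^*`, the closed point of `Spec P`. -/
def closedPoint (P : Type u) [CommMonoid P] : MonPrime P where
  carrier := {a | ¬ IsUnit a}
  mul_mem a b hb h := hb (isUnit_of_mul_isUnit_right h)
  one_notMem h := h isUnit_one
  mem_or_mem a b h := by
    by_contra! hc
    simp only [Set.mem_ofPred_eq, not_not] at hc
    exact h (hc.1.mul hc.2)

end MonPrime

/-! ### Monoidal spaces -/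

/-- A topological space with a sheaf of commutative monoids, the sheaf being presented by its
espace étalé: there is a monoid `stalk x` at every point, the sections over an open set `U` are
certain families `(s x ∈ stalk x)` indexed by `x ∈ U`, being a section is a local condition closed
under products, every element of `stalk x` is the germ at `x` of a section, and two sections
with the same germ at `x` agree near `x`. -/
structure MonoidalSpace where
  carrier : Type u
  [top : TopologicalSpace carrier]
  stalk : carrier → Type u
  [mon : ∀ x, CommMonoid (stalk x)]
  IsSection : ∀ U : Opens carrier, (∀ x : U, stalk x) → Prop
  one_isSection : ∀ U, IsSection U 1
  mul_isSection : ∀ U s t, IsSection U s → IsSection U t → IsSection U (s * t)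
  restrict : ∀ (U V : Opens carrier) (h : U ≤ V) (s : ∀ x : V, stalk x), IsSection V s →
    IsSection U fun x => s ⟨x, h x.2⟩
  glue : ∀ (U : Opens carrier) (s : ∀ x : U, stalk x),
    (∀ x : U, ∃ (V : Opens carrier) (h : V ≤ U), x.1 ∈ V ∧ IsSection V fun y => s ⟨y, h y.2⟩) →
    IsSection U s
  germ_surj : ∀ x (a : stalk x), ∃ (U : Opens carrier) (hx : x ∈ U) (s : ∀ y : U, stalk y),
    IsSection U s ∧ s ⟨x, hx⟩ = a
  germ_inj : ∀ (U : Opens carrier) (s t : ∀ y : U, stalk y), IsSection U s → IsSection U t →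
    ∀ x : U, s x = t x → ∃ V : Opens carrier, x.1 ∈ V ∧ ∀ y : U, y.1 ∈ V → s y = t y

attribute [instance] MonoidalSpace.top MonoidalSpace.mon

namespace MonoidalSpace

/-- A morphism of locally monoidal spaces: a continuous map `f` with a morphism of sheaves of
monoids `f⁻¹ 𝒪_Y → 𝒪_X`, given by its stalks, which are local homomorphisms. -/
@[ext]
structure Hom (X : MonoidalSpace.{u}) (Y : MonoidalSpace.{v}) where
  base : X.carrier → Y.carrier
  continuous_base : Continuous base
  stalkMap : ∀ x, Y.stalk (base x) →* X.stalk x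
  isSection : ∀ (V : Opens Y.carrier) (s : ∀ y : V, Y.stalk y), Y.IsSection V s →
    X.IsSection (V.comap ⟨base, continuous_base⟩) fun x => stalkMap x (s ⟨base x, x.2⟩)
  isLocal : ∀ x (a : Y.stalk (base x)), IsUnit (stalkMap x a) → IsUnit a

/-- The identity morphism. -/
def Hom.id (X : MonoidalSpace.{u}) : Hom X X where
  base x := x
  continuous_base := continuous_id
  stalkMap _ := MonoidHom.id _
  isSection _ _ hs := hs
  isLocal _ _ ha := ha

/-- The composition of `f : X → Y` and `g : Y → Z`. -/
def Hom.comp {X : MonoidalSpace.{u}} {Y : MonoidalSpace.{v}} {Z : MonoidalSpace.{w}}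
    (f : Hom X Y) (g : Hom Y Z) : Hom X Z where
  base x := g.base (f.base x)
  continuous_base := g.continuous_base.comp f.continuous_base
  stalkMap x := (f.stalkMap x).comp (g.stalkMap (f.base x))
  isSection V s hs := f.isSection _ _ (g.isSection V s hs)
  isLocal x a ha := g.isLocal _ a (f.isLocal x _ ha)

/-- A morphism is strict if `f⁻¹ 𝒪_Y → 𝒪_X` is an isomorphism, i.e. bijective on stalks. -/
def Hom.IsStrict {X : MonoidalSpace.{u}} {Y : MonoidalSpace.{v}} (f : Hom X Y) : Prop :=
  ∀ x, Function.Bijective (f.stalkMap x)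

/-- An open immersion, i.e. an isomorphism onto an open subspace. -/
def Hom.IsOpenImmersion {X : MonoidalSpace.{u}} {Y : MonoidalSpace.{v}} (f : Hom X Y) : Prop :=
  Topology.IsOpenEmbedding f.base ∧ f.IsStrict

/-- A monoidal space is sharp if its stalks have no unit but the neutral element. -/
def IsSharp (X : MonoidalSpace.{u}) : Prop :=
  ∀ x (a : X.stalk x), IsUnit a → a = 1

end MonoidalSpace

/-- The spectrum of a commutative monoid: the points are the prime ideals, the stalk at `p` is
`P_p / P_p^*`, and the sections are the families that are locally given by elements of `P`
(note that `P → P_p / P_p^*` is surjective). -/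
abbrev specM (P : Type u) [CommMonoid P] : MonoidalSpace.{u} where
  carrier := MonPrime P
  stalk p := p.Stalk
  IsSection U s := ∀ x : U, ∃ (V : Opens (MonPrime P)) (a : P), x.1 ∈ V ∧
    ∀ y : U, y.1 ∈ V → s y = y.1.toStalk a
  one_isSection U x := ⟨U, 1, x.2, fun y _ => (map_one y.1.toStalk).symm⟩
  mul_isSection U s t hs ht x := by
    obtain ⟨V, a, hV, ha⟩ := hs x
    obtain ⟨W, b, hW, hb⟩ := ht x
    refine ⟨V ⊓ W, a * b, ⟨hV, hW⟩, fun y hy => ?_⟩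
    rw [Pi.mul_apply, ha y hy.1, hb y hy.2, map_mul]
  restrict U V h s hs x := by
    obtain ⟨W, a, hW, ha⟩ := hs ⟨x, h x.2⟩
    exact ⟨W, a, hW, fun y hy => ha ⟨y, h y.2⟩ hy⟩
  glue U s hs x := by
    obtain ⟨V, h, hx, hV⟩ := hs x
    obtain ⟨W, a, hW, ha⟩ := hV ⟨x, hx⟩
    exact ⟨V ⊓ W, a, ⟨hx, hW⟩, fun y hy => ha ⟨y, hy.1⟩ hy.2⟩
  germ_surj p s := by
    obtain ⟨a, rfl⟩ := p.toStalk_surjective s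
    exact ⟨⊤, trivial, fun q => q.1.toStalk a, fun q => ⟨⊤, a, trivial, fun _ _ => rfl⟩, rfl⟩
  germ_inj U s t hs ht x hx := by
    obtain ⟨V, a, hV, ha⟩ := hs x
    obtain ⟨W, b, hW, hb⟩ := ht x
    rw [ha x hV, hb x hW, MonPrime.toStalk_eq_iff] at hx
    obtain ⟨c, hc, d, hd, e⟩ := hx
    refine ⟨V ⊓ W ⊓ ⟨_, MonPrime.isOpen_basic c⟩ ⊓ ⟨_, MonPrime.isOpen_basic d⟩,
      ⟨⟨⟨hV, hW⟩, hc⟩, hd⟩, fun y hy => ?_⟩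
    rw [ha y hy.1.1.1, hb y hy.1.1.2, MonPrime.toStalk_eq_iff]
    exact ⟨c, hy.1.2, d, hy.2, e⟩

/-- The morphism `Spec Q → Spec P` induced by a homomorphism `P → Q`. -/
noncomputable def specM.map {P : Type u} [CommMonoid P] {Q : Type v} [CommMonoid Q] (h : P →* Q) :
    MonoidalSpace.Hom (specM Q) (specM P) where
  base := MonPrime.comap h
  continuous_base := MonPrime.continuous_comap h
  stalkMap q := MonPrime.stalkMap h q
  isSection V s hs x := by
    obtain ⟨W, a, hW, ha⟩ := hs ⟨MonPrime.comap h x.1, x.2⟩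
    refine ⟨W.comap ⟨_, MonPrime.continuous_comap h⟩, h a, hW, fun y hy => ?_⟩
    exact (congrArg (MonPrime.stalkMap h y.1) (ha ⟨MonPrime.comap h y.1, y.2⟩ hy)).trans
      (MonPrime.stalkMap_toStalk h y.1 a)
  isLocal q s hs := MonPrime.isUnit_of_isUnit_stalkMap h q s hs

/-! ### Kato fans and extended cone complexes -/

/-- An open subspace of `F` containing `y` and isomorphic to `Spec P` with `P` fine and saturated. -/
structure AffineNhd (F : MonoidalSpace.{u}) (y : F.carrier) where
  P : Type u
  [mon : CommMonoid P]
  fs : IsFs P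
  incl : MonoidalSpace.Hom (specM P) F
  isOpenImmersion : incl.IsOpenImmersion
  pt : MonPrime P
  incl_pt : incl.base pt = y

/-- A fine and saturated Kato fan: a quasi-compact sharp monoidal space that is covered by open
subspaces isomorphic to `Spec P` with `P` fine and saturated. -/
structure IsFsKatoFan (F : MonoidalSpace.{u}) : Prop where
  sharp : F.IsSharp
  quasiCompact : CompactSpace F.carrier
  affine : ∀ y : F.carrier, Nonempty (AffineNhd F y)

/-- The extended cone complex of `F`, the set of morphisms `Spec [0, ∞] → F`. -/
def ExtCone (F : MonoidalSpace.{u}) : Type u := MonoidalSpace.Hom (specM RBar) F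

namespace ExtCone

/-- The point of the extended cone complex of `F` that a homomorphism `P → [0, ∞]` defines on an
open affine subspace `Spec P` of `F`. -/
noncomputable def ofAffine {F : MonoidalSpace.{u}} {P : Type u} [CommMonoid P]
    (j : MonoidalSpace.Hom (specM P) F) (h : P →* RBar) : ExtCone F :=
  (specM.map h).comp j

/-- A morphism `Spec [0, ∞] → F` is the same thing as a point `y` of `F` (the image of the closed
point) together with a local homomorphism `h : 𝒪_{F, y} → [0, ∞]`; this is the morphism given by
such a pair. In an affine neighbourhood `Spec P` of `y` it is induced by the composition
`P → 𝒪_{F, y} → [0, ∞]`. -/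
def ofStalkAux {F : MonoidalSpace.{u}} : {y : F.carrier} → AffineNhd F y →
    (F.stalk y →* RBar) → ExtCone F
  | _, @AffineNhd.mk _ _ _ _ _ j hj p rfl, h => ofAffine j <|
      (h.comp (MulEquiv.ofBijective (j.stalkMap p) (hj.2 p)).symm.toMonoidHom).comp p.toStalk

/-- The point of the extended cone complex given by a point `y` and a local homomorphism
`𝒪_{F, y} → [0, ∞]`; it does not depend on the choice of the affine neighbourhood. -/
def ofStalk {F : MonoidalSpace.{u}} (hF : IsFsKatoFan F) (y : F.carrier) (h : F.stalk y →* RBar) :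
    ExtCone F :=
  ofStalkAux (hF.affine y).some h

/-- The weak topology: a set `A` is closed if and only if its trace on `Hom(P, [0, ∞])` (with the
topology of pointwise convergence) is closed for every open affine subspace `Spec P` of `F`. -/
instance (F : MonoidalSpace.{u}) : TopologicalSpace (ExtCone F) :=
  ⨆ (P : Type u) (_ : CommMonoid P) (j : MonoidalSpace.Hom (specM P) F) (_ : j.IsOpenImmersion),
    TopologicalSpace.coinduced (ofAffine j)
      (TopologicalSpace.induced (fun (h : P →* RBar) (p : P) => h p) inferInstance)

/-- The map of extended cone complexes induced by a morphism of Kato fans. -/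
def map {F : MonoidalSpace.{u}} {G : MonoidalSpace.{v}} (g : MonoidalSpace.Hom F G) (z : ExtCone F) :
    ExtCone G :=
  MonoidalSpace.Hom.comp z g

/-- The reduction map, given by the image of the closed point of `Spec [0, ∞]`. -/
def reduction {F : MonoidalSpace.{u}} (z : ExtCone F) : F.carrier :=
  MonoidalSpace.Hom.base z (MonPrime.closedPoint RBar)

end ExtCone

/-! ### The sharp monoidal space of a presheaf of monoids -/

section SharpSpace

variable {X : Type u} [TopologicalSpace X] (M : (Opens X)ᵒᵖ ⥤ CommMonCat.{u})

/-- Restriction of sections. -/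
def res {U V : Opens X} (h : U ≤ V) : M.obj (op V) →* M.obj (op U) := (M.map (homOfLE h).op).hom

theorem res_res {U V W : Opens X} (h : U ≤ V) (h' : V ≤ W) (m : M.obj (op W)) :
    res M h (res M h' m) = res M (h.trans h') m := by
  have : M.map (homOfLE (h.trans h')).op = M.map (homOfLE h').op ≫ M.map (homOfLE h).op := by
    rw [← M.map_comp]; rfl
  exact (congrArg (fun f => f.hom m) this).symm

/-- A section of `M` on an open neighbourhood of `x`. -/
structure LocalSection (x : X) where
  U : Opens X
  mem : x ∈ U
  m : M.obj (op U)

/-- Two sections near `x` are identified if they differ by a unit after shrinking. -/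
instance LocalSection.setoid (x : X) : Setoid (LocalSection M x) where
  r s t := ∃ (W : Opens X) (_ : x ∈ W) (h : W ≤ s.U) (h' : W ≤ t.U),
    Associated (res M h s.m) (res M h' t.m)
  iseqv := by
    refine ⟨fun s => ⟨s.U, s.mem, le_rfl, le_rfl, Associated.refl _⟩, ?_, ?_⟩
    · rintro s t ⟨W, hx, h, h', ha⟩
      exact ⟨W, hx, h', h, ha.symm⟩
    · rintro s t r ⟨W, hx, h, h', ha⟩ ⟨W', hx', k, k', hb⟩
      refine ⟨W ⊓ W', ⟨hx, hx'⟩, inf_le_left.trans h, inf_le_right.trans k', ?_⟩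
      have h1 := ha.map (res M (inf_le_left : W ⊓ W' ≤ W))
      have h2 := hb.map (res M (inf_le_right : W ⊓ W' ≤ W'))
      rw [res_res, res_res] at h1 h2
      exact h1.trans h2

/-- The stalk `M_x / M_x^*`. -/
def SharpStalk (x : X) : Type u := Quotient (LocalSection.setoid M x)

/-- The class of a section in `M_x / M_x^*`. -/
def sharpGerm {x : X} (U : Opens X) (hx : x ∈ U) (m : M.obj (op U)) : SharpStalk M x :=
  Quotient.mk _ ⟨U, hx, m⟩

variable {M} in
theorem sharpGerm_surj {x : X} (a : SharpStalk M x) :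
    ∃ (U : Opens X) (hx : x ∈ U) (m : M.obj (op U)), sharpGerm M U hx m = a :=
  Quotient.inductionOn a fun s => ⟨s.U, s.mem, s.m, rfl⟩

variable {M} in
theorem sharpGerm_eq_iff {x : X} {U V : Opens X} (hU : x ∈ U) (hV : x ∈ V) (m : M.obj (op U))
    (n : M.obj (op V)) : sharpGerm M U hU m = sharpGerm M V hV n ↔
      ∃ (W : Opens X) (_ : x ∈ W) (h : W ≤ U) (h' : W ≤ V), Associated (res M h m) (res M h' n) :=
  Quotient.eq (r := LocalSection.setoid M x)

theorem sharpGerm_res {x : X} {U V : Opens X} (h : U ≤ V) (hx : x ∈ U) (m : M.obj (op V)) :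
    sharpGerm M U hx (res M h m) = sharpGerm M V (h hx) m :=
  (sharpGerm_eq_iff _ _ _ _).2 ⟨U, hx, le_rfl, h, by rw [res_res]⟩

instance (x : X) : CommMonoid (SharpStalk M x) where
  one := sharpGerm M ⊤ trivial 1
  mul := Quotient.map₂ (fun s t => ⟨s.U ⊓ t.U, ⟨s.mem, t.mem⟩,
      res M inf_le_left s.m * res M inf_le_right t.m⟩) (by
    rintro s s' ⟨W, hx, h, h', ha⟩ t t' ⟨W', hx', k, k', hb⟩
    refine ⟨W ⊓ W', ⟨hx, hx'⟩, inf_le_inf h k, inf_le_inf h' k', ?_⟩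
    have h1 := ha.map (res M (inf_le_left : W ⊓ W' ≤ W))
    have h2 := hb.map (res M (inf_le_right : W ⊓ W' ≤ W'))
    simp only [map_mul, res_res] at h1 h2 ⊢
    exact h1.mul_mul h2)
  mul_assoc a b c := by
    induction a, b, c using Quotient.inductionOn₃ with | _ a b c
    refine Quotient.sound ⟨a.U ⊓ b.U ⊓ c.U, ⟨⟨a.mem, b.mem⟩, c.mem⟩, le_rfl,
      (inf_assoc ..).le, ?_⟩
    simp only [map_mul, res_res, mul_assoc]
    exact Associated.refl _
  one_mul a := by
    induction a using Quotient.inductionOn with | _ a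
    refine Quotient.sound ⟨a.U, a.mem, le_inf le_top le_rfl, le_rfl, ?_⟩
    simp only [res_res, map_one, one_mul]
    exact Associated.refl _
  mul_one a := by
    induction a using Quotient.inductionOn with | _ a
    refine Quotient.sound ⟨a.U, a.mem, le_inf le_rfl le_top, le_rfl, ?_⟩
    simp only [res_res, map_one, mul_one]
    exact Associated.refl _
  mul_comm a b := by
    induction a, b using Quotient.inductionOn₂ with | _ a b
    refine Quotient.sound ⟨a.U ⊓ b.U, ⟨a.mem, b.mem⟩, le_rfl, (inf_comm ..).le, ?_⟩
    simp only [map_mul, res_res, mul_comm]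
    exact Associated.refl _

theorem sharpGerm_one {x : X} (U : Opens X) (hx : x ∈ U) : sharpGerm M U hx 1 = 1 :=
  (sharpGerm_eq_iff hx (Opens.mem_top x) _ _).2 ⟨U, hx, le_rfl, le_top, by rw [map_one, map_one]⟩

theorem sharpGerm_mul {x : X} (U : Opens X) (hx : x ∈ U) (m n : M.obj (op U)) :
    sharpGerm M U hx (m * n) = sharpGerm M U hx m * sharpGerm M U hx n :=
  (sharpGerm_eq_iff hx (show x ∈ U ⊓ U from ⟨hx, hx⟩) _ _).2
    ⟨U, hx, le_rfl, le_inf le_rfl le_rfl, by simp only [map_mul, res_res]; exact Associated.refl _⟩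

/-- A unit of a stalk of `M / M^*` is trivial. -/
theorem sharpGerm_isUnit {x : X} {U : Opens X} (hx : x ∈ U) (m : M.obj (op U))
    (hm : IsUnit (sharpGerm M U hx m)) :
    ∃ (W : Opens X) (_ : x ∈ W) (h : W ≤ U), IsUnit (res M h m) := by
  obtain ⟨b, hb⟩ := hm.exists_right_inv
  obtain ⟨V, hV, n, rfl⟩ := sharpGerm_surj b
  obtain ⟨W, hW, h, h', ha⟩ := (sharpGerm_eq_iff (show x ∈ U ⊓ V from ⟨hx, hV⟩) (Opens.mem_top x) _ _).1 hb
  refine ⟨W, hW, h.trans inf_le_left, ?_⟩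
  rw [map_one, associated_one_iff_isUnit, map_mul, res_res, res_res] at ha
  exact isUnit_of_mul_isUnit_left ha

theorem sharpGerm_eq_one {x : X} {U : Opens X} (hx : x ∈ U) (m : M.obj (op U))
    (hm : IsUnit m) : sharpGerm M U hx m = 1 := by
  rw [← sharpGerm_one M U hx, sharpGerm_eq_iff]
  exact ⟨U, hx, le_rfl, le_rfl, by
    rw [map_one, associated_one_iff_isUnit]; exact hm.map _⟩

/-- A family `φ U : M(U) → N` of homomorphisms, compatible with restriction and trivial on units,
on the open neighbourhoods `U` of `x` induces `M_x / M_x^* → N`. -/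
def sharpLift {N : Type v} [CommMonoid N] {x : X} (φ : ∀ U : Opens X, x ∈ U → (M.obj (op U) →* N))
    (hres : ∀ (U V : Opens X) (hU : x ∈ U) (hV : x ∈ V) (h : U ≤ V) m, φ U hU (res M h m) = φ V hV m)
    (hunit : ∀ (U : Opens X) (hU : x ∈ U) m, IsUnit m → φ U hU m = 1) : SharpStalk M x →* N where
  toFun := Quotient.lift (fun s => φ s.U s.mem s.m) (by
    rintro s t ⟨W, hx, h, h', ⟨a, ha⟩⟩
    rw [← hres W _ hx _ h, ← hres W _ hx _ h', ← ha, map_mul, hunit W hx a a.isUnit, mul_one])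
  map_one' := map_one (φ ⊤ trivial)
  map_mul' a b := by
    induction a, b using Quotient.inductionOn₂ with | _ a b
    change φ (a.U ⊓ b.U) ⟨a.mem, b.mem⟩ (res M _ a.m * res M _ b.m) = φ _ a.mem a.m * φ _ b.mem b.m
    rw [map_mul]
    exact congrArg₂ (· * ·) (hres _ _ _ a.mem inf_le_left _) (hres _ _ _ b.mem inf_le_right _)

@[simp]
theorem sharpLift_sharpGerm {N : Type v} [CommMonoid N] {x : X}
    (φ : ∀ U : Opens X, x ∈ U → (M.obj (op U) →* N)) (hres hunit) (U : Opens X) (hx : x ∈ U) (m) :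
    sharpLift M φ hres hunit (sharpGerm M U hx m) = φ U hx m := rfl

/-- The sharp monoidal space `(X, M / M^*)`: the sheaf of monoids is the sheaf associated to
`U ↦ M(U) / M(U)^*`. -/
abbrev sharpSpace : MonoidalSpace.{u} where
  carrier := X
  stalk x := SharpStalk M x
  IsSection U s := ∀ x : U, ∃ (V : Opens X) (_ : x.1 ∈ V) (m : M.obj (op V)),
    ∀ (y : U) (hy : y.1 ∈ V), s y = sharpGerm M V hy m
  one_isSection U x := ⟨U, x.2, 1, fun y hy => (sharpGerm_one M U hy).symm⟩
  mul_isSection U s t hs ht x := by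
    obtain ⟨V, hV, m, hm⟩ := hs x
    obtain ⟨W, hW, n, hn⟩ := ht x
    refine ⟨V ⊓ W, ⟨hV, hW⟩, res M inf_le_left m * res M inf_le_right n, fun y hy => ?_⟩
    rw [Pi.mul_apply, hm y hy.1, hn y hy.2, sharpGerm_mul, sharpGerm_res, sharpGerm_res]
  restrict U V h s hs x := by
    obtain ⟨W, hW, m, hm⟩ := hs ⟨x, h x.2⟩
    exact ⟨W, hW, m, fun y hy => hm ⟨y, h y.2⟩ hy⟩
  glue U s hs x := by
    obtain ⟨V, h, hx, hV⟩ := hs x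
    obtain ⟨W, hW, m, hm⟩ := hV ⟨x, hx⟩
    refine ⟨V ⊓ W, ⟨hx, hW⟩, res M inf_le_right m, fun y hy => ?_⟩
    rw [sharpGerm_res]
    exact hm ⟨y, hy.1⟩ hy.2
  germ_surj x a := by
    obtain ⟨U, hx, m, rfl⟩ := sharpGerm_surj a
    exact ⟨U, hx, fun y => sharpGerm M U y.2 m, fun y => ⟨U, y.2, m, fun z hz => rfl⟩, rfl⟩
  germ_inj U s t hs ht x hx := by
    obtain ⟨V, hV, m, hm⟩ := hs x
    obtain ⟨W, hW, n, hn⟩ := ht x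
    rw [hm x hV, hn x hW, sharpGerm_eq_iff] at hx
    obtain ⟨W', hW', h, h', ha⟩ := hx
    refine ⟨W', hW', fun y hy => ?_⟩
    rw [hm y (h hy), hn y (h' hy), sharpGerm_eq_iff]
    exact ⟨W', hy, h, h', ha⟩

end SharpSpace

/-! ### The small étale site -/

namespace Et

variable {X : Scheme.{u}}

/-- The structure morphism of an étale `X`-scheme. -/
abbrev str (U : X.Etale) : U.left ⟶ X := U.hom

/-- Morphisms of étale `X`-schemes. -/
def homMk {U V : X.Etale} (g : U.left ⟶ V.left) (w : g ≫ str V = str U) : U ⟶ V :=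
  MorphismProperty.Over.homMk g w

theorem homMk_left {U V : X.Etale} (g : U.left ⟶ V.left) (w : g ≫ str V = str U) :
    (homMk g w).left = g := rfl

theorem hom_ext {U V : X.Etale} {g h : U ⟶ V} (e : g.left = h.left) : g = h :=
  MorphismProperty.Over.Hom.ext e

theorem w {U V : X.Etale} (g : U ⟶ V) : g.left ≫ str V = str U :=
  MorphismProperty.Over.w g

theorem comp_left {U V W : X.Etale} (g : U ⟶ V) (h : V ⟶ W) :
    (g ≫ h).left = g.left ≫ h.left := rfl

theorem id_left (U : X.Etale) : (𝟙 U : U ⟶ U).left = 𝟙 U.left := rfl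

/-- Open subsets of `X` as étale `X`-schemes. -/
def ofOpens (X : Scheme.{u}) : X.Opens ⥤ X.Etale where
  obj U := Scheme.Etale.mk U.ι
  map h := homMk (X.homOfLE h.le) (X.homOfLE_ι _)
  map_id U := hom_ext (X.homOfLE_rfl U)
  map_comp g h := hom_ext (X.homOfLE_homOfLE g.le h.le).symm

end Et
/-! ### Logarithmic schemes -/

/-- A logarithmic structure on (the small étale site of) a scheme `X`: a sheaf of commutative
monoids `M` with a homomorphism `ρ : M → 𝒪_X` to the multiplicative monoid of the structure sheaf
that restricts to an isomorphism `ρ⁻¹ 𝒪_X^* → 𝒪_X^*`. -/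
structure LogStructure (X : Scheme.{u}) where
  M : X.Etaleᵒᵖ ⥤ CommMonCat.{u}
  isSheaf : Presheaf.IsSheaf X.smallEtaleTopology M
  ρ : ∀ U : X.Etale, M.obj (op U) →* Γ(U.left, ⊤)
  ρ_map : ∀ {U V : X.Etale} (h : U ⟶ V) (m : M.obj (op V)),
    ρ U ((M.map h.op).hom m) = h.left.appTop.hom (ρ V m)
  existsUnique_unit : ∀ (U : X.Etale) (f : Γ(U.left, ⊤)), IsUnit f → ∃! m : M.obj (op U), ρ U m = f

namespace LogStructure

variable {X : Scheme.{u}} (L : LogStructure X)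

/-- Restriction of sections of `M` along a morphism of étale `X`-schemes. -/
def res {U V : X.Etale} (h : U ⟶ V) : L.M.obj (op V) →* L.M.obj (op U) := (L.M.map h.op).hom

theorem res_res {U V W : X.Etale} (h : U ⟶ V) (h' : V ⟶ W) (m : L.M.obj (op W)) :
    L.res h (L.res h' m) = L.res (h ≫ h') m := by
  have : L.M.map (h ≫ h').op = L.M.map h'.op ≫ L.M.map h.op := by
    rw [← L.M.map_comp]; rfl
  exact (congrArg (fun f => f.hom m) this).symm

theorem res_id {U : X.Etale} (m : L.M.obj (op U)) : L.res (𝟙 U) m = m :=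
  congrArg (fun f => f.hom m) (L.M.map_id (op U))

theorem isUnit_of_isUnit_ρ {U : X.Etale} (m : L.M.obj (op U)) (hm : IsUnit (L.ρ U m)) :
    IsUnit m := by
  obtain ⟨c, hc⟩ := hm.exists_right_inv
  obtain ⟨n, hn, -⟩ := L.existsUnique_unit U c (IsUnit.of_mul_eq_one_right _ hc)
  refine IsUnit.of_mul_eq_one n ((L.existsUnique_unit U 1 isUnit_one).unique ?_ (map_one _))
  rw [map_mul, hn, hc]

/-- A homomorphism `β : P → M(U)` is a chart on `U` if `M` restricted to `U` is the logarithmic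
structure associated with the constant sheaf `P`, that is, if it is the pushout of
`P ⊇ (ρ β)⁻¹ 𝒪^* → 𝒪^*` in sheaves of monoids: locally every section of `M` is the product of an
element of `P` and a unit, and two such products `p` and `q u` define the same section of
`M` only if, locally, there are `a, b` in `P` that are invertible in `𝒪` with `p a = q b` and
`u a = b`. -/
structure IsChart {U : X.Etale} {P : Type u} [CommMonoid P] (β : P →* L.M.obj (op U)) : Prop where
  surj : ∀ (V : X.Etale) (h : V ⟶ U) (m : L.M.obj (op V)) (v : V.left),
    ∃ (W : X.Etale) (j : W ⟶ V) (w : W.left) (p : P) (u : L.M.obj (op W)),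
      j.left w = v ∧ IsUnit u ∧ L.res j m = L.res (j ≫ h) (β p) * u
  inj : ∀ (V : X.Etale) (h : V ⟶ U) (p q : P) (u : L.M.obj (op V)), IsUnit u →
    L.res h (β p) = L.res h (β q) * u → ∀ v : V.left,
      ∃ (W : X.Etale) (j : W ⟶ V) (w : W.left) (a b : P),
        j.left w = v ∧ IsUnit (L.ρ W (L.res (j ≫ h) (β a))) ∧
          IsUnit (L.ρ W (L.res (j ≫ h) (β b))) ∧ p * a = q * b ∧
            L.res j u * L.res (j ≫ h) (β a) = L.res (j ≫ h) (β b)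

/-- A logarithmic structure is fine and saturated if étale locally it has a chart by a fine and
saturated monoid. -/
def IsFineSaturated : Prop :=
  ∀ x : X, ∃ (U : X.Etale) (y : U.left) (P : Type u) (_ : CommMonoid P) (β : P →* L.M.obj (op U)),
    Et.str U y = x ∧ IsFs P ∧ L.IsChart β

/-- The logarithmic structure is defined on the Zariski site: it is the pullback of its restriction
to the Zariski site, i.e. étale locally every section of `M` is the product of a unit and
the pullback of a section defined on an open subset of `X`. -/
def IsZariski : Prop :=
  ∀ (U : X.Etale) (m : L.M.obj (op U)) (x : U.left),
    ∃ (W : X.Etale) (j : W ⟶ U) (w : W.left) (V : X.Opens) (h : W ⟶ (Et.ofOpens X).obj V)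
      (n : L.M.obj (op ((Et.ofOpens X).obj V))) (u : L.M.obj (op W)),
      j.left w = x ∧ IsUnit u ∧ L.res j m = L.res h n * u

/-- The restriction of `M` to the Zariski site. -/
def zar : X.Opensᵒᵖ ⥤ CommMonCat.{u} := (Et.ofOpens X).op ⋙ L.M

/-- The sharp monoidal space `(X, M / M^*)` on the Zariski site. -/
abbrev char : MonoidalSpace.{u} := sharpSpace L.zar

end LogStructure

/-- Fine and saturated (étale) logarithmic schemes of finite type over the field `k`. -/
structure LogSch (k : Type u) [Field k] where
  X : Scheme.{u}
  toBase : X ⟶ Spec (CommRingCat.of k)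
  locallyOfFiniteType : LocallyOfFiniteType toBase
  quasiCompact : QuasiCompact toBase
  log : LogStructure X
  fs : log.IsFineSaturated

namespace LogSch

variable {k : Type u} [Field k]

/-- A morphism of logarithmic schemes over `k`: a morphism of `k`-schemes `f : X → Y` with a
homomorphism `M_Y → f_* M_X` over `𝒪_Y → f_* 𝒪_X` (equivalently, a morphism of
logarithmic structures `f^* M_Y → M_X`). It is given by its components `M_Y(V) → M_X(U)` for all
étale `U → X` and `V → Y` and all morphisms `g : U → V` over `f`. -/
structure Hom (S T : LogSch.{u} k) where
  base : S.X ⟶ T.X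
  base_over : base ≫ T.toBase = S.toBase
  app : ∀ {U : S.X.Etale} {V : T.X.Etale} (g : U.left ⟶ V.left),
    g ≫ Et.str V = Et.str U ≫ base → (T.log.M.obj (op V) →* S.log.M.obj (op U))
  res_app : ∀ {U' U : S.X.Etale} {V : T.X.Etale} (h : U' ⟶ U) (g : U.left ⟶ V.left)
    (w : g ≫ Et.str V = Et.str U ≫ base) (w' : (h.left ≫ g) ≫ Et.str V = Et.str U' ≫ base)
    (n : T.log.M.obj (op V)), S.log.res h (app g w n) = app (h.left ≫ g) w' n
  app_res : ∀ {U : S.X.Etale} {V V' : T.X.Etale} (g : U.left ⟶ V.left) (h : V ⟶ V')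
    (w : g ≫ Et.str V = Et.str U ≫ base) (w' : (g ≫ h.left) ≫ Et.str V' = Et.str U ≫ base)
    (n : T.log.M.obj (op V')), app g w (T.log.res h n) = app (g ≫ h.left) w' n
  ρ_app : ∀ {U : S.X.Etale} {V : T.X.Etale} (g : U.left ⟶ V.left)
    (w : g ≫ Et.str V = Et.str U ≫ base) (n : T.log.M.obj (op V)),
    S.log.ρ U (app g w n) = g.appTop.hom (T.log.ρ V n)

namespace Hom

theorem ext' {S T : LogSch.{u} k} {f g : Hom S T} (hb : f.base = g.base)
    (h : ∀ {U : S.X.Etale} {V : T.X.Etale} (a : U.left ⟶ V.left)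
      (w : a ≫ Et.str V = Et.str U ≫ f.base) (w' : a ≫ Et.str V = Et.str U ≫ g.base) n,
      f.app a w n = g.app a w' n) : f = g := by
  obtain ⟨b, _, F, _, _, _⟩ := f
  obtain ⟨b', _, G, _, _, _⟩ := g
  obtain rfl : b = b' := hb
  have : @F = @G := by
    funext U V a w
    exact MonoidHom.ext fun n => h a w w n
  subst this
  rfl

/-- The components do not depend on the way in which the morphism of schemes is written. -/
theorem app_congr {S T : LogSch.{u} k} (f : Hom S T) {U : S.X.Etale} {V : T.X.Etale}
    {a b : U.left ⟶ V.left} (e : a = b) (w : a ≫ Et.str V = Et.str U ≫ f.base)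
    (w' : b ≫ Et.str V = Et.str U ≫ f.base) (n) : f.app a w n = f.app b w' n := by
  subst e
  rfl

/-- The identity of a logarithmic scheme. -/
def id (S : LogSch.{u} k) : Hom S S where
  base := 𝟙 S.X
  base_over := Category.id_comp _
  app g w := S.log.res (Et.homMk g (w.trans (Category.comp_id _)))
  res_app _ _ _ _ n := S.log.res_res _ _ n
  app_res _ _ _ _ n := S.log.res_res _ _ n
  ρ_app _ _ n := S.log.ρ_map _ n

section Comp

variable {S T R : LogSch.{u} k} (f : Hom S T) (g : Hom T R)

/-- The base change `V ×_R T → T` of an étale morphism `V → R`. -/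
def pb (V : R.X.Etale) : T.X.Etale :=
  Scheme.Etale.mk (pullback.snd (Et.str V) g.base)

/-- The projection `V ×_R T → V`. -/
def pbFst (V : R.X.Etale) : (g.pb V).left ⟶ V.left := pullback.fst (Et.str V) g.base

theorem pbFst_w (V : R.X.Etale) : g.pbFst V ≫ Et.str V = Et.str (g.pb V) ≫ g.base :=
  pullback.condition

/-- The morphism to `V ×_R T` given by morphisms to `V` and `T`. -/
def pbLift {V : R.X.Etale} {U : Scheme.{u}} (a : U ⟶ V.left) (b : U ⟶ T.X)
    (w : a ≫ Et.str V = b ≫ g.base) : U ⟶ (g.pb V).left := pullback.lift a b w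

theorem pbLift_fst {V : R.X.Etale} {U : Scheme.{u}} (a : U ⟶ V.left) (b : U ⟶ T.X)
    (w : a ≫ Et.str V = b ≫ g.base) : g.pbLift a b w ≫ g.pbFst V = a := pullback.lift_fst _ _ _

theorem pbLift_str {V : R.X.Etale} {U : Scheme.{u}} (a : U ⟶ V.left) (b : U ⟶ T.X)
    (w : a ≫ Et.str V = b ≫ g.base) : g.pbLift a b w ≫ Et.str (g.pb V) = b :=
  pullback.lift_snd _ _ _

theorem pb_ext {V : R.X.Etale} {U : Scheme.{u}} {c d : U ⟶ (g.pb V).left}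
    (h : c ≫ g.pbFst V = d ≫ g.pbFst V) (h' : c ≫ Et.str (g.pb V) = d ≫ Et.str (g.pb V)) : c = d :=
  pullback.hom_ext h h'

/-- The components of a composition. -/
def compApp {U : S.X.Etale} {V : R.X.Etale} (a : U.left ⟶ V.left)
    (w : a ≫ Et.str V = Et.str U ≫ f.base ≫ g.base) : R.log.M.obj (op V) →* S.log.M.obj (op U) :=
  (f.app (g.pbLift a (Et.str U ≫ f.base) (w.trans (Category.assoc _ _ _).symm))
    (g.pbLift_str _ _ _)).comp (g.app (g.pbFst V) (g.pbFst_w V))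

/-- The components of a composition, computed through any factorization. -/
theorem app_app {U : S.X.Etale} {V : T.X.Etale} {W : R.X.Etale} (a : U.left ⟶ V.left)
    (b : V.left ⟶ W.left) (wa : a ≫ Et.str V = Et.str U ≫ f.base)
    (wb : b ≫ Et.str W = Et.str V ≫ g.base)
    (w : (a ≫ b) ≫ Et.str W = Et.str U ≫ f.base ≫ g.base) (n : R.log.M.obj (op W)) :
    f.app a wa (g.app b wb n) = compApp f g (a ≫ b) w n := by
  have h1 := g.res_app (Et.homMk (g.pbLift b (Et.str V) wb) (g.pbLift_str _ _ _)) (g.pbFst W)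
    (g.pbFst_w W) (by rw [Et.homMk_left, g.pbLift_fst]; exact wb) n
  have e1 : (Et.homMk (g.pbLift b (Et.str V) wb) (g.pbLift_str _ _ _)).left ≫ g.pbFst W = b :=
    g.pbLift_fst b (Et.str V) wb
  rw [g.app_congr e1 _ wb] at h1
  rw [← h1]
  have e2 : a ≫ (Et.homMk (g.pbLift b (Et.str V) wb) (g.pbLift_str _ _ _) : V ⟶ g.pb W).left =
      g.pbLift (a ≫ b) (Et.str U ≫ f.base) (w.trans (Category.assoc _ _ _).symm) := by
    rw [Et.homMk_left]
    apply g.pb_ext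
    · rw [g.pbLift_fst, Category.assoc, g.pbLift_fst]
    · rw [g.pbLift_str, Category.assoc, g.pbLift_str, wa]
  rw [f.app_res a _ wa (by rw [e2, g.pbLift_str])]
  exact f.app_congr e2 _ _ _

/-- The composition of morphisms of logarithmic schemes. -/
def comp : Hom S R where
  base := f.base ≫ g.base
  base_over := by rw [Category.assoc, g.base_over, f.base_over]
  app a w := compApp f g a w
  res_app {U' U V} h a w w' n := by
    have e : h.left ≫ g.pbLift a (Et.str U ≫ f.base) (w.trans (Category.assoc _ _ _).symm) =
        g.pbLift (h.left ≫ a) (Et.str U' ≫ f.base) (w'.trans (Category.assoc _ _ _).symm) := by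
      apply g.pb_ext
      · rw [Category.assoc, g.pbLift_fst, g.pbLift_fst]
      · rw [Category.assoc, g.pbLift_str, g.pbLift_str, ← Category.assoc, Et.w]
    refine (f.res_app h _ (g.pbLift_str _ _ _) (by rw [e, g.pbLift_str]) _).trans ?_
    exact f.app_congr e _ _ _
  app_res {U V V'} a h w w' n := by
    have w1 : g.pbFst V ≫ Et.str V = Et.str (g.pb V) ≫ g.base := g.pbFst_w V
    have w2 : (g.pbFst V ≫ h.left) ≫ Et.str V' = Et.str (g.pb V) ≫ g.base := by
      rw [Category.assoc, Et.w, w1]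
    have e : g.pbLift a (Et.str U ≫ f.base) (w.trans (Category.assoc _ _ _).symm) ≫
        g.pbFst V ≫ h.left = a ≫ h.left := by
      rw [← Category.assoc, g.pbLift_fst]
    have h1 : compApp f g a w (R.log.res h n) = f.app
        (g.pbLift a (Et.str U ≫ f.base) (w.trans (Category.assoc _ _ _).symm))
        (g.pbLift_str _ _ _) (g.app (g.pbFst V ≫ h.left) w2 n) :=
      congrArg _ (g.app_res (g.pbFst V) h w1 w2 n)
    rw [h1, app_app f g _ _ _ _ (by rw [e]; exact w')]
    simp only [e]
  ρ_app {U V} a w n := by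
    refine (f.ρ_app _ (g.pbLift_str _ _ _) _).trans ?_
    rw [g.ρ_app, ← CommRingCat.comp_apply, ← Scheme.Hom.comp_appTop, g.pbLift_fst]

theorem comp_app_comp {U : S.X.Etale} {V : T.X.Etale} {W : R.X.Etale} (a : U.left ⟶ V.left)
    (b : V.left ⟶ W.left) (wa : a ≫ Et.str V = Et.str U ≫ f.base)
    (wb : b ≫ Et.str W = Et.str V ≫ g.base)
    (w : (a ≫ b) ≫ Et.str W = Et.str U ≫ (f.comp g).base) (n : R.log.M.obj (op W)) :
    (f.comp g).app (a ≫ b) w n = f.app a wa (g.app b wb n) :=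
  (app_app f g a b wa wb w n).symm

end Comp

end Hom

theorem id_app_id (S : LogSch.{u} k) {U : S.X.Etale} (w) (n : S.log.M.obj (op U)) :
    (Hom.id S).app (𝟙 U.left) w n = n := S.log.res_id n

instance : Category (LogSch.{u} k) where
  Hom := Hom
  id := Hom.id
  comp f g := f.comp g
  id_comp {S T} f := Hom.ext' (Category.id_comp _) fun {U V} a w w' n => by
    have e := Category.id_comp a
    have h := Hom.comp_app_comp (Hom.id S) f (𝟙 U.left) a
      ((Category.id_comp _).trans (Category.comp_id _).symm) w' (by rw [e]; exact w) n
    rw [id_app_id] at h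
    rw [← h]
    exact Hom.app_congr _ e.symm _ _ _
  comp_id {S T} f := Hom.ext' (Category.comp_id _) fun {U V} a w w' n => by
    have e := Category.comp_id a
    have h := Hom.comp_app_comp f (Hom.id T) a (𝟙 V.left) w'
      ((Category.id_comp _).trans (Category.comp_id _).symm) (by rw [e]; exact w) n
    rw [id_app_id] at h
    rw [← h]
    exact Hom.app_congr _ e.symm _ _ _
  assoc {S T R Q} f g h := Hom.ext' (Category.assoc _ _ _) fun {U V} a w w' n => by
    have wV : a ≫ Et.str V = (Et.str U ≫ f.base ≫ g.base) ≫ h.base := by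
      rw [w', Category.assoc]
      rfl
    let b := h.pbLift a (Et.str U ≫ f.base ≫ g.base) wV
    have wb : b ≫ Et.str (h.pb V) = (Et.str U ≫ f.base) ≫ g.base := by
      rw [h.pbLift_str, Category.assoc]
    let c := g.pbLift b (Et.str U ≫ f.base) wb
    have wc : c ≫ Et.str (g.pb (h.pb V)) = Et.str U ≫ f.base := g.pbLift_str _ _ _
    have eb : b ≫ h.pbFst V = a := h.pbLift_fst _ _ _
    have ec : c ≫ g.pbFst (h.pb V) = b := g.pbLift_fst _ _ _
    have wb' : b ≫ Et.str (h.pb V) = Et.str U ≫ (f.comp g).base := h.pbLift_str _ _ _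
    have wd : (g.pbFst (h.pb V) ≫ h.pbFst V) ≫ Et.str V =
        Et.str (g.pb (h.pb V)) ≫ (g.comp h).base := by
      rw [Category.assoc, h.pbFst_w, ← Category.assoc, g.pbFst_w, Category.assoc]
      rfl
    have h1 := Hom.comp_app_comp (f.comp g) h b (h.pbFst V) wb' (h.pbFst_w V)
      (by rw [eb]; exact w) n
    have h2 := Hom.comp_app_comp f g c (g.pbFst (h.pb V)) wc (g.pbFst_w _)
      (by rw [ec]; exact wb') (h.app (h.pbFst V) (h.pbFst_w V) n)
    have ecb : c ≫ g.pbFst (h.pb V) ≫ h.pbFst V = a := by rw [← Category.assoc, ec, eb]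
    have h3 := Hom.comp_app_comp f (g.comp h) c (g.pbFst (h.pb V) ≫ h.pbFst V) wc wd
      (by rw [ecb]; exact w') n
    have h4 := Hom.comp_app_comp g h (g.pbFst (h.pb V)) (h.pbFst V) (g.pbFst_w _) (h.pbFst_w V)
      wd n
    rw [h4, ← h2] at h3
    rw [((f.comp g).comp h).app_congr eb.symm w (by rw [eb]; exact w), h1,
      (f.comp (g.comp h)).app_congr ecb.symm w' (by rw [ecb]; exact w'), h3]
    exact (f.comp g).app_congr ec.symm _ _ _

/-! ### Characteristic morphisms -/

section Char

variable {S T : LogSch.{u} k} (f : S ⟶ T)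

/-- The component `M_T(V) → M_S(f⁻¹ V)` for an open subset `V`. -/
def openApp (V : T.X.Opens) : T.log.zar.obj (op V) →* S.log.zar.obj (op (f.base ⁻¹ᵁ V)) :=
  f.app (U := (Et.ofOpens S.X).obj (f.base ⁻¹ᵁ V)) (V := (Et.ofOpens T.X).obj V)
    (f.base ∣_ V) (morphismRestrict_ι _ _)

theorem openApp_res {U V : T.X.Opens} (h : U ≤ V) (n : T.log.zar.obj (op V)) :
    openApp f U (res T.log.zar h n) =
      res S.log.zar (f.base.preimage_mono h) (openApp f V n) := by
  have w : (f.base ∣_ U ≫ T.X.homOfLE h) ≫ V.ι = (f.base ⁻¹ᵁ U).ι ≫ f.base := by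
    rw [Category.assoc, Scheme.homOfLE_ι, morphismRestrict_ι]
  have w' : (S.X.homOfLE (f.base.preimage_mono h) ≫ f.base ∣_ V) ≫ V.ι =
      (f.base ⁻¹ᵁ U).ι ≫ f.base := by
    rw [Category.assoc, morphismRestrict_ι, ← Category.assoc, Scheme.homOfLE_ι]
  have e : f.base ∣_ U ≫ T.X.homOfLE h = S.X.homOfLE (f.base.preimage_mono h) ≫ f.base ∣_ V := by
    rw [← cancel_mono V.ι, w, w']
  exact (Hom.app_res f (U := (Et.ofOpens S.X).obj (f.base ⁻¹ᵁ U))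
    (V := (Et.ofOpens T.X).obj U) (V' := (Et.ofOpens T.X).obj V) (f.base ∣_ U)
    ((Et.ofOpens T.X).map (homOfLE h)) (morphismRestrict_ι _ _) w n).trans
      ((Hom.app_congr f (U := (Et.ofOpens S.X).obj (f.base ⁻¹ᵁ U))
        (V := (Et.ofOpens T.X).obj V) e w w' n).trans
        (Hom.res_app f (V := (Et.ofOpens T.X).obj V)
          ((Et.ofOpens S.X).map (homOfLE (f.base.preimage_mono h))) (f.base ∣_ V)
          (morphismRestrict_ι _ _) w' n).symm)

theorem isUnit_of_openApp {x : S.X} {V : T.X.Opens} (n : T.log.zar.obj (op V)) {W : S.X.Opens} (hW : x ∈ W) (h : W ≤ f.base ⁻¹ᵁ V)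
    (hn : IsUnit (res S.log.zar h (openApp f V n))) :
    ∃ (V' : T.X.Opens) (_ : f.base x ∈ V') (h' : V' ≤ V), IsUnit (res T.log.zar h' n) := by
  let s : Γ((V : Scheme.{u}), ⊤) := T.log.ρ ((Et.ofOpens T.X).obj V) n
  let g : (W : Scheme.{u}) ⟶ (V : Scheme.{u}) := S.X.homOfLE h ≫ f.base ∣_ V
  have hg : g ≫ V.ι = W.ι ≫ f.base := by
    rw [Category.assoc, morphismRestrict_ι, ← Category.assoc, S.X.homOfLE_ι]
  have h1 : IsUnit (g.appTop.hom s) := by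
    have e := S.log.ρ_map ((Et.ofOpens S.X).map (homOfLE h)) (openApp f V n)
    have e' := Hom.ρ_app f (U := (Et.ofOpens S.X).obj (f.base ⁻¹ᵁ V))
      (V := (Et.ofOpens T.X).obj V) (f.base ∣_ V) (morphismRestrict_ι _ _) n
    have e'' : g.appTop.hom s = S.log.ρ ((Et.ofOpens S.X).obj W)
        (res S.log.zar h (openApp f V n)) := by
      refine Eq.trans ?_ e.symm
      refine Eq.trans ?_ (congrArg (S.X.homOfLE h).appTop.hom e'.symm)
      rw [Scheme.Hom.comp_appTop]
      rfl
    rw [e'']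
    exact hn.map _
  have h2 : g ⟨x, hW⟩ ∈ (V : Scheme.{u}).basicOpen s := by
    have := Scheme.preimage_basicOpen_top g s
    rw [Scheme.basicOpen_of_isUnit _ h1] at this
    change (⟨x, hW⟩ : (W : Scheme.{u})) ∈ g ⁻¹ᵁ (V : Scheme.{u}).basicOpen s
    rw [this]
    trivial
  have h3 : V.ι (g ⟨x, hW⟩) = f.base x := by
    have : (g ≫ V.ι) ⟨x, hW⟩ = (W.ι ≫ f.base) ⟨x, hW⟩ := by rw [hg]
    exact this
  have hV' : V.ι ''ᵁ (V : Scheme.{u}).basicOpen s ≤ V := by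
    rintro _ ⟨y, -, rfl⟩
    exact y.2
  refine ⟨V.ι ''ᵁ (V : Scheme.{u}).basicOpen s, ⟨_, h2, h3⟩, hV', ?_⟩
  refine T.log.isUnit_of_isUnit_ρ _ ?_
  have e := T.log.ρ_map ((Et.ofOpens T.X).map (homOfLE hV')) n
  have h4 : IsUnit ((T.X.homOfLE hV').appTop.hom s) := by
    rw [Scheme.homOfLE_appTop]
    have h5 := ((V : Scheme.{u}).toRingedSpace.isUnit_res_basicOpen s).map
      (T.X.presheaf.map (homOfLE (Scheme.Opens.ι_image_le
        (V.ι ''ᵁ (V : Scheme.{u}).basicOpen s) ⊤)).op).hom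
    have h6 : ∀ {A B C : T.X.Opens} (a : A ⟶ B) (b : B ⟶ C) (c : A ⟶ C) (t : Γ(T.X, C)),
        (T.X.presheaf.map a.op).hom ((T.X.presheaf.map b.op).hom t) =
          (T.X.presheaf.map c.op).hom t := by
      intro A B C a b c t
      rw [← CommRingCat.comp_apply, ← Functor.map_comp, ← op_comp, Subsingleton.elim (a ≫ b) c]
    exact Eq.mp (congrArg IsUnit (h6 _ _ _ _)) h5
  exact Eq.mpr (congrArg IsUnit e) h4

/-- The map `M_T(V) → M_{S, x} / M_{S, x}^*` for an open neighbourhood `V` of `f x`. -/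
def charGermMap {x : S.X} (V : T.X.Opens) (hV : x ∈ f.base ⁻¹ᵁ V) :
    T.log.zar.obj (op V) →* SharpStalk S.log.zar x where
  toFun n := sharpGerm S.log.zar (f.base ⁻¹ᵁ V) hV (openApp f V n)
  map_one' := by rw [map_one, sharpGerm_one]
  map_mul' m n := by rw [map_mul, sharpGerm_mul]

theorem charGermMap_res {x : S.X} {U V : T.X.Opens} (h : U ≤ V) (hU : x ∈ f.base ⁻¹ᵁ U)
    (m : T.log.zar.obj (op V)) :
    charGermMap f U hU (res T.log.zar h m) = charGermMap f V (f.base.preimage_mono h hU) m := by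
  change sharpGerm _ _ _ _ = sharpGerm _ _ _ _
  rw [openApp_res, sharpGerm_res]

/-- The homomorphism `M_{T, f x} / M_{T, f x}^* → M_{S, x} / M_{S, x}^*`. -/
def charStalkMap (x : S.X) : SharpStalk T.log.zar (f.base x) →* SharpStalk S.log.zar x :=
  sharpLift T.log.zar (fun V hV => charGermMap f V hV)
    (fun _ _ hU _ h m => charGermMap_res f h hU m)
    (fun _ _ _ hm => sharpGerm_eq_one _ _ _ (hm.map _))

theorem isUnit_of_charStalkMap (x : S.X) (a : SharpStalk T.log.zar (f.base x))
    (ha : IsUnit (charStalkMap f x a)) : IsUnit a := by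
  obtain ⟨V, hV, n, rfl⟩ := sharpGerm_surj a
  obtain ⟨W, hW, h, hn⟩ := sharpGerm_isUnit _ _ _ ha
  obtain ⟨V', hV', h', hn'⟩ := isUnit_of_openApp f n hW h hn
  rw [← sharpGerm_res _ h' hV', sharpGerm_eq_one _ _ _ hn']
  exact isUnit_one

/-- The morphism `(S, M_S / M_S^*) → (T, M_T / M_T^*)` induced by a morphism of logarithmic
schemes. -/
def charMap : MonoidalSpace.Hom S.log.char T.log.char where
  base := f.base
  continuous_base := f.base.continuous
  stalkMap x := charStalkMap f x
  isSection V s hs x := by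
    obtain ⟨W, hW, m, hm⟩ := hs ⟨f.base x.1, x.2⟩
    exact ⟨f.base ⁻¹ᵁ W, hW, openApp f W m, fun y hy =>
      congrArg (charStalkMap f y.1) (hm ⟨f.base y.1, y.2⟩ hy)⟩
  isLocal x a ha := isUnit_of_charStalkMap f x a ha

end Char

end LogSch

/-! ### The analytic space `X^ℶ` -/

/-- The underlying set of the analytic space `X^ℶ` of a scheme `X` of finite type over a trivially
valued field. On an affine open subset `Spec A` it is the set of multiplicative seminorms `A → [0, 1]`,
the reduction map sends such a seminorm to the prime ideal `{|f| < 1}`, and for varying affine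
open subsets these sets are glued along the preimages of the intersections under the reduction map. So
a point is the same thing as a point `pt` of `X` (its reduction) together with a multiplicative
(and then non-archimedean) seminorm on the local ring at `pt` that is bounded by `1` and is
smaller than `1` precisely on the maximal ideal. It is automatically trivial on the ground field. -/
@[ext]
structure Beth (X : Scheme.{u}) where
  pt : X
  val : Valuation (X.presheaf.stalk pt) ℝ≥0
  le_one : ∀ f, val f ≤ 1
  lt_one_iff : ∀ f, val f < 1 ↔ ¬ IsUnit f

namespace Beth

variable {X Y : Scheme.{u}}

/-- The values of the functions on an affine open subset `U` at the points that reduce to `U`. -/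
def eval (U : X.Opens) (x : {x : Beth X // x.pt ∈ U}) (f : Γ(X, U)) : ℝ≥0 :=
  x.1.val (X.presheaf.germ U x.1.pt x.2 f)

/-- On `U^ℶ` for `U` affine the topology is the coarsest one for which `x ↦ |f|_x` is continuous for
all functions `f` on `U`; a subset of `X^ℶ` is closed if and only if its trace on `U^ℶ` is closed
for all affine open subsets `U`. -/
instance : TopologicalSpace (Beth X) :=
  ⨆ U : X.affineOpens, TopologicalSpace.coinduced Subtype.val
    (TopologicalSpace.induced (eval U.1) inferInstance)

/-- The map `f^ℶ : X^ℶ → Y^ℶ` induced by a morphism of schemes. -/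
def map (f : X ⟶ Y) (x : Beth X) : Beth Y where
  pt := f x.pt
  val := x.val.comap (f.stalkMap x.pt).hom
  le_one _ := x.le_one _
  lt_one_iff a := (x.lt_one_iff _).trans (isUnit_map_iff (f.stalkMap x.pt).hom a).not

end Beth

/-- The homomorphism `f ↦ - log |f|` to `[0, ∞]` given by a valuation that is bounded by `1`. -/
def negLogVal {A : Type u} [CommRing A] (v : Valuation A ℝ≥0) (hv : ∀ f, v f ≤ 1) : A →* RBar where
  toFun f := Multiplicative.ofAdd (if v f = 0 then ⊤ else ENNReal.ofReal (-Real.log (v f)))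
  map_one' := by simp
  map_mul' a b := by
    rw [← ofAdd_add, map_mul]
    congr 1
    by_cases ha : v a = 0
    · simp [ha]
    by_cases hb : v b = 0
    · simp [hb]
    rw [if_neg ha, if_neg hb, if_neg (mul_ne_zero ha hb)]
    refine Eq.trans ?_ (ENNReal.ofReal_add
      (neg_nonneg.2 (Real.log_nonpos (v a).2 (NNReal.coe_le_one.2 (hv a))))
      (neg_nonneg.2 (Real.log_nonpos (v b).2 (NNReal.coe_le_one.2 (hv b)))))
    rw [NNReal.coe_mul, Real.log_mul (NNReal.coe_ne_zero.2 ha) (NNReal.coe_ne_zero.2 hb), neg_add]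

theorem negLogVal_eq_one {A : Type u} [CommRing A] (v : Valuation A ℝ≥0) (hv : ∀ f, v f ≤ 1) {f : A}
    (h : v f = 1) : negLogVal v hv f = 1 := by
  simp [negLogVal, h]

namespace LogSch

variable {k : Type u} [Field k]

/-! ### Tropicalization of Zariski logarithmic schemes -/

section TropStalk

variable (S : LogSch.{u} k)

/-- The germ at `x` of `ρ m`, for a section `m` of `M` on an open neighbourhood `U` of `x`. -/
def ρGerm (x : S.X) (U : S.X.Opens) (hx : x ∈ U) :
    S.log.zar.obj (op U) →* S.X.presheaf.stalk x :=
  (S.X.presheaf.germ U x hx).hom.toMonoidHom.comp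
    (U.topIso.hom.hom.toMonoidHom.comp (S.log.ρ ((Et.ofOpens S.X).obj U)))

theorem ρGerm_res (x : S.X) {U V : S.X.Opens} (h : U ≤ V) (hx : x ∈ U)
    (m : S.log.zar.obj (op V)) :
    S.ρGerm x U hx (res S.log.zar h m) = S.ρGerm x V (h hx) m := by
  have h1 : S.log.ρ ((Et.ofOpens S.X).obj U) (res S.log.zar h m) =
      (S.X.homOfLE h).appTop.hom (S.log.ρ ((Et.ofOpens S.X).obj V) m) :=
    S.log.ρ_map ((Et.ofOpens S.X).map (homOfLE h)) m
  have h2 : (S.X.homOfLE h).appTop ≫ U.topIso.hom = V.topIso.hom ≫ S.X.presheaf.map (homOfLE h).op := by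
    have h6 : ∀ {A B B' C : S.X.Opens} (a : A ⟶ B) (b : B ⟶ C) (a' : A ⟶ B') (b' : B' ⟶ C),
        S.X.presheaf.map b.op ≫ S.X.presheaf.map a.op =
          S.X.presheaf.map b'.op ≫ S.X.presheaf.map a'.op := by
      intro A B B' C a b a' b'
      rw [← Functor.map_comp, ← Functor.map_comp, ← op_comp, ← op_comp,
        Subsingleton.elim (a ≫ b) (a' ≫ b')]
    rw [Scheme.homOfLE_appTop]
    exact h6 _ _ _ _
  have h3 : (S.X.homOfLE h).appTop ≫ U.topIso.hom ≫ S.X.presheaf.germ U x hx =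
      V.topIso.hom ≫ S.X.presheaf.germ V x (h hx) := by
    rw [← Category.assoc, h2, Category.assoc, TopCat.Presheaf.germ_res]
  refine (congrArg (fun a => (S.X.presheaf.germ U x hx).hom (U.topIso.hom.hom a)) h1).trans ?_
  exact congrArg (fun f => f.hom (S.log.ρ ((Et.ofOpens S.X).obj V) m)) h3

/-- The composition `M_r / M_r^* → 𝒪_r / 𝒪_r^* → [0, ∞]`, where `r` is the reduction of the point `x` of
`S^ℶ` and the second map is `f ↦ - log |f|_x`. -/
def tropStalk (x : Beth S.X) : SharpStalk S.log.zar x.pt →* RBar :=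
  sharpLift S.log.zar (fun U hU => (negLogVal x.val x.le_one).comp (S.ρGerm x.pt U hU))
    (fun _ _ hU _ h m => congrArg (negLogVal x.val x.le_one) (S.ρGerm_res x.pt h hU m))
    (fun U hU _ hm =>
      negLogVal_eq_one _ x.le_one (le_antisymm (x.le_one _)
        (not_lt.1 ((x.lt_one_iff _).not.2 (not_not.2 (hm.map (S.ρGerm x.pt U hU)))))))

end TropStalk

/-- The universal property of the characteristic morphism `(S, M_S / M_S^*) → F_S`: it is a strict
morphism to a fine and saturated Kato fan, and every strict morphism to a fine and saturated
Kato fan factors uniquely through it by a strict morphism. -/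
structure IsCharacteristic (S : LogSch.{u} k) {F : MonoidalSpace.{u}}
    (φ : MonoidalSpace.Hom S.log.char F) : Prop where
  isFsKatoFan : IsFsKatoFan F
  isStrict : φ.IsStrict
  existsUnique : ∀ (G : MonoidalSpace.{u}) (ψ : MonoidalSpace.Hom S.log.char G), IsFsKatoFan G →
    ψ.IsStrict → ∃! g : MonoidalSpace.Hom F G, g.IsStrict ∧ φ.comp g = ψ

/-- The logarithmic structure is defined on the Zariski site and `S` has a characteristic
morphism. -/
structure IsSimple (S : LogSch.{u} k) : Prop where
  isZariski : S.log.IsZariski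
  exists_characteristic : ∃ (F : MonoidalSpace.{u}) (φ : MonoidalSpace.Hom S.log.char F),
    S.IsCharacteristic φ

namespace IsSimple

variable {S T : LogSch.{u} k}

/-- The Kato fan `F_S`. -/
def fan (hS : S.IsSimple) : MonoidalSpace.{u} := hS.exists_characteristic.choose

/-- The characteristic morphism `φ_S : (S, M_S / M_S^*) → F_S`. -/
def φ (hS : S.IsSimple) : MonoidalSpace.Hom S.log.char hS.fan :=
  hS.exists_characteristic.choose_spec.choose

theorem isCharacteristic (hS : S.IsSimple) : S.IsCharacteristic hS.φ :=
  hS.exists_characteristic.choose_spec.choose_spec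

/-- The tropicalization map `S^ℶ → F_S([0, ∞])`. A point `x` of `S^ℶ` is sent to the morphism
`Spec [0, ∞] → F_S` that maps the closed point to `φ_S(r)`, `r` the reduction of `x`, and is given
there by `𝒪_{F_S, φ_S(r)} → M_r / M_r^* → 𝒪_r / 𝒪_r^* → [0, ∞]`, the last map being `f ↦ - log |f|_x`. -/
def trop (hS : S.IsSimple) (x : Beth S.X) : ExtCone hS.fan :=
  ExtCone.ofStalk hS.isCharacteristic.isFsKatoFan (hS.φ.base x.pt)
    ((S.tropStalk x).comp (hS.φ.stalkMap x.pt))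

/-- `g : F_S → F_T` is compatible with `f : S → T` and the characteristic morphisms. -/
def IsFanMap (hS : S.IsSimple) (hT : T.IsSimple) (f : S ⟶ T)
    (g : MonoidalSpace.Hom hS.fan hT.fan) : Prop :=
  hS.φ.comp g = (charMap f).comp hT.φ

end IsSimple

/-! ### Tropicalization of étale logarithmic schemes -/

/-- Strict surjective étale morphisms `f : S → T`. For étale `f` the inverse image `f^* M_T` is the
restriction of `M_T` to the étale `S`-schemes, so that strictness means that
`M_T(U) → M_S(U)` is bijective for all étale `U → S`. -/
structure IsStrictEtaleCover {S T : LogSch.{u} k} (f : S ⟶ T) : Prop where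
  etale : Etale f.base
  surjective : Function.Surjective f.base
  strict : ∀ U : S.X.Etale, Function.Bijective
    (f.app (U := U) (V := Scheme.Etale.mk (Et.str U ≫ f.base)) (𝟙 U.left) (Category.id_comp _))

/-- Simple strict étale coverings of `T`. -/
structure SimpleCover (T : LogSch.{u} k) where
  src : LogSch.{u} k
  simple : src.IsSimple
  map : src ⟶ T
  cover : IsStrictEtaleCover map

/-- The identifications that the morphisms of simple strict étale coverings impose on the disjoint
union of the extended cone complexes of all simple strict étale coverings. -/
inductive GenExtCone.Rel (T : LogSch.{u} k) :
    (Σ c : SimpleCover T, ExtCone c.simple.fan) → (Σ c : SimpleCover T, ExtCone c.simple.fan) → Prop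
  | mk (c d : SimpleCover T) (h : c.src ⟶ d.src) (hh : IsStrictEtaleCover h)
      (w : h ≫ d.map = c.map) (g : MonoidalSpace.Hom c.simple.fan d.simple.fan)
      (hg : c.simple.IsFanMap d.simple h g) (z : ExtCone c.simple.fan) :
      GenExtCone.Rel T ⟨c, z⟩ ⟨d, ExtCone.map g z⟩

/-- The generalized extended cone complex of `T`: the colimit, in topological spaces, of the extended
cone complexes of all simple strict étale coverings of `T`. -/
def GenExtCone (T : LogSch.{u} k) : Type (u + 1) := Quot (GenExtCone.Rel T)

instance (T : LogSch.{u} k) : TopologicalSpace (GenExtCone T) :=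
  inferInstanceAs (TopologicalSpace (Quot (GenExtCone.Rel T)))

/-- The map from the extended cone complex of a simple strict étale covering to the colimit. -/
def SimpleCover.ι {T : LogSch.{u} k} (c : SimpleCover T) (z : ExtCone c.simple.fan) :
    GenExtCone T :=
  Quot.mk _ ⟨c, z⟩

/-- `t` is the colimit of the tropicalization maps of all simple strict étale coverings. -/
def IsTrop (T : LogSch.{u} k) (t : Beth T.X → GenExtCone T) : Prop :=
  ∀ (c : SimpleCover T) (x : Beth c.src.X), t (Beth.map c.map.base x) = c.ι (c.simple.trop x)

/-- `s` is compatible with the maps of Kato fans that are induced by morphisms of simple strict étale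
coverings lying over `f`. -/
def IsInduced {S T : LogSch.{u} k} (f : S ⟶ T) (s : GenExtCone S → GenExtCone T) : Prop :=
  ∀ (c : SimpleCover S) (d : SimpleCover T) (h : c.src ⟶ d.src), h ≫ d.map = c.map ≫ f →
    ∀ g : MonoidalSpace.Hom c.simple.fan d.simple.fan, c.simple.IsFanMap d.simple h g →
      ∀ z : ExtCone c.simple.fan, s (c.ι z) = d.ι (ExtCone.map g z)

end LogSch

end LogTrop

end

/-!
The tropicalization of a logarithmic scheme is constructed étale locally from Kato fans, so the proof
has to control morphisms of Kato fans, points of the analytic space over étale coverings, and simple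
coverings.

*Fans.* In a fine and saturated Kato fan every point has a smallest neighbourhood, which is the
spectrum of its stalk. A homomorphism of a stalk of a fan to a stalk of a sharp monoidal space
therefore extends in a unique way to the generizations (`IsFsKatoFan.exists_gen`,
`IsFsKatoFan.gen_unique`).

*Descent.* A characteristic morphism `φ : X → F` has the universal property for strict morphisms only.
For locally constant data on `X` that live over the generizations of the points `φ x`, the étale space
of germs over `F` is again a Kato fan, and the universal property of `φ` provides a section of it.
So such data depend on the point of `F` only (`Hom.IsInitial.descent`), and every point of `F` is a
generization of a point `φ x` (`Hom.IsInitial.exists_specializes`). Applied to the local factorizations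
of a not necessarily strict morphism this gives `Hom.IsInitial.existsUnique_factor`, hence the
morphism of fans that is induced by a morphism of simple logarithmic schemes.

*Analytic spaces.* The analytic space of an affine scheme is compact and Hausdorff, so quasi-compact
morphisms induce closed maps (`Beth.isClosedMap_map`). Valuations bounded by `1` extend along étale
homomorphisms with prescribed center (`exists_valuation_of_etale`, by going down for flat extensions
of valuation rings and domination of local rings by valuation rings), and compatible valuations on
two étale algebras extend to the tensor product (`exists_valuation_tensorProduct`). So strict étale
coverings are surjective on analytic spaces, and for two strict étale coverings the analytic space
of the fibre product surjects onto the fibre product of the analytic spaces.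

*Simple coverings.* A chart gives a strict morphism from an étale neighbourhood of a point `y` to a
fan. After shrinking the neighbourhood every stratum specializes to `y`, and then this morphism is
characteristic up to separating components (`MonoidalSpace.exists_isInitial`,
`LogSch.isSimple_of_charts`). This proves `LogSch.nonempty_simpleCover`. A strict étale morphism
of simple logarithmic schemes induces a strict morphism of fans (`LogSch.IsSimple.fanMap_isStrict`),
along which points of the extended cone complexes lift locally in a unique way.

*The colimit.* Any two simple coverings have a common refinement, by a simple covering of the fibre
product. The tropicalization map is defined by lifting points to a covering, and it is continuous
because a closed surjection is a quotient map (`LogSch.exists_trop`, `LogSch.IsTrop.continuous`). The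
map `Σ(f)` is defined by lifting a point of the extended cone complex of a covering to a refinement
that maps to a covering of the target. That the value does not depend on the lift is once more descent
along the characteristic morphism (`LogSch.existsUnique_induced`), and continuity follows from lifting
affine open subsets of the fan (`LogSch.continuous_induced`).
-/

noncomputable section

namespace LogTrop

/-! ### Generization maps of monoidal spaces -/

/-- A homomorphism out of `A` that identifies the elements with the same image under a surjective
homomorphism `f : A → B` factors through `f`. -/
def liftSurj {A : Type*} {B : Type*} {C : Type*} [CommMonoid A] [CommMonoid B] [CommMonoid C]
    (f : A →* B) (hf : Function.Surjective f) (g : A →* C) (hg : ∀ a b, f a = f b → g a = g b) :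
    B →* C where
  toFun b := g (Function.surjInv hf b)
  map_one' := by
    rw [← map_one g]
    exact hg _ _ (by rw [Function.surjInv_eq hf, map_one])
  map_mul' x y := by
    rw [← map_mul g]
    exact hg _ _ (by simp only [map_mul, Function.surjInv_eq hf])

theorem liftSurj_apply {A : Type*} {B : Type*} {C : Type*} [CommMonoid A] [CommMonoid B]
    [CommMonoid C] (f : A →* B) (hf : Function.Surjective f) (g : A →* C)
    (hg : ∀ a b, f a = f b → g a = g b) (a : A) : liftSurj f hf g hg (f a) = g a :=
  hg _ _ (Function.surjInv_eq hf _)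

namespace MonoidalSpace

variable {X : MonoidalSpace.{u}} {Y : MonoidalSpace.{v}}

theorem exists_open_eq {U V : Opens X.carrier} {s : ∀ y : U, X.stalk y} {t : ∀ y : V, X.stalk y}
    (hs : X.IsSection U s) (ht : X.IsSection V t) {x : X.carrier} (hU : x ∈ U) (hV : x ∈ V)
    (e : s ⟨x, hU⟩ = t ⟨x, hV⟩) :
    ∃ W : Opens X.carrier, x ∈ W ∧ ∃ (h : W ≤ U) (h' : W ≤ V), ∀ y (hy : y ∈ W),
      s ⟨y, h hy⟩ = t ⟨y, h' hy⟩ := by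
  obtain ⟨W, hW, hWe⟩ := X.germ_inj (U ⊓ V) _ _ (X.restrict _ U inf_le_left s hs)
    (X.restrict _ V inf_le_right t ht) ⟨x, hU, hV⟩ e
  exact ⟨W ⊓ (U ⊓ V), ⟨hW, hU, hV⟩, inf_le_right.trans inf_le_left,
    inf_le_right.trans inf_le_right, fun y hy => hWe ⟨y, hy.2⟩ hy.1⟩

theorem exists_cosp {x₁ x : X.carrier} (h : x₁ ⤳ x) (a : X.stalk x) :
    ∃ b : X.stalk x₁, ∀ (U : Opens X.carrier) (s : ∀ y : U, X.stalk y) (hx : x ∈ U),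
      X.IsSection U s → s ⟨x, hx⟩ = a → s ⟨x₁, h.mem_open U.2 hx⟩ = b := by
  obtain ⟨U, hx, s, hs, rfl⟩ := X.germ_surj x a
  refine ⟨s ⟨x₁, h.mem_open U.2 hx⟩, fun V t hV ht e => ?_⟩
  obtain ⟨W, hW, h1, h2, hWe⟩ := exists_open_eq ht hs hV hx e
  exact hWe x₁ (h.mem_open W.2 hW)

/-- The generization map `𝒪_x → 𝒪_{x₁}` for a generization `x₁` of `x`. -/
def cosp {x₁ x : X.carrier} (h : x₁ ⤳ x) : X.stalk x →* X.stalk x₁ where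
  toFun a := (exists_cosp h a).choose
  map_one' := ((exists_cosp h 1).choose_spec ⊤ 1 trivial (X.one_isSection _) rfl).symm
  map_mul' a b := by
    obtain ⟨U, hx, s, hs, rfl⟩ := X.germ_surj x a
    obtain ⟨V, hx', t, ht, rfl⟩ := X.germ_surj x b
    have h1 := (exists_cosp h _).choose_spec U s hx hs rfl
    have h2 := (exists_cosp h _).choose_spec V t hx' ht rfl
    have h3 := (exists_cosp h (s ⟨x, hx⟩ * t ⟨x, hx'⟩)).choose_spec (U ⊓ V) _ ⟨hx, hx'⟩
      (X.mul_isSection _ _ _ (X.restrict _ U inf_le_left s hs)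
        (X.restrict _ V inf_le_right t ht)) rfl
    rw [← h1, ← h2, ← h3]
    rfl

theorem cosp_section {x₁ x : X.carrier} (h : x₁ ⤳ x) {U : Opens X.carrier}
    {s : ∀ y : U, X.stalk y} (hs : X.IsSection U s) (hx : x ∈ U) (hx₁ : x₁ ∈ U) :
    cosp h (s ⟨x, hx⟩) = s ⟨x₁, hx₁⟩ :=
  ((exists_cosp h (s ⟨x, hx⟩)).choose_spec U s hx hs rfl).symm

theorem cosp_refl {x : X.carrier} (h : x ⤳ x) (a : X.stalk x) : cosp h a = a := by
  obtain ⟨U, hx, s, hs, rfl⟩ := X.germ_surj x a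
  exact cosp_section h hs hx hx

theorem cosp_cosp {x₂ x₁ x : X.carrier} (h : x₁ ⤳ x) (h' : x₂ ⤳ x₁) (a : X.stalk x) :
    cosp h' (cosp h a) = cosp (h'.trans h) a := by
  obtain ⟨U, hx, s, hs, rfl⟩ := X.germ_surj x a
  have h1 : x₁ ∈ U := h.mem_open U.2 hx
  have h2 : x₂ ∈ U := h'.mem_open U.2 h1
  rw [cosp_section h hs hx h1, cosp_section h' hs h1 h2, cosp_section _ hs hx h2]

theorem cosp_bijective_of_eq {x₁ x : X.carrier} (e : x₁ = x) (h : x₁ ⤳ x) :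
    Function.Bijective (cosp h) := by
  subst e
  have : ⇑(cosp h) = id := funext (cosp_refl h)
  rw [this]
  exact Function.bijective_id

theorem Hom.specializes (m : Hom X Y) {x₁ x : X.carrier} (h : x₁ ⤳ x) :
    m.base x₁ ⤳ m.base x :=
  h.map m.continuous_base

theorem Hom.stalkMap_cosp (m : Hom X Y) {x₁ x : X.carrier} (h : x₁ ⤳ x)
    (h' : m.base x₁ ⤳ m.base x) (a : Y.stalk (m.base x)) :
    m.stalkMap x₁ (cosp h' a) = cosp h (m.stalkMap x a) := by
  obtain ⟨U, hx, s, hs, rfl⟩ := Y.germ_surj _ a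
  have h1 : m.base x₁ ∈ U := h'.mem_open U.2 hx
  rw [cosp_section h' hs hx h1]
  exact (cosp_section (U := U.comap ⟨m.base, m.continuous_base⟩) h (m.isSection U s hs) hx h1).symm

/-- Two morphisms agree if they agree on points and on stalks; the stalks at the equal points `m x`
and `m' x` are identified by a generization map rather than by a cast. -/
theorem Hom.ext_cosp {m m' : Hom X Y} (h : ∀ x, ∃ e : m.base x = m'.base x, ∀ a,
    m.stalkMap x (cosp (specializes_of_eq e) a) = m'.stalkMap x a) : m = m' := by
  obtain ⟨b, hb, s, hs, hl⟩ := m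
  obtain ⟨b', hb', s', hs', hl'⟩ := m'
  obtain rfl : b = b' := funext fun x => (h x).1
  obtain rfl : s = s' := funext fun x => MonoidHom.ext fun a => by
    have := (h x).2 a
    rwa [cosp_refl] at this
  rfl

theorem Hom.congr_base {m m' : Hom X Y} (h : m = m') (x : X.carrier) : m.base x = m'.base x := by
  rw [h]

theorem Hom.congr_stalkMap {m m' : Hom X Y} (h : m = m') {x : X.carrier}
    (e : m.base x ⤳ m'.base x) (a : Y.stalk (m'.base x)) :
    m.stalkMap x (cosp e a) = m'.stalkMap x a := by
  subst h
  rw [cosp_refl]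

/-- The set of elements of `𝒪_x` that do not become units at the generization `x₁`. -/
def genPrime {x₁ x : X.carrier} (h : x₁ ⤳ x) : MonPrime (X.stalk x) where
  carrier := {a | ¬ IsUnit (cosp h a)}
  mul_mem a b hb hab := hb (by rw [map_mul] at hab; exact isUnit_of_mul_isUnit_right hab)
  one_notMem h1 := h1 (by rw [map_one]; exact isUnit_one)
  mem_or_mem a b hab := by
    by_contra! hc
    simp only [Set.mem_ofPred_eq, not_not] at hc
    exact hab (by rw [map_mul]; exact hc.1.mul hc.2)

theorem mem_genPrime {x₁ x : X.carrier} (h : x₁ ⤳ x) (a : X.stalk x) :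
    a ∈ (genPrime h).carrier ↔ ¬ IsUnit (cosp h a) := Iff.rfl

theorem Hom.genPrime_comap (m : Hom X Y) {x₁ x : X.carrier} (h : x₁ ⤳ x)
    (h' : m.base x₁ ⤳ m.base x) :
    (genPrime h).comap (m.stalkMap x) = genPrime h' := by
  ext a
  change ¬ IsUnit (cosp h (m.stalkMap x a)) ↔ ¬ IsUnit (cosp h' a)
  rw [← m.stalkMap_cosp h h']
  exact not_congr ⟨m.isLocal _ _, fun hu => hu.map _⟩

end MonoidalSpace

/-! ### Generizations in the spectrum of a monoid -/

namespace MonPrime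

variable {P : Type u} [CommMonoid P]

theorem specializes_iff {q p : MonPrime P} : q ⤳ p ↔ q.carrier ⊆ p.carrier := by
  constructor
  · intro h a ha
    by_contra hp
    exact h.mem_open (isOpen_basic a) hp ha
  · intro h
    rw [Specializes, nhds_generateFrom, nhds_generateFrom]
    refine le_iInf₂ ?_
    rintro _ ⟨hp, f, rfl⟩
    exact iInf₂_le _ ⟨fun hf => hp (h hf), f, rfl⟩

theorem specializes_closedPoint (p : MonPrime P) : p ⤳ closedPoint P :=
  specializes_iff.2 fun a ha hu => by
    obtain ⟨b, hb⟩ := hu.exists_right_inv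
    exact p.one_notMem (by rw [← hb, mul_comm]; exact p.mul_mem b a ha)

theorem isUnit_toStalk_iff (p : MonPrime P) {a : P} : IsUnit (p.toStalk a) ↔ a ∉ p.carrier :=
  ⟨p.mem_face_of_isUnit, fun h => by rw [p.toStalk_eq_one h]; exact isUnit_one⟩

theorem cosp_toStalk {q p : MonPrime P} (h : q ⤳ p) (a : P) :
    MonoidalSpace.cosp (X := specM P) h (p.toStalk a) = q.toStalk a :=
  MonoidalSpace.cosp_section (X := specM P) (U := ⊤) (s := fun q => q.1.toStalk a) h
    (fun _ => ⟨⊤, a, trivial, fun _ _ => rfl⟩) trivial trivial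

theorem genPrime_comap_toStalk {q p : MonPrime P} (h : q ⤳ p) :
    (MonoidalSpace.genPrime (X := specM P) h).comap p.toStalk = q := by
  ext a
  change ¬ IsUnit (MonoidalSpace.cosp (X := specM P) h (p.toStalk a)) ↔ _
  rw [cosp_toStalk, isUnit_toStalk_iff, not_not]

/-- In the spectrum of a finitely generated monoid every point has a smallest neighbourhood. -/
theorem exists_basic_le (hP : Monoid.FG P) (p : MonPrime P) :
    ∃ f, f ∉ p.carrier ∧ ∀ q : MonPrime P, f ∉ q.carrier → q.carrier ⊆ p.carrier := by
  classical
  obtain ⟨S, hS⟩ := (Monoid.fg_def.1 hP)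
  -- a face is determined by the generators in it; invert all generators outside `p`
  refine ⟨∏ g ∈ S.filter (· ∉ p.carrier), g,
    p.face.prod_mem fun g hg => (Finset.mem_filter.1 hg).2, fun q hq a ha => ?_⟩
  by_contra hap
  have key : ∀ a ∈ Submonoid.closure (S : Set P), a ∈ p.face → a ∈ q.face := by
    intro a ha
    induction ha using Submonoid.closure_induction with
    | mem g hg =>
      intro hgp
      have : g ∣ ∏ g ∈ S.filter (· ∉ p.carrier), g :=
        Finset.dvd_prod_of_mem _ (Finset.mem_filter.2 ⟨hg, hgp⟩)
      obtain ⟨c, hc⟩ := this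
      rw [hc] at hq
      exact q.left_mem_face hq
    | one => exact fun _ => q.face.one_mem
    | mul a b _ _ iha ihb =>
      intro hab
      have hab' := hab
      rw [mul_comm] at hab'
      exact q.face.mul_mem (iha (p.left_mem_face hab)) (ihb (p.left_mem_face hab'))
  exact key a (hS ▸ Submonoid.mem_top a) hap ha

theorem isOpen_setOf_specializes (hP : Monoid.FG P) (p : MonPrime P) :
    IsOpen {q : MonPrime P | q ⤳ p} := by
  obtain ⟨f, hf, h⟩ := exists_basic_le hP p
  convert isOpen_basic (P := P) f using 1
  ext q
  exact ⟨fun hq hfq => hf (specializes_iff.1 hq hfq), fun hq => specializes_iff.2 (h q hq)⟩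

/-! #### The spectrum of the stalk -/

/-- The prime ideals of `P_p / P_p^*` are the prime ideals of `P` inside `p`. -/
def toStalkPrime (p q : MonPrime P) (h : q.carrier ⊆ p.carrier) : MonPrime p.Stalk where
  carrier := p.toStalk '' q.carrier
  mul_mem s t ht := by
    obtain ⟨a, rfl⟩ := p.toStalk_surjective s
    obtain ⟨b, hb, rfl⟩ := ht
    exact ⟨a * b, q.mul_mem a b hb, map_mul _ _ _⟩
  one_notMem := by
    rintro ⟨a, ha, e⟩
    exact p.mem_face_of_isUnit (by rw [e]; exact isUnit_one) (h ha)
  mem_or_mem s t := by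
    obtain ⟨a, rfl⟩ := p.toStalk_surjective s
    obtain ⟨b, rfl⟩ := p.toStalk_surjective t
    rintro ⟨c, hc, e⟩
    rw [← map_mul, toStalk_eq_iff] at e
    obtain ⟨s, hs, t, ht, e⟩ := e
    have h1 : a * b * t ∈ q.carrier := by
      rw [← e, mul_comm]; exact q.mul_mem _ _ hc
    rcases q.mem_or_mem _ _ h1 with h2 | h2
    · exact (q.mem_or_mem _ _ h2).imp (fun h => ⟨a, h, rfl⟩) fun h => ⟨b, h, rfl⟩
    · exact absurd (h h2) ht

theorem toStalk_mem_toStalkPrime (p q : MonPrime P) (h : q.carrier ⊆ p.carrier) {a : P} :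
    p.toStalk a ∈ (toStalkPrime p q h).carrier ↔ a ∈ q.carrier := by
  refine ⟨?_, fun ha => ⟨a, ha, rfl⟩⟩
  rintro ⟨b, hb, e⟩
  rw [toStalk_eq_iff] at e
  obtain ⟨s, hs, t, ht, e⟩ := e
  have h1 : a * t ∈ q.carrier := by
    rw [← e, mul_comm]; exact q.mul_mem _ _ hb
  exact (q.mem_or_mem _ _ h1).resolve_right fun h2 => ht (h h2)

theorem comap_toStalk_subset (p : MonPrime P) (𝔮 : MonPrime p.Stalk) :
    (𝔮.comap p.toStalk).carrier ⊆ p.carrier := by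
  intro a ha
  by_contra hap
  have : p.toStalk a ∈ 𝔮.carrier := ha
  rw [p.toStalk_eq_one hap] at this
  exact 𝔮.one_notMem this

theorem comap_toStalk_toStalkPrime (p q : MonPrime P) (h : q.carrier ⊆ p.carrier) :
    (toStalkPrime p q h).comap p.toStalk = q :=
  MonPrime.ext (Set.ext fun _ => toStalk_mem_toStalkPrime p q h)

theorem comap_injective {Q : Type*} [CommMonoid Q] {f : P →* Q} (hf : Function.Surjective f) :
    Function.Injective (comap f) := by
  intro q q' e
  ext s
  obtain ⟨a, rfl⟩ := hf s
  exact iff_of_eq (congrArg (fun r : MonPrime P => a ∈ r.carrier) e)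

theorem isFs_stalk (hP : IsFs P) (p : MonPrime P) : IsFs p.Stalk where
  fg := by
    have := hP.fg
    exact Monoid.fg_of_surjective p.toStalk p.toStalk_surjective
  cancel x y z := by
    obtain ⟨a, rfl⟩ := p.toStalk_surjective x
    obtain ⟨b, rfl⟩ := p.toStalk_surjective y
    obtain ⟨c, rfl⟩ := p.toStalk_surjective z
    rw [← map_mul, ← map_mul, toStalk_eq_iff, toStalk_eq_iff]
    rintro ⟨s, hs, t, ht, e⟩
    exact ⟨s, hs, t, ht, hP.cancel a _ _ (by rw [← mul_assoc, e, mul_assoc])⟩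
  saturated x y z n hn := by
    obtain ⟨a, rfl⟩ := p.toStalk_surjective x
    obtain ⟨b, rfl⟩ := p.toStalk_surjective y
    obtain ⟨c, rfl⟩ := p.toStalk_surjective z
    rw [← map_pow, ← map_pow, ← map_mul, toStalk_eq_iff]
    rintro ⟨s, hs, t, ht, e⟩
    obtain ⟨m, rfl⟩ : ∃ m, n = m + 1 := ⟨n - 1, by omega⟩
    have e' : (a * s) ^ (m + 1) = b ^ (m + 1) * (c * t * s ^ m) := by
      rw [mul_pow, pow_succ s, mul_comm (s ^ m), ← mul_assoc, e]
      simp only [mul_assoc]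
    obtain ⟨d, hd⟩ := hP.saturated _ _ _ _ hn e'
    refine ⟨p.toStalk d, ?_⟩
    rw [← map_mul, toStalk_eq_iff]
    exact ⟨s, hs, 1, p.face.one_mem, by rw [hd, mul_one]⟩

/-- The spectrum of `P_p / P_p^*` is the open subspace of the generizations of `p`. It is open since
`P` is finitely generated. -/
theorem comap_toStalk_isOpenEmbedding (hP : Monoid.FG P) (p : MonPrime P) :
    Topology.IsOpenEmbedding (comap p.toStalk) := by
  refine Topology.IsOpenEmbedding.of_continuous_injective_isOpenMap (continuous_comap _)
    (comap_injective p.toStalk_surjective) ?_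
  intro U hU
  have key : ∀ q ∈ comap p.toStalk '' U, {r : MonPrime P | r ⤳ q} ⊆ comap p.toStalk '' U := by
    rintro _ ⟨𝔮, h𝔮, rfl⟩ r hr
    have hr' := specializes_iff.1 hr
    have hrp := hr'.trans (comap_toStalk_subset p 𝔮)
    refine ⟨toStalkPrime p r hrp, ?_, comap_toStalk_toStalkPrime p r hrp⟩
    refine (specializes_iff.2 ?_ : toStalkPrime p r hrp ⤳ 𝔮).mem_open hU h𝔮
    rintro _ ⟨a, ha, rfl⟩
    exact hr' ha
  rw [isOpen_iff_forall_mem_open]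
  exact fun q hq => ⟨_, key q hq, isOpen_setOf_specializes hP q, specializes_rfl⟩

theorem stalkMap_toStalk_bijective (p : MonPrime P) (𝔮 : MonPrime p.Stalk) :
    Function.Bijective (stalkMap p.toStalk 𝔮) := by
  refine ⟨?_, ?_⟩
  · intro x y
    obtain ⟨a, rfl⟩ := (comap p.toStalk 𝔮).toStalk_surjective x
    obtain ⟨b, rfl⟩ := (comap p.toStalk 𝔮).toStalk_surjective y
    rw [stalkMap_toStalk, stalkMap_toStalk, toStalk_eq_iff, toStalk_eq_iff]
    rintro ⟨s, hs, t, ht, e⟩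
    obtain ⟨s, rfl⟩ := p.toStalk_surjective s
    obtain ⟨t, rfl⟩ := p.toStalk_surjective t
    rw [← map_mul, ← map_mul, toStalk_eq_iff] at e
    obtain ⟨s', hs', t', ht', e⟩ := e
    have hle : p.face ≤ (comap p.toStalk 𝔮).face := fun c hc hc' => hc (comap_toStalk_subset p 𝔮 hc')
    exact ⟨s * s', (comap p.toStalk 𝔮).face.mul_mem hs (hle hs'), t * t',
      (comap p.toStalk 𝔮).face.mul_mem ht (hle ht'), by rw [← mul_assoc, e, mul_assoc]⟩
  · intro y
    obtain ⟨x, rfl⟩ := 𝔮.toStalk_surjective y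
    obtain ⟨a, rfl⟩ := p.toStalk_surjective x
    exact ⟨(comap p.toStalk 𝔮).toStalk a, stalkMap_toStalk _ _ _⟩

theorem specM_map_toStalk_isOpenImmersion (hP : Monoid.FG P) (p : MonPrime P) :
    (specM.map p.toStalk).IsOpenImmersion :=
  ⟨comap_toStalk_isOpenEmbedding hP p, stalkMap_toStalk_bijective p⟩

theorem comap_toStalk_closedPoint (p : MonPrime P) :
    comap p.toStalk (closedPoint p.Stalk) = p := by
  ext a
  change ¬ IsUnit (p.toStalk a) ↔ _
  rw [isUnit_toStalk_iff, not_not]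

end MonPrime

/-! ### Local structure of Kato fans -/

namespace MonoidalSpace

variable {X : MonoidalSpace.{u}} {Y : MonoidalSpace.{v}} {Z : MonoidalSpace.{w}}

theorem Hom.IsOpenImmersion.comp {f : Hom X Y} {g : Hom Y Z} (hf : f.IsOpenImmersion)
    (hg : g.IsOpenImmersion) : (f.comp g).IsOpenImmersion :=
  ⟨hg.1.comp hf.1, fun x => (hf.2 x).comp (hg.2 (f.base x))⟩

theorem Hom.IsStrict.comp {f : Hom X Y} {g : Hom Y Z} (hf : f.IsStrict) (hg : g.IsStrict) :
    (f.comp g).IsStrict :=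
  fun x => (hf x).comp (hg (f.base x))

theorem Hom.isStrict_id : (Hom.id X).IsStrict := fun _ => Function.bijective_id

theorem Hom.isUnit_stalkMap_iff (m : Hom X Y) (x : X.carrier) (a : Y.stalk (m.base x)) :
    IsUnit (m.stalkMap x a) ↔ IsUnit a :=
  ⟨m.isLocal x a, fun h => h.map _⟩

theorem specM_isSharp (P : Type u) [CommMonoid P] : (specM P).IsSharp :=
  fun _ _ ha => Associates.isUnit_iff_eq_one _ |>.1 ha

end MonoidalSpace

open MonoidalSpace

namespace IsFsKatoFan

variable {F : MonoidalSpace.{u}}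

/-- Every point of a Kato fan has an affine neighbourhood in which it is the closed point. -/
theorem exists_localNhd (hF : IsFsKatoFan F) (y : F.carrier) :
    ∃ (P : Type u) (_ : CommMonoid P) (_ : IsFs P) (j : Hom (specM P) F),
      j.IsOpenImmersion ∧ j.base (MonPrime.closedPoint P) = y := by
  obtain ⟨P, hP, j, hj, p, rfl⟩ := (hF.affine y).some
  refine ⟨p.Stalk, inferInstance, p.isFs_stalk hP, (specM.map p.toStalk).comp j,
    (p.specM_map_toStalk_isOpenImmersion hP.fg).comp hj, ?_⟩
  exact congrArg j.base p.comap_toStalk_closedPoint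

theorem exists_eq_of_specializes {P : Type v} [CommMonoid P] {j : Hom (specM P) F}
    (hj : j.IsOpenImmersion) {p : MonPrime P} {y : F.carrier} (h : y ⤳ j.base p) :
    ∃ q : MonPrime P, j.base q = y ∧ q ⤳ p := by
  obtain ⟨q, rfl⟩ := h.mem_open hj.1.isOpen_range ⟨p, rfl⟩
  exact ⟨q, rfl, hj.1.isInducing.specializes_iff.1 h⟩

/-- Generizations `y₁` of `y` are determined by the prime ideal of `𝒪_y` of the elements that do not
become invertible at `y₁`. Together with `exists_genPrime_eq` the generizations of `y` are the prime
ideals of `𝒪_y`. -/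
theorem eq_of_genPrime_eq (hF : IsFsKatoFan F) {y₁ y₂ y : F.carrier} (h₁ : y₁ ⤳ y) (h₂ : y₂ ⤳ y)
    (e : genPrime h₁ = genPrime h₂) : y₁ = y₂ := by
  obtain ⟨P, _, hP, j, hj, rfl⟩ := hF.exists_localNhd y
  obtain ⟨q₁, rfl, k₁⟩ := exists_eq_of_specializes hj h₁
  obtain ⟨q₂, rfl, k₂⟩ := exists_eq_of_specializes hj h₂
  rw [← j.genPrime_comap k₁, ← j.genPrime_comap k₂] at e
  have e' := MonPrime.comap_injective (hj.2 _).2 e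
  rw [← MonPrime.genPrime_comap_toStalk k₁, ← MonPrime.genPrime_comap_toStalk k₂, e']

theorem exists_genPrime_eq (hF : IsFsKatoFan F) (y : F.carrier) (𝔮 : MonPrime (F.stalk y)) :
    ∃ (y₁ : F.carrier) (h : y₁ ⤳ y), genPrime h = 𝔮 := by
  obtain ⟨P, _, hP, j, hj, rfl⟩ := hF.exists_localNhd y
  let e := MulEquiv.ofBijective (j.stalkMap (MonPrime.closedPoint P)) (hj.2 _)
  let 𝔮' : MonPrime (MonPrime.closedPoint P).Stalk := 𝔮.comap e.symm.toMonoidHom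
  have hq := (𝔮'.comap (MonPrime.toStalk _)).specializes_closedPoint
  refine ⟨j.base (𝔮'.comap (MonPrime.toStalk _)), j.specializes hq, ?_⟩
  rw [← j.genPrime_comap hq, MonPrime.comap_injective (MonPrime.toStalk_surjective _)
    (MonPrime.genPrime_comap_toStalk hq)]
  ext a
  change e.symm (e a) ∈ 𝔮.carrier ↔ _
  rw [e.symm_apply_apply]

theorem cosp_surjective (hF : IsFsKatoFan F) {y₁ y : F.carrier} (h : y₁ ⤳ y) :
    Function.Surjective (cosp h) := by
  obtain ⟨P, _, hP, j, hj, rfl⟩ := hF.exists_localNhd y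
  obtain ⟨q, rfl, k⟩ := exists_eq_of_specializes hj h
  intro b
  obtain ⟨a, ha⟩ := q.toStalk_surjective (j.stalkMap q b)
  obtain ⟨c, hc⟩ := (hj.2 _).2 ((MonPrime.closedPoint P).toStalk a)
  refine ⟨c, (hj.2 q).1 ?_⟩
  rw [j.stalkMap_cosp k h, hc, ← ha]
  exact MonPrime.cosp_toStalk k a

/-- The generization map `𝒪_y → 𝒪_{y₁}` is the sharp localization: two elements with the same image
agree up to factors that become invertible. -/
theorem exists_mul_eq_of_cosp_eq (hF : IsFsKatoFan F) {y₁ y : F.carrier} (h : y₁ ⤳ y) {a b : F.stalk y}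
    (e : cosp h a = cosp h b) :
    ∃ s t, IsUnit (cosp h s) ∧ IsUnit (cosp h t) ∧ a * s = b * t := by
  obtain ⟨P, _, hP, j, hj, rfl⟩ := hF.exists_localNhd y
  obtain ⟨q, rfl, k⟩ := exists_eq_of_specializes hj h
  have e' := congrArg (j.stalkMap q) e
  rw [j.stalkMap_cosp k h, j.stalkMap_cosp k h] at e'
  obtain ⟨α, hα⟩ := (MonPrime.closedPoint P).toStalk_surjective (j.stalkMap _ a)
  obtain ⟨β, hβ⟩ := (MonPrime.closedPoint P).toStalk_surjective (j.stalkMap _ b)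
  rw [← hα, ← hβ] at e'
  replace e' : q.toStalk α = q.toStalk β :=
    (MonPrime.cosp_toStalk k α).symm.trans (e'.trans (MonPrime.cosp_toStalk k β))
  obtain ⟨s, hs, t, ht, e'⟩ := q.toStalk_eq_iff.1 e'
  have key : ∀ s ∈ q.face, ∃ c, j.stalkMap _ c = (MonPrime.closedPoint P).toStalk s ∧
      IsUnit (cosp h c) := by
    intro s hs
    obtain ⟨c, hc⟩ := (hj.2 _).2 ((MonPrime.closedPoint P).toStalk s)
    refine ⟨c, hc, j.isLocal q _ ?_⟩
    rw [j.stalkMap_cosp k h, hc]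
    exact (MonPrime.cosp_toStalk k s).symm ▸ (q.isUnit_toStalk_iff.2 hs)
  obtain ⟨c, hc, huc⟩ := key s hs
  obtain ⟨d, hd, hud⟩ := key t ht
  refine ⟨c, d, huc, hud, (hj.2 _).1 ?_⟩
  rw [map_mul, map_mul, hc, hd, ← hα, ← hβ]
  exact (map_mul _ _ _).symm.trans ((congrArg _ e').trans (map_mul _ _ _))

theorem isOpen_setOf_specializes (hF : IsFsKatoFan F) (y : F.carrier) :
    IsOpen {y₁ : F.carrier | y₁ ⤳ y} := by
  obtain ⟨P, _, hP, j, hj, rfl⟩ := hF.exists_localNhd y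
  convert hj.1.isOpen_range using 1
  ext y₁
  refine ⟨fun h => ?_, ?_⟩
  · obtain ⟨q, hq, -⟩ := exists_eq_of_specializes hj h
    exact ⟨q, hq⟩
  · rintro ⟨q, rfl⟩
    exact j.specializes q.specializes_closedPoint

/-- The smallest open neighbourhood of a point of a Kato fan. -/
def minNhd (hF : IsFsKatoFan F) (y : F.carrier) : Opens F.carrier :=
  ⟨{y₁ | y₁ ⤳ y}, hF.isOpen_setOf_specializes y⟩

/-- The open subsets of a Kato fan are the subsets that are stable under generization. -/
theorem isOpen_of_stable (hF : IsFsKatoFan F) {U : Set F.carrier}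
    (h : ∀ y ∈ U, ∀ y₁, y₁ ⤳ y → y₁ ∈ U) : IsOpen U := by
  rw [isOpen_iff_forall_mem_open]
  exact fun y hy => ⟨_, h y hy, hF.isOpen_setOf_specializes y, specializes_rfl⟩

theorem fg_stalk (hF : IsFsKatoFan F) (y : F.carrier) : Monoid.FG (F.stalk y) := by
  obtain ⟨P, _, hP, j, hj, rfl⟩ := hF.exists_localNhd y
  have := ((MonPrime.closedPoint P).isFs_stalk hP).fg
  let e := MulEquiv.ofBijective (j.stalkMap (MonPrime.closedPoint P)) (hj.2 _)
  exact Monoid.fg_of_surjective e.symm.toMonoidHom e.symm.surjective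

/-- Every germ extends to a section on the smallest open neighbourhood. -/
theorem cosp_isSection (hF : IsFsKatoFan F) (y : F.carrier) (a : F.stalk y) :
    F.IsSection (hF.minNhd y) fun y₁ => cosp y₁.2 a := by
  obtain ⟨U, hy, s, hs, rfl⟩ := F.germ_surj y a
  have hle : hF.minNhd y ≤ U := fun y₁ h => (show y₁ ⤳ y from h).mem_open U.2 hy
  convert F.restrict _ _ hle s hs using 2 with y₁
  exact cosp_section _ hs hy _

/-- A homomorphism `𝒪_{G, z} → 𝒪_{X, x}` extends to the generizations of `x`. -/
theorem exists_gen {G : MonoidalSpace.{v}} (hG : IsFsKatoFan G) {X : MonoidalSpace.{u}}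
    (hX : X.IsSharp) {x₁ x : X.carrier} (h : x₁ ⤳ x) {z : G.carrier}
    (m : G.stalk z →* X.stalk x) :
    ∃ (z₁ : G.carrier) (k : z₁ ⤳ z) (m₁ : G.stalk z₁ →* X.stalk x₁),
      (∀ a, IsUnit (m₁ a) → IsUnit a) ∧ ∀ a, m₁ (cosp k a) = cosp h (m a) := by
  obtain ⟨z₁, k, e⟩ := hG.exists_genPrime_eq z ((genPrime h).comap m)
  have hu : ∀ a, IsUnit (cosp k a) ↔ IsUnit (cosp h (m a)) := fun a =>
    not_iff_not.1 (iff_of_eq (congrArg (fun q : MonPrime _ => a ∈ q.carrier) e))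
  have hs := hG.cosp_surjective k
  have hm : ∀ a b, cosp k a = cosp k b → (cosp h).comp m a = (cosp h).comp m b := by
    intro a b eab
    obtain ⟨s, t, hs, ht, e⟩ := hG.exists_mul_eq_of_cosp_eq k eab
    have h1 := congrArg ((cosp h).comp m) e
    rw [map_mul, map_mul] at h1
    -- `𝒪_{X, x₁}` is sharp, so units do not matter
    have h2 : (cosp h).comp m s = 1 := hX _ _ ((hu s).1 hs)
    have h3 : (cosp h).comp m t = 1 := hX _ _ ((hu t).1 ht)
    rwa [h2, h3, mul_one, mul_one] at h1
  refine ⟨z₁, k, liftSurj _ hs _ hm, fun a ha => ?_, fun a => liftSurj_apply _ hs _ hm a⟩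
  obtain ⟨b, rfl⟩ := hs a
  rw [liftSurj_apply] at ha
  exact (hu b).2 ha

/-- Two homomorphisms at generizations of `z` that are compatible with the same homomorphism at `z`
agree. -/
theorem gen_unique {G : MonoidalSpace.{v}} (hG : IsFsKatoFan G) {X : MonoidalSpace.{u}}
    {x₁ x : X.carrier} (h : x₁ ⤳ x) {z z₁ z₂ : G.carrier} (m : G.stalk z →* X.stalk x)
    (k₁ : z₁ ⤳ z) (k₂ : z₂ ⤳ z) (m₁ : G.stalk z₁ →* X.stalk x₁) (m₂ : G.stalk z₂ →* X.stalk x₁)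
    (l₁ : ∀ a, IsUnit (m₁ a) → IsUnit a) (l₂ : ∀ a, IsUnit (m₂ a) → IsUnit a)
    (c₁ : ∀ a, m₁ (cosp k₁ a) = cosp h (m a)) (c₂ : ∀ a, m₂ (cosp k₂ a) = cosp h (m a)) :
    ∃ e : z₁ = z₂, ∀ a, m₁ (cosp (specializes_of_eq e) a) = m₂ a := by
  have e : z₁ = z₂ := by
    refine hG.eq_of_genPrime_eq k₁ k₂ (MonPrime.ext (Set.ext fun a => ?_))
    rw [mem_genPrime, mem_genPrime]
    refine not_congr ⟨fun hu => l₂ _ ?_, fun hu => l₁ _ ?_⟩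
    · rw [c₂, ← c₁]; exact hu.map _
    · rw [c₁, ← c₂]; exact hu.map _
  refine ⟨e, fun a => ?_⟩
  obtain ⟨b, rfl⟩ := hG.cosp_surjective k₂ a
  rw [cosp_cosp, c₁, c₂]

/-- Two morphisms to a Kato fan that agree at a point agree at its generizations. -/
theorem hom_agree_gen {G : MonoidalSpace.{v}} (hG : IsFsKatoFan G) {X : MonoidalSpace.{u}}
    (m m' : Hom X G) {x₁ x : X.carrier} (h : x₁ ⤳ x)
    (hx : ∃ e : m.base x = m'.base x, ∀ a,
      m.stalkMap x (cosp (specializes_of_eq e) a) = m'.stalkMap x a) :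
    ∃ e : m.base x₁ = m'.base x₁, ∀ a,
      m.stalkMap x₁ (cosp (specializes_of_eq e) a) = m'.stalkMap x₁ a := by
  obtain ⟨e, he⟩ := hx
  have k₁ := (m.specializes h).trans (specializes_of_eq e)
  refine hG.gen_unique h (m'.stalkMap x) k₁ (m'.specializes h) _ _
    (m.isLocal x₁) (m'.isLocal x₁) (fun a => ?_) (fun a => m'.stalkMap_cosp h _ a)
  rw [← he, ← m.stalkMap_cosp h (m.specializes h), cosp_cosp]

/-- A morphism of Kato fans that is strict at a point is strict at its generizations. -/
theorem stalkMap_bijective_gen {G : MonoidalSpace.{v}} (hF : IsFsKatoFan F) (hG : IsFsKatoFan G)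
    (g : Hom F G) {y₁ y : F.carrier} (h : y₁ ⤳ y) (hy : Function.Bijective (g.stalkMap y)) :
    Function.Bijective (g.stalkMap y₁) := by
  have hg := g.specializes h
  constructor
  · intro a b e
    obtain ⟨a, rfl⟩ := hG.cosp_surjective hg a
    obtain ⟨b, rfl⟩ := hG.cosp_surjective hg b
    rw [g.stalkMap_cosp h, g.stalkMap_cosp h] at e
    obtain ⟨s, t, hs, ht, e⟩ := hF.exists_mul_eq_of_cosp_eq h e
    obtain ⟨s, rfl⟩ := hy.2 s
    obtain ⟨t, rfl⟩ := hy.2 t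
    rw [← map_mul, ← map_mul] at e
    have e' := congrArg (cosp hg) (hy.1 e)
    rw [← g.stalkMap_cosp h hg, g.isUnit_stalkMap_iff] at hs ht
    rwa [map_mul, map_mul, hG.sharp _ _ hs, hG.sharp _ _ ht, mul_one, mul_one] at e'
  · intro b
    obtain ⟨c, rfl⟩ := hF.cosp_surjective h b
    obtain ⟨a, rfl⟩ := hy.2 c
    exact ⟨cosp hg a, g.stalkMap_cosp h hg a⟩

/-- Near `y₁` a strict morphism of Kato fans is a bijection of the generizations. -/
theorem exists_unique_gen_of_isStrict {G : MonoidalSpace.{v}} (hF : IsFsKatoFan F)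
    (hG : IsFsKatoFan G) {g : Hom F G} (hg : g.IsStrict) {y : F.carrier} {z : G.carrier}
    (h : z ⤳ g.base y) : ∃! y₁, y₁ ⤳ y ∧ g.base y₁ = z := by
  let e := MulEquiv.ofBijective (g.stalkMap y) (hg y)
  obtain ⟨y₁, k, hk⟩ := hF.exists_genPrime_eq y ((genPrime h).comap e.symm.toMonoidHom)
  refine ⟨y₁, ⟨k, hG.eq_of_genPrime_eq (g.specializes k) h ?_⟩, ?_⟩
  · rw [← g.genPrime_comap k, hk]
    ext a
    change e.symm (e a) ∈ (genPrime h).carrier ↔ _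
    rw [e.symm_apply_apply]
  · rintro y₂ ⟨k₂, rfl⟩
    refine hF.eq_of_genPrime_eq k₂ k (MonPrime.comap_injective (hg y).2 ?_)
    rw [g.genPrime_comap k₂ h, hk]
    ext a
    change _ ↔ e.symm (e a) ∈ (genPrime h).carrier
    rw [e.symm_apply_apply]

/-- A family of local homomorphisms on stalks that is compatible with generization is a
morphism of Kato fans. -/
def homOfCosp {G : MonoidalSpace.{v}} (hF : IsFsKatoFan F) (b : F.carrier → G.carrier)
    (m : ∀ y, G.stalk (b y) →* F.stalk y) (hm : ∀ y a, IsUnit (m y a) → IsUnit a)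
    (hb : ∀ y₁ y, y₁ ⤳ y → b y₁ ⤳ b y)
    (hc : ∀ y₁ y (h : y₁ ⤳ y) (k : b y₁ ⤳ b y) a, m y₁ (cosp k a) = cosp h (m y a)) : Hom F G where
  base := b
  continuous_base := continuous_def.2 fun _ hU =>
    hF.isOpen_of_stable fun y hy y₁ h => (hb y₁ y h).mem_open hU hy
  stalkMap := m
  isSection V s hs := by
    refine F.glue _ _ fun y => ?_
    have hle : ∀ y₁, y₁ ⤳ y.1 → b y₁ ∈ V := fun y₁ h => (hb y₁ y.1 h).mem_open V.2 y.2
    refine ⟨hF.minNhd y.1, hle, specializes_rfl, ?_⟩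
    convert hF.cosp_isSection y.1 (m y.1 (s ⟨b y.1, y.2⟩)) using 2 with y₁
    have k := hb y₁.1 y.1 y₁.2
    rw [← hc _ _ y₁.2 k, cosp_section k hs y.2 (hle y₁ y₁.2)]
  isLocal := hm

end IsFsKatoFan

/-! ### Morphisms to the spectrum of a monoid -/

namespace MonoidalSpace

section ToSpecM

variable {X : MonoidalSpace.{u}} (hX : X.IsSharp) {Q : Type v} [CommMonoid Q]
  (β : ∀ x, Q →* X.stalk x) (hβ : ∀ a, X.IsSection ⊤ fun x => β x.1 a)

/-- The prime ideal of the elements that are not invertible at `x`. -/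
def nonunitPrime {A : Type*} [CommMonoid A] (β : Q →* A) : MonPrime Q where
  carrier := {a | ¬ IsUnit (β a)}
  mul_mem a b hb hab := hb (by rw [map_mul] at hab; exact isUnit_of_mul_isUnit_right hab)
  one_notMem h1 := h1 (by rw [map_one]; exact isUnit_one)
  mem_or_mem a b hab := by
    by_contra! hc
    simp only [Set.mem_ofPred_eq, not_not] at hc
    exact hab (by rw [map_mul]; exact hc.1.mul hc.2)

theorem mem_face_nonunitPrime {A : Type*} [CommMonoid A] (β : Q →* A) {a : Q} :
    a ∈ (nonunitPrime β).face ↔ IsUnit (β a) := not_not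

theorem exists_open_eq_one (hX : X.IsSharp) {U : Opens X.carrier} {s : ∀ x : U, X.stalk x}
    (hs : X.IsSection U s) (x : U) (hx : IsUnit (s x)) : ∃ V : Opens X.carrier, x.1 ∈ V ∧ ∀ y : U, y.1 ∈ V → s y = 1 :=
  X.germ_inj U s 1 hs (X.one_isSection U) x (hX _ _ hx)

include hX hβ in
theorem continuous_nonunitPrime : Continuous fun x => nonunitPrime (β x) := by
  refine continuous_generateFrom_iff.2 ?_
  rintro _ ⟨a, rfl⟩
  rw [isOpen_iff_forall_mem_open]
  intro x hx
  obtain ⟨V, hV, h⟩ := exists_open_eq_one hX (hβ a) ⟨x, trivial⟩ (not_not.1 hx)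
  exact ⟨V, fun y hy => not_not.2 (by rw [h ⟨y, trivial⟩ hy]; exact isUnit_one), V.2, hV⟩

include hX in
theorem eq_of_toStalk_nonunitPrime (x : X.carrier) (a b : Q)
    (hab : (nonunitPrime (β x)).toStalk a = (nonunitPrime (β x)).toStalk b) : β x a = β x b := by
  obtain ⟨s, hs, t, ht, e⟩ := (MonPrime.toStalk_eq_iff _).1 hab
  rw [mem_face_nonunitPrime] at hs ht
  have e' := congrArg (β x) e
  rwa [map_mul, map_mul, hX _ _ hs, hX _ _ ht, mul_one, mul_one] at e'

/-- The morphism `X → Spec Q` to the spectrum of `Q` given by a homomorphism from `Q` to the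
global sections of the structure sheaf of a sharp monoidal space. -/
def toSpecM : Hom X (specM Q) where
  base x := nonunitPrime (β x)
  continuous_base := continuous_nonunitPrime hX β hβ
  stalkMap x := (nonunitPrime (β x)).liftStalk (β x) (eq_of_toStalk_nonunitPrime hX β x)
  isSection V s hs := by
    refine X.glue _ _ fun x => ?_
    obtain ⟨W, a, hW, ha⟩ := hs ⟨nonunitPrime (β x.1), x.2⟩
    let O : Opens X.carrier := Opens.comap ⟨_, continuous_nonunitPrime hX β hβ⟩ V ⊓
      Opens.comap ⟨_, continuous_nonunitPrime hX β hβ⟩ W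
    refine ⟨O, inf_le_left, ⟨x.2, hW⟩, ?_⟩
    have h1 := X.restrict O _ le_top _ (hβ a)
    have h2 : (fun y : O => β y.1 a) = fun y : O => (nonunitPrime (β y.1)).liftStalk (β y.1)
        (eq_of_toStalk_nonunitPrime hX β y.1) (s ⟨_, y.2.1⟩) := by
      funext y
      refine Eq.trans ?_ (congrArg _ (ha ⟨_, y.2.1⟩ y.2.2).symm)
      exact (MonPrime.liftStalk_toStalk _ _ (eq_of_toStalk_nonunitPrime hX β y.1) a).symm
    exact Eq.mp (congrArg _ h2) h1
  isLocal x s hs := by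
    obtain ⟨a, rfl⟩ := (nonunitPrime (β x)).toStalk_surjective s
    rw [MonPrime.liftStalk_toStalk] at hs
    exact (MonPrime.isUnit_toStalk_iff _).2 (not_not.2 hs)

theorem toSpecM_stalkMap (x : X.carrier) (a : Q) :
    (toSpecM hX β hβ).stalkMap x ((nonunitPrime (β x)).toStalk a) = β x a :=
  MonPrime.liftStalk_toStalk _ _ (eq_of_toStalk_nonunitPrime hX β x) a

end ToSpecM

/-- If `x` is the closed point of a local monoidal space `X`, a morphism from `X` to a Kato fan is
given by a local homomorphism of stalks at `x`. -/
theorem exists_hom_of_local {G : MonoidalSpace.{v}} (hG : IsFsKatoFan G) {X : MonoidalSpace.{u}}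
    (hX : X.IsSharp) {x : X.carrier} (hx : ∀ x₁, x₁ ⤳ x) {z : G.carrier}
    (m : G.stalk z →* X.stalk x) (hm : ∀ a, IsUnit (m a) → IsUnit a) :
    ∃ (g : Hom X G) (e : g.base x = z),
      ∀ a, g.stalkMap x (cosp (specializes_of_eq e) a) = m a := by
  obtain ⟨Q, _, hQ, j, hj, rfl⟩ := hG.exists_localNhd z
  let c := MonPrime.closedPoint Q
  let e := MulEquiv.ofBijective (j.stalkMap c) (hj.2 c)
  -- the stalk at the closed point consists of the global sections
  let β₀ : Q →* X.stalk x := (m.comp e.symm.toMonoidHom).comp c.toStalk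
  have hβ : ∀ a, X.IsSection ⊤ fun x₁ => cosp (hx x₁.1) (β₀ a) := by
    intro a
    obtain ⟨U, hU, s, hs, e⟩ := X.germ_surj x (β₀ a)
    have hle : ⊤ ≤ U := fun x₁ _ => (hx x₁).mem_open U.2 hU
    convert X.restrict _ _ hle s hs using 2 with x₁
    rw [← e, cosp_section _ hs hU (hle trivial)]
  let τ := toSpecM hX (fun x₁ => (cosp (hx x₁)).comp β₀) hβ
  have hβ₀ : ∀ a, ((cosp (hx x)).comp β₀) a = m (e.symm (c.toStalk a)) :=
    fun a => cosp_refl (hx x) _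
  have hc : τ.base x = c := by
    ext a
    change ¬ IsUnit (((cosp (hx x)).comp β₀) a) ↔ ¬ IsUnit a
    rw [hβ₀]
    refine not_congr ⟨fun h => ?_, fun h => ((h.map c.toStalk).map e.symm).map m⟩
    have h1 := (hm _ h).map e
    rw [e.apply_symm_apply, MonPrime.isUnit_toStalk_iff] at h1
    exact not_not.1 h1
  refine ⟨τ.comp j, congrArg j.base hc, fun a => ?_⟩
  refine (congrArg (τ.stalkMap x) (j.stalkMap_cosp (specializes_of_eq hc)
    (specializes_of_eq (congrArg j.base hc)) a)).trans ?_
  obtain ⟨α, hα⟩ := c.toStalk_surjective (j.stalkMap c a)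
  rw [← hα]
  refine (congrArg (τ.stalkMap x) (MonPrime.cosp_toStalk (specializes_of_eq hc) α)).trans ?_
  refine (toSpecM_stalkMap hX _ hβ x α).trans ((hβ₀ α).trans ?_)
  rw [hα]
  exact congrArg m (e.symm_apply_apply a)

/-- A morphism from a local monoidal space to a Kato fan is determined at the closed point. -/
theorem hom_ext_of_local {G : MonoidalSpace.{v}} (hG : IsFsKatoFan G) {X : MonoidalSpace.{u}}
    {x : X.carrier} (hx : ∀ x₁, x₁ ⤳ x) {m m' : Hom X G}
    (h : ∃ e : m.base x = m'.base x, ∀ a,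
      m.stalkMap x (cosp (specializes_of_eq e) a) = m'.stalkMap x a) : m = m' :=
  Hom.ext_cosp fun x₁ => hG.hom_agree_gen m m' (hx x₁) h

theorem Hom.isOpenImmersion_id {X : MonoidalSpace.{u}} : (Hom.id X).IsOpenImmersion :=
  ⟨Topology.IsOpenEmbedding.id, Hom.isStrict_id⟩

theorem compactSpace_of_forall_specializes {α : Type*} [TopologicalSpace α] {c : α}
    (h : ∀ x : α, x ⤳ c) : CompactSpace α :=
  ⟨isCompact_of_finite_subcover fun U hU hc => by
    obtain ⟨i, hi⟩ := Set.mem_iUnion.1 (hc (Set.mem_univ c))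
    exact ⟨{i}, fun x _ => by simpa using (h x).mem_open (hU i) hi⟩⟩

theorem isFsKatoFan_specM {P : Type u} [CommMonoid P] (hP : IsFs P) : IsFsKatoFan (specM P) where
  sharp := specM_isSharp P
  quasiCompact := compactSpace_of_forall_specializes MonPrime.specializes_closedPoint
  affine y := ⟨⟨P, hP, Hom.id _, Hom.isOpenImmersion_id, y, rfl⟩⟩

end MonoidalSpace

/-! ### Descent along a characteristic morphism -/

namespace MonoidalSpace

/-- The inverse image of the structure sheaf of `F` under a continuous map `T → F`. -/
abbrev pullback (F : MonoidalSpace.{u}) {T : Type u} [TopologicalSpace T] (π : T → F.carrier)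
    (hπ : Continuous π) : MonoidalSpace.{u} where
  carrier := T
  stalk t := F.stalk (π t)
  IsSection U s := ∀ t : U, ∃ (V : Opens T) (W : Opens F.carrier) (σ : ∀ y : W, F.stalk y),
    t.1 ∈ V ∧ F.IsSection W σ ∧ ∀ u : U, u.1 ∈ V → ∃ h : π u.1 ∈ W, s u = σ ⟨π u.1, h⟩
  one_isSection U t := ⟨U, ⊤, 1, t.2, F.one_isSection _, fun u _ => ⟨trivial, rfl⟩⟩
  mul_isSection U s s' hs hs' t := by
    obtain ⟨V, W, σ, hV, hσ, h⟩ := hs t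
    obtain ⟨V', W', σ', hV', hσ', h'⟩ := hs' t
    refine ⟨V ⊓ V', W ⊓ W', _, ⟨hV, hV'⟩, F.mul_isSection _ _ _
      (F.restrict _ _ inf_le_left σ hσ) (F.restrict _ _ inf_le_right σ' hσ'), fun u hu => ?_⟩
    obtain ⟨k, e⟩ := h u hu.1
    obtain ⟨k', e'⟩ := h' u hu.2
    exact ⟨⟨k, k'⟩, by rw [Pi.mul_apply, e, e']; rfl⟩
  restrict U V h s hs t := by
    obtain ⟨V', W, σ, hV, hσ, k⟩ := hs ⟨t.1, h t.2⟩
    exact ⟨V', W, σ, hV, hσ, fun u hu => k ⟨u.1, h u.2⟩ hu⟩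
  glue U s hs t := by
    obtain ⟨V, h, ht, hV⟩ := hs t
    obtain ⟨V', W, σ, hV', hσ, k⟩ := hV ⟨t.1, ht⟩
    exact ⟨V ⊓ V', W, σ, ⟨ht, hV'⟩, hσ, fun u hu => k ⟨u.1, hu.1⟩ hu.2⟩
  germ_surj t a := by
    obtain ⟨U, hU, s, hs, rfl⟩ := F.germ_surj (π t) a
    exact ⟨U.comap ⟨π, hπ⟩, hU, fun u => s ⟨π u.1, u.2⟩,
      fun u => ⟨⊤, U, s, trivial, hs, fun u' _ => ⟨u'.2, rfl⟩⟩, rfl⟩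
  germ_inj U s s' hs hs' t e := by
    obtain ⟨V, W, σ, hV, hσ, h⟩ := hs t
    obtain ⟨V', W', σ', hV', hσ', h'⟩ := hs' t
    obtain ⟨k, e₁⟩ := h t hV
    obtain ⟨k', e₂⟩ := h' t hV'
    rw [e₁, e₂] at e
    obtain ⟨O, hO, l, l', hO'⟩ := exists_open_eq hσ hσ' k k' e
    refine ⟨V ⊓ V' ⊓ O.comap ⟨π, hπ⟩, ⟨⟨hV, hV'⟩, hO⟩, fun u hu => ?_⟩
    rw [(h u hu.1.1).2, (h' u hu.1.2).2]
    exact hO' _ hu.2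

section Pullback

variable (F : MonoidalSpace.{u}) {T : Type u} [TopologicalSpace T] (π : T → F.carrier)
    (hπ : Continuous π)

/-- The projection of the inverse image. -/
def pullbackProj : Hom (F.pullback π hπ) F where
  base := π
  continuous_base := hπ
  stalkMap _ := MonoidHom.id _
  isSection V s hs _ := ⟨⊤, V, s, trivial, hs, fun u _ => ⟨u.2, rfl⟩⟩
  isLocal _ _ h := h

theorem pullbackProj_isStrict : (F.pullbackProj π hπ).IsStrict := fun _ => Function.bijective_id

/-- A lift of a morphism to the inverse image. -/
def pullbackLift {X : MonoidalSpace.{v}} (ψ : Hom X F) (b : X.carrier → T) (hb : Continuous b)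
    (e : ∀ x, π (b x) = ψ.base x) : Hom X (F.pullback π hπ) where
  base := b
  continuous_base := hb
  stalkMap x := (ψ.stalkMap x).comp (cosp (specializes_of_eq (e x).symm))
  isSection V s hs := by
    refine X.glue _ _ fun x => ?_
    obtain ⟨V', W, σ, hV', hσ, h⟩ := hs ⟨b x.1, x.2⟩
    have hW : ψ.base x.1 ∈ W := by rw [← e]; exact (h ⟨b x.1, x.2⟩ hV').1
    let O : Opens X.carrier := Opens.comap ⟨b, hb⟩ V ⊓ Opens.comap ⟨b, hb⟩ V' ⊓
      Opens.comap ⟨ψ.base, ψ.continuous_base⟩ W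
    refine ⟨O, inf_le_left.trans inf_le_left, ⟨⟨x.2, hV'⟩, hW⟩, ?_⟩
    have h1 := X.restrict O _ inf_le_right _ (ψ.isSection W σ hσ)
    have h2 : (fun y : O => ψ.stalkMap y.1 (σ ⟨ψ.base y.1, y.2.2⟩)) = fun y : O =>
        (ψ.stalkMap y.1).comp (cosp (specializes_of_eq (e y.1).symm)) (s ⟨b y.1, y.2.1.1⟩) := by
      funext y
      obtain ⟨k, hk⟩ := h ⟨b y.1, y.2.1.1⟩ y.2.1.2
      rw [hk]
      exact congrArg _ (cosp_section _ hσ k y.2.2).symm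
    exact Eq.mp (congrArg _ h2) h1
  isLocal x a ha := by
    have h1 := ψ.isLocal x _ ha
    obtain ⟨c, hc⟩ := (cosp_bijective_of_eq (X := F) (e x).symm
      (specializes_of_eq (e x).symm)).2 (h1.unit⁻¹ : (F.stalk (ψ.base x))ˣ).1
    refine IsUnit.of_mul_eq_one c ((cosp_bijective_of_eq (X := F) (e x).symm
      (specializes_of_eq (e x).symm)).1 ?_)
    rw [map_mul, hc, map_one]
    exact h1.mul_val_inv

theorem pullbackLift_isStrict {X : MonoidalSpace.{v}} {ψ : Hom X F} (hψ : ψ.IsStrict)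
    (b : X.carrier → T) (hb : Continuous b) (e : ∀ x, π (b x) = ψ.base x) :
    (F.pullbackLift π hπ ψ b hb e).IsStrict :=
  fun x => (hψ x).comp (cosp_bijective_of_eq (X := F) (e x).symm _)

theorem pullbackLift_proj {X : MonoidalSpace.{v}} (ψ : Hom X F) (b : X.carrier → T)
    (hb : Continuous b) (e : ∀ x, π (b x) = ψ.base x) :
    (F.pullbackLift π hπ ψ b hb e).comp (F.pullbackProj π hπ) = ψ :=
  Hom.ext_cosp fun x => ⟨e x, fun a => congrArg (ψ.stalkMap x)
    ((cosp_cosp (X := F) (specializes_of_eq (e x)) (specializes_of_eq (e x).symm) a).trans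
      (cosp_refl _ a))⟩

end Pullback

/-- A strict morphism to a fine and saturated Kato fan that is initial among such morphisms. -/
structure Hom.IsInitial {X F : MonoidalSpace.{u}} (φ : Hom X F) : Prop where
  isFsKatoFan : IsFsKatoFan F
  isStrict : φ.IsStrict
  existsUnique : ∀ (G : MonoidalSpace.{u}) (ψ : Hom X G), IsFsKatoFan G → ψ.IsStrict →
    ∃! g : Hom F G, g.IsStrict ∧ φ.comp g = ψ

namespace Descent

variable {X F : MonoidalSpace.{u}} (φ : Hom X F) {Z : Type v} (ρ : Z → F.carrier)
  {V : Z → Type w} (θ : X.carrier → ∀ z, V z)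

/-- Pairs of a point `x` and a generization of its image. -/
abbrev Pair : Type u := {p : X.carrier × F.carrier // p.2 ⤳ φ.base p.1}

/-- Two points `x`, `x'` are identified over a common generization `y` of their images if the
families `θ x` and `θ x'` agree on everything that lies over the generizations of `y`. -/
def setoid : Setoid (Pair φ) where
  r p q := p.1.2 = q.1.2 ∧ ∀ z, ρ z ⤳ p.1.2 → θ p.1.1 z = θ q.1.1 z
  iseqv := ⟨fun _ => ⟨rfl, fun _ _ => rfl⟩,
    fun h => ⟨h.1.symm, fun z hz => (h.2 z (by rw [h.1]; exact hz)).symm⟩,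
    fun h h' => ⟨h.1.trans h'.1, fun z hz => (h.2 z hz).trans (h'.2 z (h.1 ▸ hz))⟩⟩

/-- The underlying space of the étale space over `F` of the germs of `θ`. -/
def Space : Type u := Quotient (setoid φ ρ θ)

/-- The germ of `θ x` at a generization `y` of the image of `x`. -/
def germ (x : X.carrier) (y : F.carrier) (h : y ⤳ φ.base x) : Space φ ρ θ :=
  Quotient.mk (setoid φ ρ θ) ⟨⟨x, y⟩, h⟩

variable {φ ρ θ}

theorem germ_eq_iff {x x' : X.carrier} {y y' : F.carrier} {h : y ⤳ φ.base x}
    {h' : y' ⤳ φ.base x'} : germ φ ρ θ x y h = germ φ ρ θ x' y' h' ↔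
      y = y' ∧ ∀ z, ρ z ⤳ y → θ x z = θ x' z :=
  Quotient.eq (r := setoid φ ρ θ)

theorem germ_surj (t : Space φ ρ θ) : ∃ x y h, germ φ ρ θ x y h = t :=
  Quotient.inductionOn t fun p => ⟨p.1.1, p.1.2, p.2, rfl⟩

theorem germ_gen {x x' : X.carrier} {y y' : F.carrier} {h : y ⤳ φ.base x} {h' : y' ⤳ φ.base x'}
    (e : germ φ ρ θ x y h = germ φ ρ θ x' y' h') {y₁ : F.carrier} (k : y₁ ⤳ y') :
    ∃ l : y₁ ⤳ φ.base x, germ φ ρ θ x y₁ l = germ φ ρ θ x' y₁ (k.trans h') := by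
  obtain ⟨rfl, hz⟩ := germ_eq_iff.1 e
  exact ⟨k.trans h, germ_eq_iff.2 ⟨rfl, fun z h => hz z (h.trans k)⟩⟩

/-- The open sets are those that are stable under generization. -/
instance : TopologicalSpace (Space φ ρ θ) where
  IsOpen U := ∀ x y h y₁ (k : y₁ ⤳ y), germ φ ρ θ x y h ∈ U → germ φ ρ θ x y₁ (k.trans h) ∈ U
  isOpen_univ _ _ _ _ _ _ := trivial
  isOpen_inter _ _ hU hV x y h y₁ k ht := ⟨hU x y h y₁ k ht.1, hV x y h y₁ k ht.2⟩
  isOpen_sUnion _ hS x y h y₁ k := by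
    rintro ⟨U, hU, ht⟩
    exact ⟨U, hU, hS U hU x y h y₁ k ht⟩

theorem isOpen_iff {U : Set (Space φ ρ θ)} : IsOpen U ↔ ∀ x y h y₁ (k : y₁ ⤳ y),
    germ φ ρ θ x y h ∈ U → germ φ ρ θ x y₁ (k.trans h) ∈ U := Iff.rfl

variable (φ ρ θ) in
/-- The projection to `F`. -/
def proj : Space φ ρ θ → F.carrier := Quotient.lift (fun p => p.1.2) fun _ _ h => h.1

theorem proj_germ {x : X.carrier} {y : F.carrier} (h : y ⤳ φ.base x) :
    proj φ ρ θ (germ φ ρ θ x y h) = y := rfl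

theorem continuous_proj : Continuous (proj φ ρ θ) :=
  continuous_def.2 fun _ hU => isOpen_iff.2 fun _ _ _ _ k ht => k.mem_open hU ht

variable (φ ρ θ) in
/-- The étale space with the inverse image of the structure sheaf of `F`. -/
abbrev fan : MonoidalSpace.{u} := F.pullback (proj φ ρ θ) continuous_proj

/-- The étale space of germs is a Kato fan: near the germ of `θ x` at `y` it looks like the smallest
neighbourhood of `y` in `F`, and it is quasi-compact since every germ is a generization of a germ `θ
x` at `φ x`. -/
theorem isFsKatoFan_fan [CompactSpace X.carrier] (hF : IsFsKatoFan F)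
    (hc : Continuous fun x => germ φ ρ θ x (φ.base x) specializes_rfl) :
    IsFsKatoFan (fan φ ρ θ) where
  sharp t a ha := hF.sharp _ a ha
  quasiCompact := ⟨isCompact_of_finite_subcover fun U hU hcov => by
    obtain ⟨s, hs⟩ := isCompact_univ.elim_finite_subcover (fun i => _) (fun i => (hU i).preimage hc)
      (fun x _ => by simpa using hcov (Set.mem_univ (germ φ ρ θ x (φ.base x) specializes_rfl)))
    refine ⟨s, fun t _ => ?_⟩
    obtain ⟨x, y, h, rfl⟩ := germ_surj t
    have := hs (Set.mem_univ x)
    simp only [Set.mem_iUnion, Set.mem_preimage] at this ⊢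
    obtain ⟨i, hi, hx⟩ := this
    exact ⟨i, hi, isOpen_iff.1 (hU i) x _ _ y h hx⟩⟩
  affine t := by
    obtain ⟨x, y, h, rfl⟩ := germ_surj t
    obtain ⟨P, _, hP, j, hj, rfl⟩ := hF.exists_localNhd y
    have hle : ∀ p, j.base p ⤳ φ.base x := fun p => (j.specializes p.specializes_closedPoint).trans h
    have hopen : Topology.IsOpenEmbedding fun p => germ φ ρ θ x (j.base p) (hle p) := by
      refine Topology.IsOpenEmbedding.of_continuous_injective_isOpenMap ?_ ?_ ?_
      · exact continuous_def.2 fun U hU => (isFsKatoFan_specM hP).isOpen_of_stable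
          fun p hp p₁ k => isOpen_iff.1 hU x _ (hle p) _ (j.specializes k) hp
      · intro p q e
        exact hj.1.injective (germ_eq_iff.1 e).1
      · intro W hW
        refine isOpen_iff.2 fun x' y' h' y₁ k => ?_
        rintro ⟨p, hp, e⟩
        obtain ⟨l, e₁⟩ := germ_gen e k
        have hy : y₁ ⤳ j.base p := by rw [(germ_eq_iff.1 e).1]; exact k
        obtain ⟨q, rfl, hq⟩ := IsFsKatoFan.exists_eq_of_specializes hj hy
        exact ⟨q, hq.mem_open hW hp, e₁⟩
    exact ⟨⟨P, hP, F.pullbackLift _ continuous_proj j _ hopen.continuous fun _ => rfl,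
      ⟨hopen, F.pullbackLift_isStrict _ _ hj.2 _ _ _⟩, MonPrime.closedPoint P, rfl⟩⟩

/-- If `θ` is locally constant, the germs of `θ x` at `φ x` form a continuous map from `X` to the
étale space. -/
theorem continuous_germ (hF : IsFsKatoFan F)
    (hθ : ∀ x, ∃ W : Opens X.carrier, x ∈ W ∧ ∀ u ∈ W, ∀ z, ρ z ⤳ φ.base u → θ x z = θ u z) :
    Continuous fun x => germ φ ρ θ x (φ.base x) specializes_rfl := by
  refine continuous_def.2 fun U hU => isOpen_iff_forall_mem_open.2 fun x hx => ?_
  obtain ⟨W, hW, h⟩ := hθ x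
  refine ⟨W ∩ φ.base ⁻¹' hF.minNhd (φ.base x), fun u hu => ?_,
    W.2.inter ((hF.minNhd _).2.preimage φ.continuous_base), hW, specializes_rfl⟩
  have h1 := isOpen_iff.1 hU x _ specializes_rfl _ hu.2 hx
  rwa [germ_eq_iff.2 ⟨rfl, fun z hz => h u hu.1 z hz⟩] at h1

end Descent

namespace Hom.IsInitial

variable {X F : MonoidalSpace.{u}} {φ : Hom X F} {Z : Type v} {ρ : Z → F.carrier}
  {V : Z → Type w} {θ : X.carrier → ∀ z, V z}

/-- The étale space of germs has a section that extends the germs given by the points of `X`: apply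
the universal property to the morphism from `X` to the étale space. -/
theorem exists_descent_section [CompactSpace X.carrier] (hφ : φ.IsInitial)
    (hθ : ∀ x, ∃ W : Opens X.carrier, x ∈ W ∧ ∀ u ∈ W, ∀ z, ρ z ⤳ φ.base u → θ x z = θ u z) :
    ∃ g : F.carrier → Descent.Space φ ρ θ, (∀ y, Descent.proj φ ρ θ (g y) = y) ∧
      ∀ x y (h : y ⤳ φ.base x), g y = Descent.germ φ ρ θ x y h := by
  have hF := hφ.isFsKatoFan
  have hc := Descent.continuous_germ hF hθ
  obtain ⟨g, ⟨hg, e⟩, -⟩ := hφ.existsUnique _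
    (F.pullbackLift _ Descent.continuous_proj φ _ hc fun _ => rfl)
    (Descent.isFsKatoFan_fan hF hc) (F.pullbackLift_isStrict _ _ hφ.isStrict _ _ _)
  -- the composition with the projection is an endomorphism of the initial object
  have hid : g.comp (F.pullbackProj _ Descent.continuous_proj) = Hom.id F := by
    obtain ⟨i, -, hi⟩ := hφ.existsUnique F φ hF hφ.isStrict
    refine (hi _ ⟨hg.comp (F.pullbackProj_isStrict _ _), ?_⟩).trans
      (hi (Hom.id F) ⟨Hom.isStrict_id, rfl⟩).symm
    exact (congrArg (fun m => Hom.comp m (F.pullbackProj _ Descent.continuous_proj)) e).trans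
      (F.pullbackLift_proj _ _ _ _ _ _)
  have hp : ∀ y, Descent.proj φ ρ θ (g.base y) = y := Hom.congr_base hid
  refine ⟨g.base, hp, fun x y h => ?_⟩
  have h1 : g.base y ⤳ Descent.germ φ ρ θ x (φ.base x) specializes_rfl := by
    have := Hom.congr_base e x
    change g.base (φ.base x) = Descent.germ φ ρ θ x (φ.base x) specializes_rfl at this
    rw [← this]
    exact g.specializes h
  -- the germs of `θ x` form an open subset, so `g y`, a generization of one of them, is one of
  -- them
  have h2 : IsOpen {t : Descent.Space φ ρ θ | ∃ y h, Descent.germ φ ρ θ x y h = t} := by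
    refine Descent.isOpen_iff.2 fun x' y' h' y₁ k => ?_
    rintro ⟨y, h, e⟩
    obtain ⟨l, e₁⟩ := Descent.germ_gen e k
    exact ⟨y₁, l, e₁⟩
  obtain ⟨y', h', e'⟩ := h1.mem_open h2 ⟨_, _, rfl⟩
  have h3 := hp y
  rw [← e', Descent.proj_germ] at h3
  subst h3
  exact e'.symm

/-- Descent along a characteristic morphism `φ : X → F`: locally constant data on `X` that live
over the generizations of the points `φ x` only depend on the point of `F`. -/
theorem descent [CompactSpace X.carrier] (hφ : φ.IsInitial)
    (hθ : ∀ x, ∃ W : Opens X.carrier, x ∈ W ∧ ∀ u ∈ W, ∀ z, ρ z ⤳ φ.base u → θ x z = θ u z)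
    {x x' : X.carrier} {z : Z} (h : ρ z ⤳ φ.base x) (h' : ρ z ⤳ φ.base x') : θ x z = θ x' z := by
  obtain ⟨g, -, hg⟩ := hφ.exists_descent_section hθ
  exact (Descent.germ_eq_iff.1 ((hg x _ h).symm.trans (hg x' _ h'))).2 z specializes_rfl

/-- Every point of the target of a characteristic morphism is a generization of a point of the
image. -/
theorem exists_specializes [CompactSpace X.carrier] (hφ : φ.IsInitial) (y : F.carrier) :
    ∃ x, y ⤳ φ.base x := by
  -- for trivial data the étale space is the open subset of the generizations of image points
  obtain ⟨g, hp, -⟩ := hφ.exists_descent_section (Z := PEmpty.{1}) (V := fun _ => PUnit.{1})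
    (ρ := PEmpty.elim) (θ := fun _ _ => PUnit.unit) (fun x => ⟨⊤, trivial, fun _ _ _ _ => rfl⟩)
  obtain ⟨x, y', h, e⟩ := Descent.germ_surj (g y)
  refine ⟨x, ?_⟩
  have h1 := hp y
  rw [← e, Descent.proj_germ] at h1
  rwa [← h1]

theorem hom_ext_of_exists_specializes (hφ : φ.IsStrict) {G : MonoidalSpace.{v}} (hG : IsFsKatoFan G)
    (hsp : ∀ y, ∃ x, y ⤳ φ.base x) {g g' : Hom F G} (h : φ.comp g = φ.comp g') : g = g' := by
  refine Hom.ext_cosp fun y => ?_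
  obtain ⟨x, hx⟩ := hsp y
  have e : g.base (φ.base x) = g'.base (φ.base x) := Hom.congr_base h x
  exact hG.hom_agree_gen g g' hx ⟨e, fun a => (hφ x).1
    (Hom.congr_stalkMap h (specializes_of_eq e) a)⟩

section Factor

variable {G : MonoidalSpace.{v}} (ψ : Hom X G)

/-- For a strict morphism `φ : X → F` and a morphism `ψ : X → G`, the homomorphism
`𝒪_{G, ψ x} → 𝒪_{X, x} ≃ 𝒪_{F, φ x}`. -/
def stalkFactor (hφ : φ.IsStrict) (x : X.carrier) :
    G.stalk (ψ.base x) →* F.stalk (φ.base x) :=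
  (MulEquiv.ofBijective (φ.stalkMap x) (hφ x)).symm.toMonoidHom.comp (ψ.stalkMap x)

theorem stalkMap_stalkFactor (hφ : φ.IsStrict) (x : X.carrier) (a : G.stalk (ψ.base x)) :
    φ.stalkMap x (stalkFactor ψ hφ x a) = ψ.stalkMap x a :=
  (MulEquiv.ofBijective (φ.stalkMap x) (hφ x)).apply_symm_apply _

/-- Near `x` the homomorphisms `stalkFactor` are compatible with generization. -/
theorem exists_stalkFactor_cosp (hφ : φ.IsStrict) (hF : IsFsKatoFan F) (hG : IsFsKatoFan G)
    (x : X.carrier) : ∃ W : Opens X.carrier, x ∈ W ∧ ∀ u ∈ W,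
      ∃ (k : ψ.base u ⤳ ψ.base x) (l : φ.base u ⤳ φ.base x), ∀ a,
        stalkFactor ψ hφ u (cosp k a) = cosp l (stalkFactor ψ hφ x a) := by
  have key : ∀ a, ∃ W : Opens X.carrier, x ∈ W ∧ ∀ u ∈ W,
      ∀ (k : ψ.base u ⤳ ψ.base x) (l : φ.base u ⤳ φ.base x),
        stalkFactor ψ hφ u (cosp k a) = cosp l (stalkFactor ψ hφ x a) := by
    intro a
    have h₁ := ψ.isSection _ _ (hG.cosp_isSection (ψ.base x) a)
    have h₂ := φ.isSection _ _ (hF.cosp_isSection (φ.base x) (stalkFactor ψ hφ x a))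
    obtain ⟨W, hW, h, h', e⟩ := exists_open_eq h₁ h₂ (x := x)
      (specializes_rfl : ψ.base x ⤳ ψ.base x) (specializes_rfl : φ.base x ⤳ φ.base x) 
        (((congrArg (ψ.stalkMap x) (cosp_refl _ a)).trans (stalkMap_stalkFactor ψ hφ x a).symm).trans
          (congrArg (φ.stalkMap x) (cosp_refl _ _)).symm)
    refine ⟨W, hW, fun u hu k l => (hφ u).1 ?_⟩
    rw [stalkMap_stalkFactor]
    exact e u hu
  -- finitely many generators of the stalk of `G` give one neighbourhood for all elements
  obtain ⟨S, hS⟩ := Monoid.fg_def.1 (hG.fg_stalk (ψ.base x))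
  choose W hW hWe using key
  have hO : IsOpen (⋂ a ∈ S, (W a : Set X.carrier)) :=
    isOpen_biInter_finset fun a _ => (W a).2
  refine ⟨⟨_, hO⟩ ⊓ (hG.minNhd (ψ.base x)).comap ⟨_, ψ.continuous_base⟩ ⊓
    (hF.minNhd (φ.base x)).comap ⟨_, φ.continuous_base⟩,
    ⟨⟨Set.mem_iInter₂.2 fun a _ => hW a, specializes_rfl⟩, specializes_rfl⟩, fun u hu => ?_⟩
  refine ⟨hu.1.2, hu.2, fun a => ?_⟩
  have ha : a ∈ Submonoid.closure (S : Set (G.stalk (ψ.base x))) := hS ▸ Submonoid.mem_top a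
  induction ha using Submonoid.closure_induction with
  | mem a ha => exact hWe a u (Set.mem_iInter₂.1 hu.1.1 a ha) _ _
  | one => simp only [map_one]
  | mul a b _ _ iha ihb => simp only [map_mul, iha, ihb]

/-- The possible values at `y` of a factorization of `ψ` through `φ`, seen from the point `x`. -/
def factorSet (hφ : φ.IsStrict) (x : X.carrier) (y : F.carrier) :
    Set (Σ z : G.carrier, G.stalk z →* F.stalk y) :=
  {p | (∀ a, IsUnit (p.2 a) → IsUnit a) ∧ ∃ (k : p.1 ⤳ ψ.base x) (h : y ⤳ φ.base x),
    ∀ a, p.2 (cosp k a) = cosp h (stalkFactor ψ hφ x a)}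

variable {ψ}

/-- The homomorphism `𝒪_{G, ψ x} → 𝒪_{F, φ x}` extends to every generization `y` of `φ x`, and in a
single way by `factorSet_subsingleton`. -/
theorem factorSet_nonempty (hφ : φ.IsStrict) (hF : IsFsKatoFan F) (hG : IsFsKatoFan G)
    {x : X.carrier} {y : F.carrier} (h : y ⤳ φ.base x) : (factorSet ψ hφ x y).Nonempty := by
  obtain ⟨z, k, m, hm, e⟩ := hG.exists_gen hF.sharp h (stalkFactor ψ hφ x)
  exact ⟨⟨z, m⟩, hm, k, h, e⟩

theorem factorSet_subsingleton (hφ : φ.IsStrict) (hG : IsFsKatoFan G)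
    (x : X.carrier) (y : F.carrier) : (factorSet ψ hφ x y).Subsingleton := by
  rintro ⟨z, m⟩ ⟨hm, k, h, e⟩ ⟨z', m'⟩ ⟨hm', k', h', e'⟩
  obtain ⟨e₁, e₂⟩ := hG.gen_unique h _ k k' m m' hm hm' e e'
  have e₃ : z = z' := e₁
  subst e₃
  congr
  ext a
  exact (congrArg m (cosp_refl _ a)).symm.trans (e₂ a)

/-- The local factorizations at `x` and at a nearby point `u` agree. -/
theorem factorSet_eq (hφ : φ.IsStrict) (hF : IsFsKatoFan F) (hG : IsFsKatoFan G)
    {x u : X.carrier} (k : ψ.base u ⤳ ψ.base x) (l : φ.base u ⤳ φ.base x)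
    (e : ∀ a, stalkFactor ψ hφ u (cosp k a) = cosp l (stalkFactor ψ hφ x a)) {y : F.carrier}
    (h : y ⤳ φ.base u) : factorSet ψ hφ x y = factorSet ψ hφ u y := by
  have h1 : factorSet ψ hφ u y ⊆ factorSet ψ hφ x y := by
    rintro p ⟨hp, k', h', e'⟩
    refine ⟨hp, k'.trans k, h'.trans l, fun a => ?_⟩
    rw [← cosp_cosp k k', e', e, cosp_cosp]
  refine subset_antisymm (fun p hp => ?_) h1
  obtain ⟨q, hq⟩ := factorSet_nonempty hφ hF hG h
  rwa [factorSet_subsingleton hφ hG x y hp (h1 hq)]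

theorem exists_factorSet_eq (hφ : φ.IsStrict) (hF : IsFsKatoFan F) (hG : IsFsKatoFan G)
    (x : X.carrier) : ∃ W : Opens X.carrier, x ∈ W ∧ ∀ u ∈ W, ∀ y, y ⤳ φ.base u →
      factorSet ψ hφ x y = factorSet ψ hφ u y := by
  obtain ⟨W, hW, h⟩ := exists_stalkFactor_cosp ψ hφ hF hG x
  refine ⟨W, hW, fun u hu y hy => ?_⟩
  obtain ⟨k, l, e⟩ := h u hu
  exact factorSet_eq hφ hF hG k l e hy

/-- If the local factorizations of a morphism to a Kato fan do not depend on the point of `X`, there is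
a unique global one. -/
theorem existsUnique_factor_of_factorSet_eq (hs : φ.IsStrict) (hF : IsFsKatoFan F)
    (hG : IsFsKatoFan G) (hsp : ∀ y, ∃ x, y ⤳ φ.base x)
    (hθ : ∀ x x' y, y ⤳ φ.base x → y ⤳ φ.base x' → factorSet ψ hs x y = factorSet ψ hs x' y) :
    ∃! g : Hom F G, φ.comp g = ψ := by
  have hex : ∀ y, ∃ p, ∀ x, y ⤳ φ.base x → p ∈ factorSet ψ hs x y := fun y => by
    obtain ⟨x, hx⟩ := hsp y
    obtain ⟨p, hp⟩ := factorSet_nonempty (ψ := ψ) hs hF hG hx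
    exact ⟨p, fun x' hx' => hθ x x' y hx hx' ▸ hp⟩
  choose p hp using hex
  have hgen : ∀ y₁ y (h : y₁ ⤳ y), ∃ k : (p y₁).1 ⤳ (p y).1, ∀ a,
      (p y₁).2 (cosp k a) = cosp h ((p y).2 a) := by
    intro y₁ y h
    obtain ⟨x, hx⟩ := hsp y
    obtain ⟨hl, k, h', e⟩ := hp y x hx
    obtain ⟨z, k', m, hm, e'⟩ := hG.exists_gen hF.sharp h (p y).2
    have h1 : (⟨z, m⟩ : Σ z : G.carrier, G.stalk z →* F.stalk y₁) ∈ factorSet ψ hs x y₁ :=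
      ⟨hm, k'.trans k, h.trans h', fun a => by rw [← cosp_cosp k k', e', e, cosp_cosp]⟩
    rw [factorSet_subsingleton hs hG x y₁ (hp y₁ x (h.trans hx)) h1]
    exact ⟨k', e'⟩
  let g : Hom F G := hF.homOfCosp (fun y => (p y).1) (fun y => (p y).2)
    (fun y => by obtain ⟨x, hx⟩ := hsp y; exact (hp y x hx).1)
    (fun y₁ y h => (hgen y₁ y h).1) (fun y₁ y h k a => (hgen y₁ y h).2 a)
  have hcomp : φ.comp g = ψ := by
    refine Hom.ext_cosp fun x => ?_
    obtain ⟨hl, k, h', e⟩ := hp (φ.base x) x specializes_rfl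
    obtain ⟨e₁, e₂⟩ := hG.gen_unique (specializes_refl (φ.base x)) (stalkFactor ψ hs x) k
      specializes_rfl (p (φ.base x)).2 (stalkFactor ψ hs x) hl (fun a ha => by
        refine ψ.isLocal x a ?_
        rw [← stalkMap_stalkFactor ψ hs]
        exact ha.map _) e (fun a => by rw [cosp_refl, cosp_refl])
    refine ⟨e₁, fun a => (congrArg (φ.stalkMap x) (e₂ a)).trans (stalkMap_stalkFactor ψ hs x a)⟩
  exact ⟨g, hcomp, fun g' hg' => hom_ext_of_exists_specializes hs hG hsp (hg'.trans hcomp.symm)⟩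

/-- A not necessarily strict morphism to a Kato fan factors uniquely through a characteristic
morphism. Locally on `X` there is a factorization through the smallest neighbourhoods of the points
of `F`, and these factorizations descend to `F`. -/
theorem existsUnique_factor [CompactSpace X.carrier] (hφ : φ.IsInitial) (hG : IsFsKatoFan G)
    (ψ : Hom X G) : ∃! g : Hom F G, φ.comp g = ψ := by
  have hF := hφ.isFsKatoFan
  have hs := hφ.isStrict
  exact existsUnique_factor_of_factorSet_eq hs hF hG hφ.exists_specializes fun x x' y h h' =>
    hφ.descent (ρ := fun y => y) (V := fun y => Set (Σ z : G.carrier, G.stalk z →* F.stalk y))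
      (θ := fun x y => factorSet ψ hs x y) (exists_factorSet_eq hs hF hG) h h'

end Factor

end Hom.IsInitial

/-- A criterion for the existence of a characteristic morphism. Suppose that `X` is the disjoint union
of open subsets (the fibres of `i`) each of which has a point `y` such that every point `x` of
the subset has the same image in `F` as some common generization of `x` and `y`. A strict
morphism `X → F` then becomes initial after separating the images of the open subsets. -/
theorem exists_isInitial {X F : MonoidalSpace.{u}} [CompactSpace X.carrier] {φ : Hom X F}
    (hF : IsFsKatoFan F) (hφ : φ.IsStrict) {ι : Type w} (i : X.carrier → ι) (c : ι → X.carrier)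
    (hi : ∀ x, ∃ W : Opens X.carrier, x ∈ W ∧ ∀ u ∈ W, i x = i u)
    (hc : ∀ x, ∃ x', x' ⤳ x ∧ x' ⤳ c (i x) ∧ φ.base x' = φ.base x) :
    ∃ (G : MonoidalSpace.{u}) (ψ : Hom X G), ψ.IsInitial := by
  let ρ : F.carrier → F.carrier := fun y => y
  let θ : X.carrier → F.carrier → ι := fun x _ => i x
  have hθ : ∀ x, ∃ W : Opens X.carrier, x ∈ W ∧ ∀ u ∈ W, ∀ z, ρ z ⤳ φ.base u → θ x z = θ u z :=
    fun x => by
      obtain ⟨W, hW, h⟩ := hi x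
      exact ⟨W, hW, fun u hu _ _ => h u hu⟩
  have hcont := Descent.continuous_germ (θ := θ) hF hθ
  have hG := Descent.isFsKatoFan_fan hF hcont
  let ψ : Hom X (Descent.fan φ ρ θ) :=
    F.pullbackLift _ Descent.continuous_proj φ _ hcont fun _ => rfl
  have hψ : ψ.IsStrict := F.pullbackLift_isStrict _ _ hφ _ _ _
  have hbase : ∀ x, ψ.base x = Descent.germ φ ρ θ x (φ.base x) specializes_rfl := fun _ => rfl
  have hgen : ∀ {x x'}, x' ⤳ x → i x' = i x := fun {x x'} h => by
    obtain ⟨W, hW, hWi⟩ := hi x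
    exact (hWi x' (h.mem_open W.2 hW)).symm
  have hsp : ∀ t : Descent.Space φ ρ θ, ∃ x, t ⤳ ψ.base x := fun t => by
    obtain ⟨x, y, h, rfl⟩ := Descent.germ_surj t
    exact ⟨x, specializes_iff_forall_open.2 fun U hU hx => Descent.isOpen_iff.1 hU x _ _ y h hx⟩
  -- the open subset that contains `x` can be read off from every generization of the image of `x`
  have hij : ∀ {t : Descent.Space φ ρ θ} {x x'}, t ⤳ ψ.base x → t ⤳ ψ.base x' → i x = i x' := by
    intro t x x' h h'
    have h1 : ∀ x, IsOpen {t : Descent.Space φ ρ θ |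
        ∃ x' y h, i x' = i x ∧ Descent.germ φ ρ θ x' y h = t} := fun x =>
      Descent.isOpen_iff.2 fun x₁ y₁ k₁ y₂ k₂ => by
        rintro ⟨x', y, l, e, e'⟩
        obtain ⟨l', e''⟩ := Descent.germ_gen e' k₂
        exact ⟨x', y₂, l', e, e''⟩
    obtain ⟨x₁, y₁, k₁, e₁, rfl⟩ := h.mem_open (h1 x) ⟨x, _, _, rfl, rfl⟩
    obtain ⟨x₂, y₂, k₂, e₂, e₃⟩ := h'.mem_open (h1 x') ⟨x', _, _, rfl, rfl⟩
    obtain ⟨rfl, e₄⟩ := Descent.germ_eq_iff.1 e₃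
    rw [← e₁, ← e₂]
    exact (e₄ y₂ specializes_rfl).symm
  have hψx : ∀ {x x'}, φ.base x' = φ.base x → i x' = i x → ψ.base x' = ψ.base x := fun h h' =>
    Descent.germ_eq_iff.2 ⟨h, fun _ _ => h'⟩
  refine ⟨_, ψ, hG, hψ, fun H χ hH hχ => ?_⟩
  obtain ⟨g, hg, hgu⟩ := Hom.IsInitial.existsUnique_factor_of_factorSet_eq (ψ := χ) hψ hG hH hsp (by
    -- the factorization seen from `x`, from `x'`, and from the special point of the open subset is
    -- the same, as `x'` is close to both other points
    have key : ∀ {x y}, y ⤳ ψ.base x → Hom.IsInitial.factorSet χ hψ x y =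
        Hom.IsInitial.factorSet χ hψ (c (i x)) y := by
      intro x y h
      obtain ⟨x', h₁, h₂, e⟩ := hc x
      have e' : ψ.base x' = ψ.base x := hψx e (hgen h₁)
      have h' : y ⤳ ψ.base x' := by rwa [e']
      obtain ⟨W, hW, hWx⟩ := Hom.IsInitial.exists_factorSet_eq (ψ := χ) hψ hG hH x
      obtain ⟨W', hW', hWx'⟩ := Hom.IsInitial.exists_factorSet_eq (ψ := χ) hψ hG hH (c (i x))
      exact (hWx x' (h₁.mem_open W.2 hW) y h').trans (hWx' x' (h₂.mem_open W'.2 hW') y h').symm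
    intro x x' y h h'
    rw [key h, key h', hij h h'])
  refine ⟨g, ⟨fun y => ?_, hg⟩, fun g' hg' => hgu g' hg'.2⟩
  obtain ⟨x, hx⟩ := hsp y
  refine hG.stalkMap_bijective_gen hH g hx ?_
  have h1 := hχ x
  subst hg
  exact (Function.Bijective.of_comp_iff' (hψ x) _).1 h1

end MonoidalSpace

/-! ### Extended cone complexes -/

namespace RBar

theorem eq_one_of_isUnit {a : RBar} (h : IsUnit a) : a = 1 := by
  obtain ⟨b, hb⟩ := h.exists_right_inv
  have : Multiplicative.toAdd a + Multiplicative.toAdd b = 0 := hb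
  exact (add_eq_zero.1 this).1

/-- The closed point of `Spec [0, ∞]`. -/
abbrev pt : MonPrime RBar := MonPrime.closedPoint RBar

theorem toStalk_injective : Function.Injective pt.toStalk := by
  intro a b e
  obtain ⟨s, hs, t, ht, e⟩ := pt.toStalk_eq_iff.1 e
  rwa [eq_one_of_isUnit (not_not.1 hs), eq_one_of_isUnit (not_not.1 ht), mul_one, mul_one] at e

/-- The stalk of `Spec [0, ∞]` at the closed point is `[0, ∞]`. -/
def stalkEquiv : RBar ≃* pt.Stalk :=
  MulEquiv.ofBijective pt.toStalk ⟨toStalk_injective, pt.toStalk_surjective⟩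

end RBar

namespace ExtCone

variable {F : MonoidalSpace.{u}} {G : MonoidalSpace.{v}}

/-- If the reduction of a point of the extended cone complex is a generization of `y`, the induced
homomorphism from `𝒪_y` to `[0, ∞]` (the latter as the stalk at the closed point). -/
def germVal (z : ExtCone F) {y : F.carrier} (k : z.reduction ⤳ y) : F.stalk y →* RBar.pt.Stalk :=
  (Hom.stalkMap z RBar.pt).comp (cosp k)

theorem germVal_apply (z : ExtCone F) {y : F.carrier} (k : z.reduction ⤳ y) (a : F.stalk y) :
    z.germVal k a = Hom.stalkMap z RBar.pt (cosp k a) := rfl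

/-- A point of the extended cone complex whose reduction is a generization of `y` is determined by
the homomorphism from `𝒪_y` to `[0, ∞]`. -/
theorem eq_of_germVal_eq (hF : IsFsKatoFan F) {z z' : ExtCone F} {y : F.carrier}
    (k : z.reduction ⤳ y) (k' : z'.reduction ⤳ y) (h : ∀ a, z.germVal k a = z'.germVal k' a) :
    z = z' :=
  hom_ext_of_local (X := specM RBar) (x := RBar.pt) hF MonPrime.specializes_closedPoint <|
    hF.gen_unique (X := specM RBar) (specializes_refl RBar.pt) (z'.germVal k') k k' _ _
      (Hom.isLocal z RBar.pt) (Hom.isLocal z' RBar.pt)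
      (fun a => (h a).trans (cosp_refl (X := specM RBar) _ _).symm)
      (fun _ => (cosp_refl (X := specM RBar) _ _).symm)

/-- On germs the map of extended cone complexes is composition with `𝒪_{G, g y} → 𝒪_{F, y}`. -/
theorem germVal_map (g : Hom F G) (z : ExtCone F) {y : F.carrier} (k : z.reduction ⤳ y)
    (k' : (map g z).reduction ⤳ g.base y) (a : G.stalk (g.base y)) :
    (map g z).germVal k' a = z.germVal k (g.stalkMap y a) :=
  congrArg (Hom.stalkMap z RBar.pt) (g.stalkMap_cosp k k' a)

/-- On an affine open subset the germ of the point given by `h : P → [0, ∞]` is `h`. -/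
theorem germVal_ofAffine {P : Type u} [CommMonoid P] (j : Hom (specM P) F) (h : P →* RBar)
    {p : MonPrime P} (hp : RBar.pt.comap h ⤳ p) (k : (ofAffine j h).reduction ⤳ j.base p)
    {a : F.stalk (j.base p)} {α : P} (hα : j.stalkMap p a = p.toStalk α) :
    (ofAffine j h).germVal k a = RBar.pt.toStalk (h α) := by
  refine (congrArg (MonPrime.stalkMap h RBar.pt) (j.stalkMap_cosp hp k a)).trans ?_
  rw [hα]
  exact (congrArg (MonPrime.stalkMap h RBar.pt) (MonPrime.cosp_toStalk hp α)).trans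
    (MonPrime.stalkMap_toStalk h RBar.pt α)

/-- Every homomorphism `𝒪_y → [0, ∞]` comes from a point of the extended cone complex. -/
theorem exists_germVal_eq (hF : IsFsKatoFan F) (y : F.carrier) (m : F.stalk y →* RBar.pt.Stalk) :
    ∃ (z : ExtCone F) (k : z.reduction ⤳ y), ∀ a, z.germVal k a = m a := by
  obtain ⟨P, _, hP, j, hj, rfl⟩ := hF.exists_localNhd y
  let c := MonPrime.closedPoint P
  let e := MulEquiv.ofBijective (j.stalkMap c) (hj.2 c)
  let h : P →* RBar := ((RBar.stalkEquiv.symm.toMonoidHom.comp m).comp e.symm.toMonoidHom).comp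
    c.toStalk
  have hc := (RBar.pt.comap h).specializes_closedPoint
  refine ⟨ofAffine j h, j.specializes hc, fun a => ?_⟩
  obtain ⟨α, hα⟩ := c.toStalk_surjective (e a)
  refine (germVal_ofAffine j h hc _ (show j.stalkMap c a = c.toStalk α from hα.symm)).trans ?_
  change RBar.stalkEquiv (RBar.stalkEquiv.symm (m (e.symm (c.toStalk α)))) = m a
  rw [hα, MulEquiv.apply_symm_apply, MulEquiv.symm_apply_apply]

/-- The point given by a local homomorphism `h : 𝒪_y → [0, ∞]` reduces to `y` and induces `h` there.
-/
theorem ofStalkAux_spec {y : F.carrier} (A : AffineNhd F y) (h : F.stalk y →* RBar)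
    (hl : ∀ a, IsUnit (h a) → IsUnit a) :
    ∃ k : reduction (ofStalkAux A h) = y, ∀ a,
      germVal (ofStalkAux A h) (specializes_of_eq k) a = RBar.pt.toStalk (h a) := by
  obtain ⟨P, hP, j, hj, p, rfl⟩ := A
  let e := MulEquiv.ofBijective (j.stalkMap p) (hj.2 p)
  let h' : P →* RBar := (h.comp e.symm.toMonoidHom).comp p.toStalk
  have hp : RBar.pt.comap h' = p := by
    ext α
    change ¬ IsUnit (h (e.symm (p.toStalk α))) ↔ _
    rw [← not_not (a := α ∈ p.carrier), ← p.isUnit_toStalk_iff]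
    refine not_congr ⟨fun hu => ?_, fun hu => (hu.map e.symm).map h⟩
    have h1 := (hl _ hu).map e
    rwa [e.apply_symm_apply] at h1
  refine ⟨congrArg j.base hp, fun a => ?_⟩
  obtain ⟨α, hα⟩ := p.toStalk_surjective (e a)
  refine (germVal_ofAffine j h' (specializes_of_eq hp) _
    (show j.stalkMap p a = p.toStalk α from hα.symm)).trans ?_
  change RBar.pt.toStalk (h (e.symm (p.toStalk α))) = _
  rw [hα, MulEquiv.symm_apply_apply]

theorem reduction_ofStalk (hF : IsFsKatoFan F) {y : F.carrier} {h : F.stalk y →* RBar}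
    (hl : ∀ a, IsUnit (h a) → IsUnit a) : (ofStalk hF y h).reduction = y :=
  (ofStalkAux_spec _ h hl).1

theorem germVal_ofStalk (hF : IsFsKatoFan F) {y : F.carrier} {h : F.stalk y →* RBar}
    (hl : ∀ a, IsUnit (h a) → IsUnit a) (k : (ofStalk hF y h).reduction ⤳ y) (a : F.stalk y) :
    (ofStalk hF y h).germVal k a = RBar.pt.toStalk (h a) :=
  (ofStalkAux_spec _ h hl).2 a

/-- Along a strict morphism of Kato fans, the points of the extended cone complex near `g y` lift
uniquely to points near `y`. -/
theorem exists_lift (hF : IsFsKatoFan F) (hG : IsFsKatoFan G) {g : Hom F G} (hg : g.IsStrict)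
    {y : F.carrier} {z : ExtCone G} (k : z.reduction ⤳ g.base y) :
    ∃ z' : ExtCone F, z'.reduction ⤳ y ∧ map g z' = z := by
  let e := MulEquiv.ofBijective (g.stalkMap y) (hg y)
  obtain ⟨z', k', h⟩ := exists_germVal_eq hF y ((z.germVal k).comp e.symm.toMonoidHom)
  have k₁ : (map g z').reduction ⤳ g.base y := g.specializes k'
  refine ⟨z', k', eq_of_germVal_eq hG k₁ k fun a => ?_⟩
  rw [germVal_map g z' k', h]
  exact congrArg (z.germVal k) (e.symm_apply_apply a)

theorem lift_unique (hF : IsFsKatoFan F) {g : Hom F G} (hg : g.IsStrict) {y : F.carrier}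
    {z z' : ExtCone F} (k : z.reduction ⤳ y) (k' : z'.reduction ⤳ y) (h : map g z = map g z') :
    z = z' := by
  refine eq_of_germVal_eq hF k k' fun a => ?_
  obtain ⟨a, rfl⟩ := (hg y).2 a
  have k₁ : (map g z).reduction ⤳ g.base y := g.specializes k
  have k₂ : (map g z').reduction ⤳ g.base y := g.specializes k'
  rw [← germVal_map g z k k₁, ← germVal_map g z' k' k₂]
  simp only [h]

/-- The topology of pointwise convergence on `Hom(P, [0, ∞])`. -/
abbrev homTopology (P : Type u) [CommMonoid P] : TopologicalSpace (P →* RBar) :=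
  TopologicalSpace.induced (fun (h : P →* RBar) (p : P) => h p) inferInstance

/-- The weak topology: continuity is tested on the sets `Hom(P, [0, ∞])` of the affine open subsets
`Spec P`. -/
theorem continuous_dom_iff {T : Type w} [TopologicalSpace T] {f : ExtCone F → T} :
    Continuous f ↔ ∀ (P : Type u) (_ : CommMonoid P) (j : Hom (specM P) F),
      j.IsOpenImmersion → @Continuous _ _ (homTopology P) _ fun h => f (ofAffine j h) := by
  simp only [continuous_iSup_dom, continuous_coinduced_dom]
  rfl

theorem continuous_ofAffine_of_isOpenImmersion {P : Type u} [CommMonoid P] {j : Hom (specM P) F}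
    (hj : j.IsOpenImmersion) : @Continuous _ _ (homTopology P) _ (ofAffine j) :=
  continuous_dom_iff.1 continuous_id P _ j hj

/-- The map `Hom(P, [0, ∞]) → Σ(F)` given by a morphism `Spec P → F` is continuous also if the
morphism is not an open immersion. -/
theorem continuous_ofAffine (hF : IsFsKatoFan F) {P : Type u} [CommMonoid P]
    (j : Hom (specM P) F) : @Continuous _ _ (homTopology P) _ (ofAffine j) := by
  let c := MonPrime.closedPoint P
  obtain ⟨Q, _, hQ, i, hi, e⟩ := hF.exists_localNhd (j.base c)
  let c' := MonPrime.closedPoint Q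
  let E := MulEquiv.ofBijective (i.stalkMap c') (hi.2 c')
  let γ : Q →* c.Stalk := (((j.stalkMap c).comp (cosp (specializes_of_eq e.symm))).comp
    E.symm.toMonoidHom).comp c'.toStalk
  -- `[0, ∞]` has no units but `0`, so `h` factors through `P / P^*`
  have hlift : ∀ (h : P →* RBar) (a b : P), c.toStalk a = c.toStalk b → h a = h b := by
    intro h a b hab
    obtain ⟨s, hs, t, ht, e⟩ := c.toStalk_eq_iff.1 hab
    have h1 := congrArg h e
    rwa [map_mul, map_mul, RBar.eq_one_of_isUnit ((not_not.1 hs : IsUnit s).map h),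
      RBar.eq_one_of_isUnit ((not_not.1 ht : IsUnit t).map h), mul_one, mul_one] at h1
  -- near the image of the closed point of `Spec P` the morphism comes from a homomorphism `Q → P /
  -- P^*`, and the map is composition with it
  let r : (P →* RBar) → (Q →* RBar) := fun h => (c.liftStalk h (hlift h)).comp γ
  have hr : ∀ h, ofAffine j h = ofAffine i (r h) := by
    intro h
    have hc := (RBar.pt.comap h).specializes_closedPoint
    have hc' := (RBar.pt.comap (r h)).specializes_closedPoint
    have k : (ofAffine j h).reduction ⤳ j.base c := j.specializes hc
    have k' : (ofAffine i (r h)).reduction ⤳ i.base c' := i.specializes hc'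
    refine eq_of_germVal_eq hF (k.trans (specializes_of_eq e.symm)) k' fun a => ?_
    obtain ⟨α, hα⟩ := c'.toStalk_surjective (E a)
    rw [germVal_ofAffine i (r h) hc' k' (show i.stalkMap c' a = c'.toStalk α from hα.symm)]
    obtain ⟨β, hβ⟩ := c.toStalk_surjective
      (j.stalkMap c (cosp (specializes_of_eq e.symm) a))
    have h1 := germVal_ofAffine j h hc k hβ.symm
    rw [germVal_apply, cosp_cosp] at h1
    rw [germVal_apply, h1]
    change _ = RBar.pt.toStalk (c.liftStalk h (hlift h) (j.stalkMap c (cosp _ (E.symm _))))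
    rw [hα, E.symm_apply_apply, ← hβ, c.liftStalk_toStalk]
  rw [show ofAffine j = ofAffine i ∘ r from funext hr]
  let := homTopology P
  let := homTopology Q
  refine (continuous_ofAffine_of_isOpenImmersion hi).comp ?_
  refine continuous_induced_rng.2 (continuous_pi fun q => ?_)
  obtain ⟨α, hα⟩ := c.toStalk_surjective (γ q)
  have h2 : (fun h : P →* RBar => r h q) = fun h => h α := by
    funext h
    change c.liftStalk h (hlift h) (γ q) = _
    rw [← hα, c.liftStalk_toStalk]
  exact h2 ▸ (continuous_apply α).comp continuous_induced_dom

theorem continuous_map {G : MonoidalSpace.{u}} (hG : IsFsKatoFan G) (g : Hom F G) : Continuous (map g) :=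
  continuous_dom_iff.2 fun _ _ j _ => continuous_ofAffine hG (j.comp g)

/-- A morphism from an affine fan to the target of a strict morphism `g` lifts, if its closed point
is mapped to a generization of a point in the image of `g`. -/
theorem exists_hom_lift (hF : IsFsKatoFan F) (hG : IsFsKatoFan G) {g : Hom F G} (hg : g.IsStrict)
    {P : Type w} [CommMonoid P] (j : Hom (specM P) G) {y : F.carrier}
    (k : j.base (MonPrime.closedPoint P) ⤳ g.base y) : ∃ i : Hom (specM P) F, i.comp g = j := by
  let c := MonPrime.closedPoint P
  obtain ⟨y₁, ⟨-, e⟩, -⟩ := hF.exists_unique_gen_of_isStrict hG hg k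
  let E := MulEquiv.ofBijective (g.stalkMap y₁) (hg y₁)
  have hE : ∀ a, E.symm (g.stalkMap y₁ a) = a := E.symm_apply_apply
  let m : F.stalk y₁ →* c.Stalk :=
    ((j.stalkMap c).comp (cosp (specializes_of_eq e.symm))).comp E.symm.toMonoidHom
  have hm : ∀ a, IsUnit (m a) → IsUnit a := by
    intro a ha
    obtain ⟨b, rfl⟩ := E.surjective a
    have h1 := j.isLocal c _ ha
    change IsUnit (cosp (specializes_of_eq e.symm) (E.symm (E b))) at h1
    rw [E.symm_apply_apply] at h1
    have h2 := h1.map (cosp (specializes_of_eq e))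
    rw [cosp_cosp, cosp_refl] at h2
    exact h2.map E
  obtain ⟨i, rfl, hi⟩ := exists_hom_of_local hF (specM_isSharp P) MonPrime.specializes_closedPoint
    m hm
  refine ⟨i, hom_ext_of_local (X := specM P) (x := c) hG MonPrime.specializes_closedPoint
    ⟨e, fun a => ?_⟩⟩
  have h1 := hi (g.stalkMap _ (cosp (specializes_of_eq e) a))
  rw [cosp_refl] at h1
  refine h1.trans ?_
  change j.stalkMap c (cosp _ (E.symm (g.stalkMap _ _))) = _
  rw [hE, cosp_cosp, cosp_refl]

end ExtCone

/-! ### The topology of the analytic space -/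

namespace Beth

variable {X Y Z : Scheme.{u}}

/-- The points of `X^ℶ` that reduce to the open subset `U`, with the coarsest topology for which the
absolute values of the functions on `U` are continuous. -/
def On (U : X.Opens) : Type u := {x : Beth X // x.pt ∈ U}

/-- The absolute value of a function on `U`. -/
def abs {U : X.Opens} (x : On U) (f : Γ(X, U)) : ℝ≥0 := eval U x f

instance (U : X.Opens) : TopologicalSpace (On U) :=
  TopologicalSpace.induced abs inferInstance

/-- The inclusion into `X^ℶ`. -/
def On.incl {U : X.Opens} (x : On U) : Beth X := x.1

/-- The topology of `X^ℶ` is glued along reduction from the affine open subschemes: `X^ℶ` carries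
the final topology. -/
theorem isClosed_iff {A : Set (Beth X)} :
    IsClosed A ↔ ∀ U : X.Opens, IsAffineOpen U → IsClosed (On.incl (U := U) ⁻¹' A) := by
  simp only [← isOpen_compl_iff, ← Set.preimage_compl]
  rw [isOpen_iSup_iff]
  exact ⟨fun h U hU => h ⟨U, hU⟩, fun h U => h U.1 U.2⟩

theorem continuous_to_on {T : Type*} [TopologicalSpace T] {U : X.Opens} {φ : T → On U}
    (h : ∀ f, Continuous fun t => abs (φ t) f) : Continuous φ :=
  continuous_induced_rng.2 (continuous_pi h)

theorem continuous_abs {U : X.Opens} (f : Γ(X, U)) : Continuous fun x : On U => abs x f :=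
  (continuous_apply f).comp continuous_induced_dom

theorem abs_mul {U : X.Opens} (x : On U) (f g : Γ(X, U)) : abs x (f * g) = abs x f * abs x g := by
  simp only [abs, eval, map_mul]

theorem abs_pow {U : X.Opens} (x : On U) (f : Γ(X, U)) (n : ℕ) : abs x (f ^ n) = abs x f ^ n := by
  simp only [abs, eval, map_pow]

theorem abs_le_one {U : X.Opens} (x : On U) (f : Γ(X, U)) : abs x f ≤ 1 := x.1.le_one _

theorem val_eq_one_iff (x : Beth X) (f) : x.val f = 1 ↔ IsUnit f := by
  rw [← not_iff_not, ← x.lt_one_iff, lt_iff_le_and_ne, and_iff_right (x.le_one f)]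

theorem abs_eq_one_iff {U : X.Opens} (x : On U) (f : Γ(X, U)) :
    abs x f = 1 ↔ x.1.pt ∈ X.basicOpen f :=
  (x.1.val_eq_one_iff _).trans (X.mem_basicOpen _ _ x.2).symm

/-- The inclusion of the points that reduce to `U` into those that reduce to a bigger `V`. -/
def On.ofLE {U V : X.Opens} (h : U ≤ V) (x : On U) : On V := ⟨x.1, h x.2⟩

theorem abs_ofLE {U V : X.Opens} (h : U ≤ V) (x : On U) (f : Γ(X, V)) :
    abs (x.ofLE h) f = abs x (X.presheaf.map (homOfLE h).op f) := by
  exact (congrArg x.1.val (X.presheaf.germ_res_apply (homOfLE h) x.1.pt x.2 f)).symm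

theorem continuous_ofLE {U V : X.Opens} (h : U ≤ V) : Continuous (On.ofLE h) :=
  continuous_to_on fun f => by
    simp only [abs_ofLE]
    exact continuous_abs _

/-- The points that reduce to the basic open subset `D(g)` form the closed locus `|g| = 1`, with the
induced topology: there `|f / g ^ n| = |f|`. -/
theorem isClosedEmbedding_ofLE_basicOpen {U : X.Opens} (hU : IsAffineOpen U) (g : Γ(X, U)) :
    Topology.IsClosedEmbedding (On.ofLE (X.basicOpen_le g)) := by
  have hinj : Function.Injective (On.ofLE (X.basicOpen_le g)) :=
    fun x y e => Subtype.ext (congrArg (fun z : On U => z.1) e)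
  have hr : Set.range (On.ofLE (X.basicOpen_le g)) = {x | abs x g = 1} := by
    ext x
    constructor
    · rintro ⟨y, rfl⟩
      exact (abs_eq_one_iff _ _).2 y.2
    · intro hx
      exact ⟨⟨x.1, (abs_eq_one_iff _ _).1 hx⟩, rfl⟩
  refine ⟨⟨⟨le_antisymm (continuous_iff_le_induced.1 (continuous_ofLE _)) ?_⟩, hinj⟩, ?_⟩
  · let t := TopologicalSpace.induced (On.ofLE (X.basicOpen_le g)) inferInstance
    refine continuous_id_iff_le.1 ?_
    refine @continuous_to_on X _ t _ _ fun h => ?_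
    simp only [id_eq]
    have := hU.isLocalization_basicOpen g
    obtain ⟨⟨f, ⟨_, n, rfl⟩⟩, e⟩ := IsLocalization.surj (Submonoid.powers g) h
    have h1 : (fun x : On (X.basicOpen g) => abs x h) = fun x => abs (x.ofLE (X.basicOpen_le g)) f := by
      funext x
      have h2 : abs x (algebraMap Γ(X, U) Γ(X, X.basicOpen g) (g ^ n)) = 1 := by
        refine (abs_ofLE (X.basicOpen_le g) x (g ^ n)).symm.trans ?_
        rw [abs_pow, (abs_eq_one_iff (x.ofLE (X.basicOpen_le g)) g).2 x.2, one_pow]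
      have h3 := congrArg (abs x) e
      rw [abs_mul, h2, mul_one] at h3
      exact h3.trans (abs_ofLE (X.basicOpen_le g) x f).symm
    rw [h1]
    exact (continuous_abs f).comp continuous_induced_dom
  · rw [hr]
    exact isClosed_singleton.preimage (continuous_abs g)

/-- Closedness on an affine open subset can be checked locally: finitely many basic open subsets
define a finite closed covering of the analytic space. -/
theorem isClosed_of_local {U : X.Opens} (hU : IsAffineOpen U) {A : Set (Beth X)}
    (h : ∀ x ∈ U, ∃ V : X.Opens, x ∈ V ∧ ∀ W : X.Opens, IsAffineOpen W → W ≤ V →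
      IsClosed (On.incl (U := W) ⁻¹' A)) : IsClosed (On.incl (U := U) ⁻¹' A) := by
  choose V hxV hV using h
  have h1 : ∀ x : U, ∃ g : Γ(X, U), X.basicOpen g ≤ V x.1 x.2 ∧ x.1 ∈ X.basicOpen g :=
    fun x => hU.exists_basicOpen_le ⟨x.1, hxV x.1 x.2⟩ x.2
  choose g hg hxg using h1
  obtain ⟨s, hs⟩ := hU.isCompact.elim_finite_subcover (fun x : U => (X.basicOpen (g x) : Set X))
    (fun x => (X.basicOpen (g x)).2) fun x hx => Set.mem_iUnion.2 ⟨⟨x, hx⟩, hxg _⟩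
  have h2 : On.incl (U := U) ⁻¹' A = ⋃ x ∈ s, On.ofLE (X.basicOpen_le (g x)) ''
      (On.incl (U := X.basicOpen (g x)) ⁻¹' A) := by
    ext y
    simp only [Set.mem_iUnion]
    constructor
    · intro hy
      obtain ⟨x, hx, hyx⟩ := Set.mem_iUnion₂.1 (hs y.2)
      exact ⟨x, hx, ⟨y.1, hyx⟩, hy, rfl⟩
    · rintro ⟨x, hx, z, hz, rfl⟩
      exact hz
  rw [h2]
  exact isClosed_biUnion_finset fun x _ => (isClosedEmbedding_ofLE_basicOpen hU (g x)).isClosedMap _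
    (hV _ _ _ (hU.basicOpen _) (hg x))

/-- The map induced by a morphism on the points that reduce to given open subsets. -/
def On.map (f : X ⟶ Y) {U : X.Opens} {V : Y.Opens} (h : U ≤ f ⁻¹ᵁ V) (x : On U) : On V :=
  ⟨Beth.map f x.1, h x.2⟩

theorem abs_map (f : X ⟶ Y) {U : X.Opens} {V : Y.Opens} (h : U ≤ f ⁻¹ᵁ V) (x : On U)
    (g : Γ(Y, V)) : abs (x.map f h) g = abs (x.ofLE h) (f.app V g) := by
  change x.1.val ((f.stalkMap x.1.pt).hom _) = x.1.val _
  exact congrArg x.1.val (Scheme.Hom.germ_stalkMap_apply f V x.1.pt (h x.2) g)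

theorem continuous_on_map (f : X ⟶ Y) {U : X.Opens} {V : Y.Opens} (h : U ≤ f ⁻¹ᵁ V) :
    Continuous (On.map f h) :=
  continuous_to_on fun g => by
    simp only [abs_map]
    exact (continuous_abs _).comp (continuous_ofLE h)

/-- The maps of analytic spaces are continuous. Affine open subsets of `X` that map into affine open
subsets of `Y` suffice to test closedness. -/
theorem continuous_map (f : X ⟶ Y) : Continuous (map f) := by
  refine continuous_iff_isClosed.2 fun A hA => isClosed_iff.2 fun U hU => ?_
  refine isClosed_of_local hU fun x hx => ?_
  obtain ⟨_, ⟨V, hV, rfl⟩, hxV, -⟩ := Y.isBasis_affineOpens.exists_subset_of_mem_open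
    (Set.mem_univ (f x)) isOpen_univ
  refine ⟨f ⁻¹ᵁ V, hxV, fun W hW hWV => ?_⟩
  exact (isClosed_iff.1 hA V hV).preimage (continuous_on_map f hWV)

/-! ### Points of the analytic space of an affine scheme -/

theorem exists_germ_mul {U : X.Opens} (hU : IsAffineOpen U) {x : X} (hx : x ∈ U)
    (a : X.presheaf.stalk x) : ∃ f g : Γ(X, U), IsUnit (X.presheaf.germ U x hx g) ∧
      a * X.presheaf.germ U x hx g = X.presheaf.germ U x hx f := by
  have := hU.isLocalization_stalk ⟨x, hx⟩
  let : Algebra Γ(X, U) (X.presheaf.stalk x) := (X.presheaf.germ U x hx).hom.toAlgebra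
  obtain ⟨⟨f, g⟩, e⟩ := IsLocalization.surj (hU.primeIdealOf ⟨x, hx⟩).asIdeal.primeCompl a
  exact ⟨f, g, IsLocalization.map_units _ g, e⟩

/-- A point over an affine open subset is determined by the absolute values of the functions: its
reduction is the prime ideal of the functions with `|f| < 1`. -/
theorem abs_injective {U : X.Opens} (hU : IsAffineOpen U) : Function.Injective (abs (U := U)) := by
  rintro ⟨⟨x, v, hv, hv'⟩, hx⟩ ⟨⟨y, w, hw, hw'⟩, hy⟩ e
  have hxy : ∀ f : Γ(X, U), x ∈ X.basicOpen f ↔ y ∈ X.basicOpen f := fun f => by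
    have h1 := abs_eq_one_iff ⟨⟨x, v, hv, hv'⟩, hx⟩ f
    have h2 := abs_eq_one_iff ⟨⟨y, w, hw, hw'⟩, hy⟩ f
    rw [e] at h1
    exact h1.symm.trans h2
  obtain rfl : x = y := by
    refine Inseparable.eq (inseparable_iff_forall_isOpen.2 fun O hO => ?_)
    change x ∈ (⟨O, hO⟩ : X.Opens) ↔ y ∈ (⟨O, hO⟩ : X.Opens)
    constructor
    · intro h
      obtain ⟨f, hf, hxf⟩ := hU.exists_basicOpen_le ⟨x, h⟩ hx
      exact hf ((hxy f).1 hxf)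
    · intro h
      obtain ⟨f, hf, hxf⟩ := hU.exists_basicOpen_le ⟨y, h⟩ hy
      exact hf ((hxy f).2 hxf)
  obtain rfl : v = w := by
    ext a
    obtain ⟨f, g, hg, ea⟩ := exists_germ_mul hU hx a
    have h1 : v (X.presheaf.germ U x hx f) = w (X.presheaf.germ U x hx f) := congrFun e f
    have h2 : v (X.presheaf.germ U x hx g) = 1 := val_eq_one_iff ⟨x, v, hv, hv'⟩ _ |>.2 hg
    have h3 : w (X.presheaf.germ U x hx g) = 1 := val_eq_one_iff ⟨x, w, hw, hw'⟩ _ |>.2 hg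
    rw [← ea, map_mul, map_mul, h2, h3, mul_one, mul_one] at h1
    rw [h1]
  rfl

/-- A multiplicative seminorm on the functions on an affine open subset that is bounded by `1` is a
point of the analytic space. -/
theorem exists_abs_eq {U : X.Opens} (hU : IsAffineOpen U) (v : Valuation Γ(X, U) ℝ≥0)
    (hv : ∀ f, v f ≤ 1) : ∃ x : On U, ∀ f, abs x f = v f := by
  let I : Ideal Γ(X, U) :=
    { carrier := {f | v f < 1}
      add_mem' := fun ha hb => (v.map_add _ _).trans_lt (max_lt ha hb)
      zero_mem' := by simp
      smul_mem' := fun a b hb => by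
        change v (a * b) < 1
        rw [map_mul]
        exact (mul_le_of_le_one_left' (hv a)).trans_lt hb }
  have hI : I.IsPrime :=
    { ne_top' := fun h => by
        have : (1 : Γ(X, U)) ∈ I := h ▸ Submodule.mem_top
        exact absurd (show v 1 < 1 from this) (by simp)
      mem_or_mem' := fun {a b} hab => by
        by_contra! hc
        have ha : v a = 1 := le_antisymm (hv a) (not_lt.1 hc.1)
        have hb : v b = 1 := le_antisymm (hv b) (not_lt.1 hc.2)
        have : v (a * b) < 1 := hab
        rw [map_mul, ha, hb, mul_one] at this
        exact lt_irrefl _ this }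
  let p : PrimeSpectrum Γ(X, U) := ⟨I, hI⟩
  have hp : hU.fromSpec p ∈ U := by
    have : hU.fromSpec p ∈ hU.fromSpec.opensRange := ⟨p, rfl⟩
    rwa [hU.opensRange_fromSpec] at this
  let B := X.presheaf.stalk (hU.fromSpec p)
  let : Algebra Γ(X, U) B := (X.presheaf.germ U _ hp).hom.toAlgebra
  have hB : IsLocalization.AtPrime B p.asIdeal := hU.isLocalization_stalk' p hp
  -- functions outside the center have absolute value `1`, so `v` extends to the local ring
  have hS : p.asIdeal.primeCompl ≤ v.supp.primeCompl := by
    intro f hf h0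
    exact hf (show v f < 1 by rw [show v f = 0 from h0]; exact zero_lt_one)
  let w : Valuation B ℝ≥0 := v.extendToLocalization hS B
  have hw : ∀ f, w (algebraMap _ B f) = v f := v.extendToLocalization_apply_map_apply hS B
  have key : ∀ a : B, ∃ f, w a = v f ∧ (IsUnit a ↔ IsUnit (algebraMap _ B f)) := by
    intro a
    obtain ⟨⟨f, g⟩, e⟩ := IsLocalization.surj p.asIdeal.primeCompl a
    have hg : v g = 1 := le_antisymm (hv _) (not_lt.1 g.2)
    have hu := IsLocalization.map_units B g
    refine ⟨f, ?_, ?_⟩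
    · rw [← hw f, ← e, map_mul, hw, hg, mul_one]
    · rw [← e, IsUnit.mul_iff, and_iff_left hu]
  refine ⟨⟨⟨hU.fromSpec p, w, fun a => ?_, fun a => ?_⟩, hp⟩, hw⟩
  · obtain ⟨f, hf, -⟩ := key a
    rw [hf]
    exact hv f
  · obtain ⟨f, hf, hu⟩ := key a
    rw [hf, hu, IsLocalization.AtPrime.isUnit_to_map_iff B p.asIdeal]
    exact not_not.symm

/-- The multiplicative seminorms bounded by `1` are cut out by closed conditions in the product of
the `ℝ≥0`. -/
theorem isClosed_range_abs {U : X.Opens} (hU : IsAffineOpen U) :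
    IsClosed (Set.range (abs (U := U))) := by
  have h : Set.range (abs (U := U)) = {v | v 0 = 0 ∧ v 1 = 1 ∧ (∀ f g, v (f * g) = v f * v g) ∧
      (∀ f g, v (f + g) ≤ max (v f) (v g)) ∧ ∀ f, v f ≤ 1} := by
    ext v
    constructor
    · rintro ⟨x, rfl⟩
      refine ⟨?_, ?_, abs_mul x, fun f g => ?_, abs_le_one x⟩
      · simp only [abs, eval, map_zero]
      · simp only [abs, eval, map_one]
      · simp only [abs, eval, map_add]
        exact Valuation.map_add _ _ _
    · rintro ⟨h0, h1, hm, ha, hv⟩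
      obtain ⟨x, hx⟩ := exists_abs_eq hU
        { toFun := v, map_zero' := h0, map_one' := h1, map_mul' := hm, map_add_le_max' := ha } hv
      exact ⟨x, funext hx⟩
  rw [h]
  simp only [Set.ofPred_and, Set.ofPred_forall]
  refine IsClosed.inter (isClosed_eq (continuous_apply _) continuous_const) <|
    IsClosed.inter (isClosed_eq (continuous_apply _) continuous_const) <|
    IsClosed.inter (isClosed_iInter fun f => isClosed_iInter fun g => isClosed_eq (continuous_apply _)
      ((continuous_apply f).mul (continuous_apply g))) <|
    IsClosed.inter (isClosed_iInter fun f => isClosed_iInter fun g => isClosed_le (continuous_apply _)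
      ((continuous_apply f).max (continuous_apply g))) <|
    isClosed_iInter fun f => isClosed_le (continuous_apply _) continuous_const

/-- The analytic space of an affine scheme is compact, as a closed subset of a product of unit
intervals. -/
theorem compactSpace_on {U : X.Opens} (hU : IsAffineOpen U) : CompactSpace (On U) := by
  have h1 : Topology.IsClosedEmbedding (abs (U := U)) :=
    ⟨⟨⟨rfl⟩, abs_injective hU⟩, isClosed_range_abs hU⟩
  have h2 : IsCompact (Set.univ.pi fun _ : Γ(X, U) => Set.Iic (1 : ℝ≥0)) :=
    isCompact_univ_pi fun _ => by
      rw [show Set.Iic (1 : ℝ≥0) = Set.Icc 0 1 by ext; simp]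
      exact isCompact_Icc
  have h3 := h1.isCompact_preimage h2
  have h4 : abs (U := U) ⁻¹' Set.univ.pi (fun _ : Γ(X, U) => Set.Iic (1 : ℝ≥0)) = Set.univ :=
    Set.eq_univ_of_forall fun x => Set.mem_univ_pi.2 fun f => abs_le_one x f
  rwa [h4, isCompact_univ_iff] at h3

theorem t2Space_on {U : X.Opens} (hU : IsAffineOpen U) : T2Space (On U) :=
  T2Space.of_injective_continuous (abs_injective hU) continuous_induced_dom

/-- The map of analytic spaces induced by a quasi-compact morphism is closed. Over an affine open
subset of the target it is a finite union of maps from compact spaces to a Hausdorff space. -/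
theorem isClosedMap_map (f : X ⟶ Y) [QuasiCompact f] : IsClosedMap (map f) := by
  intro A hA
  refine isClosed_iff.2 fun V hV => ?_
  have hc : IsCompact (f ⁻¹ᵁ V : Set X) := f.isCompact_preimage hV.isCompact
  obtain ⟨s, hs, e⟩ := (isCompact_and_isOpen_iff_finite_and_eq_biUnion_affineOpens).1
    ⟨hc, (f ⁻¹ᵁ V).2⟩
  have hle : ∀ U ∈ s, U.1 ≤ f ⁻¹ᵁ V := fun U hU x hx => by
    change x ∈ (f ⁻¹ᵁ V : Set X)
    rw [e]
    exact Set.mem_biUnion hU hx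
  have h2 : On.incl (U := V) ⁻¹' (map f '' A) =
      ⋃ U : s, On.map f (hle U.1 U.2) '' (On.incl (U := U.1.1) ⁻¹' A) := by
    ext y
    simp only [Set.mem_iUnion]
    constructor
    · rintro ⟨x, hx, e'⟩
      have hxV : x.pt ∈ (f ⁻¹ᵁ V : Set X) := by
        change (map f x).pt ∈ V
        rw [e']
        exact y.2
      rw [e] at hxV
      obtain ⟨U, hU, hxU⟩ := Set.mem_iUnion₂.1 hxV
      exact ⟨⟨U, hU⟩, ⟨x, hxU⟩, hx, Subtype.ext e'⟩
    · rintro ⟨U, x, hx, rfl⟩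
      exact ⟨x.1, hx, rfl⟩
  rw [h2]
  have := hs.to_subtype
  have := t2Space_on hV
  refine isClosed_iUnion_of_finite fun U => ?_
  have := compactSpace_on U.1.2
  exact ((isClosed_iff.1 hA _ U.1.2).isCompact.image (continuous_on_map f _)).isClosed

theorem ext_of_abs {x y : Beth X} {U : X.Opens} (hU : IsAffineOpen U) (hx : x.pt ∈ U)
    (hy : y.pt ∈ U) (h : ∀ f, abs (U := U) ⟨x, hx⟩ f = abs (U := U) ⟨y, hy⟩ f) : x = y :=
  congrArg (fun z : On U => z.1) (abs_injective hU (funext h))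

theorem exists_affine (x : X) : ∃ U : X.Opens, IsAffineOpen U ∧ x ∈ U := by
  obtain ⟨_, ⟨V, hV, rfl⟩, hxV, -⟩ := X.isBasis_affineOpens.exists_subset_of_mem_open
    (Set.mem_univ x) isOpen_univ
  exact ⟨V, hV, hxV⟩

theorem map_id (x : Beth X) : map (𝟙 X) x = x := by
  obtain ⟨U, hU, hx⟩ := exists_affine x.pt
  refine ext_of_abs hU (x := map (𝟙 X) x) hx hx fun f => ?_
  refine (abs_map (𝟙 X) (U := U) (V := U) le_rfl ⟨x, hx⟩ f).trans ?_
  simp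
  rfl

theorem map_comp (f : X ⟶ Y) (g : Y ⟶ Z) (x : Beth X) : map (f ≫ g) x = map g (map f x) := by
  obtain ⟨U, hU, hx⟩ := exists_affine ((f ≫ g) x.pt)
  refine ext_of_abs hU (x := map (f ≫ g) x) (y := map g (map f x)) hx hx fun a => ?_
  refine (abs_map (f ≫ g) (U := (f ≫ g) ⁻¹ᵁ U) (V := U) le_rfl ⟨x, hx⟩ a).trans ?_
  refine Eq.trans ?_ (abs_map g (U := g ⁻¹ᵁ U) (V := U) le_rfl ⟨map f x, hx⟩ a).symm
  exact (abs_map f (U := f ⁻¹ᵁ g ⁻¹ᵁ U) (V := g ⁻¹ᵁ U) le_rfl ⟨x, hx⟩ _).symm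

end Beth

/-! ### Extension of valuations -/

section Valuations

/-- The value group of an algebraic extension is torsion over the value group of the base: in an
equation for `x` two of the nonzero terms have the same, largest value. -/
theorem exists_pow_val_eq {K L Γ : Type*} [Field K] [Field L] [Algebra K L]
    [LinearOrderedCommGroupWithZero Γ] (μ : Valuation L Γ) {x : L} (hx : IsAlgebraic K x)
    (hx0 : x ≠ 0) : ∃ (n : ℕ) (a : K), 0 < n ∧ a ≠ 0 ∧ μ x ^ n = μ (algebraMap K L a) := by
  obtain ⟨p, hp, hpx⟩ := hx
  have hne : p.support.Nonempty := Polynomial.support_nonempty.2 hp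
  let t : ℕ → L := fun i => algebraMap K L (p.coeff i) * x ^ i
  have ht : ∀ i ∈ p.support, t i ≠ 0 := fun i hi => mul_ne_zero
    (by simpa using Polynomial.mem_support_iff.1 hi) (pow_ne_zero _ hx0)
  obtain ⟨i, hi, him⟩ := p.support.exists_max_image (fun i => μ (t i)) hne
  have hsum : ∑ j ∈ p.support, t j = 0 := by
    rw [Polynomial.aeval_eq_sum_range, Finset.sum_congr rfl fun j _ => Algebra.smul_def _ _] at hpx
    rw [← hpx]
    refine Finset.sum_subset (fun j hj => ?_) fun j _ hj => ?_
    · exact Finset.mem_range_succ_iff.2 (Polynomial.le_natDegree_of_mem_supp _ hj)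
    · simp only [t, Polynomial.notMem_support_iff.1 hj, map_zero, zero_mul]
  obtain ⟨j, hj, hji, hjm⟩ : ∃ j ∈ p.support, j ≠ i ∧ μ (t j) = μ (t i) := by
    by_contra! hc
    have h1 : μ (∑ j ∈ p.support.erase i, t j) < μ (t i) :=
      μ.map_sum_lt (μ.ne_zero_iff.2 (ht i hi)) fun j hj =>
        lt_of_le_of_ne (him j (Finset.mem_of_mem_erase hj))
          (hc j (Finset.mem_of_mem_erase hj) (Finset.ne_of_mem_erase hj))
    rw [← Finset.add_sum_erase _ _ hi] at hsum
    rw [← neg_eq_of_add_eq_zero_right hsum, Valuation.map_neg] at h1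
    exact lt_irrefl _ h1
  have key : ∀ {i j : ℕ}, i ∈ p.support → j ∈ p.support → i < j → μ (t j) = μ (t i) →
      ∃ (n : ℕ) (a : K), 0 < n ∧ a ≠ 0 ∧ μ x ^ n = μ (algebraMap K L a) := by
    intro i j hi hj hij e
    have hi' := Polynomial.mem_support_iff.1 hi
    have hj' := Polynomial.mem_support_iff.1 hj
    refine ⟨j - i, p.coeff i / p.coeff j, Nat.sub_pos_of_lt hij, div_ne_zero hi' hj', ?_⟩
    simp only [t, map_mul, map_pow] at e
    have h1 : μ x ^ j = μ x ^ (j - i) * μ x ^ i := by rw [← pow_add, Nat.sub_add_cancel hij.le]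
    rw [h1, ← mul_assoc] at e
    have h2 := mul_right_cancel₀ (pow_ne_zero _ (μ.ne_zero_iff.2 hx0)) e
    rw [map_div₀, map_div₀, ← h2, mul_div_cancel_left₀]
    exact μ.ne_zero_iff.2 (by simpa using hj')
  rcases lt_or_gt_of_ne hji with h | h
  · exact key hj hi h hjm.symm
  · exact key hi hj h hjm

/-- A real valued valuation extends along an algebraic extension of fields to a valuation with a
given valuation ring: every value has a positive power that is the value of an element of the
small field. -/
theorem exists_extension_of_valuationSubring {K L : Type*} [Field K] [Field L] [Algebra K L]
    [Algebra.IsAlgebraic K L] (v : Valuation K ℝ≥0) (B : ValuationSubring L)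
    (hB : ∀ a : K, algebraMap K L a ∈ B ↔ v a ≤ 1) :
    ∃ w : Valuation L ℝ≥0, (∀ a, w (algebraMap K L a) = v a) ∧ ∀ x, w x ≤ 1 ↔ x ∈ B := by
  let μ := B.valuation
  have hle : ∀ a b : K, b ≠ 0 →
      (μ (algebraMap K L a) ≤ μ (algebraMap K L b) ↔ v a ≤ v b) := by
    intro a b hb
    have h1 : μ (algebraMap K L b) ≠ 0 := μ.ne_zero_iff.2 (by simpa using hb)
    rw [← div_le_one₀ (zero_lt_iff.2 h1), ← map_div₀, ← map_div₀]
    refine (B.valuation_le_one_iff _).trans ((hB _).trans ?_)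
    rw [map_div₀, div_le_one₀ (zero_lt_iff.2 (v.ne_zero_iff.2 hb))]
  have hex : ∀ x : L, x ≠ 0 → ∃ (n : ℕ) (a : K), 0 < n ∧ a ≠ 0 ∧ μ x ^ n = μ (algebraMap K L a) :=
    fun x hx => exists_pow_val_eq μ (Algebra.IsAlgebraic.isAlgebraic x) hx
  choose! n a hn ha hna using hex
  classical
  let w : L → ℝ≥0 := fun x => if x = 0 then 0 else v (a x) ^ ((n x : ℝ)⁻¹)
  have hw0 : w 0 = 0 := if_pos rfl
  have hwx : ∀ x, x ≠ 0 → w x ^ n x = v (a x) := by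
    intro x hx
    simp only [w, if_neg hx]
    rw [← NNReal.rpow_natCast, ← NNReal.rpow_mul, inv_mul_cancel₀ (by exact_mod_cast (hn x hx).ne'),
      NNReal.rpow_one]
  have hcmp : ∀ x, x ≠ 0 → ∀ (m : ℕ) (b : K), 0 < m → b ≠ 0 → μ x ^ m = μ (algebraMap K L b) →
      w x ^ m = v b := by
    intro x hx m b hm hb e
    refine pow_left_injective (hn x hx).ne' ?_
    change (w x ^ m) ^ n x = v b ^ n x
    rw [← pow_mul, mul_comm, pow_mul, hwx x hx, ← map_pow, ← map_pow]
    have h1 : μ (algebraMap K L (a x ^ m)) = μ (algebraMap K L (b ^ n x)) := by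
      rw [map_pow, map_pow, map_pow, map_pow, ← hna x hx, ← e, ← pow_mul, ← pow_mul, mul_comm]
    exact le_antisymm ((hle _ _ (pow_ne_zero _ hb)).1 h1.le)
      ((hle _ _ (pow_ne_zero _ (ha x hx))).1 h1.ge)
  have hwK : ∀ b, w (algebraMap K L b) = v b := by
    intro b
    by_cases hb : b = 0
    · rw [hb, map_zero, hw0, map_zero]
    · have := hcmp (algebraMap K L b) (by simpa using hb) 1 b one_pos hb (pow_one _)
      rwa [pow_one] at this
  have hw1 : w 1 = 1 := by rw [← map_one (algebraMap K L), hwK, map_one]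
  have hwmul : ∀ x y, w (x * y) = w x * w y := by
    intro x y
    by_cases hx : x = 0
    · rw [hx, zero_mul, hw0, zero_mul]
    by_cases hy : y = 0
    · rw [hy, mul_zero, hw0, mul_zero]
    refine pow_left_injective (mul_pos (hn x hx) (hn y hy)).ne' ?_
    change w (x * y) ^ (n x * n y) = (w x * w y) ^ (n x * n y)
    rw [hcmp (x * y) (mul_ne_zero hx hy) (n x * n y) (a x ^ n y * a y ^ n x)
      (mul_pos (hn x hx) (hn y hy)) (mul_ne_zero (pow_ne_zero _ (ha x hx)) (pow_ne_zero _ (ha y hy)))]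
    · rw [mul_pow, pow_mul, hwx x hx, mul_comm (n x), pow_mul, hwx y hy, map_mul, map_pow, map_pow]
    · rw [map_mul, mul_pow, pow_mul, hna x hx, mul_comm (n x), pow_mul, hna y hy]
      simp only [map_mul, map_pow]
  have hwle : ∀ x, w x ≤ 1 ↔ x ∈ B := by
    intro x
    by_cases hx : x = 0
    · rw [hx, hw0]
      exact iff_of_true zero_le_one B.zero_mem
    rw [← pow_le_one_iff (hn x hx).ne', hwx x hx, ← map_one v, ← hle _ _ one_ne_zero, ← hna x hx,
      map_one, map_one, pow_le_one_iff (hn x hx).ne']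
    exact B.valuation_le_one_iff x
  refine ⟨{ toFun := w, map_zero' := hw0, map_one' := hw1, map_mul' := hwmul,
            map_add_le_max' := ?_ }, hwK, hwle⟩
  have hadd : ∀ x y : L, y ≠ 0 → w x ≤ w y → w (x + y) ≤ w y := by
    intro x y hy h
    have hy' : w y ≠ 0 := by
      intro h0
      have := hwx y hy
      rw [h0, zero_pow (hn y hy).ne'] at this
      exact v.ne_zero_iff.2 (ha y hy) this.symm
    have h1 : w (x / y) ≤ 1 := by
      have : w (x / y) * w y = w x := by rw [← hwmul, div_mul_cancel₀ _ hy]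
      rw [← this] at h
      exact le_of_mul_le_mul_right (by rwa [one_mul]) (pos_iff_ne_zero.2 hy')
    have h2 : w (x / y + 1) ≤ 1 := (hwle _).2 (B.add_mem _ _ ((hwle _).1 h1) B.one_mem)
    have h3 : w (x + y) = w (x / y + 1) * w y := by
      rw [← hwmul, add_mul, div_mul_cancel₀ _ hy, one_mul]
    rw [h3]
    exact mul_le_of_le_one_left' h2
  intro x y
  change w (x + y) ≤ max (w x) (w y)
  by_cases hx : x = 0
  · rw [hx, zero_add]; exact le_max_right _ _
  by_cases hy : y = 0
  · rw [hy, add_zero]; exact le_max_left _ _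
  rcases le_total (w x) (w y) with h | h
  · exact (hadd x y hy h).trans (le_max_right _ _)
  · rw [add_comm]
    exact (hadd y x hx h).trans (le_max_left _ _)

/-- A prime ideal `n` of a flat algebraic algebra `D` over the valuation ring of a real valued
valuation is the center of an extension of the valuation to `D` if it lies over the maximal
ideal: by going down `n` contains a prime ideal `q` over `0`, and the image of the localization at `n`
in the fraction field of `D / q` is dominated by a valuation ring. -/
theorem exists_valuation_of_flat {K : Type*} [Field K] (v : Valuation K ℝ≥0) {D : Type*} [CommRing D]
    [Algebra v.valuationSubring D] [Module.Flat v.valuationSubring D]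
    [Algebra.IsAlgebraic v.valuationSubring D] (n : Ideal D) [n.IsPrime]
    (hn : ∀ a : v.valuationSubring, algebraMap _ D a ∈ n ↔ v a < 1) :
    ∃ w : Valuation D ℝ≥0, (∀ a : v.valuationSubring, w (algebraMap _ D a) = v a) ∧
      (∀ d, w d ≤ 1) ∧ ∀ d, w d < 1 ↔ d ∈ n := by
  let V := v.valuationSubring
  let m : Ideal V := n.comap (algebraMap V D)
  have : n.LiesOver m := ⟨rfl⟩
  obtain ⟨q, hqn, hq, hqV⟩ := n.exists_ideal_le_liesOver_of_le (p := (⊥ : Ideal V)) (q := m) bot_le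
  let L := FractionRing (D ⧸ q)
  let g : D →+* L := (algebraMap (D ⧸ q) L).comp (Ideal.Quotient.mk q)
  have hg : ∀ d, g d = 0 ↔ d ∈ q := fun d =>
    (FaithfulSMul.algebraMap_eq_zero_iff (D ⧸ q) L).trans Ideal.Quotient.eq_zero_iff_mem
  let gV : V →+* L := g.comp (algebraMap V D)
  have hgV : Function.Injective gV := by
    rw [injective_iff_map_eq_zero]
    intro a ha
    have h1 : a ∈ q.comap (algebraMap V D) := (hg _).1 ha
    have h2 : q.comap (algebraMap V D) = ⊥ := hqV.over.symm
    rwa [h2] at h1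
  let : Algebra K L := (IsFractionRing.lift hgV : K →+* L).toAlgebra
  have hKL : ∀ a : V, algebraMap K L a = g (algebraMap V D a) := fun a =>
    IsFractionRing.lift_algebraMap hgV a
  have hint : ∀ d, IsAlgebraic K (g d) := by
    intro d
    obtain ⟨p, hp, hpd⟩ := Algebra.IsAlgebraic.isAlgebraic (R := V) d
    refine ⟨p.map (algebraMap V K), ?_, ?_⟩
    · rwa [Ne, Polynomial.map_eq_zero_iff (IsFractionRing.injective V K)]
    · rw [Polynomial.aeval_def, Polynomial.eval₂_map]
      have e : (algebraMap K L).comp (algebraMap V K) = g.comp (algebraMap V D) :=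
        RingHom.ext hKL
      rw [e, ← Polynomial.hom_eval₂, ← Polynomial.aeval_def, hpd, map_zero]
  have : Algebra.IsAlgebraic K L := ⟨fun x => by
    obtain ⟨a, b, hb, rfl⟩ := IsFractionRing.div_surjective (A := D ⧸ q) x
    obtain ⟨a, rfl⟩ := Ideal.Quotient.mk_surjective a
    obtain ⟨b, rfl⟩ := Ideal.Quotient.mk_surjective b
    rw [div_eq_mul_inv]
    exact (hint a).mul (hint b).inv⟩
  have hunit : ∀ y : n.primeCompl, IsUnit (g y) := fun y =>
    isUnit_iff_ne_zero.2 fun h => y.2 (hqn ((hg _).1 h))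
  obtain ⟨B, hB, hloc⟩ := IsLocalRing.exists_factor_valuationRing
    (IsLocalization.lift hunit : Localization.AtPrime n →+* L)
  have hlift : ∀ d, (IsLocalization.lift hunit : Localization.AtPrime n →+* L)
      (algebraMap D _ d) = g d := IsLocalization.lift_eq hunit
  have hgB : ∀ d, g d ∈ B := fun d => by
    rw [← hlift]
    exact hB _
  have hgu : ∀ d, d ∉ n ↔ g d ≠ 0 ∧ (g d)⁻¹ ∈ B := by
    intro d
    constructor
    · intro hd
      have h1 : IsUnit (algebraMap D (Localization.AtPrime n) d) :=
        IsLocalization.map_units _ (⟨d, hd⟩ : n.primeCompl)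
      refine ⟨(hunit ⟨d, hd⟩).ne_zero, ?_⟩
      have h2 := hB ((h1.unit⁻¹ : (Localization.AtPrime n)ˣ) : Localization.AtPrime n)
      rw [map_units_inv] at h2
      change (_)⁻¹ ∈ B.toSubring at h2
      rw [IsUnit.unit_spec, hlift] at h2
      exact h2
    · rintro ⟨h0, h1⟩ hd
      have h2 : IsUnit ((IsLocalization.lift hunit : Localization.AtPrime n →+* L).codRestrict
          B.toSubring hB (algebraMap D _ d)) := by
        refine IsUnit.of_mul_eq_one (⟨(g d)⁻¹, h1⟩ : B.toSubring) (Subtype.ext ?_)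
        change _ * (g d)⁻¹ = (1 : L)
        change (IsLocalization.lift hunit : Localization.AtPrime n →+* L) (algebraMap D _ d) *
          (g d)⁻¹ = 1
        rw [hlift, mul_inv_cancel₀ h0]
      have h3 := isUnit_of_map_unit _ _ h2
      exact ((IsLocalization.AtPrime.isUnit_to_map_iff (Localization.AtPrime n) n d).1 h3) hd
  obtain ⟨w, hwK, hwB⟩ := exists_extension_of_valuationSubring v B fun a => by
    constructor
    · intro h
      by_contra! hc
      have ha0 : a ≠ 0 := by
        rintro rfl
        simp at hc
      have h1 : v a⁻¹ < 1 := by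
        rw [map_inv₀]
        exact inv_lt_one_of_one_lt₀ hc
      let b : V := ⟨a⁻¹, h1.le⟩
      have h2 : algebraMap V D b ∈ n := (hn b).2 h1
      refine ((hgu (algebraMap V D b)).2 ⟨?_, ?_⟩) h2
      · rw [← hKL, Ne, FaithfulSMul.algebraMap_eq_zero_iff]
        exact inv_ne_zero ha0
      · rw [← hKL, ← map_inv₀]
        change algebraMap K L (a⁻¹)⁻¹ ∈ B
        rwa [inv_inv]
    · intro h
      rw [show a = ((⟨a, h⟩ : V) : K) from rfl, hKL]
      exact hgB _
  refine ⟨w.comap g, fun a => ?_, fun d => (hwB _).2 (hgB d), fun d => ?_⟩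
  · rw [Valuation.comap_apply, ← hKL, hwK]
  · rw [← not_iff_not, hgu, Valuation.comap_apply, not_lt, ← hwB]
    by_cases h0 : g d = 0
    · simp [h0]
    · rw [map_inv₀, inv_le_one₀ (zero_lt_iff.2 (w.ne_zero_iff.2 h0)), and_iff_right h0]

/-- A valuation on a ring comes from the fraction field of the quotient by its support. -/
theorem exists_field_of_valuation {A : Type u} [CommRing A] (v : Valuation A ℝ≥0) :
    ∃ (K : Type u) (_ : Field K) (φ : A →+* K) (w : Valuation K ℝ≥0), (∀ a, w (φ a) = v a) ∧
      (∀ x, ∃ a b, φ b ≠ 0 ∧ x = φ a / φ b) ∧ ∀ (L : Type u) [Field L] (ψ : A →+* L),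
        (∀ a, ψ a = 0 ↔ v a = 0) → ∃ χ : K →+* L, χ.comp φ = ψ := by
  let Q := A ⧸ v.supp
  have hS : nonZeroDivisors Q ≤ (v.onQuot le_rfl : Valuation Q ℝ≥0).supp.primeCompl := by
    intro x hx h0
    obtain ⟨a, rfl⟩ := Ideal.Quotient.mk_surjective x
    have h1 : v a = 0 := h0
    refine nonZeroDivisors.ne_zero hx (Ideal.Quotient.eq_zero_iff_mem.2 h1)
  refine ⟨FractionRing Q, inferInstance, (algebraMap Q _).comp (Ideal.Quotient.mk _),
    (v.onQuot le_rfl).extendToLocalization hS _, fun a => ?_, fun x => ?_, fun L _ ψ hψ => ?_⟩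
  · exact Valuation.extendToLocalization_apply_map_apply _ hS _ _
  · obtain ⟨a, b, hb, rfl⟩ := IsFractionRing.div_surjective (A := Q) x
    obtain ⟨a, rfl⟩ := Ideal.Quotient.mk_surjective a
    obtain ⟨b, rfl⟩ := Ideal.Quotient.mk_surjective b
    exact ⟨a, b, IsFractionRing.to_map_ne_zero_of_mem_nonZeroDivisors (R := Q) hb, rfl⟩
  · have h1 : Function.Injective (Ideal.Quotient.lift v.supp ψ fun a ha => (hψ a).2 ha) := by
      rw [injective_iff_map_eq_zero]
      intro x hx
      obtain ⟨a, rfl⟩ := Ideal.Quotient.mk_surjective x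
      rw [Ideal.Quotient.lift_mk] at hx
      exact Ideal.Quotient.eq_zero_iff_mem.2 ((hψ a).1 hx)
    refine ⟨IsFractionRing.lift h1, RingHom.ext fun a => ?_⟩
    exact (IsFractionRing.lift_algebraMap h1 _).trans (Ideal.Quotient.lift_mk _ _ _)

open TensorProduct in
/-- Prime ideals of two algebras over the same prime ideal come from a prime ideal of the tensor
product. -/
theorem exists_prime_tensorProduct {A B C : Type u} [CommRing A] [CommRing B] [CommRing C]
    [Algebra A B] [Algebra A C] (p : Ideal B) (q : Ideal C) [p.IsPrime] [q.IsPrime]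
    (h : ∀ a, algebraMap A B a ∈ p ↔ algebraMap A C a ∈ q) :
    ∃ n : Ideal (B ⊗[A] C), n.IsPrime ∧ (∀ b, b ⊗ₜ[A] (1 : C) ∈ n ↔ b ∈ p) ∧
      ∀ c, (1 : B) ⊗ₜ[A] c ∈ n ↔ c ∈ q := by
  obtain ⟨z, hz, hz'⟩ := Scheme.Pullback.exists_preimage_pullback
    (f := Spec.map (CommRingCat.ofHom (algebraMap A B)))
    (g := Spec.map (CommRingCat.ofHom (algebraMap A C)))
    (⟨p, inferInstance⟩ : PrimeSpectrum B) (⟨q, inferInstance⟩ : PrimeSpectrum C)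
    (PrimeSpectrum.ext (Ideal.ext h))
  let n : PrimeSpectrum (B ⊗[A] C) := (pullbackSpecIso A B C).hom z
  have h1 : (Spec.map (CommRingCat.ofHom
      (Algebra.TensorProduct.includeLeftRingHom : B →+* B ⊗[A] C))) n =
      (⟨p, inferInstance⟩ : PrimeSpectrum B) := by
    rw [← hz, ← pullbackSpecIso_hom_fst]
    rfl
  have h2 : (Spec.map (CommRingCat.ofHom
      (AlgHom.toRingHom (Algebra.TensorProduct.includeRight : C →ₐ[A] B ⊗[A] C)))) n =
      (⟨q, inferInstance⟩ : PrimeSpectrum C) := by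
    rw [← hz', ← pullbackSpecIso_hom_snd]
    rfl
  exact ⟨n.asIdeal, n.2, fun b => Ideal.ext_iff.1 (congrArg PrimeSpectrum.asIdeal h1) b,
    fun c => Ideal.ext_iff.1 (congrArg PrimeSpectrum.asIdeal h2) c⟩

open TensorProduct in
/-- The image of an étale `A`-algebra in a `K`-algebra `L` is algebraic over the field `K`, as the
étale `K`-algebra `K ⊗ B` is finite. -/
theorem isAlgebraic_map_of_etale {A B K L : Type u} [CommRing A] [CommRing B] [Algebra A B]
    [Algebra.Etale A B] [Field K] [Algebra A K] [CommRing L] [Nontrivial L] [Algebra K L]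
    [Algebra A L] [IsScalarTower A K L] (ψ : B →ₐ[A] L) (b : B) : IsAlgebraic K (ψ b) := by
  have h1 : Algebra.Etale K (K ⊗[A] B) := inferInstance
  have h2 : Module.Finite K (K ⊗[A] B) := Algebra.FormallyUnramified.finite_of_free _ _
  have h3 : IsIntegral K ((1 : K) ⊗ₜ[A] b) := Algebra.IsIntegral.isIntegral _
  have h4 := h3.map (Algebra.TensorProduct.lift (Algebra.ofId K L) ψ fun _ _ => mul_comm _ _)
  have h5 : Algebra.TensorProduct.lift (Algebra.ofId K L) ψ (fun _ _ => mul_comm _ _)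
      ((1 : K) ⊗ₜ[A] b) = ψ b := by
    refine (Algebra.TensorProduct.lift_tmul _ _ _ _ _).trans ?_
    rw [map_one, one_mul]
  rw [← h5]
  exact h4.isAlgebraic

/-- A valuation `v ≤ 1` extends along an étale homomorphism with prescribed center. -/
theorem exists_valuation_of_etale {A B : Type u} [CommRing A] [CommRing B] [Algebra A B]
    [Algebra.Etale A B] (v : Valuation A ℝ≥0) (hv : ∀ a, v a ≤ 1) (p : Ideal B) [p.IsPrime]
    (hp : ∀ a, algebraMap A B a ∈ p ↔ v a < 1) :
    ∃ w : Valuation B ℝ≥0, (∀ a, w (algebraMap A B a) = v a) ∧ (∀ b, w b ≤ 1) ∧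
      ∀ b, w b < 1 ↔ b ∈ p := by
  obtain ⟨K, _, φ, u, hu, -, -⟩ := exists_field_of_valuation v
  let V := u.valuationSubring
  -- replace `A` by the valuation ring of the residue field of `v`
  let φV : A →+* V := φ.codRestrict V.toSubring fun a => (hu a).trans_le (hv a)
  let : Algebra A V := φV.toAlgebra
  let D := TensorProduct A V B
  obtain ⟨n, hn, hnV, hnB⟩ := exists_prime_tensorProduct (IsLocalRing.maximalIdeal V) p fun a => by
    rw [hp, ← hu]
    exact Valuation.mem_maximalIdeal_iff _ _
  have : Algebra.IsAlgebraic V D := ⟨fun d => by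
    have h1 := Algebra.TensorProduct.includeRight_injective (A := K) (B := D)
      (IsFractionRing.injective V K)
    have : Nontrivial D := ⟨⟨0, 1, fun h => hn.ne_top
      ((Ideal.eq_top_iff_one _).2 (h ▸ n.zero_mem))⟩⟩
    have : Nontrivial (TensorProduct V K D) := h1.nontrivial
    have h3 : IsAlgebraic K (Algebra.TensorProduct.includeRight d : TensorProduct V K D) :=
      isAlgebraic_map_of_etale (A := V) _ d
    have h4 : IsAlgebraic V (Algebra.TensorProduct.includeRight d : TensorProduct V K D) :=
      (IsFractionRing.isAlgebraic_iff V K _).2 h3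
    exact (isAlgebraic_algHom_iff _ h1).1 h4⟩
  obtain ⟨w, hw, hw1, hwn⟩ := exists_valuation_of_flat u n fun a => (hnV a).trans (Valuation.mem_maximalIdeal_iff _ _)
  refine ⟨w.comap Algebra.TensorProduct.includeRight.toRingHom, fun a => ?_, fun b => hw1 _,
    fun b => (hwn _).trans (hnB b)⟩
  have h1 := hw (algebraMap A V a)
  rw [← IsScalarTower.algebraMap_apply A V D] at h1
  refine Eq.trans ?_ (h1.trans (hu a))
  exact congrArg w ((Algebra.TensorProduct.includeRight : B →ₐ[A] D).commutes a)

/-- The homomorphism of valuation rings given by an extension of valued fields. -/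
def valuationSubringMap {K L : Type*} [Field K] [Field L] [Algebra K L] {v : Valuation K ℝ≥0}
    {w : Valuation L ℝ≥0} (h : ∀ a, w (algebraMap K L a) = v a) :
    v.valuationSubring →+* w.valuationSubring :=
  ((algebraMap K L).comp v.valuationSubring.subtype).codRestrict w.valuationSubring.toSubring
    fun a => (h a).trans_le a.2

/-- A valuation on `D` that is `≤ 1` and restricts to `v` on the valuation ring of `v` restricts to `w`
on the valuation ring of every algebraic extension `w` of `v`. -/
theorem eq_of_isAlgebraic_extension {K L D : Type*} [Field K] [Field L] [Algebra K L]
    [Algebra.IsAlgebraic K L] [CommRing D] {v : Valuation K ℝ≥0} {w : Valuation L ℝ≥0}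
    (h : ∀ a, w (algebraMap K L a) = v a) (i : w.valuationSubring →+* D) (s : Valuation D ℝ≥0)
    (hs : ∀ d, s d ≤ 1) (hsv : ∀ a, s (i (valuationSubringMap h a)) = v a)
    (x : w.valuationSubring) : s (i x) = w x := by
  by_cases hx : x = 0
  · simp [hx]
  have hx' : (x : L) ≠ 0 := fun e => hx (Subtype.ext e)
  obtain ⟨n, a, hn, ha, e⟩ := exists_pow_val_eq w (Algebra.IsAlgebraic.isAlgebraic (R := K) (x : L)) hx'
  rw [h] at e
  have hva : v a ≤ 1 := by
    rw [← e]
    exact pow_le_one' x.2 n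
  let b : v.valuationSubring := ⟨a, hva⟩
  have hb0 : algebraMap K L a ≠ 0 := by simpa using ha
  have hy : w (x ^ n / algebraMap K L a) = 1 := by
    rw [map_div₀, map_pow, e, h, div_self (v.ne_zero_iff.2 ha)]
  let y : w.valuationSubring := ⟨_, hy.le⟩
  let y' : w.valuationSubring := ⟨(x ^ n / algebraMap K L a)⁻¹, by
    change w _ ≤ 1
    rw [map_inv₀, hy, inv_one]⟩
  have hyy : y * y' = 1 := Subtype.ext (mul_inv_cancel₀ (w.ne_zero_iff.1 (by rw [hy]; exact one_ne_zero)))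
  have hsy : s (i y) = 1 := by
    refine le_antisymm (hs _) ?_
    have h1 : s (i y) * s (i y') = 1 := by rw [← map_mul, ← map_mul, hyy, map_one, map_one]
    rw [← h1]
    exact mul_le_of_le_one_right' (hs _)
  have hxy : x ^ n = y * valuationSubringMap h b := Subtype.ext (div_mul_cancel₀ _ hb0).symm
  refine pow_left_injective hn.ne' ?_
  change s (i x) ^ n = w x ^ n
  rw [← map_pow, ← map_pow, hxy, map_mul, map_mul, hsy, one_mul, hsv, e]

/-- An algebraic extension of valuation rings is flat and algebraic. Flatness is torsion-freeness
over a valuation ring. -/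
theorem flat_and_isAlgebraic_valuationSubring {K L : Type*} [Field K] [Field L] [Algebra K L]
    [Algebra.IsAlgebraic K L] {v : Valuation K ℝ≥0} {w : Valuation L ℝ≥0}
    (h : ∀ a, w (algebraMap K L a) = v a) :
    letI := (valuationSubringMap h).toAlgebra
    Module.Flat v.valuationSubring w.valuationSubring ∧
      Algebra.IsAlgebraic v.valuationSubring w.valuationSubring := by
  let := (valuationSubringMap h).toAlgebra
  constructor
  · rw [Module.Flat.flat_iff_torsion_eq_bot_of_isBezout, ← Submodule.isTorsionFree_iff_torsion_eq_bot]
    have : FaithfulSMul v.valuationSubring w.valuationSubring := by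
      rw [faithfulSMul_iff_algebraMap_injective]
      intro a b e
      exact Subtype.ext ((algebraMap K L).injective (congrArg Subtype.val e))
    infer_instance
  · refine ⟨fun x => ?_⟩
    have h1 : IsAlgebraic K (x : L) := Algebra.IsAlgebraic.isAlgebraic _
    have h2 : IsAlgebraic v.valuationSubring (x : L) := (IsFractionRing.isAlgebraic_iff _ K _).2 h1
    let f : w.valuationSubring →ₐ[v.valuationSubring] L :=
      { w.valuationSubring.subtype with commutes' := fun a => rfl }
    exact (isAlgebraic_algHom_iff f Subtype.val_injective).1 h2

open TensorProduct in
theorem isAlgebraic_tensorProduct {R B C : Type*} [CommRing R] [IsDomain R] [CommRing B] [CommRing C]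
    [Algebra R B] [Algebra R C] [Algebra.IsAlgebraic R B] [Algebra.IsAlgebraic R C] :
    Algebra.IsAlgebraic R (B ⊗[R] C) := by
  refine ⟨fun d => ?_⟩
  induction d using TensorProduct.induction_on with
  | zero => exact isAlgebraic_zero
  | add x y hx hy => exact hx.add hy
  | tmul x y =>
    have h1 : IsAlgebraic R (Algebra.TensorProduct.includeLeft x : B ⊗[R] C) :=
      (Algebra.IsAlgebraic.isAlgebraic (R := R) x).algHom
        (Algebra.TensorProduct.includeLeft : B →ₐ[R] B ⊗[R] C)
    have h2 : IsAlgebraic R (Algebra.TensorProduct.includeRight y : B ⊗[R] C) :=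
      (Algebra.IsAlgebraic.isAlgebraic (R := R) y).algHom
        (Algebra.TensorProduct.includeRight : C →ₐ[R] B ⊗[R] C)
    have h3 := h1.mul h2
    rwa [Algebra.TensorProduct.includeLeft_apply, Algebra.TensorProduct.includeRight_apply,
      Algebra.TensorProduct.tmul_mul_tmul, one_mul, mul_one] at h3

open TensorProduct in
/-- Two algebraic extensions `w` and `t` of a valuation `v` are dominated by a common one: apply
`exists_valuation_of_flat` to the tensor product of their valuation rings over that of `v`. The
valuation that is obtained restricts to `w` and `t`, because it restricts to `v`. -/
theorem exists_valuation_tensorProduct_field {K L M : Type u} [Field K] [Field L] [Field M]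
    [Algebra K L] [Algebra K M] [Algebra.IsAlgebraic K L] [Algebra.IsAlgebraic K M]
    {v : Valuation K ℝ≥0} {w : Valuation L ℝ≥0} {t : Valuation M ℝ≥0}
    (hw : ∀ a, w (algebraMap K L a) = v a) (ht : ∀ a, t (algebraMap K M a) = v a) :
    ∃ (D : Type u) (_ : CommRing D) (i : w.valuationSubring →+* D) (j : t.valuationSubring →+* D)
      (s : Valuation D ℝ≥0), i.comp (valuationSubringMap hw) = j.comp (valuationSubringMap ht) ∧
        (∀ d, s d ≤ 1) ∧ (∀ x, s (i x) = w x) ∧ ∀ y, s (j y) = t y := by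
  let R := v.valuationSubring
  let : Algebra R w.valuationSubring := (valuationSubringMap hw).toAlgebra
  let : Algebra R t.valuationSubring := (valuationSubringMap ht).toAlgebra
  obtain ⟨_, _⟩ := flat_and_isAlgebraic_valuationSubring hw
  obtain ⟨_, _⟩ := flat_and_isAlgebraic_valuationSubring ht
  let D := w.valuationSubring ⊗[R] t.valuationSubring
  have : Module.Flat R D := inferInstance
  have : Algebra.IsAlgebraic R D := isAlgebraic_tensorProduct
  have hmw : ∀ a : R, algebraMap R w.valuationSubring a ∈ IsLocalRing.maximalIdeal _ ↔ v a < 1 :=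
    fun a => (Valuation.mem_maximalIdeal_iff _ w).trans (by rw [← hw]; rfl)
  have hmt : ∀ a : R, algebraMap R t.valuationSubring a ∈ IsLocalRing.maximalIdeal _ ↔ v a < 1 :=
    fun a => (Valuation.mem_maximalIdeal_iff _ t).trans (by rw [← ht]; rfl)
  obtain ⟨n, hn, hnw, -⟩ := exists_prime_tensorProduct
    (IsLocalRing.maximalIdeal w.valuationSubring) (IsLocalRing.maximalIdeal t.valuationSubring)
    fun a => (hmw a).trans (hmt a).symm
  obtain ⟨s, hs, hs1, -⟩ := exists_valuation_of_flat v (D := D) n fun a =>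
    (hnw (algebraMap R _ a)).trans (hmw a)
  have e : (Algebra.TensorProduct.includeLeftRingHom : w.valuationSubring →+* D).comp
      (valuationSubringMap hw) = (AlgHom.toRingHom (Algebra.TensorProduct.includeRight :
        t.valuationSubring →ₐ[R] D)).comp (valuationSubringMap ht) :=
    RingHom.ext fun a => ((Algebra.TensorProduct.includeRight :
        t.valuationSubring →ₐ[R] D).commutes a).symm
  refine ⟨D, inferInstance, Algebra.TensorProduct.includeLeftRingHom,
    AlgHom.toRingHom Algebra.TensorProduct.includeRight, s, e, hs1, ?_, ?_⟩
  · exact eq_of_isAlgebraic_extension hw _ s hs1 hs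
  · refine eq_of_isAlgebraic_extension ht _ s hs1 fun a => ?_
    rw [← hs]
    exact congrArg s (RingHom.congr_fun e a).symm

open TensorProduct in
/-- Valuations `≤ 1` on two étale `A`-algebras that agree on `A` come from a valuation on the tensor
product. -/
theorem exists_valuation_tensorProduct {A B C : Type u} [CommRing A] [CommRing B] [CommRing C]
    [Algebra A B] [Algebra A C] [Algebra.Etale A B] [Algebra.Etale A C] (v : Valuation B ℝ≥0)
    (hv : ∀ b, v b ≤ 1) (w : Valuation C ℝ≥0) (hw : ∀ c, w c ≤ 1)
    (h : ∀ a, v (algebraMap A B a) = w (algebraMap A C a)) :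
    ∃ s : Valuation (B ⊗[A] C) ℝ≥0, (∀ d, s d ≤ 1) ∧ (∀ b, s (b ⊗ₜ 1) = v b) ∧
      ∀ c, s (1 ⊗ₜ c) = w c := by
  obtain ⟨K, _, φ, u, hu, hKs, hK⟩ := exists_field_of_valuation (v.comap (algebraMap A B))
  -- the valuations on `B` and `C` factor through algebraic extensions of the residue field of the
  -- valuation on `A`
  have key : ∀ {B : Type u} [CommRing B] [Algebra A B] [Algebra.Etale A B] (v : Valuation B ℝ≥0),
      (∀ a, v (algebraMap A B a) = u (φ a)) → ∃ (L : Type u) (_ : Field L) (_ : Algebra K L)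
        (ψ : B →+* L) (t : Valuation L ℝ≥0), Algebra.IsAlgebraic K L ∧
          (∀ a, t (algebraMap K L a) = u a) ∧ (∀ b, t (ψ b) = v b) ∧
            ∀ a, ψ (algebraMap A B a) = algebraMap K L (φ a) := by
    intro B _ _ _ v hv
    obtain ⟨L, _, ψ, t, ht, hLs, -⟩ := exists_field_of_valuation v
    obtain ⟨χ, hχ⟩ := hK L (ψ.comp (algebraMap A B)) fun a => by
      rw [← t.zero_iff, RingHom.comp_apply, ht, hv, hu]
    have hχ' : ∀ a, χ (φ a) = ψ (algebraMap A B a) := fun a => RingHom.congr_fun hχ a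
    let : Algebra K L := χ.toAlgebra
    refine ⟨L, inferInstance, inferInstance, ψ, t, ?_, fun a => ?_, ht, fun a => (hχ' a).symm⟩
    · let : Algebra A K := φ.toAlgebra
      let : Algebra A L := (ψ.comp (algebraMap A B)).toAlgebra
      have : IsScalarTower A K L := IsScalarTower.of_algebraMap_eq fun a => (hχ' a).symm
      have h1 : ∀ b, IsAlgebraic K (ψ b) :=
        isAlgebraic_map_of_etale (A := A) ({ ψ with commutes' := fun a => rfl } : B →ₐ[A] L)
      refine ⟨fun x => ?_⟩
      obtain ⟨a, b, -, rfl⟩ := hLs x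
      rw [div_eq_mul_inv]
      exact (h1 a).mul (h1 b).inv
    · obtain ⟨a, b, -, rfl⟩ := hKs a
      change t (χ _) = _
      rw [map_div₀, map_div₀, map_div₀, hχ', hχ', ht, ht, hv, hv]
  obtain ⟨L, _, _, ψ, t, _, ht, hψ, hψA⟩ := key v fun a => (hu a).symm
  obtain ⟨M, _, _, χ, r, _, hr, hχ, hχA⟩ := key w fun a => (h a).symm.trans (hu a).symm
  obtain ⟨D, _, i, j, s, hij, hs1, hsi, hsj⟩ := exists_valuation_tensorProduct_field ht hr
  let ψ' : B →+* t.valuationSubring :=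
    ψ.codRestrict t.valuationSubring.toSubring fun b => (hψ b).trans_le (hv b)
  let χ' : C →+* r.valuationSubring :=
    χ.codRestrict r.valuationSubring.toSubring fun c => (hχ c).trans_le (hw c)
  let : Algebra A D := (i.comp (ψ'.comp (algebraMap A B))).toAlgebra
  let f : B →ₐ[A] D := { i.comp ψ' with commutes' := fun a => rfl }
  have hg (a : A) : j (χ' (algebraMap A C a)) = i (ψ' (algebraMap A B a)) := by
    let b : u.valuationSubring := ⟨φ a, (hu a).trans_le (hv _)⟩
    have h1 : ψ' (algebraMap A B a) = valuationSubringMap ht b := Subtype.ext (hψA a)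
    have h2 : χ' (algebraMap A C a) = valuationSubringMap hr b := Subtype.ext (hχA a)
    rw [h1, h2]
    exact (RingHom.congr_fun hij b).symm
  let g : C →ₐ[A] D := { j.comp χ' with commutes' := hg }
  let F := Algebra.TensorProduct.lift f g fun _ _ => mul_comm _ _
  refine ⟨s.comap F.toRingHom, fun d => hs1 _, fun b => ?_, fun c => ?_⟩
  · change s (F (b ⊗ₜ 1)) = _
    have h1 : F (b ⊗ₜ 1) = i (ψ' b) :=
      (Algebra.TensorProduct.lift_tmul f g _ b 1).trans (by rw [map_one, mul_one]; rfl)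
    rw [h1]
    exact (hsi _).trans (hψ b)
  · change s (F (1 ⊗ₜ c)) = _
    have h1 : F (1 ⊗ₜ c) = j (χ' c) :=
      (Algebra.TensorProduct.lift_tmul f g _ 1 c).trans (by rw [map_one, one_mul]; rfl)
    rw [h1]
    exact (hsj _).trans (hχ c)

end Valuations

/-! ### Lifting points of the analytic space along étale morphisms -/

namespace Beth

variable {X Y Z : Scheme.{u}}

/-- The restriction of the seminorm of a point to the functions on an open subset. -/
def valOn {U : X.Opens} (x : On U) : Valuation Γ(X, U) ℝ≥0 :=
  x.1.val.comap (X.presheaf.germ U x.1.pt x.2).hom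

theorem exists_affine_le (f : Y ⟶ X) {U : X.Opens} {y : Y} (hy : f y ∈ U) :
    ∃ W : Y.Opens, IsAffineOpen W ∧ y ∈ W ∧ W ≤ f ⁻¹ᵁ U := by
  obtain ⟨_, ⟨W, hW, rfl⟩, hyW, hWU⟩ := Y.isBasis_affineOpens.exists_subset_of_mem_open
    (show y ∈ f ⁻¹ᵁ U from hy) (f ⁻¹ᵁ U).2
  exact ⟨W, hW, hyW, hWU⟩

theorem abs_appLE (f : Y ⟶ X) {U : X.Opens} {W : Y.Opens} (h : W ≤ f ⁻¹ᵁ U) (y : On W)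
    (a : Γ(X, U)) : abs (y.map f h) a = abs y (f.appLE U W h a) := by
  rw [abs_map, abs_ofLE]
  rfl

theorem etale_appLE (f : Y ⟶ X) [Etale f] {U : X.Opens} (hU : IsAffineOpen U) {W : Y.Opens}
    (hW : IsAffineOpen W) (h : W ≤ f ⁻¹ᵁ U) :
    letI := (f.appLE U W h).hom.toAlgebra
    Algebra.Etale Γ(X, U) Γ(Y, W) :=
  letI := (f.appLE U W h).hom.toAlgebra
  RingHom.etale_algebraMap.1 (f.etale_appLE hU hW h)

theorem mem_primeIdealOf_iff {U : X.Opens} (hU : IsAffineOpen U) {x : X} (hx : x ∈ U) (f : Γ(X, U)) :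
    f ∈ (hU.primeIdealOf ⟨x, hx⟩).asIdeal ↔ x ∉ X.basicOpen f := by
  rw [hU.primeIdealOf_eq_map_closedPoint, X.mem_basicOpen _ _ hx]
  exact Iff.rfl

theorem eq_of_mem_basicOpen_iff {U : X.Opens} (hU : IsAffineOpen U) {x y : X} (hx : x ∈ U)
    (hy : y ∈ U) (h : ∀ f : Γ(X, U), x ∈ X.basicOpen f ↔ y ∈ X.basicOpen f) : x = y := by
  have h1 : hU.primeIdealOf ⟨x, hx⟩ = hU.primeIdealOf ⟨y, hy⟩ :=
    PrimeSpectrum.ext (Ideal.ext fun f => by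
      rw [mem_primeIdealOf_iff hU hx, mem_primeIdealOf_iff hU hy, h])
  have h2 := congrArg hU.fromSpec h1
  rwa [hU.fromSpec_primeIdealOf, hU.fromSpec_primeIdealOf] at h2

theorem abs_lt_one_iff {U : X.Opens} (x : On U) (f : Γ(X, U)) :
    abs x f < 1 ↔ x.1.pt ∉ X.basicOpen f := by
  rw [← abs_eq_one_iff, lt_iff_le_and_ne, and_iff_right (abs_le_one x f)]

theorem mem_basicOpen_appLE (f : Y ⟶ X) {U : X.Opens} {W : Y.Opens} (h : W ≤ f ⁻¹ᵁ U) {y : Y}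
    (hy : y ∈ W) (a : Γ(X, U)) : y ∈ Y.basicOpen (f.appLE U W h a) ↔ f y ∈ X.basicOpen a := by
  rw [Scheme.Hom.appLE, CommRingCat.comp_apply, Scheme.basicOpen_res, ← Scheme.preimage_basicOpen]
  exact and_iff_right hy

/-- A valuation `≤ 1` on `R` is a point of the analytic space of `Spec R`. -/
theorem exists_beth_spec {R : CommRingCat.{u}} (v : Valuation R ℝ≥0) (hv : ∀ r, v r ≤ 1) :
    ∃ x : Beth (Spec R), ∀ {Y : Scheme.{u}} {V : Y.Opens} (hV : IsAffineOpen V) (φ : Γ(Y, V) ⟶ R),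
      ∃ h : (map (Spec.map φ ≫ hV.fromSpec) x).pt ∈ V, ∀ f,
        abs (U := V) ⟨map (Spec.map φ ≫ hV.fromSpec) x, h⟩ f = v (φ f) := by
  obtain ⟨⟨x, hx'⟩, hx⟩ := exists_abs_eq (isAffineOpen_top (Spec R))
    (v.comap (Scheme.ΓSpecIso R).hom.hom) fun _ => hv _
  refine ⟨x, fun {Y V} hV φ => ?_⟩
  have h1 : ∀ z, hV.fromSpec z ∈ V := fun z => by
    have : hV.fromSpec z ∈ hV.fromSpec.opensRange := ⟨z, rfl⟩
    rwa [hV.opensRange_fromSpec] at this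
  refine ⟨h1 _, fun f => ?_⟩
  have h2 : (⊤ : (Spec R).Opens) ≤ (Spec.map φ ≫ hV.fromSpec) ⁻¹ᵁ V := fun z _ => h1 _
  refine (abs_appLE (Spec.map φ ≫ hV.fromSpec) h2 ⟨x, hx'⟩ f).trans ((hx _).trans ?_)
  have h6 : (⊤ : (Spec Γ(Y, V)).Opens) ≤ hV.fromSpec ⁻¹ᵁ V := fun z _ => h1 z
  have h3 : (Spec.map φ ≫ hV.fromSpec).appLE V ⊤ h2 ≫ (Scheme.ΓSpecIso R).hom = φ := by
    have h4 : hV.fromSpec.appLE V ⊤ h6 = (Scheme.ΓSpecIso _).inv := by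
      refine (congrArg (· ≫ (Spec Γ(Y, V)).presheaf.map (homOfLE h6).op) hV.fromSpec_app_self).trans ?_
      refine (Category.assoc _ _ _).trans ?_
      rw [← Functor.map_comp]
      exact (congrArg _ ((Spec Γ(Y, V)).presheaf.map_id _)).trans (Category.comp_id _)
    have h5 : (Spec.map φ ≫ hV.fromSpec).appLE V ⊤ h2 =
        hV.fromSpec.appLE V ⊤ h6 ≫ (Spec.map φ).appTop := by
      rw [Scheme.Hom.appTop, ← Scheme.Hom.appLE_eq_app]
      exact (Scheme.Hom.appLE_comp_appLE _ _ _ _ _ h6 le_rfl).symm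
    rw [h5, h4, Category.assoc, Scheme.ΓSpecIso_naturality, Iso.inv_hom_id_assoc]
  exact congrArg v (congrArg (fun g => g.hom f) h3)

/-- For étale `f : Y → X` a point of `X^ℶ` lifts to every point of `Y` over its reduction. -/
theorem exists_map_eq_of_etale (f : Y ⟶ X) [Etale f] (x : Beth X) (q : Y) (hq : f q = x.pt) :
    ∃ y : Beth Y, map f y = x ∧ y.pt = q := by
  obtain ⟨U, hU, hxU⟩ := exists_affine x.pt
  obtain ⟨W, hW, hqW, hWU⟩ := exists_affine_le f (hq ▸ hxU : f q ∈ U)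
  let x' : On U := ⟨x, hxU⟩
  let : Algebra Γ(X, U) Γ(Y, W) := (f.appLE U W hWU).hom.toAlgebra
  have : Algebra.Etale Γ(X, U) Γ(Y, W) := etale_appLE f hU hW hWU
  obtain ⟨w, hwv, hw1, hwp⟩ := exists_valuation_of_etale (valOn x') (abs_le_one x')
    (hW.primeIdealOf ⟨q, hqW⟩).asIdeal fun a => by
      refine (mem_primeIdealOf_iff hW hqW _).trans ?_
      refine Iff.trans ?_ (abs_lt_one_iff x' a).symm
      refine ((mem_basicOpen_appLE f hWU hqW a).trans ?_).not
      rw [hq]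
  obtain ⟨y, hy⟩ := exists_abs_eq hW w hw1
  refine ⟨y.1, ?_, ?_⟩
  · refine ext_of_abs hU (x := map f y.1) (hWU y.2) hxU fun a => ?_
    refine (abs_appLE f hWU y a).trans ((hy _).trans (hwv a))
  · refine eq_of_mem_basicOpen_iff hW y.2 hqW fun b => not_iff_not.1 ?_
    rw [← mem_primeIdealOf_iff hW hqW, ← hwp, ← hy, abs_lt_one_iff]

/-- Points of `Y^ℶ` and `Z^ℶ` over the same point of `X^ℶ` come from a point of `(Y ×_X Z)^ℶ` if `Y` and
`Z` are étale over `X`. -/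
theorem exists_pullback_map_eq (f : Y ⟶ X) (g : Z ⟶ X) [Etale f] [Etale g] (y : Beth Y) (z : Beth Z)
    (h : map f y = map g z) :
    ∃ e : Beth (pullback f g), map (pullback.fst f g) e = y ∧ map (pullback.snd f g) e = z := by
  obtain ⟨U, hU, hyU⟩ := exists_affine (f y.pt)
  have hpt : g z.pt ∈ U := by
    have : f y.pt = g z.pt := congrArg Beth.pt h
    rwa [← this]
  obtain ⟨V, hV, hyV, hVU⟩ := exists_affine_le f hyU
  obtain ⟨W, hW, hzW, hWU⟩ := exists_affine_le g hpt
  let y' : On V := ⟨y, hyV⟩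
  let z' : On W := ⟨z, hzW⟩
  let : Algebra Γ(X, U) Γ(Y, V) := (f.appLE U V hVU).hom.toAlgebra
  let : Algebra Γ(X, U) Γ(Z, W) := (g.appLE U W hWU).hom.toAlgebra
  have := etale_appLE f hU hV hVU
  have := etale_appLE g hU hW hWU
  obtain ⟨s, hs1, hsy, hsz⟩ := exists_valuation_tensorProduct (A := Γ(X, U)) (valOn y') (abs_le_one y')
    (valOn z') (abs_le_one z') fun a => by
      refine (abs_appLE f hVU y' a).symm.trans (Eq.trans ?_ (abs_appLE g hWU z' a))
      exact congrArg (fun x : On U => abs x a) (Subtype.ext h)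
  let D := TensorProduct Γ(X, U) Γ(Y, V) Γ(Z, W)
  obtain ⟨x, hx⟩ := exists_beth_spec (R := CommRingCat.of D) s hs1
  let i : Γ(Y, V) ⟶ CommRingCat.of D :=
    CommRingCat.ofHom (Algebra.TensorProduct.includeLeftRingHom : Γ(Y, V) →+* D)
  let j : Γ(Z, W) ⟶ CommRingCat.of D :=
    CommRingCat.ofHom (Algebra.TensorProduct.includeRight : Γ(Z, W) →ₐ[Γ(X, U)] D).toRingHom
  have hij : f.appLE U V hVU ≫ i = g.appLE U W hWU ≫ j := CommRingCat.hom_ext <| RingHom.ext fun a =>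
    ((Algebra.TensorProduct.includeRight : Γ(Z, W) →ₐ[Γ(X, U)] D).commutes a).symm
  have hw : (Spec.map i ≫ hV.fromSpec) ≫ f = (Spec.map j ≫ hW.fromSpec) ≫ g := by
    rw [Category.assoc, Category.assoc, ← IsAffineOpen.SpecMap_appLE_fromSpec f hU hV hVU,
      ← IsAffineOpen.SpecMap_appLE_fromSpec g hU hW hWU, ← Spec.map_comp_assoc,
      ← Spec.map_comp_assoc, hij]
  obtain ⟨h1, h2⟩ := hx hV i
  obtain ⟨h3, h4⟩ := hx hW j
  refine ⟨map (pullback.lift _ _ hw) x, ?_, ?_⟩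
  · rw [← map_comp, pullback.lift_fst]
    exact ext_of_abs hV h1 hyV fun a => (h2 a).trans (hsy a)
  · rw [← map_comp, pullback.lift_snd]
    exact ext_of_abs hW h3 hzW fun a => (h4 a).trans (hsz a)

end Beth

/-! ### Tropicalization of simple logarithmic schemes -/

/-- `-log|f| = 0` exactly if `|f| = 1`. The monoid `[0, ∞]` is written multiplicatively, so its zero
is `1`. -/
theorem negLogVal_eq_one_iff {A : Type u} [CommRing A] (v : Valuation A ℝ≥0) (hv : ∀ f, v f ≤ 1)
    {f : A} : negLogVal v hv f = 1 ↔ v f = 1 := by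
  refine ⟨fun h => le_antisymm (hv f) ?_, negLogVal_eq_one v hv⟩
  by_cases h0 : v f = 0
  · have h1 : Multiplicative.ofAdd (if v f = 0 then (⊤ : ℝ≥0∞) else
        ENNReal.ofReal (-Real.log (v f))) = 1 := h
    rw [if_pos h0] at h1
    exact absurd (congrArg Multiplicative.toAdd h1) ENNReal.top_ne_zero
  · have h1 : Multiplicative.ofAdd (if v f = 0 then (⊤ : ℝ≥0∞) else
        ENNReal.ofReal (-Real.log (v f))) = 1 := h
    rw [if_neg h0] at h1
    have h2 : ENNReal.ofReal (-Real.log (v f)) = 0 := congrArg Multiplicative.toAdd h1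
    rw [ENNReal.ofReal_eq_zero, neg_nonpos] at h2
    have h3 : (0 : ℝ) < v f := NNReal.coe_pos.2 (pos_iff_ne_zero.2 h0)
    by_contra! hc
    exact absurd (Real.log_neg h3 (by exact_mod_cast hc)) (not_lt.2 h2)

/-- The map `-log : [0, ∞) → [0, ∞]`, with `-log t` truncated at `0`, is continuous, also at `t =
0`, where it is `∞`. -/
theorem continuous_negLog : Continuous fun t : ℝ≥0 =>
    (Multiplicative.ofAdd (if t = 0 then ⊤ else ENNReal.ofReal (-Real.log t)) : RBar) := by
  have h : (fun t : ℝ≥0 => if t = 0 then ⊤ else ENNReal.ofReal (-Real.log t)) =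
      fun t : ℝ≥0 => (-ENNReal.log (t : ℝ≥0∞)).toENNReal := by
    funext t
    split_ifs with h
    · simp [h]
    · rw [ENNReal.log_pos_real (by simpa using h) (by simp)]
      simp only [ENNReal.coe_toReal]
      rw [← EReal.coe_neg]
      rfl
  refine continuous_ofAdd.comp ?_
  rw [h]
  exact EReal.continuous_toENNReal.comp (continuous_neg.comp
    (ENNReal.continuous_log.comp ENNReal.continuous_coe))

namespace LogSch

variable {k : Type u} [Field k] {S T : LogSch.{u} k}

theorem isSharp_char (S : LogSch.{u} k) : S.log.char.IsSharp := by
  intro x a ha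
  obtain ⟨U, hU, m, rfl⟩ := sharpGerm_surj a
  obtain ⟨W, hW, h, hm⟩ := sharpGerm_isUnit _ _ _ ha
  rw [← sharpGerm_res _ h hW, sharpGerm_eq_one _ _ _ hm]

instance (S : LogSch.{u} k) : CompactSpace S.log.char.carrier := by
  have := S.quasiCompact
  exact QuasiCompact.compactSpace_of_compactSpace S.toBase

theorem IsCharacteristic.isInitial {F : MonoidalSpace.{u}} {φ : MonoidalSpace.Hom S.log.char F}
    (h : S.IsCharacteristic φ) : φ.IsInitial :=
  ⟨h.isFsKatoFan, h.isStrict, h.existsUnique⟩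

theorem tropStalk_sharpGerm (x : Beth S.X) (U : S.X.Opens) (hx : x.pt ∈ U)
    (m : S.log.zar.obj (op U)) :
    S.tropStalk x (sharpGerm S.log.zar U hx m) = negLogVal x.val x.le_one (S.ρGerm x.pt U hx m) := rfl

/-- The homomorphism `ρ` on an open subset, with values in the functions on that subset. -/
def ρOpen (S : LogSch.{u} k) (U : S.X.Opens) : S.log.zar.obj (op U) →* Γ(S.X, U) :=
  U.topIso.hom.hom.toMonoidHom.comp (S.log.ρ ((Et.ofOpens S.X).obj U))

theorem ρOpen_res {U V : S.X.Opens} (h : U ≤ V) (m : S.log.zar.obj (op V)) :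
    S.ρOpen U (res S.log.zar h m) = S.X.presheaf.map (homOfLE h).op (S.ρOpen V m) := by
  have h1 : S.log.ρ ((Et.ofOpens S.X).obj U) (res S.log.zar h m) =
      (S.X.homOfLE h).appTop.hom (S.log.ρ ((Et.ofOpens S.X).obj V) m) :=
    S.log.ρ_map ((Et.ofOpens S.X).map (homOfLE h)) m
  have h2 : (S.X.homOfLE h).appTop ≫ U.topIso.hom =
      V.topIso.hom ≫ S.X.presheaf.map (homOfLE h).op := by
    have h6 : ∀ {A B B' C : S.X.Opens} (a : A ⟶ B) (b : B ⟶ C) (a' : A ⟶ B') (b' : B' ⟶ C),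
        S.X.presheaf.map b.op ≫ S.X.presheaf.map a.op =
          S.X.presheaf.map b'.op ≫ S.X.presheaf.map a'.op := by
      intro A B B' C a b a' b'
      rw [← Functor.map_comp, ← Functor.map_comp, ← op_comp, ← op_comp,
        Subsingleton.elim (a ≫ b) (a' ≫ b')]
    rw [Scheme.homOfLE_appTop]
    exact h6 _ _ _ _
  exact (congrArg U.topIso.hom.hom h1).trans
    (congrArg (fun f => f.hom (S.log.ρ ((Et.ofOpens S.X).obj V) m)) h2)

theorem ρOpen_openApp (f : S ⟶ T) (V : T.X.Opens) (n : T.log.zar.obj (op V)) :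
    S.ρOpen (f.base ⁻¹ᵁ V) (openApp f V n) = f.base.app V (T.ρOpen V n) := by
  have h1 := Hom.ρ_app f (U := (Et.ofOpens S.X).obj (f.base ⁻¹ᵁ V))
    (V := (Et.ofOpens T.X).obj V) (f.base ∣_ V) (morphismRestrict_ι _ _) n
  have h2 : (f.base ∣_ V).appTop ≫ (f.base ⁻¹ᵁ V).topIso.hom = V.topIso.hom ≫ f.base.app V := by
    refine (congrArg (· ≫ _) (morphismRestrict_appTop f.base V)).trans ?_
    refine (Category.assoc _ _ _).trans (Eq.trans ?_ (Scheme.Hom.naturality f.base _).symm)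
    refine congrArg (f.base.app _ ≫ ·) ?_
    exact (Functor.map_comp _ _ _).symm
  exact (congrArg (f.base ⁻¹ᵁ V).topIso.hom.hom h1).trans
    (congrArg (fun g => g.hom (T.log.ρ ((Et.ofOpens T.X).obj V) n)) h2)

theorem isUnit_of_isUnit_ρOpen {U : S.X.Opens} (m : S.log.zar.obj (op U)) (h : IsUnit (S.ρOpen U m)) :
    IsUnit m := by
  refine S.log.isUnit_of_isUnit_ρ _ ?_
  have h1 := h.map U.topIso.inv.hom
  have h2 : U.topIso.inv.hom (S.ρOpen U m) = S.log.ρ ((Et.ofOpens S.X).obj U) m :=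
    congrArg (fun g => g.hom (S.log.ρ ((Et.ofOpens S.X).obj U) m)) U.topIso.hom_inv_id
  rwa [h2] at h1

/-- Sections of `M` are units where their image in `𝒪` is one. -/
theorem isUnit_of_ρGerm {x : S.X} {U : S.X.Opens} (hx : x ∈ U) (m : S.log.zar.obj (op U))
    (hm : IsUnit (S.ρGerm x U hx m)) : sharpGerm S.log.zar U hx m = 1 := by
  have hxs : x ∈ S.X.basicOpen (S.ρOpen U m) := (S.X.mem_basicOpen _ _ hx).2 hm
  have hle : S.X.basicOpen (S.ρOpen U m) ≤ U := S.X.basicOpen_le _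
  rw [← sharpGerm_res _ hle hxs]
  refine sharpGerm_eq_one _ _ _ (isUnit_of_isUnit_ρOpen _ ?_)
  rw [ρOpen_res]
  exact S.X.toRingedSpace.isUnit_res_basicOpen _

/-- The homomorphism `M_x / M_x^* → [0, ∞]` is local. -/
theorem isUnit_of_tropStalk (x : Beth S.X) (a : SharpStalk S.log.zar x.pt)
    (ha : IsUnit (S.tropStalk x a)) : IsUnit a := by
  obtain ⟨U, hU, m, rfl⟩ := sharpGerm_surj a
  rw [tropStalk_sharpGerm] at ha
  have h1 := RBar.eq_one_of_isUnit ha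
  rw [negLogVal_eq_one_iff] at h1
  rw [isUnit_of_ρGerm hU m ((x.val_eq_one_iff _).1 h1)]
  exact isUnit_one

namespace IsSimple

variable (hS : S.IsSimple) (hT : T.IsSimple)

theorem isUnit_of_trop (x : Beth S.X) (a : hS.fan.stalk (hS.φ.base x.pt))
    (ha : IsUnit (((S.tropStalk x).comp (hS.φ.stalkMap x.pt)) a)) : IsUnit a :=
  hS.φ.isLocal x.pt a (isUnit_of_tropStalk x _ ha)

theorem reduction_trop (x : Beth S.X) : (hS.trop x).reduction = hS.φ.base x.pt :=
  ExtCone.reduction_ofStalk _ (hS.isUnit_of_trop x)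

/-- The tropicalization of `x` is given by `𝒪_{F, φ(r(x))} ≃ M_{r(x)} / M_{r(x)}^* → [0, ∞]`. -/
theorem germVal_trop (x : Beth S.X) (h : (hS.trop x).reduction ⤳ hS.φ.base x.pt)
    (a : hS.fan.stalk (hS.φ.base x.pt)) :
    (hS.trop x).germVal h a = RBar.pt.toStalk (S.tropStalk x (hS.φ.stalkMap x.pt a)) :=
  ExtCone.germVal_ofStalk _ (hS.isUnit_of_trop x) h a

end IsSimple

theorem tropStalk_map (f : S ⟶ T) (x : Beth S.X) (a : SharpStalk T.log.zar (f.base x.pt)) :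
    T.tropStalk (Beth.map f.base x) a = S.tropStalk x (charStalkMap f x.pt a) := by
  obtain ⟨V, hV, n, rfl⟩ := sharpGerm_surj a
  have h2 : (f.base.stalkMap x.pt).hom (T.ρGerm (f.base x.pt) V hV n) =
      S.ρGerm x.pt (f.base ⁻¹ᵁ V) hV (openApp f V n) := by
    exact (Scheme.Hom.germ_stalkMap_apply f.base V x.pt hV _).trans
      (congrArg (S.X.presheaf.germ (f.base ⁻¹ᵁ V) x.pt hV) (ρOpen_openApp f V n).symm)
  exact congrArg (fun b => (Multiplicative.ofAdd (if x.val b = 0 then ⊤ else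
    ENNReal.ofReal (-Real.log (x.val b))) : RBar)) h2

namespace IsSimple

variable {hS : S.IsSimple} {hT : T.IsSimple}

theorem existsUnique_isFanMap (hS : S.IsSimple) (hT : T.IsSimple) (f : S ⟶ T) :
    ∃! g : MonoidalSpace.Hom hS.fan hT.fan, hS.IsFanMap hT f g :=
  hS.isCharacteristic.isInitial.existsUnique_factor hT.isCharacteristic.isFsKatoFan _

/-- The tropicalization of `x` seen from a specialization `y` of `φ(r(x))`. -/
theorem germVal_trop_of_specializes (hS : S.IsSimple) (x : Beth S.X) {y : hS.fan.carrier}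
    (k : hS.φ.base x.pt ⤳ y) (k' : (hS.trop x).reduction ⤳ y) (a : hS.fan.stalk y) :
    (hS.trop x).germVal k' a =
      RBar.pt.toStalk (S.tropStalk x (hS.φ.stalkMap x.pt (cosp k a))) := by
  rw [← hS.germVal_trop x (specializes_of_eq (hS.reduction_trop x))]
  exact congrArg (MonoidalSpace.Hom.stalkMap (hS.trop x) RBar.pt) (cosp_cosp _ _ a).symm

/-- Tropicalization is compatible with the maps induced by a morphism of simple logarithmic schemes.
-/
theorem trop_map {f : S ⟶ T} {g : MonoidalSpace.Hom hS.fan hT.fan} (hg : hS.IsFanMap hT f g)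
    (x : Beth S.X) : hT.trop (Beth.map f.base x) = ExtCone.map g (hS.trop x) := by
  have hb : hT.φ.base (f.base x.pt) = g.base (hS.φ.base x.pt) :=
    (MonoidalSpace.Hom.congr_base hg x.pt).symm
  have k : (hT.trop (Beth.map f.base x)).reduction ⤳ g.base (hS.φ.base x.pt) :=
    (specializes_of_eq (hT.reduction_trop (Beth.map f.base x))).trans (specializes_of_eq hb)
  have k₀ := specializes_of_eq (hS.reduction_trop x)
  have k₁ : (ExtCone.map g (hS.trop x)).reduction ⤳ g.base (hS.φ.base x.pt) := g.specializes k₀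
  refine ExtCone.eq_of_germVal_eq hT.isCharacteristic.isFsKatoFan k k₁ fun a => ?_
  rw [hT.germVal_trop_of_specializes _ (specializes_of_eq hb) k, ExtCone.germVal_map g _ k₀ k₁, hS.germVal_trop]
  refine congrArg _ ((tropStalk_map f x _).trans (congrArg _ ?_))
  exact MonoidalSpace.Hom.congr_stalkMap (m := (charMap f).comp hT.φ) (m' := hS.φ.comp g) hg.symm
    (x := x.pt) (specializes_of_eq hb) a

/-- The tropicalization map is continuous: over a small affine open subset of `X` it is the
composition of `Hom(P, [0, ∞]) → Σ(F)` with the map `y ↦ (p ↦ -log|m_p|_y)` for sections `m_p` of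
`M` that lift the generators `p` of the chart `P → 𝒪_F`. -/
theorem continuous_trop (hS : S.IsSimple) : Continuous hS.trop := by
  have hF := hS.isCharacteristic.isFsKatoFan
  refine continuous_iff_isClosed.2 fun A hA => Beth.isClosed_iff.2 fun U hU => ?_
  refine Beth.isClosed_of_local hU fun x _ => ?_
  obtain ⟨P, _, hP, j, hj, hjx⟩ := hF.exists_localNhd (hS.φ.base x)
  let c := MonPrime.closedPoint P
  let E := MulEquiv.ofBijective (j.stalkMap c) (hj.2 c)
  let α : P →* hS.fan.stalk (j.base c) := E.symm.toMonoidHom.comp c.toStalk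
  obtain ⟨t, ht⟩ := hP.fg
  -- lift the elements of `P` to sections of `M` near `x`
  have h1 : ∀ p : P, ∃ (V : S.X.Opens) (_ : x ∈ V) (m : S.log.zar.obj (op V)), ∀ (x' : S.X)
      (h : x' ∈ V) (k : hS.φ.base x' ⤳ j.base c),
        hS.φ.stalkMap x' (cosp k (α p)) = sharpGerm S.log.zar V h m := by
    intro p
    obtain ⟨N, hN, s, hs, e⟩ := hS.fan.germ_surj (j.base c) (α p)
    have hxN : hS.φ.base x ∈ N := by
      rw [← hjx]
      exact hN
    obtain ⟨V, hV, m, hm⟩ := hS.φ.isSection N s hs ⟨x, hxN⟩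
    let V' : S.X.Opens := V ⊓ N.comap ⟨hS.φ.base, hS.φ.continuous_base⟩
    refine ⟨V', ⟨hV, hxN⟩, res S.log.zar inf_le_left m, fun x' h k => ?_⟩
    rw [sharpGerm_res]
    rw [← hm ⟨x', h.2⟩ h.1, ← e]
    exact congrArg _ (cosp_section k hs hN h.2)
  choose V hxV m hm using h1
  let V₀ : S.X.Opens := (t.inf V) ⊓ Opens.comap ⟨hS.φ.base, hS.φ.continuous_base⟩
    ⟨_, hF.isOpen_setOf_specializes (j.base c)⟩
  have hxV₀ : x ∈ V₀ := by
    refine ⟨?_, specializes_of_eq hjx.symm⟩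
    change x ∈ (t.inf V : S.X.Opens)
    refine Finset.inf_induction (p := fun O : S.X.Opens => x ∈ O) (Opens.mem_top x)
      (fun _ h _ h' => ⟨h, h'⟩) fun p _ => hxV p
  refine ⟨V₀, hxV₀, fun W hW hWV => ?_⟩
  have hk : ∀ y : Beth.On W, hS.φ.base y.1.pt ⤳ j.base c := fun y => (hWV y.2).2
  let H : Beth.On W → P →* RBar := fun y => (S.tropStalk y.1).comp
    ((hS.φ.stalkMap y.1.pt).comp ((cosp (hk y)).comp α))
  have hH : ∀ y, ExtCone.ofAffine j (H y) = hS.trop y.1 := by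
    intro y
    have hp : RBar.pt.comap (H y) ⤳ c := MonPrime.specializes_closedPoint _
    have k : (ExtCone.ofAffine j (H y)).reduction ⤳ j.base c := j.specializes hp
    have k' : (hS.trop y.1).reduction ⤳ j.base c :=
      (specializes_of_eq (hS.reduction_trop y.1)).trans (hk y)
    refine ExtCone.eq_of_germVal_eq hF k k' fun a => ?_
    obtain ⟨p, hp'⟩ := c.toStalk_surjective (E a)
    rw [ExtCone.germVal_ofAffine j (H y) hp k (α := p) hp'.symm, hS.germVal_trop_of_specializes y.1 (hk y) k']
    have : α p = a := (congrArg E.symm hp').trans (E.symm_apply_apply a)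
    change RBar.pt.toStalk (S.tropStalk y.1 (hS.φ.stalkMap y.1.pt (cosp (hk y) (α p)))) = _
    rw [this]
  -- it suffices to consider generators of `P`, on which `H` is `-log` of a function on `W`
  have hc : @Continuous _ _ _ (ExtCone.homTopology P) H := by
    refine continuous_induced_rng.2 (continuous_pi fun p => ?_)
    have hp : p ∈ Submonoid.closure (t : Set P) := by
      rw [ht]
      trivial
    induction hp using Submonoid.closure_induction with
    | one =>
      simp only [Function.comp_apply, map_one]
      exact continuous_const
    | mul p q _ _ hp hq =>
      simp only [Function.comp_apply, map_mul]
      exact hp.mul hq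
    | mem p hp =>
      have hWp : W ≤ V p := (hWV.trans inf_le_left).trans (Finset.inf_le hp)
      have e : (fun y => H y p) = fun y : Beth.On W => (Multiplicative.ofAdd
          (if Beth.abs y (S.X.presheaf.map (homOfLE hWp).op (S.ρOpen (V p) (m p))) = 0 then ⊤ else
            ENNReal.ofReal (-Real.log (Beth.abs y
              (S.X.presheaf.map (homOfLE hWp).op (S.ρOpen (V p) (m p)))))) : RBar) := by
        funext y
        refine (congrArg (S.tropStalk y.1) (hm p y.1.pt (hWp y.2) (hk y))).trans ?_
        rw [tropStalk_sharpGerm]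
        have h2 : S.ρGerm y.1.pt (V p) (hWp y.2) (m p) = S.X.presheaf.germ W y.1.pt y.2
            (S.X.presheaf.map (homOfLE hWp).op (S.ρOpen (V p) (m p))) :=
          (S.X.presheaf.germ_res_apply (homOfLE hWp) y.1.pt y.2 _).symm
        rw [h2]
        rfl
      change Continuous fun y => H y p
      rw [e]
      exact continuous_negLog.comp (Beth.continuous_abs _)
  have h3 : Beth.On.incl (U := W) ⁻¹' (hS.trop ⁻¹' A) = H ⁻¹' (ExtCone.ofAffine j ⁻¹' A) := by
    ext y
    change hS.trop y.1 ∈ A ↔ ExtCone.ofAffine j (H y) ∈ A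
    rw [hH]
  rw [h3]
  exact @IsClosed.preimage _ _ _ (ExtCone.homTopology P) _ hc _
    (@IsClosed.preimage _ _ (ExtCone.homTopology P) _ _ (ExtCone.continuous_ofAffine hF j) _ hA)

end IsSimple

end LogSch

/-! ### Sheaves on the small étale site -/

namespace Et

variable {X : Scheme.{u}}

/-- A sieve is covering if and only if its members are jointly surjective. -/
theorem mem_smallEtaleTopology_iff {U : X.Etale} (R : Sieve U) :
    R ∈ X.smallEtaleTopology U ↔ ∀ x : U.left, ∃ (W : X.Etale) (f : W ⟶ U) (w : W.left),
      R f ∧ f.left w = x := by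
  have h1 : Sieve.ofArrows _ (fun i : Σ W : X.Etale, {f : W ⟶ U // R f} => i.2.1) = R := by
    ext W f
    constructor
    · rintro ⟨_, a, _, ⟨i⟩, rfl⟩
      exact R.downward_closed i.2.2 a
    · intro hf
      exact ⟨W, 𝟙 W, f, ⟨(⟨W, f, hf⟩ : Σ W : X.Etale, {f : W ⟶ U // R f})⟩, Category.id_comp f⟩
  have h2 := Scheme.ofArrows_mem_smallEtaleTopology_iff
    (fun i : Σ W : X.Etale, {f : W ⟶ U // R f} => i.2.1)
  rw [h1] at h2
  rw [h2, Set.eq_univ_iff_forall]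
  refine forall_congr' fun x => ?_
  constructor
  · intro h
    obtain ⟨⟨W, f, hf⟩, w, hw⟩ := Set.mem_iUnion.1 h
    exact ⟨W, f, w, hf, hw⟩
  · rintro ⟨W, f, w, hf, hw⟩
    exact Set.mem_iUnion.2 ⟨⟨W, f, hf⟩, w, hw⟩

instance etale_str (U : X.Etale) : Etale (str U) := U.prop

instance etale_left {U V : X.Etale} (f : U ⟶ V) : Etale f.left := by
  have : Etale (f.left ≫ str V) := by
    rw [Et.w]
    infer_instance
  exact Etale.of_comp f.left (str V)

/-- An étale `X'`-scheme as an étale `X`-scheme, for étale `g : X' → X`. -/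
def push {X' : Scheme.{u}} (g : X' ⟶ X) [Etale g] : X'.Etale ⥤ X.Etale where
  obj V := Scheme.Etale.mk (str V ≫ g)
  map h := homMk h.left (by
    change h.left ≫ str _ ≫ g = str _ ≫ g
    rw [← Category.assoc, Et.w])
  map_id V := hom_ext rfl
  map_comp g h := hom_ext rfl

/-- The étale `X`-scheme `W → V → X` for an étale `X`-scheme `V` and an étale morphism `W → V`. -/
def comp (V : X.Etale) {W : Scheme.{u}} (j : W ⟶ V.left) [Etale j] : X.Etale :=
  Scheme.Etale.mk (j ≫ str V)

/-- The morphism from `W → V → X` to `V`. -/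
def compHom (V : X.Etale) {W : Scheme.{u}} (j : W ⟶ V.left) [Etale j] : comp V j ⟶ V :=
  homMk j rfl

end Et

theorem isUnit_of_basicOpen_eq_top {X : Scheme.{u}} {U : X.Opens} {s : Γ(X, U)}
    (h : X.basicOpen s = U) : IsUnit s := by
  refine X.toRingedSpace.isUnit_of_isUnit_germ U s fun x hx => ?_
  rw [← h] at hx
  exact (X.toRingedSpace.mem_basicOpen s x _).1 hx

namespace LogStructure

variable {X : Scheme.{u}} (L : LogStructure X)

/-- Sections of `M` glue. The sheaf condition is about morphisms to `M` from arbitrary monoids;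
sections of `M` are morphisms from the free monoid on one generator. -/
theorem amalgamate {U : X.Etale} (R : Sieve U)
    (hR : ∀ x : U.left, ∃ (W : X.Etale) (f : W ⟶ U) (w : W.left), R f ∧ f.left w = x)
    (s : ∀ {W : X.Etale} (f : W ⟶ U), R f → L.M.obj (op W))
    (hs : ∀ {W W' : X.Etale} (f : W ⟶ U) (hf : R f) (g : W' ⟶ W),
      L.res g (s f hf) = s (g ≫ f) (R.downward_closed hf g)) :
    ∃! t : L.M.obj (op U), ∀ {W : X.Etale} (f : W ⟶ U) (hf : R f), L.res f t = s f hf := by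
  -- the free monoid on one generator, and the morphism from it given by a section
  let E : CommMonCat.{u} := CommMonCat.of (ULift.{u} (Multiplicative ℕ))
  let e : ∀ (M : CommMonCat.{u}), M → (E ⟶ M) := fun M m =>
    CommMonCat.ofHom ((powersHom M m).comp MulEquiv.ulift.toMonoidHom)
  let g : E := ULift.up (Multiplicative.ofAdd 1)
  have he : ∀ (M : CommMonCat.{u}) (m : M), (e M m).hom g = m := fun M m => by
    change m ^ 1 = m
    rw [pow_one]
  have hext : ∀ (M : CommMonCat.{u}) (f f' : E ⟶ M), f.hom g = f'.hom g → f = f' := by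
    intro M f f' h
    refine CommMonCat.hom_ext (MonoidHom.ext fun x => ?_)
    have hx : x = g ^ (Multiplicative.toAdd x.down) := by
      refine ULift.ext _ _ ?_
      rw [ULift.pow_down]
      change x.down = (Multiplicative.ofAdd 1) ^ (Multiplicative.toAdd x.down)
      rw [← ofAdd_nsmul]
      simp
    rw [hx, map_pow, map_pow, h]
  have h1 := L.isSheaf E R ((Et.mem_smallEtaleTopology_iff R).2 hR)
    (fun W f hf => e _ (s f hf)) (by
      intro Y₁ Y₂ Z g₁ g₂ f₁ f₂ h₁ h₂ hc
      refine hext _ _ _ ?_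
      change L.res g₁ ((e _ (s f₁ h₁)).hom g) = L.res g₂ ((e _ (s f₂ h₂)).hom g)
      rw [he, he, hs, hs]
      congr 1)
  obtain ⟨t, ht, htu⟩ := h1
  refine ⟨t.hom g, fun f hf => ?_, fun t' ht' => ?_⟩
  · have := congrArg (fun a => a.hom g) (ht f hf)
    exact this.trans (he _ _)
  · have h2 := htu (e _ t') fun W f hf => hext _ _ _ (by
      change L.res f ((e _ t').hom g) = (e _ (s f hf)).hom g
      rw [he, he]
      exact ht' f hf)
    rw [← h2, he]

/-- Sections of `M` agree if they agree étale locally. -/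
theorem ext_of_local {U : X.Etale} {m n : L.M.obj (op U)} (h : ∀ x : U.left,
    ∃ (W : X.Etale) (f : W ⟶ U) (w : W.left), f.left w = x ∧ L.res f m = L.res f n) : m = n := by
  let R : Sieve U :=
    { arrows := fun W f => L.res f m = L.res f n
      downward_closed := fun {W W'} f hf g => by
        rw [← L.res_res, ← L.res_res, hf] }
  obtain ⟨t, -, ht⟩ := L.amalgamate R
    (fun x => by
      obtain ⟨W, f, w, hw, e⟩ := h x
      exact ⟨W, f, w, e, hw⟩)
    (fun f _ => L.res f n) fun f _ g => L.res_res g f n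
  rw [ht m fun f hf => hf, ht n fun f hf => rfl]

/-- A section exists as soon as it exists locally and is locally characterized by a local property. -/
theorem exists_of_local {U : X.Etale} (P : ∀ {W : X.Etale}, (W ⟶ U) → L.M.obj (op W) → Prop)
    (hres : ∀ {W W' : X.Etale} (f : W ⟶ U) (g : W' ⟶ W) (m), P f m → P (g ≫ f) (L.res g m))
    (huniq : ∀ {W : X.Etale} (f : W ⟶ U) (m m'), P f m → P f m' → m = m')
    (hex : ∀ x : U.left, ∃ (W : X.Etale) (f : W ⟶ U) (w : W.left) (m : L.M.obj (op W)),
      f.left w = x ∧ P f m) :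
    ∃ t : L.M.obj (op U), ∀ {W : X.Etale} (f : W ⟶ U) (m), P f m → L.res f t = m := by
  let R : Sieve U :=
    { arrows := fun W f => ∃ m, P f m
      downward_closed := fun {W W'} f hf g => by
        obtain ⟨m, hm⟩ := hf
        exact ⟨_, hres f g m hm⟩ }
  obtain ⟨t, ht, -⟩ := L.amalgamate R
    (fun x => by
      obtain ⟨W, f, w, m, hw, hm⟩ := hex x
      exact ⟨W, f, w, ⟨m, hm⟩, hw⟩)
    (fun f hf => hf.choose) fun f hf g => huniq _ _ _ (hres f g _ hf.choose_spec)
      (Exists.choose_spec (p := fun m => P (g ≫ f) m) ⟨_, hres f g _ hf.choose_spec⟩)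
  exact ⟨t, fun f m hm => (ht f ⟨m, hm⟩).trans (huniq f _ _ (Exists.choose_spec _) hm)⟩

/-- Sections of `M` are invertible if they are invertible étale locally: so is their image in `𝒪`,
and étale morphisms detect invertible functions. -/
theorem isUnit_of_local {U : X.Etale} {m : L.M.obj (op U)} (h : ∀ x : U.left,
    ∃ (W : X.Etale) (f : W ⟶ U) (w : W.left), f.left w = x ∧ IsUnit (L.res f m)) : IsUnit m := by
  refine L.isUnit_of_isUnit_ρ _ ?_
  have h1 : U.left.basicOpen (L.ρ U m) = ⊤ := by
    refine top_unique fun x _ => ?_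
    obtain ⟨W, f, w, rfl, hw⟩ := h x
    have h4 : IsUnit (f.left.appTop.hom (L.ρ U m)) := by
      rw [← L.ρ_map f m]
      exact hw.map (L.ρ W)
    have h2 := Scheme.preimage_basicOpen_top f.left (L.ρ U m)
    rw [Scheme.basicOpen_of_isUnit _ h4] at h2
    have h3 : w ∈ f.left ⁻¹ᵁ U.left.basicOpen (L.ρ U m) := by
      rw [h2]
      trivial
    exact h3
  exact isUnit_of_basicOpen_eq_top h1

end LogStructure

/-! ### Restriction of logarithmic structures to étale schemes -/

namespace Et

variable {X X' : Scheme.{u}} (g : X' ⟶ X) [Etale g]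

variable {g} in
/-- An étale `X`-scheme over an étale `X'`-scheme `V`, as an étale `X'`-scheme. -/
def unpush {V : X'.Etale} {W : X.Etale} (j : W ⟶ (push g).obj V) : X'.Etale :=
  haveI : Etale (show W.left ⟶ V.left from j.left) := etale_left j
  Scheme.Etale.mk ((show W.left ⟶ V.left from j.left) ≫ str V)

variable {g} in
/-- The structure morphism of `unpush j` over `V`. -/
def unpushHom {V : X'.Etale} {W : X.Etale} (j : W ⟶ (push g).obj V) : unpush j ⟶ V :=
  homMk j.left rfl

variable {g} in
/-- The identity of `W`, as a morphism of étale `X`-schemes. -/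
def unpushIso {V : X'.Etale} {W : X.Etale} (j : W ⟶ (push g).obj V) :
    (push g).obj (unpush j) ⟶ W :=
  homMk (𝟙 W.left) (by
    rw [← Et.w j]
    exact (Category.id_comp _).trans (Category.assoc _ _ _).symm)

variable {g} in
/-- The identity of `W`, as a morphism of étale `X`-schemes. -/
def unpushInv {V : X'.Etale} {W : X.Etale} (j : W ⟶ (push g).obj V) :
    W ⟶ (push g).obj (unpush j) :=
  homMk (𝟙 W.left) (by
    rw [← Et.w j]
    exact (Category.id_comp _).trans (Category.assoc _ _ _))

theorem unpushIso_comp {V : X'.Etale} {W : X.Etale} (j : W ⟶ (push g).obj V) :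
    unpushIso j ≫ j = (push g).map (unpushHom j) :=
  hom_ext (Category.id_comp j.left)

theorem unpushInv_comp {V : X'.Etale} {W : X.Etale} (j : W ⟶ (push g).obj V) :
    unpushInv j ≫ (push g).map (unpushHom j) = j :=
  hom_ext (Category.id_comp j.left)

end Et

namespace LogStructure

variable {X : Scheme.{u}} (L : LogStructure X) {X' : Scheme.{u}} (g : X' ⟶ X) [Etale g]

/-- The restriction of a sheaf to an étale `X`-scheme `X'` is a sheaf: the étale `X`-schemes over an
étale `X'`-scheme `V` are the étale `X'`-schemes over `V`. -/
theorem isSheaf_restrict : Presheaf.IsSheaf X'.smallEtaleTopology ((Et.push g).op ⋙ L.M) := by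
  intro E V R hR x hx
  let c : ∀ {W W' : X.Etale} (f : W ⟶ (Et.push g).obj V) (h : W' ⟶ W),
      Et.unpush (h ≫ f) ⟶ Et.unpush f := fun f h =>
    Et.homMk h.left (by exact (Category.assoc _ _ _).symm)
  let R' : Sieve ((Et.push g).obj V) :=
    { arrows := fun W f => R (Et.unpushHom f)
      downward_closed := fun {W W'} f hf h => by
        have : Et.unpushHom (h ≫ f) = c f h ≫ Et.unpushHom f := Et.hom_ext rfl
        rw [this]
        exact R.downward_closed hf _ }
  have hx' := (Presieve.compatible_iff_sieveCompatible x).1 hx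
  let p : ∀ {W : X'.Etale} (f : W ⟶ V), Et.unpush ((Et.push g).map f) ⟶ W := fun {W} f =>
    Et.homMk (𝟙 W.left) ((Category.id_comp _).trans (Et.w f).symm)
  have hp : ∀ {W : X'.Etale} (f : W ⟶ V), Et.unpushHom ((Et.push g).map f) = p f ≫ f :=
    fun f => Et.hom_ext (Category.id_comp _).symm
  have hmem : ∀ {W : X'.Etale} (f : W ⟶ V), R f → R' ((Et.push g).map f) := fun f hf => by
    change R (Et.unpushHom ((Et.push g).map f))
    rw [hp]
    exact R.downward_closed hf _
  have hxe : ∀ {W : X'.Etale} (f f' : W ⟶ V) (hf : R f) (hf' : R f'), f = f' →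
      x f hf = x f' hf' := by
    rintro W f _ hf hf' rfl
    rfl
  let y : ∀ {W : X.Etale} (f : W ⟶ (Et.push g).obj V), R' f → (E ⟶ L.M.obj (op W)) :=
    fun f hf => x (Et.unpushHom f) hf ≫ L.M.map (Et.unpushInv f).op
  have hy : ∀ {W : X'.Etale} (f : W ⟶ V) (hf : R f), y ((Et.push g).map f) (hmem f hf) = x f hf := by
    intro W f hf
    have h1 := hx' f (p f) hf
    rw [← hxe _ _ (hmem f hf) _ (hp f)] at h1
    have h2 : Et.unpushInv ((Et.push g).map f) ≫ (Et.push g).map (p f) = 𝟙 _ :=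
      Et.hom_ext (Category.id_comp _)
    have h3 : L.M.map ((Et.push g).map (p f)).op ≫ L.M.map (Et.unpushInv ((Et.push g).map f)).op =
        𝟙 _ := by
      rw [← L.M.map_comp, ← op_comp, h2, op_id, L.M.map_id]
    change x _ _ ≫ _ = _
    rw [h1]
    exact (Category.assoc _ _ _).trans ((congrArg (x f hf ≫ ·) h3).trans (Category.comp_id _))
  obtain ⟨t, ht, htu⟩ := L.isSheaf E R' ((Et.mem_smallEtaleTopology_iff R').2 fun v => by
      obtain ⟨W, f, w, hf, hw⟩ := (Et.mem_smallEtaleTopology_iff R).1 hR v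
      exact ⟨(Et.push g).obj W, (Et.push g).map f, w, hmem f hf, hw⟩)
    (fun W f hf => y f hf) (by
      refine (Presieve.compatible_iff_sieveCompatible _).2 ?_
      intro W W' f h hf
      have h0 : Et.unpushHom (h ≫ f) = c f h ≫ Et.unpushHom f := Et.hom_ext rfl
      have h1 := hx' (Et.unpushHom f) (c f h) hf
      rw [← hxe _ _ (R'.downward_closed hf h) _ h0] at h1
      have h2 : Et.unpushInv (h ≫ f) ≫ (Et.push g).map (c f h) = h ≫ Et.unpushInv f :=
        Et.hom_ext ((Category.id_comp _).trans (Category.comp_id _).symm)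
      have h3 : L.M.map ((Et.push g).map (c f h)).op ≫ L.M.map (Et.unpushInv (h ≫ f)).op =
          L.M.map (Et.unpushInv f).op ≫ L.M.map h.op := by
        rw [← L.M.map_comp, ← op_comp, h2, op_comp, L.M.map_comp]
      change x _ _ ≫ _ = (x _ _ ≫ _) ≫ _
      rw [h1]
      exact (Category.assoc _ _ _).trans ((congrArg (x _ hf ≫ ·) h3).trans
        (Category.assoc _ _ _).symm))
  refine ⟨t, fun W f hf => (ht _ (hmem f hf)).trans (hy f hf), fun t' ht' => htu t' ?_⟩
  intro W f hf
  have h1 := ht' (Et.unpushHom f) hf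
  have h2 : L.M.map ((Et.push g).map (Et.unpushHom f)).op ≫ L.M.map (Et.unpushInv f).op =
      L.M.map f.op := by
    rw [← L.M.map_comp, ← op_comp, Et.unpushInv_comp]
  change t' ≫ L.M.map f.op = x _ _ ≫ _
  rw [← h1, ← h2]
  exact (Category.assoc _ _ _).symm

/-- The inverse image of a logarithmic structure under an étale morphism. -/
def restrict : LogStructure X' where
  M := (Et.push g).op ⋙ L.M
  isSheaf := L.isSheaf_restrict g
  ρ V := L.ρ ((Et.push g).obj V)
  ρ_map h m := L.ρ_map ((Et.push g).map h) m
  existsUnique_unit V f hf := L.existsUnique_unit ((Et.push g).obj V) f hf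

/-- Local data over `push g V` is local data over `V`, as far as restricted sections are concerned.
-/
theorem res_unpushIso {U V : X'.Etale} {W : X.Etale} (j : W ⟶ (Et.push g).obj V) (h : V ⟶ U)
    (m : L.M.obj (op ((Et.push g).obj U))) :
    L.res (Et.unpushIso j) (L.res (j ≫ (Et.push g).map h) m) =
      L.res ((Et.push g).map (Et.unpushHom j ≫ h)) m := by
  rw [L.res_res, ← Category.assoc, Et.unpushIso_comp, Functor.map_comp]

theorem res_unpushIso_id {V : X'.Etale} {W : X.Etale} (j : W ⟶ (Et.push g).obj V)
    (m : L.M.obj (op ((Et.push g).obj V))) :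
    L.res (Et.unpushIso j) (L.res j m) = L.res ((Et.push g).map (Et.unpushHom j)) m := by
  rw [L.res_res, Et.unpushIso_comp]

variable {L}

theorem IsChart.res {U U' : X.Etale} {P : Type u} [CommMonoid P] {β : P →* L.M.obj (op U)}
    (hβ : L.IsChart β) (h : U' ⟶ U) : L.IsChart ((L.res h).comp β) where
  surj V h' m v := by
    obtain ⟨W, j, w, p, u, hw, hu, e⟩ := hβ.surj V (h' ≫ h) m v
    refine ⟨W, j, w, p, u, hw, hu, e.trans ?_⟩
    rw [MonoidHom.comp_apply, L.res_res, Category.assoc]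
  inj V h' p q u hu e v := by
    simp only [MonoidHom.comp_apply, L.res_res] at e ⊢
    simpa only [Category.assoc] using hβ.inj V (h' ≫ h) p q u hu e v

theorem IsChart.restrict {U : X'.Etale} {P : Type u} [CommMonoid P]
    {β : P →* L.M.obj (op ((Et.push g).obj U))} (hβ : L.IsChart β) :
    (L.restrict g).IsChart (U := U) β where
  surj V h m v := by
    obtain ⟨W, j, w, p, u, hw, hu, e⟩ := hβ.surj _ ((Et.push g).map h) m v
    refine ⟨Et.unpush j, Et.unpushHom j, w, p,
      L.res (Et.unpushIso j) u, hw, hu.map _, ?_⟩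
    exact (L.res_unpushIso_id g j m).symm.trans ((congrArg (L.res (Et.unpushIso j)) e).trans
      ((map_mul _ _ _).trans (congrArg (· * _) (L.res_unpushIso g j h (β p)))))
  inj V h p q u hu e v := by
    obtain ⟨W, j, w, a, b, hw, ha, hb, hab, e'⟩ := hβ.inj _ ((Et.push g).map h) p q u hu e v
    have h1 : ∀ c, IsUnit (L.ρ W (L.res (j ≫ (Et.push g).map h) (β c))) →
        IsUnit ((L.restrict g).ρ _ ((L.restrict g).res (Et.unpushHom j ≫ h) (β c))) := fun c hc => by
      refine IsUnit.map _ ?_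
      have := (L.isUnit_of_isUnit_ρ _ hc).map (L.res (Et.unpushIso j))
      rw [L.res_unpushIso] at this
      exact this
    refine ⟨Et.unpush j, Et.unpushHom j, w, a, b, hw, h1 a ha, h1 b hb, hab, ?_⟩
    have e'' := congrArg (L.res (Et.unpushIso j)) e'
    exact ((congrArg₂ (· * ·) (L.res_unpushIso_id g j u).symm
      (L.res_unpushIso g j h (β a)).symm).trans (map_mul _ _ _).symm).trans
        (e''.trans (L.res_unpushIso g j h (β b)))

theorem IsFineSaturated.restrict (hL : L.IsFineSaturated) : (L.restrict g).IsFineSaturated := by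
  intro x
  obtain ⟨U, y, P, _, β, hy, hP, hβ⟩ := hL (g x)
  obtain ⟨z, hz, hz'⟩ := Scheme.Pullback.exists_preimage_pullback (f := Et.str U) (g := g) y x hy
  let U' : X'.Etale := Scheme.Etale.mk (pullback.snd (Et.str U) g)
  let h : (Et.push g).obj U' ⟶ U := Et.homMk (pullback.fst (Et.str U) g) pullback.condition
  exact ⟨U', z, P, _, (L.res h).comp β, hz', hP, (hβ.res h).restrict g⟩

/-- Charts exist locally on every étale `X`-scheme. -/
theorem IsFineSaturated.exists_chart (hL : L.IsFineSaturated) (U : X.Etale) (x : U.left) :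
    ∃ (W : X.Etale) (j : W ⟶ U) (w : W.left) (P : Type u) (_ : CommMonoid P)
      (β : P →* L.M.obj (op W)), j.left w = x ∧ IsFs P ∧ L.IsChart β := by
  obtain ⟨V, y, P, _, β, hy, hP, hβ⟩ := hL (Et.str U x)
  obtain ⟨z, hz, hz'⟩ := Scheme.Pullback.exists_preimage_pullback (f := Et.str V) (g := Et.str U) y x hy
  let W : X.Etale := Et.comp U (pullback.snd (Et.str V) (Et.str U))
  let h : W ⟶ V := Et.homMk (pullback.fst (Et.str V) (Et.str U)) pullback.condition
  exact ⟨W, Et.compHom U _, z, P, _, (L.res h).comp β, hz', hP, hβ.res h⟩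

/-- Sections of a fine and saturated logarithmic structure are cancellable with respect to units. -/
theorem IsFineSaturated.mul_unit_cancel (hL : L.IsFineSaturated) {U : X.Etale}
    {m u u' : L.M.obj (op U)} (hu : IsUnit u) (hu' : IsUnit u') (h : m * u = m * u') : u = u' := by
  refine L.ext_of_local fun x => ?_
  obtain ⟨W, j, w, P, _, β, rfl, hP, hβ⟩ := hL.exists_chart U x
  obtain ⟨W₁, j₁, w₁, p, v, rfl, hv, e⟩ := hβ.surj W (𝟙 W) (L.res j m) w
  have h1 := congrArg (L.res j₁) (congrArg (L.res j) h)
  rw [map_mul, map_mul, map_mul, map_mul, e] at h1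
  set a := L.res j₁ (L.res j u)
  set b := L.res j₁ (L.res j u')
  have ha : IsUnit a := (hu.map _).map _
  have hb : IsUnit b := (hu'.map _).map _
  obtain ⟨a', ha'⟩ := ha.exists_right_inv
  obtain ⟨v', hv'⟩ := hv.exists_right_inv
  set q := L.res (j₁ ≫ 𝟙 W) (β p)
  have h2 : q = q * (b * a') := by
    calc q = q * (v * v') * (a * a') := by rw [hv', ha', mul_one, mul_one]
      _ = (q * v * a) * (v' * a') := by ac_rfl
      _ = (q * v * b) * (v' * a') := by rw [h1]
      _ = q * (b * a') * (v * v') := by ac_rfl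
      _ = q * (b * a') := by rw [hv', mul_one]
  obtain ⟨W₂, j₂, w₂, c, d, rfl, hc, -, hcd, e₂⟩ := hβ.inj W₁ (j₁ ≫ 𝟙 W) p p _
    (hb.mul (IsUnit.of_mul_eq_one _ ((mul_comm a' a).trans ha'))) h2 w₁
  -- `p c = p d` and cancellation in `P` turn the relation between the units into an equality
  obtain rfl := hP.cancel _ _ _ hcd
  have h3 : L.res j₂ (b * a') = 1 := by
    have := L.isUnit_of_isUnit_ρ _ hc
    exact this.mul_right_cancel (e₂.trans (one_mul _).symm)
  refine ⟨W₂, j₂ ≫ j₁ ≫ j, w₂, rfl, ?_⟩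
  have h4 : L.res j₂ b = L.res j₂ a := by
    calc L.res j₂ b = L.res j₂ (b * (a * a')) := by rw [ha', mul_one]
      _ = L.res j₂ (b * a') * L.res j₂ a := by rw [← map_mul]; congr 1; ac_rfl
      _ = _ := by rw [h3, one_mul]
  rw [← L.res_res, ← L.res_res, ← L.res_res, ← L.res_res]
  exact h4.symm

/-- Sections on an open subset that are associated étale locally are associated on an open
neighbourhood: the unit between them is unique, hence it descends. -/
theorem IsFineSaturated.associated_of_etale (hL : L.IsFineSaturated) {O : X.Opens}
    (m n : L.M.obj (op ((Et.ofOpens X).obj O))) {W : X.Etale} (j : W ⟶ (Et.ofOpens X).obj O) (w : W.left)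
    (h : Associated (L.res j m) (L.res j n)) :
    ∃ (O' : X.Opens) (_ : Et.str W w ∈ O') (hO : O' ≤ O),
      Associated (L.res ((Et.ofOpens X).map (homOfLE hO)) m)
        (L.res ((Et.ofOpens X).map (homOfLE hO)) n) := by
  obtain ⟨u, hu⟩ := h
  let O' : X.Opens := ⟨Set.range (Et.str W), (Et.str W).isOpenMap.isOpen_range⟩
  have hO : O' ≤ O := by
    rintro _ ⟨y, rfl⟩
    rw [← Et.w j]
    exact (j.left y).2
  let i : (Et.ofOpens X).obj O' ⟶ (Et.ofOpens X).obj O := (Et.ofOpens X).map (homOfLE hO)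
  have hr : Set.range (Et.str W) ⊆ Set.range O'.ι := by
    rw [Scheme.Opens.range_ι]
    exact subset_rfl
  let l : W ⟶ (Et.ofOpens X).obj O' :=
    Et.homMk (show W.left ⟶ (O' : Scheme.{u}) from IsOpenImmersion.lift O'.ι (Et.str W) hr)
      (IsOpenImmersion.lift_fac O'.ι (Et.str W) hr)
  have hl : l ≫ i = j := by
    refine Et.hom_ext ?_
    have : Mono (Et.str ((Et.ofOpens X).obj O)) := inferInstanceAs (Mono O.ι)
    rw [← cancel_mono (Et.str ((Et.ofOpens X).obj O)), Et.w, Et.w]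
  have hsurj : ∀ x : ((Et.ofOpens X).obj O').left, ∃ w : W.left, l.left w = x := by
    rintro ⟨_, y, rfl⟩
    refine ⟨y, O'.ι.isOpenEmbedding.injective ?_⟩
    have : (l.left ≫ Et.str ((Et.ofOpens X).obj O')) y = Et.str W y := by rw [Et.w]
    exact this
  have hex := L.exists_of_local (U := (Et.ofOpens X).obj O')
    (fun f t => IsUnit t ∧ L.res f (L.res i m) * t = L.res f (L.res i n))
    (fun f g t ht => ⟨ht.1.map _, by rw [← L.res_res, ← L.res_res, ← map_mul, ht.2]⟩)
    (fun f t t' ht ht' => hL.mul_unit_cancel ht.1 ht'.1 (ht.2.trans ht'.2.symm))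
    (fun x => by
      obtain ⟨y, hy⟩ := hsurj x
      exact ⟨W, l, y, u, hy, u.isUnit, by rw [L.res_res, L.res_res, hl, hu]⟩)
  obtain ⟨t, ht⟩ := hex
  have ht' : L.res l t = u := ht l u ⟨u.isUnit, by rw [L.res_res, L.res_res, hl, hu]⟩
  have htu : IsUnit t := L.isUnit_of_local fun x => by
    obtain ⟨y, hy⟩ := hsurj x
    exact ⟨W, l, y, hy, by rw [ht']; exact u.isUnit⟩
  refine ⟨O', ⟨w, rfl⟩, hO, htu.unit, ?_⟩
  refine L.ext_of_local fun x => ?_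
  obtain ⟨y, hy⟩ := hsurj x
  refine ⟨W, l, y, hy, ?_⟩
  rw [map_mul]
  refine (congrArg₂ (· * ·) (L.res_res l i m) ht').trans (Eq.trans ?_ (L.res_res l i n).symm)
  rw [hl, hu]

end LogStructure

namespace LogSch

variable {k : Type u} [Field k]

/-- An étale scheme with the inverse image of the logarithmic structure. -/
def restrict (S : LogSch.{u} k) {X' : Scheme.{u}} (g : X' ⟶ S.X) [Etale g] [QuasiCompact g] :
    LogSch.{u} k where
  X := X'
  toBase := g ≫ S.toBase
  locallyOfFiniteType :=
    have := S.locallyOfFiniteType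
    inferInstance
  quasiCompact :=
    have := S.quasiCompact
    inferInstance
  log := S.log.restrict g
  fs := S.fs.restrict g

/-- The projection from an étale scheme with the inverse image of the logarithmic structure. -/
def restrictHom (S : LogSch.{u} k) {X' : Scheme.{u}} (g : X' ⟶ S.X) [Etale g] [QuasiCompact g] :
    S.restrict g ⟶ S where
  base := g
  base_over := rfl
  app {U _} a w := S.log.res (U := (Et.push g).obj U) (Et.homMk a w)
  res_app _ _ _ _ n := S.log.res_res _ _ n
  app_res _ _ _ _ n := S.log.res_res _ _ n
  ρ_app _ _ n := S.log.ρ_map _ n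

/-! ### Strict étale morphisms -/

/-- Strict étale morphisms, i.e. those for which `M_T → M_S` is bijective on the sections over every
étale `S`-scheme, considered as an étale `T`-scheme. -/
structure IsStrictEtale {S T : LogSch.{u} k} (f : S ⟶ T) : Prop where
  etale : Etale f.base
  strict : ∀ U : S.X.Etale, Function.Bijective
    (f.app (U := U) (V := Scheme.Etale.mk (Et.str U ≫ f.base)) (𝟙 U.left) (Category.id_comp _))

theorem IsStrictEtaleCover.isStrictEtale {S T : LogSch.{u} k} {f : S ⟶ T}
    (hf : IsStrictEtaleCover f) : IsStrictEtale f :=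
  ⟨hf.etale, hf.strict⟩

theorem restrictHom_isStrictEtale (S : LogSch.{u} k) {X' : Scheme.{u}} (g : X' ⟶ S.X) [Etale g]
    [QuasiCompact g] : IsStrictEtale (S.restrictHom g) where
  etale := inferInstanceAs (Etale g)
  strict U := by
    have : ∀ m : S.log.M.obj (op ((Et.push g).obj U)), (S.restrictHom g).app (U := U)
        (V := (Et.push g).obj U) (𝟙 U.left) (Category.id_comp _) m = m := fun m => S.log.res_id m
    exact ⟨fun m n h => (this m).symm.trans (h.trans (this n)), fun m => ⟨m, this m⟩⟩

theorem comp_app {S T R : LogSch.{u} k} (f : S ⟶ T) (g : T ⟶ R) {U : S.X.Etale} {V : T.X.Etale}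
    {W : R.X.Etale} (a : U.left ⟶ V.left) (b : V.left ⟶ W.left) (c : U.left ⟶ W.left)
    (h : a ≫ b = c) (wa : a ≫ Et.str V = Et.str U ≫ f.base)
    (wb : b ≫ Et.str W = Et.str V ≫ g.base)
    (w : c ≫ Et.str W = Et.str U ≫ (f ≫ g).base) (n : R.log.M.obj (op W)) :
    (f ≫ g).app c w n = f.app a wa (g.app b wb n) := by
  subst h
  exact Hom.comp_app_comp f g a b wa wb w n

theorem comp_base {S T R : LogSch.{u} k} (f : S ⟶ T) (g : T ⟶ R) :
    (f ≫ g).base = f.base ≫ g.base := rfl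

namespace IsStrictEtale

variable {S T R : LogSch.{u} k} {f : S ⟶ T}

/-- The components of a strict étale morphism `f` at isomorphisms `U ≃ V` over `f` are bijective. -/
theorem bijective_app (hf : IsStrictEtale f) {U : S.X.Etale} {V : T.X.Etale}
    (a : U.left ⟶ V.left) (ha : IsIso a) (w : a ≫ Et.str V = Et.str U ≫ f.base) :
    Function.Bijective (f.app a w) := by
  have := hf.etale
  let i : (Et.push f.base).obj U ⟶ V := Et.homMk a w
  let i' : V ⟶ (Et.push f.base).obj U := Et.homMk (show V.left ⟶ U.left from inv a) (by
    refine (IsIso.inv_comp_eq a).2 ?_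
    exact w.symm)
  have hi : Function.Bijective (T.log.res i) := by
    refine Function.bijective_iff_has_inverse.2 ⟨T.log.res i', fun n => ?_, fun n => ?_⟩
    · rw [T.log.res_res, show i' ≫ i = 𝟙 _ from Et.hom_ext (by exact IsIso.inv_hom_id a), T.log.res_id]
    · rw [T.log.res_res, show i ≫ i' = 𝟙 _ from Et.hom_ext (by exact IsIso.hom_inv_id a), T.log.res_id]
  have e : ∀ n, f.app a w n = f.app (U := U) (V := (Et.push f.base).obj U) (𝟙 U.left)
      (Category.id_comp _) (T.log.res i n) := fun n => by
    have w' : (𝟙 U.left ≫ i.left) ≫ Et.str V = Et.str U ≫ f.base := by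
      refine Eq.trans ?_ w
      exact congrArg (· ≫ _) (Category.id_comp a)
    rw [f.app_res (U := U) (V := (Et.push f.base).obj U) (𝟙 U.left) i (Category.id_comp _) w' n]
    exact f.app_congr (Category.id_comp a).symm _ _ n
  have e' : (f.app a w : _ → _) = _ ∘ _ := funext e
  rw [e']
  exact (hf.strict U).comp hi

theorem bijective_comp_app [Etale f.base] {g : T ⟶ R} [Etale (f ≫ g).base] (hg : IsStrictEtale g)
    (U : S.X.Etale) :
    Function.Bijective ((f ≫ g).app (U := U) (V := Scheme.Etale.mk (Et.str U ≫ (f ≫ g).base))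
      (𝟙 U.left) (Category.id_comp _)) ↔
    Function.Bijective (f.app (U := U) (V := Scheme.Etale.mk (Et.str U ≫ f.base))
      (𝟙 U.left) (Category.id_comp _)) := by
  have w : 𝟙 U.left ≫ Et.str U ≫ f.base ≫ g.base = Et.str ((Et.push f.base).obj U) ≫ g.base :=
    (Category.id_comp _).trans (Category.assoc _ _ _).symm
  have key : (((f ≫ g).app (U := U) (V := Scheme.Etale.mk (Et.str U ≫ (f ≫ g).base))
      (𝟙 U.left) (Category.id_comp _) : _ →* _) : _ → _) =
      f.app (U := U) (V := Scheme.Etale.mk (Et.str U ≫ f.base)) (𝟙 U.left) (Category.id_comp _) ∘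
      g.app (U := (Et.push f.base).obj U) (V := Scheme.Etale.mk (Et.str U ≫ (f ≫ g).base))
        (𝟙 U.left) w :=
    funext fun n => comp_app f g (U := U) (V := (Et.push f.base).obj U)
      (W := Scheme.Etale.mk (Et.str U ≫ (f ≫ g).base)) (𝟙 U.left) (𝟙 U.left) (𝟙 U.left)
      (Category.id_comp _) (Category.id_comp _) w (Category.id_comp _) n
  rw [key]
  exact Function.Bijective.of_comp_iff _ (hg.bijective_app _ (inferInstanceAs (IsIso (𝟙 U.left))) w)

theorem comp (hf : IsStrictEtale f) {g : T ⟶ R} (hg : IsStrictEtale g) : IsStrictEtale (f ≫ g) := by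
  have := hf.etale
  have := hg.etale
  have : Etale (f ≫ g).base := inferInstanceAs (Etale (f.base ≫ g.base))
  exact ⟨this, fun U => (bijective_comp_app hg U).2 (hf.strict U)⟩

theorem of_comp {g : T ⟶ R} (hg : IsStrictEtale g) (h : IsStrictEtale (f ≫ g)) :
    IsStrictEtale f := by
  have := h.etale
  have := hg.etale
  have : Etale (f.base ≫ g.base) := h.etale
  have h1 : Etale f.base := Etale.of_comp f.base g.base
  exact ⟨h1, fun U => (bijective_comp_app hg U).1 (h.strict U)⟩

/-- Morphisms into a scheme that is strict and étale over `S` are determined by the underlying morphism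
of schemes and the composition. -/
theorem hom_ext (hf : IsStrictEtale f) {q q' : R ⟶ S} (hb : q.base = q'.base)
    (h : q ≫ f = q' ≫ f) : q = q' := by
  refine Hom.ext' hb fun {U V} a w w' n => ?_
  have := hf.etale
  obtain ⟨m, rfl⟩ := (hf.strict V).2 n
  have e := Category.comp_id a
  have w₀ : a ≫ Et.str ((Et.push f.base).obj V) = Et.str U ≫ (q ≫ f).base := by
    refine (Category.assoc _ _ _).symm.trans ((congrArg (· ≫ f.base) w).trans ?_)
    exact Category.assoc _ _ _
  have w₁ : a ≫ Et.str ((Et.push f.base).obj V) = Et.str U ≫ (q' ≫ f).base := by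
    rw [← h]
    exact w₀
  have h1 := comp_app q f (U := U) (V := V) (W := (Et.push f.base).obj V) a (𝟙 V.left) a e w
    (Category.id_comp _) w₀ m
  have h2 := comp_app q' f (U := U) (V := V) (W := (Et.push f.base).obj V) a (𝟙 V.left) a e w'
    (Category.id_comp _) w₁ m
  refine h1.symm.trans (Eq.trans ?_ h2)
  simp only [h]

/-- A morphism into `T` lifts to a scheme that is strict and étale over `T` as soon as the underlying
morphism of schemes does. -/
theorem exists_lift (hf : IsStrictEtale f) (r : R ⟶ T) (a : R.X ⟶ S.X) (ha : a ≫ f.base = r.base) :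
    ∃ q : R ⟶ S, q.base = a ∧ q ≫ f = r := by
  have := hf.etale
  -- over étale `S`-schemes `M_S` is `M_T`, so the components of `r` for étale `T`-schemes are the
  -- components of the lift
  let B : ∀ V : S.X.Etale, T.log.M.obj (op ((Et.push f.base).obj V)) ≃* S.log.M.obj (op V) :=
    fun V => MulEquiv.ofBijective _ (hf.strict V)
  have hB : ∀ (V : S.X.Etale) (m : T.log.M.obj (op ((Et.push f.base).obj V))),
      B V m = f.app (U := V) (V := (Et.push f.base).obj V) (𝟙 V.left) (Category.id_comp _) m :=
    fun _ _ => rfl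
  have hBs : ∀ {V : S.X.Etale} {Z : T.X.Etale} (c : V.left ⟶ Z.left)
      (w : c ≫ Et.str Z = Et.str V ≫ f.base) (m : T.log.M.obj (op Z)),
      (B V).symm (f.app c w m) = T.log.res (U := (Et.push f.base).obj V) (Et.homMk c w) m := by
    intro V Z c w m
    rw [MulEquiv.symm_apply_eq, hB]
    have w' : (𝟙 V.left ≫ (Et.homMk c w : (Et.push f.base).obj V ⟶ Z).left) ≫ Et.str Z =
        Et.str V ≫ f.base := (congrArg (· ≫ Et.str Z) (Category.id_comp c)).trans w
    exact ((f.app_res (U := V) (V := (Et.push f.base).obj V) _ _ (Category.id_comp _) w' m).trans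
      (f.app_congr (Category.id_comp c) _ _ m)).symm
  have hBr : ∀ {V V' : S.X.Etale} (h : V ⟶ V') (n : S.log.M.obj (op V')),
      (B V).symm (S.log.res h n) = T.log.res ((Et.push f.base).map h) ((B V').symm n) := by
    intro V V' h n
    obtain ⟨m, rfl⟩ := (B V').surjective n
    rw [MulEquiv.symm_apply_apply, hB]
    have w' : (h.left ≫ 𝟙 V'.left) ≫ Et.str ((Et.push f.base).obj V') = Et.str V ≫ f.base :=
      (congrArg (· ≫ Et.str ((Et.push f.base).obj V')) (Category.comp_id h.left)).trans
        ((Category.assoc _ _ _).symm.trans (congrArg (· ≫ f.base) (Et.w h)))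
    refine (congrArg (B V).symm (f.res_app (V := (Et.push f.base).obj V') h _
      (Category.id_comp _) w' m)).trans ?_
    refine (hBs _ _ _).trans ?_
    exact congrArg (fun a => T.log.res a m) (Et.hom_ext (Category.comp_id h.left))
  have hw : ∀ {U : R.X.Etale} {V : S.X.Etale} (b : U.left ⟶ V.left)
      (_ : b ≫ Et.str V = Et.str U ≫ a),
      b ≫ Et.str ((Et.push f.base).obj V) = Et.str U ≫ r.base := by
    intro U V b w
    refine (Category.assoc _ _ _).symm.trans ((congrArg (· ≫ f.base) w).trans ?_)
    rw [Category.assoc, ha]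
  let q : R ⟶ S :=
    { base := a
      base_over := by rw [← f.base_over, ← Category.assoc, ha, r.base_over]
      app := fun {U V} b w =>
        (r.app (V := (Et.push f.base).obj V) b (hw b w)).comp (B V).symm.toMonoidHom
      res_app := fun h b w w' n => r.res_app h b (hw b w) (hw _ w') _
      app_res := fun {U V V'} b h w w' n => by
        refine (congrArg (r.app (V := (Et.push f.base).obj V) b (hw b w)) (hBr h n)).trans ?_
        exact r.app_res (V := (Et.push f.base).obj V) b ((Et.push f.base).map h) _ (hw _ w') _
      ρ_app := fun {U V} b w n => by
        obtain ⟨m, rfl⟩ := (B V).surjective n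
        refine (r.ρ_app (V := (Et.push f.base).obj V) b (hw b w) _).trans ?_
        refine congrArg b.appTop.hom ?_
        refine (congrArg (T.log.ρ ((Et.push f.base).obj V))
          ((B V).symm_apply_apply m)).trans ?_
        refine Eq.trans ?_ (f.ρ_app (U := V) (V := (Et.push f.base).obj V) (𝟙 V.left)
          (Category.id_comp _) m).symm
        have : (𝟙 V.left : V.left ⟶ V.left).appTop = 𝟙 _ := Scheme.Hom.id_appTop
        exact (congrArg (fun φ => φ.hom (T.log.ρ ((Et.push f.base).obj V) m)) this).symm }
  refine ⟨q, rfl, Hom.ext' ha fun {U V} c w w' n => ?_⟩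
  -- compare both sides through the étale `S`-scheme that is the pullback of `V`
  let P := f.pb V
  have wl : f.pbLift c (Et.str U ≫ a) ((w.trans (Category.assoc _ _ _).symm)) ≫ Et.str P =
    Et.str U ≫ a := f.pbLift_str _ _ _
  rw [comp_app q f _ _ c (f.pbLift_fst c (Et.str U ≫ a) (w.trans (Category.assoc _ _ _).symm))
    wl (f.pbFst_w V) w n]
  change r.app (V := (Et.push f.base).obj P) _ (hw _ wl) ((B P).symm _) = _
  have w₂ : (f.pbLift c (Et.str U ≫ a) ((w.trans (Category.assoc _ _ _).symm)) ≫
      (Et.homMk (f.pbFst V) (f.pbFst_w V) : (Et.push f.base).obj P ⟶ V).left) ≫ Et.str V =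
      Et.str U ≫ r.base := by
    refine Eq.trans ?_ w'
    exact congrArg (· ≫ Et.str V) (f.pbLift_fst _ _ _)
  refine (congrArg (r.app (V := (Et.push f.base).obj P) _ (hw _ wl))
    (hBs (f.pbFst V) (f.pbFst_w V) n)).trans ?_
  refine (r.app_res (V := (Et.push f.base).obj P) _ _ _ w₂ n).trans ?_
  exact r.app_congr (f.pbLift_fst _ _ _) _ _ n

end IsStrictEtale

end LogSch

/-! ### Strict étale coverings and their fibre products -/

namespace LogSch

variable {k : Type u} [Field k] {S T R S' : LogSch.{u} k}

theorem isNoetherian (S : LogSch.{u} k) : IsNoetherian S.X := by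
  have := S.locallyOfFiniteType
  have := S.quasiCompact
  have : IsLocallyNoetherian S.X := LocallyOfFiniteType.isLocallyNoetherian S.toBase
  have : CompactSpace S.X := QuasiCompact.compactSpace_of_compactSpace S.toBase
  exact {}

/-- Morphisms of schemes of finite type over `k` are quasi-compact, as their source is Noetherian.
-/
theorem Hom.quasiCompact (f : S ⟶ T) : QuasiCompact f.base := by
  have := S.isNoetherian
  exact quasiCompact_of_noetherianSpace_source f.base

theorem app_congr_hom {f f' : S ⟶ T} (h : f = f') {U : S.X.Etale} {V : T.X.Etale}
    (a : U.left ⟶ V.left) (w : a ≫ Et.str V = Et.str U ≫ f.base)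
    (w' : a ≫ Et.str V = Et.str U ≫ f'.base) (n : T.log.M.obj (op V)) :
    f.app a w n = f'.app a w' n := by
  subst h
  rfl

namespace IsStrictEtaleCover

theorem of_isStrictEtale {f : S ⟶ T} (hf : IsStrictEtale f) (h : Function.Surjective f.base) :
    IsStrictEtaleCover f :=
  ⟨hf.etale, h, hf.strict⟩

theorem comp {f : S ⟶ T} {g : T ⟶ R} (hf : IsStrictEtaleCover f) (hg : IsStrictEtaleCover g) :
    IsStrictEtaleCover (f ≫ g) :=
  of_isStrictEtale (hf.isStrictEtale.comp hg.isStrictEtale) (by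
    have := hg.surjective.comp hf.surjective
    intro x
    obtain ⟨y, rfl⟩ := this x
    exact ⟨y, rfl⟩)

theorem of_isIso (f : S ⟶ T) [IsIso f] : IsStrictEtaleCover f := by
  have h1 : f.base ≫ (inv f).base = 𝟙 _ := congrArg Hom.base (IsIso.hom_inv_id f)
  have h2 : (inv f).base ≫ f.base = 𝟙 _ := congrArg Hom.base (IsIso.inv_hom_id f)
  have hi : IsIso f.base := ⟨(inv f).base, h1, h2⟩
  have he : Etale f.base := inferInstance
  refine ⟨he, f.base.surjective, fun U => ?_⟩
  have w : 𝟙 U.left ≫ Et.str U = Et.str ((Et.push f.base).obj U) ≫ (inv f).base :=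
    ((Category.id_comp _).trans (Category.comp_id _).symm).trans
      ((congrArg (Et.str U ≫ ·) h1).symm.trans (Category.assoc _ _ _).symm)
  refine Function.bijective_iff_has_inverse.2
    ⟨(inv f).app (U := (Et.push f.base).obj U) (V := U) (𝟙 U.left) w, fun n => ?_, fun n => ?_⟩
  · have w' : 𝟙 U.left ≫ Et.str ((Et.push f.base).obj U) =
        Et.str ((Et.push f.base).obj U) ≫ (inv f ≫ f).base := by
      rw [IsIso.inv_hom_id]
      exact (Category.id_comp _).trans (Category.comp_id _).symm
    refine (comp_app (inv f) f (U := (Et.push f.base).obj U) (V := U) (W := (Et.push f.base).obj U)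
      (𝟙 U.left) (𝟙 U.left) (𝟙 U.left) (Category.id_comp _) w (Category.id_comp _) w' n).symm.trans ?_
    have w₁ : 𝟙 U.left ≫ Et.str ((Et.push f.base).obj U) =
        Et.str ((Et.push f.base).obj U) ≫ Hom.base (𝟙 T) :=
      (Category.id_comp _).trans (Category.comp_id _).symm
    exact (app_congr_hom (U := (Et.push f.base).obj U) (V := (Et.push f.base).obj U)
      (IsIso.inv_hom_id f) (𝟙 U.left) w' w₁ n).trans
        (id_app_id T (U := (Et.push f.base).obj U) w₁ n)
  · have w' : 𝟙 U.left ≫ Et.str U = Et.str U ≫ (f ≫ inv f).base := by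
      rw [IsIso.hom_inv_id]
      exact (Category.id_comp _).trans (Category.comp_id _).symm
    refine (comp_app f (inv f) (U := U) (V := (Et.push f.base).obj U) (W := U)
      (𝟙 U.left) (𝟙 U.left) (𝟙 U.left) (Category.id_comp _) (Category.id_comp _) w w' n).symm.trans ?_
    have w₁ : 𝟙 U.left ≫ Et.str U = Et.str U ≫ Hom.base (𝟙 S) :=
      (Category.id_comp _).trans (Category.comp_id _).symm
    exact (app_congr_hom (U := U) (V := U) (IsIso.hom_inv_id f) (𝟙 U.left) w' w₁ n).trans
      (id_app_id S w₁ n)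

end IsStrictEtaleCover

/-- The fibre product of `R` and a strict étale covering `S' → T` over `T`. It has the mapping property
of the fibre product (existence of lifts), and it surjects onto the set-theoretic fibre product of
the points and, if `R → T` is a strict étale covering as well, of the analytic spaces. -/
theorem exists_fiberProduct (g : R ⟶ T) {π : S' ⟶ T} (hπ : IsStrictEtaleCover π) :
    ∃ (E : LogSch.{u} k) (p : E ⟶ R) (q : E ⟶ S'), q ≫ π = p ≫ g ∧
      (∀ (A : LogSch.{u} k) (a : A ⟶ R) (b : A ⟶ S'), b ≫ π = a ≫ g →
        ∃ l : A ⟶ E, l ≫ p = a ∧ l ≫ q = b) ∧ IsStrictEtaleCover p ∧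
      (IsStrictEtaleCover g → IsStrictEtaleCover q) ∧
      (∀ (x : R.X) (y : S'.X), g.base x = π.base y → ∃ e : E.X, p.base e = x ∧ q.base e = y) ∧
      (IsStrictEtaleCover g → ∀ (x : Beth R.X) (y : Beth S'.X),
        Beth.map g.base x = Beth.map π.base y →
          ∃ e : Beth E.X, Beth.map p.base e = x ∧ Beth.map q.base e = y) := by
  have := hπ.etale
  have := π.quasiCompact
  let E := R.restrict (pullback.fst g.base π.base)
  let p : E ⟶ R := R.restrictHom (pullback.fst g.base π.base)
  have hp : IsStrictEtale p := R.restrictHom_isStrictEtale _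
  obtain ⟨q, hq, hqp⟩ := hπ.isStrictEtale.exists_lift (p ≫ g) (pullback.snd g.base π.base)
    pullback.condition.symm
  have hpt : ∀ (x : R.X) (y : S'.X), g.base x = π.base y →
      ∃ e : E.X, p.base e = x ∧ q.base e = y := by
    intro x y hxy
    obtain ⟨z, hz, hz'⟩ := Scheme.Pullback.exists_preimage_pullback (f := g.base) (g := π.base) x y hxy
    exact ⟨z, hz, by rw [hq]; exact hz'⟩
  refine ⟨E, p, q, hqp, fun A a b hab => ?_, .of_isStrictEtale hp fun x => ?_, fun hg => ?_, hpt, fun hg x y hxy => ?_⟩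
  · obtain ⟨l, hl, hla⟩ := hp.exists_lift a
      (pullback.lift a.base b.base (congrArg Hom.base hab).symm) (pullback.lift_fst _ _ _)
    refine ⟨l, hla, hπ.isStrictEtale.hom_ext ?_ ?_⟩
    · rw [comp_base, hq, hl]
      exact pullback.lift_snd _ _ _
    · rw [Category.assoc, hqp, ← Category.assoc, hla, hab]
  · obtain ⟨y, hy⟩ := hπ.surjective (g.base x)
    obtain ⟨e, he, -⟩ := hpt x y hy.symm
    exact ⟨e, he⟩
  · refine .of_isStrictEtale (.of_comp hπ.isStrictEtale ?_) fun y => ?_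
    · rw [hqp]
      exact hp.comp hg.isStrictEtale
    · obtain ⟨x, hx⟩ := hg.surjective (π.base y)
      obtain ⟨e, -, he⟩ := hpt x y hx
      exact ⟨e, he⟩
  · have := hg.etale
    obtain ⟨e, he, he'⟩ := Beth.exists_pullback_map_eq g.base π.base x y hxy
    exact ⟨e, he, by rw [hq]; exact he'⟩

theorem _root_.LogTrop.Et.eq_of_ofOpens {X : Scheme.{u}} {W : X.Etale} {O : X.Opens}
    (a b : W ⟶ (Et.ofOpens X).obj O) : a = b := by
  refine Et.hom_ext ?_
  have : Mono (Et.str ((Et.ofOpens X).obj O)) := inferInstanceAs (Mono O.ι)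
  rw [← cancel_mono (Et.str ((Et.ofOpens X).obj O)), Et.w, Et.w]

theorem _root_.LogTrop.Et.nonempty_hom_ofOpens {X : Scheme.{u}} {W : X.Etale} {O : X.Opens}
    (h : ∀ w, Et.str W w ∈ O) : Nonempty (W ⟶ (Et.ofOpens X).obj O) := by
  have hr : Set.range (Et.str W) ⊆ Set.range O.ι := by
    rw [Scheme.Opens.range_ι]
    rintro _ ⟨w, rfl⟩
    exact h w
  exact ⟨Et.homMk (show W.left ⟶ (O : Scheme.{u}) from IsOpenImmersion.lift O.ι (Et.str W) hr)
      (IsOpenImmersion.lift_fac O.ι (Et.str W) hr)⟩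

theorem _root_.LogTrop.Et.str_mem {X : Scheme.{u}} {W : X.Etale} {O : X.Opens}
    (j : W ⟶ (Et.ofOpens X).obj O) (w : W.left) : Et.str W w ∈ O := by
  rw [← Et.w j]
  exact (j.left w).2

/-- If sections of `M` on open subsets are associated on an étale neighbourhood of `x`, their germs
in `M_x / M_x^*` agree: the Zariski stalk injects into the étale one. -/
theorem sharpGerm_eq_of_etale (S : LogSch.{u} k) {O O' : S.X.Opens}
    (m : S.log.M.obj (op ((Et.ofOpens S.X).obj O)))
    (n : S.log.M.obj (op ((Et.ofOpens S.X).obj O'))) {W : S.X.Etale}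
    (j : W ⟶ (Et.ofOpens S.X).obj O) (j' : W ⟶ (Et.ofOpens S.X).obj O') (w : W.left) {x : S.X}
    (hw : Et.str W w = x) (hx : x ∈ O) (hx' : x ∈ O')
    (h : Associated (S.log.res j m) (S.log.res j' n)) :
    sharpGerm S.log.zar O hx m = sharpGerm S.log.zar O' hx' n := by
  subst hw
  obtain ⟨l⟩ := Et.nonempty_hom_ofOpens (W := W) (O := O ⊓ O')
    fun w => ⟨Et.str_mem j w, Et.str_mem j' w⟩
  let i : (Et.ofOpens S.X).obj (O ⊓ O') ⟶ (Et.ofOpens S.X).obj O :=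
    (Et.ofOpens S.X).map (homOfLE inf_le_left)
  let i' : (Et.ofOpens S.X).obj (O ⊓ O') ⟶ (Et.ofOpens S.X).obj O' :=
    (Et.ofOpens S.X).map (homOfLE inf_le_right)
  rw [Et.eq_of_ofOpens j (l ≫ i), Et.eq_of_ofOpens j' (l ≫ i'), ← S.log.res_res,
    ← S.log.res_res] at h
  obtain ⟨O'', hO'', hle, ha⟩ := S.fs.associated_of_etale _ _ l w h
  refine (sharpGerm_eq_iff _ _ _ _).2 ⟨O'', hO'', hle.trans inf_le_left, hle.trans inf_le_right, ?_⟩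
  rw [S.log.res_res, S.log.res_res,
    Et.eq_of_ofOpens (_ ≫ i) ((Et.ofOpens S.X).map (homOfLE (hle.trans inf_le_left))),
    Et.eq_of_ofOpens (_ ≫ i') ((Et.ofOpens S.X).map (homOfLE (hle.trans inf_le_right)))] at ha
  exact ha

/-- A strict étale morphism to a logarithmic scheme whose logarithmic structure is defined on the
Zariski site induces a strict morphism of sharp monoidal spaces. Injectivity on stalks is étale
descent of the unit between associated sections, and surjectivity holds because, étale locally,
sections of `M` come from open subsets of the target. -/
theorem charMap_isStrict {f : S ⟶ T} (hf : IsStrictEtale f) (hT : T.log.IsZariski) :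
    (charMap f).IsStrict := by
  have := hf.etale
  -- over étale `S`-schemes `M_S` is `M_T`
  let B : ∀ V : S.X.Etale, T.log.M.obj (op ((Et.push f.base).obj V)) ≃* S.log.M.obj (op V) :=
    fun V => MulEquiv.ofBijective _ (hf.strict V)
  have hB : ∀ {V : S.X.Etale} {Z : T.X.Etale} (c : V.left ⟶ Z.left)
      (w : c ≫ Et.str Z = Et.str V ≫ f.base) (m : T.log.M.obj (op Z)),
      B V (T.log.res (U := (Et.push f.base).obj V) (Et.homMk c w) m) = f.app c w m := by
    intro V Z c w m
    have w' : (𝟙 V.left ≫ (Et.homMk c w : (Et.push f.base).obj V ⟶ Z).left) ≫ Et.str Z =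
        Et.str V ≫ f.base := (congrArg (· ≫ Et.str Z) (Category.id_comp c)).trans w
    exact (f.app_res (U := V) (V := (Et.push f.base).obj V) _ _ (Category.id_comp _) w' m).trans
      (f.app_congr (Category.id_comp c) _ _ m)
  -- the restriction of `f^* n` to an étale scheme over `f⁻¹ V`
  have hO : ∀ {W : S.X.Etale} {V : T.X.Opens} (l : W ⟶ (Et.ofOpens S.X).obj (f.base ⁻¹ᵁ V))
      (c : (Et.push f.base).obj W ⟶ (Et.ofOpens T.X).obj V)
      (n : T.log.M.obj (op ((Et.ofOpens T.X).obj V))),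
      S.log.res l (openApp f V n) = B W (T.log.res c n) := by
    intro W V l c n
    have w : (l.left ≫ f.base ∣_ V) ≫ Et.str ((Et.ofOpens T.X).obj V) = Et.str W ≫ f.base := by
      refine (Category.assoc _ _ _).trans ?_
      refine (congrArg (l.left ≫ ·) (morphismRestrict_ι f.base V)).trans ?_
      exact (Category.assoc _ _ _).symm.trans (congrArg (· ≫ f.base) (Et.w l))
    rw [Et.eq_of_ofOpens c (Et.homMk (l.left ≫ f.base ∣_ V) w)]
    refine Eq.trans ?_ (hB (Z := (Et.ofOpens T.X).obj V) _ w n).symm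
    exact f.res_app (U := (Et.ofOpens S.X).obj (f.base ⁻¹ᵁ V)) (V := (Et.ofOpens T.X).obj V) l _
      (morphismRestrict_ι _ _) w n
  intro x
  constructor
  · intro a b hab
    obtain ⟨V, hV, n, rfl⟩ := sharpGerm_surj a
    obtain ⟨V', hV', n', rfl⟩ := sharpGerm_surj b
    obtain ⟨W, hW, h, h', ha⟩ := (sharpGerm_eq_iff _ _ _ _).1 (show
      sharpGerm S.log.zar (f.base ⁻¹ᵁ V) hV (openApp f V n) =
        sharpGerm S.log.zar (f.base ⁻¹ᵁ V') hV' (openApp f V' n') from hab)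
    let W₀ := (Et.ofOpens S.X).obj W
    have hc : ∀ {V : T.X.Opens}, W ≤ f.base ⁻¹ᵁ V →
        Nonempty ((Et.push f.base).obj W₀ ⟶ (Et.ofOpens T.X).obj V) := fun {V} h =>
      Et.nonempty_hom_ofOpens fun w => h w.2
    obtain ⟨c⟩ := hc h
    obtain ⟨c'⟩ := hc h'
    refine T.sharpGerm_eq_of_etale n n' c c' ⟨x, hW⟩ rfl hV hV' ?_
    have e := hO ((Et.ofOpens S.X).map (homOfLE h)) c n
    have e' := hO ((Et.ofOpens S.X).map (homOfLE h')) c' n'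
    have ha' : Associated (B W₀ (T.log.res c n)) (B W₀ (T.log.res c' n')) := by
      rw [← e, ← e']
      exact ha
    have := ha'.map (B W₀).symm
    rwa [MulEquiv.symm_apply_apply, MulEquiv.symm_apply_apply] at this
  · intro a
    obtain ⟨W, hW, m, rfl⟩ := sharpGerm_surj a
    let W₀ := (Et.ofOpens S.X).obj W
    obtain ⟨m', rfl⟩ := (B W₀).surjective m
    obtain ⟨W', j, w, V, h, n, u, hw, hu, e⟩ := hT ((Et.push f.base).obj W₀) m' ⟨x, hW⟩
    have hx : Et.str W' w = f.base x := by
      rw [← Et.w j]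
      exact (congrArg (Et.str ((Et.push f.base).obj W₀)) hw)
    have hV : f.base x ∈ V := by
      rw [← hx]
      exact Et.str_mem h w
    refine ⟨sharpGerm T.log.zar V hV n, ?_⟩
    change sharpGerm S.log.zar (f.base ⁻¹ᵁ V) hV (openApp f V n) = _
    have hstr : ∀ w', f.base (Et.str (Et.unpush j) w') ∈ V := fun w' => by
      have := Et.str_mem h w'
      rw [← Et.w j] at this
      exact this
    obtain ⟨l⟩ := Et.nonempty_hom_ofOpens (O := f.base ⁻¹ᵁ V) hstr
    have hwx : Et.str (Et.unpush j) w = x := by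
      rw [← Et.w (Et.unpushHom j)]
      exact congrArg (Et.str W₀) hw
    refine S.sharpGerm_eq_of_etale _ _ l (Et.unpushHom j) w hwx hV hW ?_
    have e1 := hO l (Et.unpushIso j ≫ h) n
    have e2 : S.log.res (Et.unpushHom j) (B W₀ m') =
        B _ (T.log.res (Et.unpushIso j ≫ j) m') := by
      have w' : ((Et.unpushHom j).left ≫ 𝟙 W₀.left) ≫ Et.str ((Et.push f.base).obj W₀) =
          Et.str (Et.unpush j) ≫ f.base :=
        (congrArg (· ≫ Et.str ((Et.push f.base).obj W₀))
          (Category.comp_id (Et.unpushHom j).left)).trans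
        ((Category.assoc _ _ _).symm.trans (congrArg (· ≫ f.base) (Et.w (Et.unpushHom j))))
      refine (f.res_app (V := (Et.push f.base).obj W₀) (Et.unpushHom j) _
        (Category.id_comp _) w' m').trans ?_
      refine (hB _ w' m').symm.trans ?_
      refine congrArg (fun a => B _ (T.log.res a m')) (Et.hom_ext ?_)
      rw [Et.unpushIso_comp]
      exact Category.comp_id (Et.unpushHom j).left
    rw [e1]
    refine Associated.trans ?_ (Associated.of_eq e2.symm)
    rw [← T.log.res_res, ← T.log.res_res, e, map_mul, map_mul]
    exact associated_mul_unit_right _ _ ((hu.map _).map _)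

namespace IsSimple

variable (hS : S.IsSimple) (hT : T.IsSimple) (hR : R.IsSimple)

/-- The morphism of Kato fans that is induced by a morphism of simple logarithmic schemes. -/
def fanMap (f : S ⟶ T) : MonoidalSpace.Hom hS.fan hT.fan := (hS.existsUnique_isFanMap hT f).choose

theorem isFanMap_fanMap (f : S ⟶ T) : hS.IsFanMap hT f (hS.fanMap hT f) :=
  (hS.existsUnique_isFanMap hT f).choose_spec.1

variable {hS hT hR} in
theorem IsFanMap.eq {f : S ⟶ T} {g : MonoidalSpace.Hom hS.fan hT.fan} (hg : hS.IsFanMap hT f g) :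
    g = hS.fanMap hT f :=
  (hS.existsUnique_isFanMap hT f).choose_spec.2 g hg

theorem fanMap_base (f : S ⟶ T) (x : S.X) :
    (hS.fanMap hT f).base (hS.φ.base x) = hT.φ.base (f.base x) :=
  MonoidalSpace.Hom.congr_base (hS.isFanMap_fanMap hT f) x

/-- For a strict étale morphism the map of Kato fans is strict: by the universal property there is a
strict factorization, and factorizations are unique. -/
theorem fanMap_isStrict {f : S ⟶ T} (hf : IsStrictEtale f) : (hS.fanMap hT f).IsStrict := by
  obtain ⟨g, ⟨hg, e⟩, -⟩ := hS.isCharacteristic.existsUnique hT.fan ((charMap f).comp hT.φ)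
    hT.isCharacteristic.isFsKatoFan
    ((charMap_isStrict hf hT.isZariski).comp hT.isCharacteristic.isStrict)
  have : hS.IsFanMap hT f g := e
  rw [← this.eq]
  exact hg

end IsSimple

end LogSch

/-! ### Existence of simple strict étale coverings -/

theorem IsFs.pi {ι : Type u} [Finite ι] {P : ι → Type u} [∀ i, CommMonoid (P i)]
    (h : ∀ i, IsFs (P i)) : IsFs (∀ i, P i) where
  fg := by
    have := fun i => (h i).fg
    infer_instance
  cancel a b c e := funext fun i => (h i).cancel _ _ _ (congrFun e i)
  saturated a b c n hn e := by
    choose d hd using fun i => (h i).saturated (a i) (b i) (c i) n hn (congrFun e i)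
    exact ⟨d, funext hd⟩

/-- In a Noetherian space a point `y` has an open neighbourhood in which every point of one of
finitely many given closed sets has a generization in that set that is also a generization of `y`. -/
theorem exists_open_generization {α : Type*} [TopologicalSpace α] [NoetherianSpace α] [QuasiSober α]
    {κ : Type*} [Finite κ] (V : κ → Set α) (hV : ∀ i, IsClosed (V i)) (y : α) :
    ∃ O : Set α, IsOpen O ∧ y ∈ O ∧ ∀ i, ∀ u ∈ O ∩ V i, ∃ u' ∈ V i, u' ⤳ u ∧ u' ⤳ y := by
  choose S hS hSc hSi hVS using fun i =>
    NoetherianSpace.exists_finite_set_isClosed_irreducible (hV i)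
  have hfin : (⋃ i, {C ∈ S i | y ∉ C}).Finite :=
    Set.finite_iUnion fun i => (hS i).subset fun _ h => h.1
  refine ⟨(⋃₀ ⋃ i, {C ∈ S i | y ∉ C})ᶜ, ?_, ?_, ?_⟩
  · rw [Set.sUnion_eq_biUnion]
    refine (hfin.isClosed_biUnion fun C hC => ?_).isOpen_compl
    obtain ⟨i, hi⟩ := Set.mem_iUnion.1 hC
    exact hSc i C hi.1
  · rintro ⟨C, hC, hy⟩
    obtain ⟨i, hi⟩ := Set.mem_iUnion.1 hC
    exact hi.2 hy
  · rintro i u ⟨huO, hu⟩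
    rw [hVS i] at hu
    obtain ⟨C, hC, huC⟩ := hu
    have hy : y ∈ C := by
      by_contra hy
      exact huO ⟨C, Set.mem_iUnion.2 ⟨i, hC, hy⟩, huC⟩
    obtain ⟨g, hg⟩ := QuasiSober.sober (hSi i C hC) (hSc i C hC)
    refine ⟨g, ?_, hg.specializes huC, hg.specializes hy⟩
    rw [hVS i]
    exact ⟨C, hC, hg.mem⟩

namespace LogStructure

variable {X : Scheme.{u}} (L : LogStructure X)

/-- The open subset on which a section of `M` is invertible. -/
def unitLocus {U : X.Etale} (m : L.M.obj (op U)) : U.left.Opens := U.left.basicOpen (L.ρ U m)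

theorem mem_unitLocus_res {U V : X.Etale} (h : V ⟶ U) (m : L.M.obj (op U)) (v : V.left) :
    v ∈ L.unitLocus (L.res h m) ↔ h.left v ∈ L.unitLocus m := by
  have e := Scheme.preimage_basicOpen_top h.left (L.ρ U m)
  rw [← L.ρ_map h m] at e
  exact iff_of_eq (congrArg (v ∈ ·) e.symm)

theorem unitLocus_mul {U : X.Etale} (m n : L.M.obj (op U)) (u : U.left) :
    u ∈ L.unitLocus (m * n) ↔ u ∈ L.unitLocus m ∧ u ∈ L.unitLocus n := by
  change u ∈ U.left.basicOpen _ ↔ _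
  rw [map_mul, Scheme.basicOpen_mul]
  rfl

theorem mem_unitLocus_one {U : X.Etale} (u : U.left) : u ∈ L.unitLocus (1 : L.M.obj (op U)) := by
  change u ∈ U.left.basicOpen _
  rw [map_one, Scheme.basicOpen_one]
  trivial

theorem mem_unitLocus_of_isUnit {U : X.Etale} {m : L.M.obj (op U)} (h : IsUnit m) (u : U.left) :
    u ∈ L.unitLocus m := by
  change u ∈ U.left.basicOpen _
  rw [Scheme.basicOpen_of_isUnit _ (h.map _)]
  trivial

/-- A section is invertible on the open subset on which it is invertible. -/
theorem exists_isUnit_of_mem_unitLocus {U : X.Etale} {m : L.M.obj (op U)} {u : U.left}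
    (hu : u ∈ L.unitLocus m) :
    ∃ (W : X.Etale) (j : W ⟶ U) (w : W.left), j.left w = u ∧ IsUnit (L.res j m) := by
  refine ⟨Et.comp U (L.unitLocus m).ι, Et.compHom U _, ⟨u, hu⟩, rfl, ?_⟩
  refine L.isUnit_of_isUnit_ρ _ (isUnit_of_basicOpen_eq_top (top_unique fun x _ => ?_))
  exact (L.mem_unitLocus_res (Et.compHom U (L.unitLocus m).ι) m x).2 x.2

end LogStructure

namespace LogSch

variable {k : Type u} [Field k] (S : LogSch.{u} k)

theorem _root_.LogTrop.Et.left_apply_eq {X : Scheme.{u}} {W : X.Etale} {O : X.Opens}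
    (j : W ⟶ (Et.ofOpens X).obj O) {w : W.left} {x : X} (h : Et.str W w = x) (hx : x ∈ O) :
    j.left w = (⟨x, hx⟩ : (O : Scheme.{u})) := by
  refine O.ι.isOpenEmbedding.injective (Eq.trans ?_ h)
  rw [← Et.w j]
  rfl

/-- A section of `M` has trivial image in `M_x / M_x^*` exactly at the points of its unit locus. -/
theorem isUnit_sharpGerm_iff {O : S.X.Opens} (m : S.log.M.obj (op ((Et.ofOpens S.X).obj O)))
    (x : S.X) (hx : x ∈ O) : IsUnit (sharpGerm S.log.zar O hx m) ↔
      (⟨x, hx⟩ : (O : Scheme.{u})) ∈ S.log.unitLocus m := by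
  constructor
  · intro h
    obtain ⟨W, hW, hWO, hm⟩ := sharpGerm_isUnit S.log.zar hx m h
    have h1 := (S.log.mem_unitLocus_res ((Et.ofOpens S.X).map (homOfLE hWO)) m ⟨x, hW⟩).1
      (S.log.mem_unitLocus_of_isUnit hm _)
    have e : _ = (⟨x, hx⟩ : (O : Scheme.{u})) :=
      Et.left_apply_eq ((Et.ofOpens S.X).map (homOfLE hWO)) (w := ⟨x, hW⟩) (x := x) rfl hx
    exact Eq.mp (congrArg (· ∈ S.log.unitLocus m) e) h1
  · intro h
    obtain ⟨W, j, w, hw, hm⟩ := S.log.exists_isUnit_of_mem_unitLocus h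
    have hx' : Et.str W w = x := by
      rw [← Et.w j]
      exact congrArg O.ι hw
    have e := S.sharpGerm_eq_of_etale m 1 j j w hx' hx hx (by
      rw [map_one]
      exact associated_one_iff_isUnit.2 hm)
    rw [e]
    exact (sharpGerm_one S.log.zar O hx).symm ▸ isUnit_one

section Chart

variable {S} {O : S.X.Opens} {P : Type u} [CommMonoid P]
  {β : P →* S.log.M.obj (op ((Et.ofOpens S.X).obj O))} (hβ : S.log.IsChart β)

include hβ

/-- For a chart `P → M` the homomorphism `P → M_x / M_x^*` is surjective. -/
theorem exists_sharpGerm_chart {x : S.X} (hx : x ∈ O) (a : SharpStalk S.log.zar x) :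
    ∃ p, sharpGerm S.log.zar O hx (β p) = a := by
  obtain ⟨U, hU, m, rfl⟩ := sharpGerm_surj a
  let V : S.X.Opens := U ⊓ O
  obtain ⟨W, j, w, p, u, hw, hu, e⟩ := hβ.surj ((Et.ofOpens S.X).obj V)
    ((Et.ofOpens S.X).map (homOfLE inf_le_right))
    (S.log.res ((Et.ofOpens S.X).map (homOfLE inf_le_left)) m) ⟨x, hU, hx⟩
  refine ⟨p, S.sharpGerm_eq_of_etale (β p) m (j ≫ (Et.ofOpens S.X).map (homOfLE inf_le_right))
    (j ≫ (Et.ofOpens S.X).map (homOfLE inf_le_left)) w ?_ hx hU ?_⟩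
  · rw [← Et.w j]
    exact congrArg V.ι hw
  · rw [← S.log.res_res j _ m, e]
    exact associated_mul_unit_right _ _ hu

/-- For a chart `P → M` two elements of `P` with the same image in `M_x / M_x^*` agree up to factors
that become invertible at `x`. So `M_x / M_x^*` is the stalk of `Spec P`. -/
theorem exists_eq_of_sharpGerm_chart {x : S.X} (hx : x ∈ O) {p q : P}
    (h : sharpGerm S.log.zar O hx (β p) = sharpGerm S.log.zar O hx (β q)) :
    ∃ a b, IsUnit (sharpGerm S.log.zar O hx (β a)) ∧ IsUnit (sharpGerm S.log.zar O hx (β b)) ∧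
      p * a = q * b := by
  obtain ⟨V, hV, hVO, _, u₀, hu₀⟩ := (sharpGerm_eq_iff _ _ _ _).1 h.symm
  obtain ⟨u, hu', hu⟩ : ∃ u : S.log.M.obj (op ((Et.ofOpens S.X).obj V)), IsUnit u ∧
      S.log.res ((Et.ofOpens S.X).map (homOfLE hVO)) (β q) * u =
        S.log.res ((Et.ofOpens S.X).map (homOfLE hVO)) (β p) := ⟨_, u₀.isUnit, hu₀⟩
  obtain ⟨W, j, w, a, b, hw, ha, hb, e, -⟩ := hβ.inj ((Et.ofOpens S.X).obj V)
    ((Et.ofOpens S.X).map (homOfLE hVO)) p q u hu' hu.symm ⟨x, hV⟩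
  have key : ∀ a, IsUnit (S.log.ρ W (S.log.res (j ≫ (Et.ofOpens S.X).map (homOfLE hVO)) (β a))) →
      IsUnit (sharpGerm S.log.zar O hx (β a)) := fun a ha => by
    rw [isUnit_sharpGerm_iff]
    have h1 := (S.log.mem_unitLocus_res (j ≫ (Et.ofOpens S.X).map (homOfLE hVO)) (β a) w).1
      (S.log.mem_unitLocus_of_isUnit (S.log.isUnit_of_isUnit_ρ _ ha) w)
    have h2 : Et.str W w = x := by
      rw [← Et.w j]
      exact congrArg (Scheme.Opens.ι V) hw
    rwa [Et.left_apply_eq _ h2 hx] at h1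
  exact ⟨a, b, key a ha, key b hb, e⟩

end Chart

/-- A logarithmic scheme is simple if it is the disjoint union of open subschemes with charts and every
stratum of each of them specializes to the same point. -/
theorem isSimple_of_charts {ι : Type u} [Finite ι] (O : ι → S.X.Opens) (c : ι → S.X)
    (i : S.X → ι) (hi : ∀ x, x ∈ O (i x)) (huniq : ∀ x j, x ∈ O j → j = i x)
    (P : ι → Type u) [∀ i, CommMonoid (P i)] (hP : ∀ i, IsFs (P i))
    (β : ∀ i, P i →* S.log.M.obj (op ((Et.ofOpens S.X).obj (O i)))) (hβ : ∀ i, S.log.IsChart (β i))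
    (hc : ∀ j x (hx : x ∈ O j), ∃ (x' : S.X) (hx' : x' ∈ O j), x' ⤳ x ∧ x' ⤳ c j ∧ ∀ p,
      (⟨x', hx'⟩ : (O j : Scheme.{u})) ∈ S.log.unitLocus (β j p) ↔
        (⟨x, hx⟩ : (O j : Scheme.{u})) ∈ S.log.unitLocus (β j p)) : S.IsSimple := by
  classical
  have hS := S.isSharp_char
  -- the product of the monoids is a chart on each `O i`, where the elements of the other factors
  -- are invertible
  let b : ∀ x : S.X, (∀ i, P i) →* SharpStalk S.log.zar x := fun x =>
    { toFun := fun a => sharpGerm S.log.zar (O (i x)) (hi x) (β (i x) (a (i x)))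
      map_one' := by
        rw [Pi.one_apply, map_one]
        exact sharpGerm_one _ _ _
      map_mul' := fun a a' => by
        rw [Pi.mul_apply, map_mul]
        exact sharpGerm_mul _ _ _ _ _ }
  have hb : ∀ {j} x (hx : x ∈ O j) a, b x a = sharpGerm S.log.zar (O j) hx (β j (a j)) := by
    intro j x hx a
    obtain rfl := huniq x j hx
    rfl
  let φ := MonoidalSpace.toSpecM hS b fun a x =>
    ⟨O (i x.1), hi x.1, β (i x.1) (a (i x.1)), fun y hy => hb y.1 hy a⟩
  have hφ : φ.IsStrict := fun x => by
    constructor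
    · intro s t hst
      obtain ⟨a, rfl⟩ := MonPrime.toStalk_surjective _ s
      obtain ⟨a', rfl⟩ := MonPrime.toStalk_surjective _ t
      have h1 : b x a = b x a' := (MonoidalSpace.toSpecM_stalkMap hS b _ x a).symm.trans
        (hst.trans (MonoidalSpace.toSpecM_stalkMap hS b _ x a'))
      obtain ⟨d, d', hd, hd', e⟩ := exists_eq_of_sharpGerm_chart (hβ (i x)) (hi x) h1
      refine (MonPrime.toStalk_eq_iff _).2
        ⟨Function.update a' (i x) d, ?_, Function.update a (i x) d', ?_, ?_⟩
      · refine (MonoidalSpace.mem_face_nonunitPrime _).2 ?_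
        change IsUnit (sharpGerm S.log.zar (O (i x)) (hi x) (β (i x) _))
        rwa [Function.update_self]
      · refine (MonoidalSpace.mem_face_nonunitPrime _).2 ?_
        change IsUnit (sharpGerm S.log.zar (O (i x)) (hi x) (β (i x) _))
        rwa [Function.update_self]
      · funext j
        rw [Pi.mul_apply, Pi.mul_apply]
        by_cases hj : j = i x
        · subst hj
          rw [Function.update_self, Function.update_self, e]
        · rw [Function.update_of_ne hj, Function.update_of_ne hj, mul_comm]
    · intro s
      obtain ⟨p, hp⟩ := exists_sharpGerm_chart (hβ (i x)) (hi x) s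
      refine ⟨MonPrime.toStalk _ (Function.update 1 (i x) p), ?_⟩
      refine (MonoidalSpace.toSpecM_stalkMap hS b _ x _).trans ?_
      change sharpGerm S.log.zar (O (i x)) (hi x) (β (i x) _) = s
      rw [Function.update_self]
      exact hp
  refine ⟨?_, ?_⟩
  · intro U m x
    let j := i (Et.str U x)
    let V : U.left.Opens := Et.str U ⁻¹ᵁ O j
    let W : S.X.Etale := Et.comp U V.ι
    obtain ⟨l⟩ := Et.nonempty_hom_ofOpens (W := W) (O := O j) fun w => w.2
    obtain ⟨W', j', w, p, u, hw, hu, e⟩ := (hβ j).surj W l (S.log.res (Et.compHom U V.ι) m)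
      ⟨x, hi _⟩
    refine ⟨W', j' ≫ Et.compHom U V.ι, w, O j, j' ≫ l, β j p, u, ?_, hu, ?_⟩
    · rw [Et.comp_left]
      exact congrArg V.ι hw
    · rw [← S.log.res_res]
      exact e
  · obtain ⟨F, ψ, hψ⟩ := MonoidalSpace.exists_isInitial (X := S.log.char)
      (MonoidalSpace.isFsKatoFan_specM (IsFs.pi hP)) hφ i c
      (fun x => ⟨O (i x), hi x, fun u hu => huniq u _ hu⟩) (fun x => by
        obtain ⟨x', hx', h1, h2, h3⟩ := hc (i x) x (hi x)
        refine ⟨x', h1, h2, ?_⟩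
        ext a
        change ¬ IsUnit (b x' a) ↔ ¬ IsUnit (b x a)
        rw [hb x' hx' a, hb x (hi x) a, isUnit_sharpGerm_iff, isUnit_sharpGerm_iff, h3])
    exact ⟨F, ψ, hψ.isFsKatoFan, hψ.isStrict, hψ.existsUnique⟩

/-- Étale locally there are charts such that every stratum specializes to a given point. -/
theorem exists_chart_generization (x : S.X) : ∃ (Y : Scheme.{u}) (g : Y ⟶ S.X) (_ : Etale g)
    (_ : CompactSpace Y) (y : Y) (P : Type u) (_ : CommMonoid P)
    (β : P →* S.log.M.obj (op (Scheme.Etale.mk g))), g y = x ∧ IsFs P ∧ S.log.IsChart β ∧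
      ∀ u : Y, ∃ u' : Y, u' ⤳ u ∧ u' ⤳ y ∧ ∀ p,
        u' ∈ S.log.unitLocus (β p) ↔ u ∈ S.log.unitLocus (β p) := by
  obtain ⟨U, y, P, _, β, hy, hP, hβ⟩ := S.fs x
  have := S.isNoetherian
  have : IsLocallyNoetherian U.left := LocallyOfFiniteType.isLocallyNoetherian (Et.str U)
  obtain ⟨A, hA, hyA, -⟩ := exists_isAffineOpen_mem_and_subset (x := y) (U := ⊤) trivial
  have : IsAffine A := hA
  have : IsNoetherian A := {}
  obtain ⟨t, ht⟩ := hP.fg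
  -- the closed sets on which given generators of `P` are not invertible
  let V : (𝒫 (t : Set P) : Set (Set P)) → Set (A : Scheme.{u}) := fun T =>
    ⋂ p ∈ T.1, {a | A.ι a ∉ S.log.unitLocus (β p)}
  have hV : ∀ T, IsClosed (V T) := fun T => isClosed_biInter fun p _ =>
    ((S.log.unitLocus (β p)).2.preimage A.ι.continuous).isClosed_compl
  have : Finite (𝒫 (t : Set P) : Set (Set P)) := (t.finite_toSet.finite_subsets).to_subtype
  obtain ⟨O, hO, hyO, h⟩ := exists_open_generization V hV ⟨y, hyA⟩
  let O' : (A : Scheme.{u}).Opens := ⟨O, hO⟩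
  let j : (O' : Scheme.{u}) ⟶ U.left := O'.ι ≫ A.ι
  let i : Et.comp U j ⟶ U := Et.compHom U j
  have hj : ∀ (o : O') (p : P), o ∈ S.log.unitLocus (S.log.res i (β p)) ↔
      A.ι o.1 ∈ S.log.unitLocus (β p) := fun o p => S.log.mem_unitLocus_res i (β p) o
  have : CompactSpace O' := isCompact_iff_compactSpace.1 (NoetherianSpace.isCompact O)
  refine ⟨O', j ≫ Et.str U, inferInstance, this, ⟨⟨y, hyA⟩, hyO⟩, P, inferInstance,
    (S.log.res i).comp β, ?_, hP, hβ.res i, ?_⟩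
  · exact hy
  · intro u
    have hT : {p ∈ (t : Set P) | A.ι u.1 ∉ S.log.unitLocus (β p)} ∈ 𝒫 (t : Set P) := fun _ h => h.1
    obtain ⟨u', hu', h1, h2⟩ := h ⟨_, hT⟩ u.1 ⟨u.2, Set.mem_iInter₂.2 fun p hp => hp.2⟩
    refine ⟨⟨u', h1.mem_open hO u.2⟩, Topology.IsInducing.subtypeVal.specializes_iff.1 h1,
      Topology.IsInducing.subtypeVal.specializes_iff.1 h2, fun p => ?_⟩
    refine (hj _ p).trans (Iff.trans ?_ (hj u p).symm)
    have hp : p ∈ Submonoid.closure (t : Set P) := ht ▸ Submonoid.mem_top p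
    induction hp using Submonoid.closure_induction with
    | mem p hp =>
      refine ⟨fun hp' => ?_, fun hp' => ?_⟩
      · by_contra hn
        exact (Set.mem_iInter₂.1 hu' p ⟨hp, hn⟩) hp'
      · exact (h1.map A.ι.continuous).mem_open (S.log.unitLocus (β p)).2 hp'
    | one =>
      rw [map_one]
      exact iff_of_true (S.log.mem_unitLocus_one _) (S.log.mem_unitLocus_one _)
    | mul p q _ _ ihp ihq =>
      rw [map_mul]
      exact (S.log.unitLocus_mul _ _ _).trans
        ((and_congr ihp ihq).trans (S.log.unitLocus_mul _ _ _).symm)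

/-- Every logarithmic scheme has a simple strict étale covering: the disjoint union of finitely many
of the étale neighbourhoods of `exists_chart_generization`. -/
theorem nonempty_simpleCover : Nonempty S.SimpleCover := by
  choose Y g hg hY y P inst β hy hP hβ h using S.exists_chart_generization
  have hcS := S.isNoetherian
  obtain ⟨t, ht⟩ := isCompact_univ.elim_finite_subcover (fun x => Set.range (g x))
    (fun x => (g x).isOpenMap.isOpen_range) (fun x _ => Set.mem_iUnion.2 ⟨x, y x, hy x⟩)
  let Y' : t → Scheme.{u} := fun i => Y i.1
  let G : (∐ Y') ⟶ S.X := Sigma.desc fun i : t => g i.1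
  have : IsZariskiLocalAtSource @Etale :=
    HasRingHomProperty.instIsZariskiLocalAtSource (P := @Etale) (Q := RingHom.Etale)
  have hG : Etale G := IsZariskiLocalAtSource.sigmaDesc (P := @Etale) fun i => hg i.1
  have hcY : CompactSpace (∐ Y' : Scheme.{u}) := by
    have : ∀ i, CompactSpace (Y' i) := fun i => hY i.1
    exact (sigmaMk Y').compactSpace
  have : IsLocallyNoetherian (∐ Y' : Scheme.{u}) := LocallyOfFiniteType.isLocallyNoetherian G
  have : IsNoetherian (∐ Y' : Scheme.{u}) := {}
  have hGq : QuasiCompact G := quasiCompact_of_noetherianSpace_source G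
  have hGι : ∀ i (z : Y' i), G (Sigma.ι Y' i z) = g i.1 z := fun i z => by
    have : Sigma.ι Y' i ≫ G = g i.1 := Sigma.ι_desc _ _
    rw [← this]
    rfl
  have hsurj : Function.Surjective G := fun x => by
    obtain ⟨i, hi⟩ := Set.mem_iUnion.1 (ht (Set.mem_univ x))
    obtain ⟨hi, z, hz⟩ := Set.mem_iUnion.1 hi
    exact ⟨Sigma.ι Y' ⟨i, hi⟩ z, (hGι _ _).trans hz⟩
  let S' := S.restrict G
  let π := S.restrictHom G
  let O : t → S'.X.Opens := fun i => (Sigma.ι Y' i).opensRange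
  have hex : ∀ x : S'.X, ∃ i, x ∈ O i := fun x => by
    obtain ⟨⟨i, z⟩, rfl⟩ := (sigmaMk Y').surjective x
    exact ⟨i, z, (sigmaMk_mk _ i z).symm⟩
  -- the index of the component of a point
  choose i hi using hex
  have huniq : ∀ x j, x ∈ O j → j = i x := fun x j hx => by
    by_contra hj
    exact ((disjoint_opensRange_sigmaι Y' j (i x) hj).le_bot ⟨hx, hi x⟩).elim
  -- the inverse of the isomorphism of `Y' j` with its image
  let a : ∀ j, (O j : Scheme.{u}) ⟶ Y' j := fun j => (Sigma.ι Y' j).isoOpensRange.inv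
  have ha : ∀ j, a j ≫ Sigma.ι Y' j = (O j).ι := fun j => Scheme.Hom.isoOpensRange_inv_comp _
  have ha' : ∀ j (z : Y' j), a j ⟨Sigma.ι Y' j z, ⟨z, rfl⟩⟩ = z := fun j z => by
    refine (Sigma.ι Y' j).isOpenEmbedding.injective ?_
    have : (a j ≫ Sigma.ι Y' j) ⟨Sigma.ι Y' j z, ⟨z, rfl⟩⟩ = Sigma.ι Y' j z := by
      rw [ha]
      rfl
    exact this
  let l : ∀ j : t, (Et.push G).obj ((Et.ofOpens (∐ Y')).obj (O j)) ⟶ Scheme.Etale.mk (g j.1) :=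
    fun j => Et.homMk (a j) (by
      have : Sigma.ι Y' j ≫ G = g j.1 := Sigma.ι_desc _ _
      change a j ≫ g j.1 = (O j).ι ≫ G
      exact (congrArg (a j ≫ ·) this).symm.trans
        ((Category.assoc _ _ _).symm.trans (congrArg (· ≫ G) (ha j))))
  have hl : ∀ j p (z : (O j : Scheme.{u})), z ∈ S.log.unitLocus (S.log.res (l j) (β j.1 p)) ↔
      a j z ∈ S.log.unitLocus (β j.1 p) := fun j p z => S.log.mem_unitLocus_res (l j) (β j.1 p) z
  refine ⟨⟨S', ?_, π, .of_isStrictEtale (S.restrictHom_isStrictEtale G) hsurj⟩⟩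
  refine S'.isSimple_of_charts O (fun j => Sigma.ι Y' j (y j.1)) i hi huniq (fun j => P j.1)
    (fun j => hP j.1) (fun j => (S.log.res (l j)).comp (β j.1))
    (fun j => ((hβ j.1).res (l j)).restrict G) fun j x hx => ?_
  obtain ⟨z, rfl⟩ := hx
  obtain ⟨z', h1, h2, h3⟩ := h j.1 z
  refine ⟨Sigma.ι Y' j z', ⟨z', rfl⟩, h1.map (Sigma.ι Y' j).continuous,
    h2.map (Sigma.ι Y' j).continuous, fun p => ?_⟩
  have e1 := hl j p ⟨Sigma.ι Y' j z', ⟨z', rfl⟩⟩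
  have e2 := hl j p ⟨Sigma.ι Y' j z, ⟨z, rfl⟩⟩
  rw [ha'] at e1 e2
  exact e1.trans ((h3 p).trans e2.symm)

end LogSch

/-! ### Functoriality of the Kato fan and refinement of coverings -/

namespace LogSch

variable {k : Type u} [Field k] {S T R S' : LogSch.{u} k}

theorem openApp_comp (f : S ⟶ T) (g : T ⟶ R) (V : R.X.Opens) (n : R.log.zar.obj (op V)) :
    openApp (f ≫ g) V n = openApp f (g.base ⁻¹ᵁ V) (openApp g V n) :=
  comp_app f g (U := (Et.ofOpens S.X).obj (f.base ⁻¹ᵁ g.base ⁻¹ᵁ V))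
    (V := (Et.ofOpens T.X).obj (g.base ⁻¹ᵁ V)) (W := (Et.ofOpens R.X).obj V)
    (f.base ∣_ g.base ⁻¹ᵁ V) (g.base ∣_ V) ((f ≫ g).base ∣_ V)
    (morphismRestrict_comp f.base g.base V).symm (morphismRestrict_ι _ _) (morphismRestrict_ι _ _)
    (morphismRestrict_ι _ _) n

theorem charMap_comp (f : S ⟶ T) (g : T ⟶ R) :
    charMap (f ≫ g) = (charMap f).comp (charMap g) := by
  refine MonoidalSpace.Hom.ext rfl (heq_of_eq (funext fun x => MonoidHom.ext fun a => ?_))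
  obtain ⟨V, hV, n, rfl⟩ := sharpGerm_surj a
  exact congrArg (sharpGerm S.log.zar (f.base ⁻¹ᵁ g.base ⁻¹ᵁ V) hV) (openApp_comp f g V n)

theorem openApp_id (V : S.X.Opens) (n : S.log.zar.obj (op V)) : openApp (𝟙 S) V n = n := by
  have e : (Hom.base (𝟙 S)) ∣_ V = 𝟙 (V : Scheme.{u}) := (cancel_mono V.ι).1
    ((morphismRestrict_ι _ _).trans ((Category.comp_id _).trans (Category.id_comp _).symm))
  have w : 𝟙 ((Et.ofOpens S.X).obj V).left ≫ Et.str ((Et.ofOpens S.X).obj V) =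
      Et.str ((Et.ofOpens S.X).obj V) ≫ Hom.base (𝟙 S) :=
    (Category.id_comp _).trans (Category.comp_id _).symm
  exact (Hom.app_congr (𝟙 S) (U := (Et.ofOpens S.X).obj V) (V := (Et.ofOpens S.X).obj V) e _ w n).trans
    (id_app_id S w n)

theorem charMap_id (S : LogSch.{u} k) : charMap (𝟙 S) = MonoidalSpace.Hom.id _ := by
  refine MonoidalSpace.Hom.ext rfl (heq_of_eq (funext fun x => MonoidHom.ext fun a => ?_))
  obtain ⟨V, hV, n, rfl⟩ := sharpGerm_surj a
  exact congrArg (sharpGerm S.log.zar V hV) (openApp_id V n)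

namespace IsSimple

variable (hS : S.IsSimple) (hT : T.IsSimple) (hR : R.IsSimple)

theorem fanMap_comp (f : S ⟶ T) (g : T ⟶ R) :
    (hS.fanMap hT f).comp (hT.fanMap hR g) = hS.fanMap hR (f ≫ g) := by
  refine IsFanMap.eq (f := f ≫ g) ?_
  have h1 : hS.φ.comp (hS.fanMap hT f) = (charMap f).comp hT.φ := hS.isFanMap_fanMap hT f
  have h2 : hT.φ.comp (hT.fanMap hR g) = (charMap g).comp hR.φ := hT.isFanMap_fanMap hR g
  change (hS.φ.comp (hS.fanMap hT f)).comp (hT.fanMap hR g) = _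
  rw [h1, charMap_comp]
  change (charMap f).comp (hT.φ.comp (hT.fanMap hR g)) = _
  rw [h2]
  rfl

theorem fanMap_id : hS.fanMap hS (𝟙 S) = MonoidalSpace.Hom.id _ := by
  refine (IsFanMap.eq (f := 𝟙 S) ?_).symm
  change hS.φ.comp (MonoidalSpace.Hom.id _) = (charMap (𝟙 S)).comp hS.φ
  rw [charMap_id]
  rfl

/-- The map of extended cone complexes that is induced by a morphism of simple logarithmic
schemes. -/
def coneMap (f : S ⟶ T) : ExtCone hS.fan → ExtCone hT.fan := ExtCone.map (hS.fanMap hT f)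

theorem coneMap_comp (f : S ⟶ T) (g : T ⟶ R) (z : ExtCone hS.fan) :
    hT.coneMap hR g (hS.coneMap hT f z) = hS.coneMap hR (f ≫ g) z :=
  congrArg (ExtCone.map · z) (hS.fanMap_comp hT hR f g)

theorem coneMap_id (z : ExtCone hS.fan) : hS.coneMap hS (𝟙 S) z = z :=
  congrArg (ExtCone.map · z) hS.fanMap_id

theorem continuous_coneMap (f : S ⟶ T) : Continuous (hS.coneMap hT f) :=
  ExtCone.continuous_map hT.isCharacteristic.isFsKatoFan _

theorem trop_map_eq (f : S ⟶ T) (x : Beth S.X) :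
    hT.trop (Beth.map f.base x) = hS.coneMap hT f (hS.trop x) :=
  trop_map (hS.isFanMap_fanMap hT f) x

theorem exists_reduction_specializes (z : ExtCone hS.fan) : ∃ x, z.reduction ⤳ hS.φ.base x :=
  hS.isCharacteristic.isInitial.exists_specializes _

variable {hS hT} in
theorem reduction_coneMap {z : ExtCone hS.fan} {x : S.X} (h : z.reduction ⤳ hS.φ.base x)
    (f : S ⟶ T) : (hS.coneMap hT f z).reduction ⤳ hT.φ.base (f.base x) := by
  rw [← hS.fanMap_base hT f x]
  exact (hS.fanMap hT f).specializes h

variable {hT} in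
/-- Points of the extended cone complex lift along strict étale morphisms, as soon as they lie near
the image of a point. -/
theorem exists_coneMap_eq {f : S ⟶ T} (hf : IsStrictEtale f) {z : ExtCone hT.fan} {x : S.X}
    (h : z.reduction ⤳ hT.φ.base (f.base x)) :
    ∃ z' : ExtCone hS.fan, z'.reduction ⤳ hS.φ.base x ∧ hS.coneMap hT f z' = z :=
  ExtCone.exists_lift hS.isCharacteristic.isFsKatoFan hT.isCharacteristic.isFsKatoFan
    (hS.fanMap_isStrict hT hf) (h.trans (specializes_of_eq (hS.fanMap_base hT f x).symm))

variable {hS hT} in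
/-- Points of the extended cone complex near the image of a fixed point are determined by their
image under a strict étale morphism. -/
theorem coneMap_injOn {f : S ⟶ T} (hf : IsStrictEtale f) {z z' : ExtCone hS.fan} {x : S.X}
    (h : z.reduction ⤳ hS.φ.base x) (h' : z'.reduction ⤳ hS.φ.base x)
    (e : hS.coneMap hT f z = hS.coneMap hT f z') : z = z' :=
  ExtCone.lift_unique hS.isCharacteristic.isFsKatoFan (hS.fanMap_isStrict hT hf) h h' e

end IsSimple

/-- A strict étale covering is surjective on analytic spaces. -/
theorem IsStrictEtaleCover.exists_map_eq {f : S ⟶ T} (hf : IsStrictEtaleCover f) (x : Beth T.X) :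
    ∃ y : Beth S.X, Beth.map f.base y = x := by
  have := hf.etale
  obtain ⟨q, hq⟩ := hf.surjective x.pt
  obtain ⟨y, hy, -⟩ := Beth.exists_map_eq_of_etale f.base x q hq
  exact ⟨y, hy⟩

theorem beth_map_comp (f : S ⟶ T) (g : T ⟶ R) (x : Beth S.X) :
    Beth.map (f ≫ g).base x = Beth.map g.base (Beth.map f.base x) :=
  Beth.map_comp f.base g.base x

/-- A simple strict étale covering of a fibre product. -/
theorem exists_simpleCover_fiberProduct (g : R ⟶ T) {π : S' ⟶ T} (hπ : IsStrictEtaleCover π) :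
    ∃ (e : R.SimpleCover) (q : e.src ⟶ S'), q ≫ π = e.map ≫ g ∧
      (IsStrictEtaleCover g → IsStrictEtaleCover q) ∧
      (∀ (x : R.X) (y : S'.X), g.base x = π.base y →
        ∃ z : e.src.X, e.map.base z = x ∧ q.base z = y) ∧
      (IsStrictEtaleCover g → ∀ (x : Beth R.X) (y : Beth S'.X),
        Beth.map g.base x = Beth.map π.base y →
          ∃ z : Beth e.src.X, Beth.map e.map.base z = x ∧ Beth.map q.base z = y) := by
  obtain ⟨E, p, q, hpq, -, hp, hq, hpt, hB⟩ := exists_fiberProduct g hπ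
  obtain ⟨c⟩ := E.nonempty_simpleCover
  refine ⟨⟨c.src, c.simple, c.map ≫ p, c.cover.comp hp⟩, c.map ≫ q, ?_, fun hg => c.cover.comp (hq hg),
    fun x y h => ?_, fun hg x y h => ?_⟩
  · rw [Category.assoc, hpq, Category.assoc]
  · obtain ⟨e, rfl, rfl⟩ := hpt x y h
    obtain ⟨z, rfl⟩ := c.cover.surjective e
    exact ⟨z, rfl, rfl⟩
  · obtain ⟨e, rfl, rfl⟩ := hB hg x y h
    obtain ⟨z, rfl⟩ := c.cover.exists_map_eq e
    exact ⟨z, beth_map_comp _ _ _, beth_map_comp _ _ _⟩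

namespace SimpleCover

/-- A simple strict étale covering of a simple strict étale covering. -/
def trans (c : S.SimpleCover) (e : c.src.SimpleCover) : S.SimpleCover :=
  ⟨e.src, e.simple, e.map ≫ c.map, e.cover.comp c.cover⟩

/-- The trivial covering. -/
def refl (hS : S.IsSimple) : S.SimpleCover := ⟨S, hS, 𝟙 S, .of_isIso _⟩

/-- The maps to the colimit are compatible with the morphisms of coverings. -/
theorem ι_coneMap {c d : S.SimpleCover} {h : c.src ⟶ d.src} (hh : IsStrictEtaleCover h)
    (w : h ≫ d.map = c.map) (z : ExtCone c.simple.fan) :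
    d.ι (c.simple.coneMap d.simple h z) = c.ι z :=
  (Quot.sound (GenExtCone.Rel.mk c d h hh w _ (c.simple.isFanMap_fanMap d.simple h) z)).symm

theorem continuous_ι (c : S.SimpleCover) : Continuous c.ι :=
  continuous_quot_mk.comp continuous_sigmaMk

/-- The extended cone complex of a simple strict étale covering maps onto that of a simple `S`. -/
theorem exists_lift (c : S.SimpleCover) (hS : S.IsSimple) (z : ExtCone hS.fan) :
    ∃ z', c.simple.coneMap hS c.map z' = z := by
  obtain ⟨x, hx⟩ := hS.exists_reduction_specializes z
  obtain ⟨x, rfl⟩ := c.cover.surjective x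
  obtain ⟨z', -, h⟩ := c.simple.exists_coneMap_eq c.cover.isStrictEtale hx
  exact ⟨z', h⟩

end SimpleCover

/-- Two morphisms over `T` from a simple logarithmic scheme to simple strict étale coverings of `T`
induce the same map to the colimit of the extended cone complexes. -/
theorem ι_coneMap_eq (hS : S.IsSimple) {d d' : T.SimpleCover} {h : S ⟶ d.src} {h' : S ⟶ d'.src}
    (w : h ≫ d.map = h' ≫ d'.map) (z : ExtCone hS.fan) :
    d.ι (hS.coneMap d.simple h z) = d'.ι (hS.coneMap d'.simple h' z) := by
  obtain ⟨E, p, q, hpq, hl, hp, hq, -, -⟩ := exists_fiberProduct d.map d'.cover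
  -- both morphisms factor through the fibre product of the coverings; `E` need not be simple, so
  -- lift to simple coverings of `E` and of the source
  obtain ⟨l, rfl, rfl⟩ := hl S h h' w.symm
  obtain ⟨e⟩ := E.nonempty_simpleCover
  obtain ⟨a, s, hs, -⟩ := exists_simpleCover_fiberProduct l e.cover
  let b : T.SimpleCover := ⟨e.src, e.simple, e.map ≫ p ≫ d.map, e.cover.comp (hp.comp d.cover)⟩
  obtain ⟨z, rfl⟩ := a.exists_lift hS z
  have h1 := SimpleCover.ι_coneMap (c := b) (d := d) (h := e.map ≫ p) (e.cover.comp hp)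
    (Category.assoc _ _ _) (a.simple.coneMap e.simple s z)
  have h2 := SimpleCover.ι_coneMap (c := b) (d := d') (h := e.map ≫ q) (e.cover.comp (hq d.cover))
    ((Category.assoc _ _ _).trans (congrArg (e.map ≫ ·) hpq)) (a.simple.coneMap e.simple s z)
  rw [IsSimple.coneMap_comp, IsSimple.coneMap_comp, ← Category.assoc a.map, ← Category.assoc a.map,
    ← hs, Category.assoc, Category.assoc]
  rw [← IsSimple.coneMap_comp a.simple e.simple d.simple, ← IsSimple.coneMap_comp a.simple e.simple d'.simple]
  exact h1.trans h2.symm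

/-! ### The tropicalization map -/

/-- The tropicalization map exists: lift a point along a fixed covering `c₀`. Lifts along `c₀` and
another covering come from a common refinement, since the analytic space of the fibre product
surjects onto the fibre product of the analytic spaces. -/
theorem exists_trop (S : LogSch.{u} k) : ∃ t : Beth S.X → GenExtCone S, S.IsTrop t := by
  obtain ⟨c₀⟩ := S.nonempty_simpleCover
  choose y hy using c₀.cover.exists_map_eq
  refine ⟨fun x => c₀.ι (c₀.simple.trop (y x)), fun c x => ?_⟩
  obtain ⟨e, q, hq, hqc, -, hB⟩ := exists_simpleCover_fiberProduct c.map c₀.cover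
  obtain ⟨z, hz, hz'⟩ := hB c.cover x (y (Beth.map c.map.base x)) (hy _).symm
  change c₀.ι (c₀.simple.trop (y (Beth.map c.map.base x))) = c.ι (c.simple.trop x)
  rw [← hz', e.simple.trop_map_eq]
  refine (SimpleCover.ι_coneMap (c := c.trans e) (hqc c.cover) hq _).trans ?_
  refine (SimpleCover.ι_coneMap (c := c.trans e) (h := e.map) e.cover rfl _).symm.trans ?_
  conv_rhs => rw [← hz]
  exact congrArg c.ι (e.simple.trop_map_eq c.simple e.map z).symm

/-- The tropicalization map is unique, as coverings are surjective on analytic spaces. -/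
theorem IsTrop.unique {t t' : Beth S.X → GenExtCone S} (ht : S.IsTrop t) (ht' : S.IsTrop t') :
    t = t' := by
  obtain ⟨c⟩ := S.nonempty_simpleCover
  funext x
  obtain ⟨y, rfl⟩ := c.cover.exists_map_eq x
  rw [ht, ht']

/-- The tropicalization map is continuous: a covering induces a closed continuous surjection of
analytic spaces, which is a quotient map. -/
theorem IsTrop.continuous {t : Beth S.X → GenExtCone S} (ht : S.IsTrop t) : Continuous t := by
  obtain ⟨c⟩ := S.nonempty_simpleCover
  have := c.map.quasiCompact
  have hq : Topology.IsQuotientMap (Beth.map c.map.base) :=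
    (Beth.isClosedMap_map c.map.base).isQuotientMap (Beth.continuous_map _) c.cover.exists_map_eq
  refine hq.continuous_iff.2 ?_
  have : t ∘ Beth.map c.map.base = c.ι ∘ c.simple.trop := funext (ht c)
  rw [this]
  exact c.continuous_ι.comp c.simple.continuous_trop

/-! ### Functoriality of the generalized extended cone complex -/

/-- The values at `z` of the map induced by `f` on the extended cone complex of `c`, computed with
a lift of `z` to a point near the image of `x` on some simple strict étale covering of `c` that maps to
a simple strict étale covering of `T`. -/
def inducedValues (f : S ⟶ T) (c : S.SimpleCover) (x : c.src.X) (z : ExtCone c.simple.fan) :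
    Set (GenExtCone T) :=
  {w | ∃ (e : c.src.SimpleCover) (d : T.SimpleCover) (h : e.src ⟶ d.src) (y : e.src.X)
    (z' : ExtCone e.simple.fan), h ≫ d.map = (e.map ≫ c.map) ≫ f ∧ e.map.base y = x ∧
      z'.reduction ⤳ e.simple.φ.base y ∧ e.simple.coneMap c.simple e.map z' = z ∧
      d.ι (e.simple.coneMap d.simple h z') = w}

/-- The value does not depend on the choices: two lifts of `z` near points over `x` come from a lift
to a common refinement, and there `ι_coneMap_eq` applies. -/
theorem subsingleton_inducedValues (f : S ⟶ T) (c : S.SimpleCover) (x : c.src.X)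
    (z : ExtCone c.simple.fan) : (inducedValues f c x z).Subsingleton := by
  rintro _ ⟨e, d, h, y, z', hd, rfl, hz', rfl, rfl⟩ _ ⟨e₁, d₁, h₁, y₁, z₁, hd₁, hy, hz₁, ez, rfl⟩
  obtain ⟨a, q, hq, hqc, hpt, -⟩ := exists_simpleCover_fiberProduct e.map e₁.cover
  obtain ⟨v, rfl, rfl⟩ := hpt y y₁ hy.symm
  have hqs := (hqc e.cover).isStrictEtale
  obtain ⟨s, hs, rfl⟩ := a.simple.exists_coneMap_eq a.cover.isStrictEtale hz'
  obtain rfl : a.simple.coneMap e₁.simple q s = z₁ := by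
    refine IsSimple.coneMap_injOn (hS := e₁.simple) (hT := c.simple) e₁.cover.isStrictEtale (IsSimple.reduction_coneMap hs q) hz₁ ?_
    rw [ez, IsSimple.coneMap_comp, IsSimple.coneMap_comp, hq]
  rw [IsSimple.coneMap_comp, IsSimple.coneMap_comp]
  refine ι_coneMap_eq a.simple ?_ s
  rw [Category.assoc, Category.assoc, hd, hd₁, ← Category.assoc, ← Category.assoc, ← Category.assoc,
    ← Category.assoc, hq]

/-- Every simple strict étale covering of `S` has a refinement that maps to a simple strict étale
covering of `T` over `f`. -/
theorem exists_simpleCover_over (f : S ⟶ T) (c : S.SimpleCover) :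
    ∃ (e : c.src.SimpleCover) (d : T.SimpleCover) (h : e.src ⟶ d.src),
      h ≫ d.map = (e.map ≫ c.map) ≫ f := by
  obtain ⟨d⟩ := T.nonempty_simpleCover
  obtain ⟨e, q, hq, -⟩ := exists_simpleCover_fiberProduct (c.map ≫ f) d.cover
  exact ⟨e, d, q, hq.trans (Category.assoc _ _ _).symm⟩

/-- The value does not depend on the point `x` near which it is computed. It is locally constant in
`x`, so it descends along the characteristic morphism. -/
theorem inducedValues_eq (f : S ⟶ T) (c : S.SimpleCover) {x x' : c.src.X}
    {z : ExtCone c.simple.fan} (h : z.reduction ⤳ c.simple.φ.base x)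
    (h' : z.reduction ⤳ c.simple.φ.base x') : inducedValues f c x z = inducedValues f c x' z := by
  refine c.simple.isCharacteristic.isInitial.descent (ρ := ExtCone.reduction)
    (V := fun _ => Set (GenExtCone T)) (θ := fun x z => inducedValues f c x z) (fun x => ?_) h h'
  obtain ⟨e, d, q, hq⟩ := exists_simpleCover_over f c
  have := e.cover.etale
  obtain ⟨y, rfl⟩ := e.cover.surjective x
  -- points of `e` whose image in the fan is a generization of that of `y` use the same lift of `z`
  let O : Set e.src.X := e.simple.φ.base ⁻¹' {t | t ⤳ e.simple.φ.base y}
  have hO : IsOpen O :=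
    (e.simple.isCharacteristic.isFsKatoFan.isOpen_setOf_specializes _).preimage e.simple.φ.continuous_base
  refine ⟨⟨e.map.base '' O, e.map.base.isOpenMap _ hO⟩, ⟨y, specializes_rfl, rfl⟩, ?_⟩
  rintro _ ⟨v, hv, rfl⟩ z hz
  obtain ⟨z', hz', rfl⟩ := e.simple.exists_coneMap_eq e.cover.isStrictEtale hz
  have h1 : d.ι (e.simple.coneMap d.simple q z') ∈
      inducedValues f c (e.map.base y) (e.simple.coneMap c.simple e.map z') :=
    ⟨e, d, q, y, z', hq, rfl, hz'.trans hv, rfl, rfl⟩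
  have h2 : d.ι (e.simple.coneMap d.simple q z') ∈
      inducedValues f c (e.map.base v) (e.simple.coneMap c.simple e.map z') :=
    ⟨e, d, q, v, z', hq, rfl, hz', rfl, rfl⟩
  exact ((subsingleton_inducedValues f c _ _).eq_singleton_of_mem h1).trans
    ((subsingleton_inducedValues f c _ _).eq_singleton_of_mem h2).symm

/-- The map from the extended cone complex of `c` to the colimit for `T` that is induced by `f` exists
uniquely. -/
theorem existsUnique_induced (f : S ⟶ T) (c : S.SimpleCover) (z : ExtCone c.simple.fan) :
    ∃! w : GenExtCone T, ∀ (e : c.src.SimpleCover) (d : T.SimpleCover) (h : e.src ⟶ d.src)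
      (z' : ExtCone e.simple.fan), h ≫ d.map = (e.map ≫ c.map) ≫ f →
      e.simple.coneMap c.simple e.map z' = z → d.ι (e.simple.coneMap d.simple h z') = w := by
  obtain ⟨e, d, q, hq⟩ := exists_simpleCover_over f c
  obtain ⟨z', rfl⟩ := e.exists_lift c.simple z
  refine ⟨d.ι (e.simple.coneMap d.simple q z'), fun e₁ d₁ q₁ z₁ hq₁ ez => ?_, fun w hw =>
    (hw e d q z' hq rfl).symm⟩
  obtain ⟨y, hy⟩ := e.simple.exists_reduction_specializes z'
  obtain ⟨y₁, hy₁⟩ := e₁.simple.exists_reduction_specializes z₁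
  have h1 := IsSimple.reduction_coneMap (hT := c.simple) hy e.map
  have h2 := IsSimple.reduction_coneMap (hT := c.simple) hy₁ e₁.map
  rw [ez] at h2
  refine subsingleton_inducedValues f c _ _ ⟨e₁, d₁, q₁, y₁, z₁, hq₁, rfl, hy₁, ez, rfl⟩ ?_
  rw [inducedValues_eq f c h2 h1]
  exact ⟨e, d, q, y, z', hq, rfl, hy, rfl, rfl⟩

/-- The map from the extended cone complex of a simple strict étale covering of `S` to the colimit for
`T` that is induced by `f`. -/
def induced (f : S ⟶ T) (c : S.SimpleCover) (z : ExtCone c.simple.fan) : GenExtCone T :=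
  (existsUnique_induced f c z).choose

/-- The defining property of `induced`. -/
theorem induced_coneMap (f : S ⟶ T) (c : S.SimpleCover) (e : c.src.SimpleCover) (d : T.SimpleCover)
    (h : e.src ⟶ d.src) (w : h ≫ d.map = (e.map ≫ c.map) ≫ f) (z : ExtCone e.simple.fan) :
    induced f c (e.simple.coneMap c.simple e.map z) = d.ι (e.simple.coneMap d.simple h z) :=
  ((existsUnique_induced f c _).choose_spec.1 e d h z w rfl).symm

/-- If the covering of `S` itself maps to a covering of `T`, no lift is needed. -/
theorem induced_eq (f : S ⟶ T) (c : S.SimpleCover) (d : T.SimpleCover) (h : c.src ⟶ d.src)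
    (w : h ≫ d.map = c.map ≫ f) (z : ExtCone c.simple.fan) :
    induced f c z = d.ι (c.simple.coneMap d.simple h z) := by
  have := induced_coneMap f c (.refl c.simple) d h (w.trans (by
    exact congrArg (· ≫ f) (Category.id_comp c.map).symm)) z
  refine (congrArg (induced f c) ?_).trans this
  exact (c.simple.coneMap_id z).symm

/-- The map is continuous: by `ExtCone.exists_hom_lift` an affine open subset of the fan of `c`
lifts to the fan of a refinement that maps to a covering of `T`. -/
theorem continuous_induced (f : S ⟶ T) (c : S.SimpleCover) : Continuous (induced f c) := by
  obtain ⟨e, d, q, hq⟩ := exists_simpleCover_over f c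
  refine ExtCone.continuous_dom_iff.2 fun P _ j _ => ?_
  obtain ⟨x, hx⟩ := c.simple.isCharacteristic.isInitial.exists_specializes
    (j.base (MonPrime.closedPoint P))
  obtain ⟨y, rfl⟩ := e.cover.surjective x
  obtain ⟨i, rfl⟩ := ExtCone.exists_hom_lift e.simple.isCharacteristic.isFsKatoFan
    c.simple.isCharacteristic.isFsKatoFan (e.simple.fanMap_isStrict c.simple e.cover.isStrictEtale) j
    (hx.trans (specializes_of_eq (e.simple.fanMap_base c.simple e.map y).symm))
  have : (fun h => induced f c (ExtCone.ofAffine (i.comp (e.simple.fanMap c.simple e.map)) h)) =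
      fun h => d.ι (e.simple.coneMap d.simple q (ExtCone.ofAffine i h)) :=
    funext fun h => induced_coneMap f c e d q hq (ExtCone.ofAffine i h)
  rw [this]
  let := ExtCone.homTopology P
  exact d.continuous_ι.comp ((e.simple.continuous_coneMap d.simple q).comp
    (ExtCone.continuous_ofAffine e.simple.isCharacteristic.isFsKatoFan i))

/-- The maps are compatible with the relation that defines the colimit. -/
theorem induced_rel (f : S ⟶ T) {a b : Σ c : S.SimpleCover, ExtCone c.simple.fan}
    (hab : GenExtCone.Rel S a b) : induced f a.1 a.2 = induced f b.1 b.2 := by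
  obtain ⟨c, d, h, hh, w, g, hg, z⟩ := hab
  rw [hg.eq]
  obtain ⟨e, d', q, hq⟩ := exists_simpleCover_over f c
  obtain ⟨z', rfl⟩ := e.exists_lift c.simple z
  refine (induced_coneMap f c e d' q hq z').trans ?_
  refine (induced_coneMap f d (SimpleCover.mk e.src e.simple (e.map ≫ h) (e.cover.comp hh)) d' q ?_
    z').symm.trans ?_
  · rw [hq, ← w]
    exact congrArg (· ≫ f) (Category.assoc _ _ _).symm
  · exact congrArg (induced f d) (e.simple.coneMap_comp c.simple d.simple e.map h z').symm

/-- The map `Σ(f)` of generalized extended cone complexes. -/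
def sig (f : S ⟶ T) : C(S.GenExtCone, T.GenExtCone) where
  toFun := Quot.lift (fun a => induced f a.1 a.2) fun _ _ h => induced_rel f h
  continuous_toFun := continuous_quot_lift _ (continuous_sigma fun c => continuous_induced f c)

theorem sig_ι (f : S ⟶ T) (c : S.SimpleCover) (z : ExtCone c.simple.fan) :
    sig f (c.ι z) = induced f c z := rfl

theorem isInduced_sig (f : S ⟶ T) : IsInduced f (sig f) := fun c d h w g hg z => by
  rw [sig_ι, hg.eq, induced_eq f c d h w]
  rfl

/-- Every point of the colimit for `S` comes from a simple strict étale covering that maps to the given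
covering of `T`. -/
theorem exists_ι_eq (f : S ⟶ T) (d : T.SimpleCover) (t : S.GenExtCone) :
    ∃ (c : S.SimpleCover) (h : c.src ⟶ d.src), h ≫ d.map = c.map ≫ f ∧ ∃ z, c.ι z = t := by
  obtain ⟨⟨c, z⟩, rfl⟩ := Quot.exists_rep t
  obtain ⟨e, q, hq, -⟩ := exists_simpleCover_fiberProduct (c.map ≫ f) d.cover
  obtain ⟨z', rfl⟩ := e.exists_lift c.simple z
  exact ⟨c.trans e, q, hq.trans (Category.assoc _ _ _).symm, z',
    (SimpleCover.ι_coneMap (c := c.trans e) (d := c) (h := e.map) e.cover rfl z').symm⟩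

/-- The map is unique, since the colimit is covered by coverings that map to a fixed covering of
`T`. -/
theorem IsInduced.eq_sig {f : S ⟶ T} {s : S.GenExtCone → T.GenExtCone} (hs : IsInduced f s) :
    s = sig f := by
  obtain ⟨d⟩ := T.nonempty_simpleCover
  funext t
  obtain ⟨c, h, w, z, rfl⟩ := exists_ι_eq f d t
  rw [hs c d h w _ (c.simple.isFanMap_fanMap d.simple h),
    isInduced_sig f c d h w _ (c.simple.isFanMap_fanMap d.simple h)]

theorem sig_id (t : S.GenExtCone) : sig (𝟙 S) t = t := by
  obtain ⟨⟨c, z⟩, rfl⟩ := Quot.exists_rep t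
  refine (induced_eq (𝟙 S) c c (𝟙 _) ?_ z).trans ?_
  · exact (Category.id_comp _).trans (Category.comp_id _).symm
  · rw [IsSimple.coneMap_id]
    rfl

/-- Functoriality can be checked on coverings of `S`, `T` and `R` that map to each other. -/
theorem sig_comp (f : S ⟶ T) (g : T ⟶ R) (t : S.GenExtCone) : sig (f ≫ g) t = sig g (sig f t) := by
  obtain ⟨d⟩ := R.nonempty_simpleCover
  obtain ⟨e⟩ := T.nonempty_simpleCover
  obtain ⟨c, q, hq, -⟩ := exists_simpleCover_fiberProduct (e.map ≫ g) d.cover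
  have hq' : q ≫ d.map = (e.trans c).map ≫ g := hq.trans (Category.assoc _ _ _).symm
  obtain ⟨b, h, w, z, rfl⟩ := exists_ι_eq f (e.trans c) t
  let q' : (e.trans c).src ⟶ d.src := q
  have hw : (h ≫ q') ≫ d.map = b.map ≫ f ≫ g := by
    rw [← Category.assoc b.map, ← w, Category.assoc, Category.assoc]
    exact congrArg (h ≫ ·) hq'
  rw [sig_ι, sig_ι, induced_eq f b (e.trans c) h w, sig_ι, induced_eq g (e.trans c) d q' hq',
    induced_eq (f ≫ g) b d (h ≫ q') hw, IsSimple.coneMap_comp]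

/-- Compatibility with tropicalization reduces to the simple case on a refinement that maps to a
covering of `T`. -/
theorem IsTrop.map {t : Beth S.X → GenExtCone S} {t' : Beth T.X → GenExtCone T} (ht : S.IsTrop t)
    (ht' : T.IsTrop t') (f : S ⟶ T) (x : Beth S.X) : t' (Beth.map f.base x) = sig f (t x) := by
  obtain ⟨d⟩ := T.nonempty_simpleCover
  obtain ⟨c⟩ := S.nonempty_simpleCover
  obtain ⟨e, q, hq, -⟩ := exists_simpleCover_fiberProduct (c.map ≫ f) d.cover
  have hq' : q ≫ d.map = (c.trans e).map ≫ f := hq.trans (Category.assoc _ _ _).symm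
  obtain ⟨y, rfl⟩ := (c.trans e).cover.exists_map_eq x
  rw [ht, sig_ι, induced_eq f (c.trans e) d q hq', ← beth_map_comp, ← hq']
  refine (congrArg t' (beth_map_comp q d.map y)).trans ((ht' d _).trans ?_)
  exact congrArg d.ι (e.simple.trop_map_eq d.simple q y)

/-- A covering that is an isomorphism is terminal among the simple strict étale coverings. -/
theorem isHomeomorph_ι (c : S.SimpleCover) [IsIso c.map] : IsHomeomorph c.ι := by
  let m : ∀ d : S.SimpleCover, d.src ⟶ c.src := fun d => d.map ≫ inv c.map
  have hm : ∀ d, IsStrictEtaleCover (m d) := fun d => d.cover.comp (.of_isIso _)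
  have hmc : ∀ d, m d ≫ c.map = d.map := fun d => by
    rw [Category.assoc, IsIso.inv_hom_id, Category.comp_id]
  let r : S.GenExtCone → ExtCone c.simple.fan :=
    Quot.lift (fun a => a.1.simple.coneMap c.simple (m a.1) a.2) (by
      rintro _ _ ⟨a, b, h, hh, w, g, hg, z⟩
      change a.simple.coneMap c.simple (m a) z = b.simple.coneMap c.simple (m b) (ExtCone.map g z)
      have e : m a = h ≫ m b := by
        rw [← Category.assoc, w]
      rw [hg.eq, e]
      exact (a.simple.coneMap_comp b.simple c.simple h (m b) z).symm)
  have hr : Continuous r := continuous_quot_lift _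
    (continuous_sigma fun d => d.simple.continuous_coneMap c.simple (m d))
  refine isHomeomorph_iff_exists_inverse.2 ⟨c.continuous_ι, r, fun z => ?_, fun t => ?_, hr⟩
  · change c.simple.coneMap c.simple (m c) z = z
    have : m c = 𝟙 _ := IsIso.hom_inv_id _
    rw [this, IsSimple.coneMap_id]
  · obtain ⟨⟨d, z⟩, rfl⟩ := Quot.exists_rep t
    exact SimpleCover.ι_coneMap (hm d) (hmc d) z

end LogSch

end LogTrop

end

theorem theorem1p1 (k : Type u) [Field k] :
    -- the tropicalization map is continuous if there is a characteristic morphism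
    (∀ (S : LogTrop.LogSch.{u} k) (hS : S.IsSimple), Continuous hS.trop) ∧
    -- in this case a morphism induces a map of extended cone complexes through the Kato fans
    (∀ (S T : LogTrop.LogSch.{u} k) (hS : S.IsSimple) (hT : T.IsSimple) (f : S ⟶ T),
      (∃! g : LogTrop.MonoidalSpace.Hom hS.fan hT.fan, hS.IsFanMap hT f g) ∧
      ∀ g : LogTrop.MonoidalSpace.Hom hS.fan hT.fan, hS.IsFanMap hT f g →
        Continuous (LogTrop.ExtCone.map g) ∧
        ∀ x : LogTrop.Beth S.X,
          hT.trop (LogTrop.Beth.map f.base x) = LogTrop.ExtCone.map g (hS.trop x)) ∧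
    -- the maps of analytic spaces are continuous and functorial
    (∀ (S T : LogTrop.LogSch.{u} k) (f : S ⟶ T), Continuous (LogTrop.Beth.map f.base)) ∧
    (∀ (S : LogTrop.LogSch.{u} k) (x : LogTrop.Beth S.X),
      LogTrop.Beth.map (LogTrop.LogSch.Hom.base (𝟙 S)) x = x) ∧
    (∀ (S T R : LogTrop.LogSch.{u} k) (f : S ⟶ T) (g : T ⟶ R) (x : LogTrop.Beth S.X),
      LogTrop.Beth.map (LogTrop.LogSch.Hom.base (f ≫ g)) x =
        LogTrop.Beth.map g.base (LogTrop.Beth.map f.base x)) ∧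
    -- every logarithmic scheme has a simple strict étale covering, and the colimit is the extended
    -- cone complex of the Kato fan if there is a characteristic morphism
    (∀ S : LogTrop.LogSch.{u} k, Nonempty S.SimpleCover) ∧
    (∀ (S : LogTrop.LogSch.{u} k) (c : S.SimpleCover), IsIso c.map → IsHomeomorph c.ι) ∧
    -- the general case
    ∃ (trop : ∀ S : LogTrop.LogSch.{u} k, C(LogTrop.Beth S.X, S.GenExtCone))
      (Sig : ∀ (S T : LogTrop.LogSch.{u} k), (S ⟶ T) → C(S.GenExtCone, T.GenExtCone)),
      (∀ S : LogTrop.LogSch.{u} k, S.IsTrop (trop S) ∧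
        ∀ t : LogTrop.Beth S.X → S.GenExtCone, S.IsTrop t → t = trop S) ∧
      (∀ (S T : LogTrop.LogSch.{u} k) (f : S ⟶ T), LogTrop.LogSch.IsInduced f (Sig S T f) ∧
        ∀ s : S.GenExtCone → T.GenExtCone, LogTrop.LogSch.IsInduced f s → s = Sig S T f) ∧
      (∀ (S T : LogTrop.LogSch.{u} k) (f : S ⟶ T) (x : LogTrop.Beth S.X),
        trop T (LogTrop.Beth.map f.base x) = Sig S T f (trop S x)) ∧
      (∀ (S : LogTrop.LogSch.{u} k) (z : S.GenExtCone), Sig S S (𝟙 S) z = z) ∧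
      (∀ (S T R : LogTrop.LogSch.{u} k) (f : S ⟶ T) (g : T ⟶ R) (z : S.GenExtCone),
        Sig S R (f ≫ g) z = Sig T R g (Sig S T f z)) := by
  choose t ht using LogTrop.LogSch.exists_trop (k := k)
  refine ⟨fun S hS => hS.continuous_trop, fun S T hS hT f => ⟨hS.existsUnique_isFanMap hT f,
    fun g hg => ⟨LogTrop.ExtCone.continuous_map hT.isCharacteristic.isFsKatoFan g,
      LogTrop.LogSch.IsSimple.trop_map hg⟩⟩, fun S T f => LogTrop.Beth.continuous_map _,
    fun S x => LogTrop.Beth.map_id x, fun S T R f g x => LogTrop.Beth.map_comp f.base g.base x,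
    fun S => S.nonempty_simpleCover, fun S c _ => LogTrop.LogSch.isHomeomorph_ι c,
    fun S => ⟨t S, (ht S).continuous⟩, fun S T f => LogTrop.LogSch.sig f,
    fun S => ⟨ht S, fun t' ht' => ht'.unique (ht S)⟩,
    fun S T f => ⟨LogTrop.LogSch.isInduced_sig f, fun s hs => hs.eq_sig⟩,
    fun S T f x => (ht S).map (ht T) f x, fun S z => LogTrop.LogSch.sig_id z,
    fun S T R f g z => LogTrop.LogSch.sig_comp f g z⟩
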